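/- **Notation.** Points are $(\xi_1,\xi_2,\zeta)\in\mathbb R^3$; $\Omega=\{\xi_1,\xi_2,\zeta>0,\ \xi_1+\zeta<1,\ \xi_2+\zeta<1\}$ is the master pyramid. $\tilde P_i$ are the Legendre polynomials on $[-1,1]$, $P_i(x)=\tilde P_i(2x-1)$. $P_i^\alpha$ are the Jacobi polynomials $P_i^{(\alpha,0)}$ shifted to $[0,1]$: $P^\alpha_0=1$, $P^\alpha_1=2x-1+\alpha x$ and $a_iP_i^\alpha=b_i(c_i(2x-1)+\alpha^2)P_{i-1}^\alpha-d_iP_{i-2}^\alpha$ for $i\ge2$, with $a_i=2i(i+\alpha)(2i+\alpha-2)$, $b_i=2i+\alpha-1$, $c_i=(2i+\alpha)(2i+\alpha-2)$, $d_i=2(i+\alpha-1)(i-1)(2i+\alpha)$. $L_i(x)=\int_0^xP_{i-1}$, $L_j^\alpha(x)=\int_0^xP^\alpha_{j-1}$ ($i,j\ge1$). For $\psi$ of order $i$, $[\psi](s_0,s_1)=\psi\big(\tfrac{s_1}{s_0+s_1}\big)(s_0+s_1)^i$ (a homogeneous polynomial), and $[P_i,P_j^{2i+1}](s_0,s_1,s_2)=[P_i](s_0,s_1)[P_j^{2i+1}](s_0+s_1,s_2)$.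 For coordinate functions $s_k,t_k,\mu_1$ put - $\phi_i^E(s_0,s_1)=[L_i](s_0,s_1)$, $\ E_i^E(s_0,s_1)=[P_i](s_0,s_1)(s_0\nabla s_1-s_1\nabla s_0)$; - $\phi^\square_{ij}(s_0,s_1,t_0,t_1)=\phi^E_i(s_0,s_1)\phi^E_j(t_0,t_1)$, $E^\square_{ij}=\phi_j^E(t_0,t_1)E_i^E(s_0,s_1)$, $V_{ij}^\square=E_i^E(s_0,s_1)\times E_j^E(t_0,t_1)$; - $\phi_{ij}^\Delta(s_0,s_1,s_2)=\phi^E_i(s_0,s_1)[L_j^{2i}](s_0+s_1,s_2)$, $E_{ij}^\Delta=[L_j^{2i+1}](s_0+s_1,s_2)E_i^E(s_0,s_1)$, $V_{ij}^\Delta=[P_i,P_j^{2i+1}](s_0,s_1,s_2)(s_0\nabla s_1\times\nabla s_2+s_1\nabla s_2\times\nabla s_0+s_2\nabla s_0\times\nabla s_1)$; - $V^{\trianglelefteq}_{ij}(s_0,s_1,r_0,r_1,t_0)=\nabla\times\big(\tfrac12t_0^2(\phi_i^E(s_0,s_1)\nabla\phi_j^E(r_0,r_1)-\phi_j^E(r_0,r_1)\nabla\phi_i^E(s_0,s_1))\big)$,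 $V_i^{\trianglerighteq}(s_0,s_1,\mu_1,t_0)=\nabla(t_0^2\phi_i^E(s_0,s_1))\times\nabla\mu_1$. Coordinates: $\nu_0(\xi_a,\zeta)=1-\xi_a-\zeta$, $\nu_1(\xi_a,\zeta)=\xi_a$, $\nu_2=\zeta$; $\mu_0(t)=1-t$, $\mu_1(t)=t$, used with $t=\xi_a/(1-\zeta)$ (scaled), $t=\zeta$, and, for traces on the base, $t=\xi_a$; $\vec\mu_{01}=(\mu_0,\mu_1)$, $\vec\nu_{012}=(\nu_0,\nu_1,\nu_2)$, etc. For a base vertex $k=(k_1,k_2)\in\{0,1\}^2$ (the point $(k_1,k_2,0)$), $\lambda_k=\mu_{k_1}(\tfrac{\xi_1}{1-\zeta})\,\nu_{k_2}(\xi_2,\zeta)$, and $\lambda_5=\zeta$. Faces: the quadrilateral face $\zeta=0$, and for $b\in\{1,2\},c\in\{0,1\}$ the triangle face $F_{b,c}$ where $\mu_c(\tfrac{\xi_b}{1-\zeta})=1$. Below $(a,b)\in\{(1,2),(2,1)\}$, $c\in\{0,1\}$, and $M_a=\vec\mu_{01}(\tfrac{\xi_a}{1-\zeta})$, $Z=\vec\mu_{01}(\zeta)$,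 $\mu=\mu_c(\tfrac{\xi_b}{1-\zeta})$. **Spaces.** $\mathcal Q^{a,b,c}$: polynomials of degree $\le a,b,c$ in the three variables ($\{0\}$ if an order is negative); $\mathcal P^p$: total degree $\le p$; $\mathcal N^p=(\mathcal P^{p-1})^3\oplus\{B\text{ homogeneous of degree }p: x\cdot B(x)=0\}$; $\mathcal{RT}^p=(\mathcal P^{p-1})^3\oplus\{\varphi(x)x:\varphi\text{ homogeneous of degree }p-1\}$. The trace is the value ($m=0$), the tangential component ($m=1$), or the normal component ($m=2$). $\Gamma^{(0),p}$ ($\Gamma^{(1),p}$, $\Gamma^{(2),p}$) consists of the $f\in H^1(\Omega)$ ($H(\mathrm{curl},\Omega)$, $H(\mathrm{div},\Omega)$) whose trace on each triangle face is the trace of an element of $\mathcal P^p$ ($\mathcal N^p$, $\mathcal{RT}^p$) and whose trace on the quadrilateral face lies in $\mathcal Q^{p,p}$ ($\mathcal Q^{p-1,p}\times\mathcal Q^{p,p-1}$, $\mathcal Q^{p-1,p-1}$) in $(\xi_1,\xi_2)$; $\Gamma^{(3),p}=L^2(\Omega)$. On $\Omega_\infty=\{0<x<1,0<y<1,z>0\}$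 let $\mathcal Q_n^{a,b,c}=\{\psi/(1+z)^n:\psi\in\mathcal Q^{a,b,c}\}$ and $$\begin{aligned}\mathcal V^{(0),p}_\infty&=\{\phi\in\mathcal Q_p^{p,p,p}:\nabla\phi\in\mathcal Q_p^{p-1,p,p-1}\times\mathcal Q_p^{p,p-1,p-1}\times\mathcal Q_{p+1}^{p,p,p-1}\},\\ \mathcal V^{(1),p}_\infty&=\{E\in\mathcal Q_{p+1}^{p-1,p,p}\times\mathcal Q_{p+1}^{p,p-1,p}\times\mathcal Q_{p+1}^{p,p,p-1}:\nabla\times E\in\mathcal Q_{p+2}^{p,p-1,p-1}\times\mathcal Q_{p+2}^{p-1,p,p-1}\times\mathcal Q_{p+1}^{p-1,p-1,p-1}\},\\ \mathcal V^{(2),p}_\infty&=\{V\in\mathcal Q_{p+2}^{p,p-1,p-1}\times\mathcal Q_{p+2}^{p-1,p,p-1}\times\mathcal Q_{p+2}^{p-1,p-1,p}:\nabla\cdot V\in\mathcal Q_{p+3}^{p-1,p-1,p-1}\},\qquad \mathcal V^{(3),p}_\infty=\mathcal Q_{p+3}^{p-1,p-1,p-1}.\end{aligned}$$ With $\tau(x,y,z)=\frac{(x,y,z)}{1+z}$,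 $J$ its Jacobian, and the pullbacks $\phi\circ\tau$, $J^{\mathsf T}(E\circ\tau)$, $\det(J)J^{-1}(V\circ\tau)$, $\det(J)(\psi\circ\tau)$ for $m=0,1,2,3$, the space $\mathcal U^{(m),p}$ consists of the elements of $\Gamma^{(m),p}$ whose pullback lies in $\mathcal V_\infty^{(m),p}$. **Theorem.** Each of the following functions lies in the indicated space, and (for $m\le2$) has the indicated traces on the five faces; traces not listed are zero. *$H^1$* (value traces): 1. $\lambda_k\in\mathcal U^{(0),1}$; quadrilateral: $\mu_{k_1}(\xi_1)\mu_{k_2}(\xi_2)$; on $F_{b,k_b}$: $\nu_{k_a}(\xi_a,\zeta)$. Also $\lambda_5\in\mathcal U^{(0),1}$; on every triangle face: $\nu_2(\zeta)$. 2. $\mu\,\phi_i^E(\vec\nu_{01}(\xi_a,\zeta))\in\mathcal U^{(0),i}$, $i\ge2$; quadrilateral: $\mu_c(\xi_b)\phi_i^E(\vec\mu_{01}(\xi_a))$; $F_{b,c}$: $\phi_i^E(\vec\nu_{01}(\xi_a,\zeta))$. 3. $\phi_i^E(\lambda_k,\lambda_5)\in\mathcal U^{(0),i}$, $i\ge2$;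 $F_{b,k_b}$: $\phi_i^E(\nu_{k_a}(\xi_a,\zeta),\nu_2(\zeta))$. 4. $\mu_0(\zeta)\phi^\square_{ij}(M_1,M_2)\in\mathcal U^{(0),\max\{i,j\}}$, $i,j\ge2$; quadrilateral: $\phi^\square_{ij}(\vec\mu_{01}(\xi_1),\vec\mu_{01}(\xi_2))$. 5. $\mu\,\phi^\Delta_{ij}(\vec\nu_{012}(\xi_a,\zeta))\in\mathcal U^{(0),i+j}$, $i\ge2,j\ge1$; $F_{b,c}$: $\phi^\Delta_{ij}(\vec\nu_{012}(\xi_a,\zeta))$. 6. $\phi^\square_{ij}(M_1,M_2)\phi_k^E(Z)\in\mathcal U^{(0),\max\{i,j,k\}}$, $i,j,k\ge2$. *$H(\mathrm{curl})$* (tangential traces): 1. $\mu E_i^E(\vec\nu_{01}(\xi_a,\zeta))\in\mathcal U^{(1),i+1}$, $i\ge0$; quadrilateral: $\mu_c(\xi_b)E_i^E(\vec\mu_{01}(\xi_a))$; $F_{b,c}$: $E_i^E(\vec\nu_{01}(\xi_a,\zeta))$. 2. $E_i^E(\lambda_k,\lambda_5)\in\mathcal U^{(1),i+1}$, $i\ge0$;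 $F_{b,k_b}$: $E_i^E(\nu_{k_a}(\xi_a,\zeta),\nu_2(\zeta))$. 3. $\mu_0(\zeta)^2E_{ij}^\square(M_a,M_b)\in\mathcal U^{(1),\max\{i+1,j\}}$, $i\ge0,j\ge2$; quadrilateral: $E_{ij}^\square(\vec\mu_{01}(\xi_a),\vec\mu_{01}(\xi_b))$. 4. $\mu E_{ij}^\Delta(\vec\nu_{012}(\xi_a,\zeta))$ and $\mu E_{ij}^\Delta(\vec\nu_{120}(\xi_a,\zeta))$ in $\mathcal U^{(1),i+j+1}$, $i\ge0,j\ge1$; $F_{b,c}$: the same expressions without $\mu$. 5. $\phi_k^E(Z)\nabla\phi_{ij}^\square(M_1,M_2)+\phi_{ij}^\square(M_1,M_2)\nabla\phi_k^E(Z)\in\mathcal U^{(1),\max\{i,j,k\}}$, $i,j,k\ge2$. 6. $\mu_0(\zeta)\phi_k^E(Z)E_{ij}^\square(M_a,M_b)\in\mathcal U^{(1),\max\{i+1,j,k\}}$, $i\ge0,\ j,k\ge2$. 7. $\phi_{ij}^\square(M_2,M_1)\,n\mu_0(\zeta)^{n-1}\nabla\mu_0(\zeta)\in\mathcal U^{(1),n}$,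 $i,j\ge2$, $n=\max\{i,j\}$. *$H(\mathrm{div})$* (normal traces): 1. $\mu_0(\zeta)^3V_{ij}^\square(M_1,M_2)\in\mathcal U^{(2),\max\{i+1,j+1\}}$, $i,j\ge0$; quadrilateral: $V_{ij}^\square(\vec\mu_{01}(\xi_1),\vec\mu_{01}(\xi_2))$. 2. $V^{f}_{ij}=\tfrac12\big(\mu V_{ij}^\Delta(\vec\nu_{012}(\xi_a,\zeta))+\mu^{-1}V_{ij}^\Delta(\vec\lambda_{de5})\big)\in\mathcal U^{(2),i+j+1}$, $i,j\ge0$, where $d,e$ are the base vertices of $F_{b,c}$ with $\xi_a=0$ and $\xi_a=1$, so that $\vec\lambda_{de5}=(\mu\nu_0(\xi_a,\zeta),\mu\nu_1(\xi_a,\zeta),\nu_2(\zeta))$; $F_{b,c}$: $V_{ij}^\Delta(\vec\nu_{012}(\xi_a,\zeta))$. 3. $\mu_0(\zeta)\phi_k^E(Z)\nabla\times E_{ij}^\square(M_a,M_b)+(\mu_0(\zeta)\nabla\phi_k^E(Z)+\phi_k^E(Z)\nabla\mu_0(\zeta))\times E_{ij}^\square(M_a,M_b)\in\mathcal U^{(2),\max\{i+1,j,k\}}$,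 $i\ge0,\ j,k\ge2$. 4. $n\mu_0(\zeta)^{n-1}\nabla\phi_{ij}^\square(M_2,M_1)\times\nabla\mu_0(\zeta)\in\mathcal U^{(2),n}$, $i,j\ge2$, $n=\max\{i,j\}$. 5. $\mu_0(\zeta)^2\phi_k^E(Z)V_{ij}^\square(M_1,M_2)\in\mathcal U^{(2),\max\{i+1,j+1,k\}}$, $i,j\ge0$, $k\ge2$. 6. $\mu_1(\zeta)^{n-1}V_{ij}^{\trianglelefteq}(M_1,M_2,\mu_0(\zeta))\in\mathcal U^{(2),n}$, $i,j\ge2$, $n=\max\{i,j\}$. 7. $\mu_1(\zeta)^{i-1}V_i^{\trianglerighteq}(M_a,\mu_1(\tfrac{\xi_b}{1-\zeta}),\mu_0(\zeta))\in\mathcal U^{(2),i}$, $i\ge2$. *$L^2$*: $[P_i](M_1)[P_j](M_2)[P_k](Z)\,(\nabla\nu_1(\xi_1,\zeta)\times\nabla\nu_1(\xi_2,\zeta))\cdot\nabla\mu_1(\zeta)\in\mathcal U^{(3),\max\{i+1,j+1,k+1\}}$, $i,j,k\ge0$. *The factor $\mu^{-1}$ is only an apparent singularity.* For $i,j\ge0$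 and functions $s_0,s_1,s_2,\mu$ that are $C^2$ near a point where $\mu\ne0$, at that point $$\tfrac1\mu V_{ij}^\Delta(\mu s_0,\mu s_1,s_2)=[P_i,P_j^{2i+1}](\mu s_0,\mu s_1,s_2)\big(\mu V_{00}^\Delta(s_0,s_1,s_2)+s_2\nabla\mu\times E_0^E(s_0,s_1)\big),$$ and, if $s_0+s_1+s_2=1$ near the point, $$\nabla\cdot\big(\tfrac1\mu V_{ij}^\Delta(\mu s_0,\mu s_1,s_2)\big)=[P_i,P_j^{2i+1}](\mu s_0,\mu s_1,s_2)\,\nabla\mu\cdot\big((i+j+3)E_0^E(s_0,s_1)\times\nabla s_2-V_{00}^\Delta(s_0,s_1,s_2)\big).$$ Moreover, in $\Omega$ each $V_{ij}^f$ coincides with the expression obtained by using the first identity with $s_k=\nu_k(\xi_a,\zeta)$, and this expression is $C^\infty$ on $\{\zeta<1\}$. -/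

import Mathlib

open MeasureTheory
open scoped ContDiff Matrix

namespace PyramidFE

noncomputable section

/-- Points `(ξ₁, ξ₂, ζ)` of physical space, and also vectors in it. -/
abbrev R3 : Type := Fin 3 → ℝ

/-! ### Classical differential operators -/

/-- The partial derivative `∂f/∂x_k`. -/
def pd (k : Fin 3) (f : R3 → ℝ) (x : R3) : ℝ := fderiv ℝ f x (Pi.single k 1)

def grad (f : R3 → ℝ) (x : R3) : R3 := fun k => pd k f x

def curl (E : R3 → R3) (x : R3) : R3 :=
  ![pd 1 (fun y => E y 2) x - pd 2 (fun y => E y 1) x,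
    pd 2 (fun y => E y 0) x - pd 0 (fun y => E y 2) x,
    pd 0 (fun y => E y 1) x - pd 1 (fun y => E y 0) x]

def div (V : R3 → R3) (x : R3) : ℝ := ∑ k : Fin 3, pd k (fun y => V y k) x

/-! ### Legendre and Jacobi polynomials, their integrals, homogenization -/

section Polynomials

open Polynomial

/-- The classical Legendre polynomials on `[-1, 1]`:
`i P̃_i = (2i-1) y P̃_{i-1} - (i-1) P̃_{i-2}`. -/
def legendreClassical : ℕ → ℝ[X]
  | 0 => 1
  | 1 => X
  | (m + 2) =>
      C (1 / ((m : ℝ) + 2)) *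
        (C (2 * (m : ℝ) + 3) * X * legendreClassical (m + 1)
          - C ((m : ℝ) + 1) * legendreClassical m)

/-- The Legendre polynomials shifted to `[0, 1]`, `P_i(x) = P̃_i(2x-1)`. -/
def legendre (i : ℕ) : ℝ[X] := (legendreClassical i).comp (2 * X - 1)

/-- The Jacobi polynomials `P_i^α = P_i^{(α,0)}` shifted to `[0, 1]`, by the recursion
`a_i P_i^α = b_i (c_i (2x-1) + α²) P_{i-1}^α - d_i P_{i-2}^α` with `a_i = 2i(i+α)(2i+α-2)`,
`b_i = 2i+α-1`, `c_i = (2i+α)(2i+α-2)`, `d_i = 2(i+α-1)(i-1)(2i+α)`. -/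
def jacobi (α : ℕ) : ℕ → ℝ[X]
  | 0 => 1
  | 1 => 2 * X - 1 + C (α : ℝ) * X
  | (m + 2) =>
      let i : ℝ := (m : ℝ) + 2
      let r : ℝ := (α : ℝ)
      C (1 / (2 * i * (i + r) * (2 * i + r - 2))) *
        (C (2 * i + r - 1) * (C ((2 * i + r) * (2 * i + r - 2)) * (2 * X - 1) + C (r ^ 2))
            * jacobi α (m + 1)
          - C (2 * (i + r - 1) * (i - 1) * (2 * i + r)) * jacobi α m)

/-- The antiderivative of a polynomial that vanishes at `0`. -/
def antider (ψ : ℝ[X]) : ℝ[X] := ψ.sum fun k a => monomial (k + 1) (a / ((k : ℝ) + 1))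

theorem eval_antider (ψ : ℝ[X]) (x : ℝ) :
    (antider ψ).eval x = ∫ t in (0 : ℝ)..x, ψ.eval t := by
  have h1 : (fun t : ℝ => ψ.eval t) = fun t => ∑ k ∈ ψ.support, ψ.coeff k * t ^ k := by
    funext t
    rw [eval_eq_sum, Polynomial.sum]
  rw [h1, intervalIntegral.integral_finsetSum]
  · unfold antider
    rw [Polynomial.sum, eval_finsetSum]
    refine Finset.sum_congr rfl fun k _ => ?_
    rw [eval_monomial, intervalIntegral.integral_const_mul, integral_pow]
    simp
    ring
  · intro k _
    apply Continuous.intervalIntegrable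
    fun_prop

/-- The integrated Legendre polynomials `L_i(x) = ∫₀ˣ P_{i-1}`, for `i ≥ 1`. -/
def intLegendre (i : ℕ) : ℝ[X] := antider (legendre (i - 1))

/-- The integrated Jacobi polynomials `L_j^α(x) = ∫₀ˣ P_{j-1}^α`, for `j ≥ 1`. -/
def intJacobi (α j : ℕ) : ℝ[X] := antider (jacobi α (j - 1))

/-- The homogenization (of order `i`) of a univariate polynomial `ψ` of degree at most `i`:
`[ψ](s₀, s₁) = ψ(s₁/(s₀+s₁)) (s₀+s₁)^i`, written as a polynomial in `s₀, s₁`. -/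
def homog (i : ℕ) (ψ : ℝ[X]) (s₀ s₁ : ℝ) : ℝ :=
  ∑ k ∈ Finset.range (i + 1), ψ.coeff k * s₁ ^ k * (s₀ + s₁) ^ (i - k)

theorem homog_eq (i : ℕ) (ψ : ℝ[X]) (hψ : ψ.natDegree ≤ i) (s₀ s₁ : ℝ) (hs : s₀ + s₁ ≠ 0) :
    homog i ψ s₀ s₁ = ψ.eval (s₁ / (s₀ + s₁)) * (s₀ + s₁) ^ i := by
  rw [eval_eq_sum_range' (Nat.lt_succ_of_le hψ), Finset.sum_mul]
  refine Finset.sum_congr rfl fun k hk => ?_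
  have hk' : k ≤ i := Nat.lt_succ_iff.mp (Finset.mem_range.mp hk)
  have : (s₀ + s₁) ^ i = (s₀ + s₁) ^ k * (s₀ + s₁) ^ (i - k) := by
    rw [← pow_add, Nat.add_sub_cancel' hk']
  rw [this, div_pow]
  field_simp

/-- `[P_i]`. -/
def hP (i : ℕ) (s₀ s₁ : ℝ) : ℝ := homog i (legendre i) s₀ s₁

/-- `[L_i]`. -/
def hL (i : ℕ) (s₀ s₁ : ℝ) : ℝ := homog i (intLegendre i) s₀ s₁

/-- `[P_j^α]`. -/
def hPJ (α j : ℕ) (s₀ s₁ : ℝ) : ℝ := homog j (jacobi α j) s₀ s₁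

/-- `[L_j^α]`. -/
def hLJ (α j : ℕ) (s₀ s₁ : ℝ) : ℝ := homog j (intJacobi α j) s₀ s₁

/-- `[P_i, P_j^α](s₀, s₁, s₂) = [P_i](s₀, s₁) [P_j^α](s₀+s₁, s₂)` with `α = 2i+1`. -/
def hPP (i j : ℕ) (s₀ s₁ s₂ : ℝ) : ℝ := hP i s₀ s₁ * hPJ (2 * i + 1) j (s₀ + s₁) s₂

end Polynomials

/-! ### Ancillary operators, acting on coordinate functions -/

/-- `φ_i^E(s₀, s₁) = [L_i](s₀, s₁)`. -/
def phiE (i : ℕ) (s₀ s₁ : R3 → ℝ) (x : R3) : ℝ := hL i (s₀ x) (s₁ x)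

/-- `E_i^E(s₀, s₁) = [P_i](s₀, s₁) (s₀ ∇s₁ - s₁ ∇s₀)`. -/
def opE (i : ℕ) (s₀ s₁ : R3 → ℝ) (x : R3) : R3 :=
  hP i (s₀ x) (s₁ x) • (s₀ x • grad s₁ x - s₁ x • grad s₀ x)

/-- `φ_ij^□(s₀, s₁, t₀, t₁) = φ_i^E(s₀, s₁) φ_j^E(t₀, t₁)`. -/
def phiQuad (i j : ℕ) (s₀ s₁ t₀ t₁ : R3 → ℝ) (x : R3) : ℝ := phiE i s₀ s₁ x * phiE j t₀ t₁ x

/-- `E_ij^□(s₀, s₁, t₀, t₁) = φ_j^E(t₀, t₁) E_i^E(s₀, s₁)`. -/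
def opEQuad (i j : ℕ) (s₀ s₁ t₀ t₁ : R3 → ℝ) (x : R3) : R3 := phiE j t₀ t₁ x • opE i s₀ s₁ x

/-- `V_ij^□(s₀, s₁, t₀, t₁) = E_i^E(s₀, s₁) × E_j^E(t₀, t₁)`. -/
def opVQuad (i j : ℕ) (s₀ s₁ t₀ t₁ : R3 → ℝ) (x : R3) : R3 := opE i s₀ s₁ x ⨯₃ opE j t₀ t₁ x

/-- `φ_ij^Δ(s₀, s₁, s₂) = φ_i^E(s₀, s₁) [L_j^{2i}](s₀+s₁, s₂)`. -/
def phiTri (i j : ℕ) (s₀ s₁ s₂ : R3 → ℝ) (x : R3) : ℝ :=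
  phiE i s₀ s₁ x * hLJ (2 * i) j (s₀ x + s₁ x) (s₂ x)

/-- `E_ij^Δ(s₀, s₁, s₂) = [L_j^{2i+1}](s₀+s₁, s₂) E_i^E(s₀, s₁)`. -/
def opETri (i j : ℕ) (s₀ s₁ s₂ : R3 → ℝ) (x : R3) : R3 :=
  hLJ (2 * i + 1) j (s₀ x + s₁ x) (s₂ x) • opE i s₀ s₁ x

/-- `V_ij^Δ(s₀, s₁, s₂) = [P_i, P_j^{2i+1}](s₀, s₁, s₂)
(s₀ ∇s₁ × ∇s₂ + s₁ ∇s₂ × ∇s₀ + s₂ ∇s₀ × ∇s₁)`. -/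
def opVTri (i j : ℕ) (s₀ s₁ s₂ : R3 → ℝ) (x : R3) : R3 :=
  hPP i j (s₀ x) (s₁ x) (s₂ x) •
    (s₀ x • (grad s₁ x ⨯₃ grad s₂ x) + s₁ x • (grad s₂ x ⨯₃ grad s₀ x)
      + s₂ x • (grad s₀ x ⨯₃ grad s₁ x))

/-- `V_ij^⊴(s₀, s₁, r₀, r₁, t₀) =
∇ × (½ t₀² (φ_i^E(s₀,s₁) ∇φ_j^E(r₀,r₁) - φ_j^E(r₀,r₁) ∇φ_i^E(s₀,s₁)))`. -/
def opVLeft (i j : ℕ) (s₀ s₁ r₀ r₁ t₀ : R3 → ℝ) : R3 → R3 :=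
  curl fun x => (1 / 2 * t₀ x ^ 2) •
    (phiE i s₀ s₁ x • grad (phiE j r₀ r₁) x - phiE j r₀ r₁ x • grad (phiE i s₀ s₁) x)

/-- `V_i^⊵(s₀, s₁, μ₁, t₀) = ∇(t₀² φ_i^E(s₀, s₁)) × ∇μ₁`. -/
def opVRight (i : ℕ) (s₀ s₁ μ₁ t₀ : R3 → ℝ) (x : R3) : R3 :=
  grad (fun y => t₀ y ^ 2 * phiE i s₀ s₁ y) x ⨯₃ grad μ₁ x

/-! ### The master pyramid and its coordinates

Indices `a b c : Fin 2` stand for the two horizontal axes `ξ₁, ξ₂` and for the subscript of `μ`. -/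

/-- The master pyramid. -/
def Omega : Set R3 := {x | 0 < x 0 ∧ 0 < x 1 ∧ 0 < x 2 ∧ x 0 + x 2 < 1 ∧ x 1 + x 2 < 1}

/-- The 2D triangle affine coordinates `ν_k(ξ_a, ζ)`. -/
def nu (k : Fin 3) (a : Fin 2) : R3 → ℝ :=
  ![fun x => 1 - x a.castSucc - x 2, fun x => x a.castSucc, fun x => x 2] k

/-- The scaled quadrilateral coordinates `μ_c(ξ_a / (1 - ζ))`. -/
def muS (c a : Fin 2) : R3 → ℝ :=
  ![fun x => 1 - x a.castSucc / (1 - x 2), fun x => x a.castSucc / (1 - x 2)] c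

/-- The unscaled quadrilateral coordinates `μ_c(ξ_a)`. -/
def muQ (c a : Fin 2) : R3 → ℝ := ![fun x => 1 - x a.castSucc, fun x => x a.castSucc] c

/-- The vertical coordinates `μ_c(ζ)`. -/
def muZ (c : Fin 2) : R3 → ℝ := ![fun x => 1 - x 2, fun x => x 2] c

/-- The pyramid affine-related coordinates; `lam d` is `λ_{d+1}`. -/
def lam : Fin 5 → R3 → ℝ :=
  ![fun x => (1 - x 0 - x 2) * (1 - x 1 - x 2) / (1 - x 2),
    fun x => x 0 * (1 - x 1 - x 2) / (1 - x 2),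
    fun x => x 0 * x 1 / (1 - x 2),
    fun x => (1 - x 0 - x 2) * x 1 / (1 - x 2),
    fun x => x 2]

/-- The (zero-based) number of the base vertex `(ξ₁, ξ₂, ζ) = (k₁, k₂, 0)`. -/
def baseVertex (k₁ k₂ : Fin 2) : Fin 5 := ![![0, 3], ![1, 2]] k₁ k₂

/-- The base vertex with coordinate `k` along the axis `a` and `c` along the other axis. -/
def vertexAlong (a k c : Fin 2) : Fin 5 := if a = 0 then baseVertex k c else baseVertex c k

/-- `φ_ij^□` at the scaled coordinates: first pair `μ_0, μ_1` of `ξ_a/(1-ζ)`, second pair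
`μ_0, μ_1` of `ξ_b/(1-ζ)`. Similarly for `opEQuadS` and `opVQuadS`. -/
def phiQuadS (i j : ℕ) (a b : Fin 2) : R3 → ℝ :=
  phiQuad i j (muS 0 a) (muS 1 a) (muS 0 b) (muS 1 b)

def opEQuadS (i j : ℕ) (a b : Fin 2) : R3 → R3 :=
  opEQuad i j (muS 0 a) (muS 1 a) (muS 0 b) (muS 1 b)

def opVQuadS (i j : ℕ) (a b : Fin 2) : R3 → R3 :=
  opVQuad i j (muS 0 a) (muS 1 a) (muS 0 b) (muS 1 b)

/-- `φ_k^E(μ_0(ζ), μ_1(ζ))`. -/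
def phiZ (k : ℕ) : R3 → ℝ := phiE k (muZ 0) (muZ 1)

/-! ### Faces -/

/-- The quadrilateral face `ζ = 0`, and the triangle faces: `tri b c` is the face on which
`μ_c(ξ_b/(1-ζ)) = 1`, that is `ξ_b = c (1 - ζ)`. -/
inductive Face
  | quad : Face
  | tri (b c : Fin 2) : Face

/-- A nonnegative affine function on the closed pyramid whose zero set is the given face. -/
def faceFun : Face → R3 → ℝ
  | .quad => fun x => x 2
  | .tri b c => ![fun x => x b.castSucc, fun x => 1 - x b.castSucc - x 2] c

/-- The open set of points strictly inside all the half spaces of the pyramid except the one that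
belongs to the face `F`; it meets the boundary of the pyramid exactly in the open face `F`. -/
def faceNhd (F : Face) : Set R3 := {x | ∀ F', F' ≠ F → 0 < faceFun F' x}

/-- The parameter domain of an open face: the unit square or the unit triangle. -/
def faceDom : Face → Set (ℝ × ℝ)
  | .quad => {u | 0 < u.1 ∧ u.1 < 1 ∧ 0 < u.2 ∧ u.2 < 1}
  | .tri _ _ => {u | 0 < u.1 ∧ 0 < u.2 ∧ u.1 + u.2 < 1}

/-- An affine parametrization of the face by `faceDom`. -/
def facePar : Face → ℝ × ℝ → R3
  | .quad => fun u => ![u.1, u.2, 0]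
  | .tri b c => fun u =>
      if b = 0 then ![((c : ℕ) : ℝ) * (1 - u.2), u.1, u.2]
      else ![u.1, ((c : ℕ) : ℝ) * (1 - u.2), u.2]

/-- The outward normal to a face, scaled with the area element of `facePar`, so that
`n dS = faceNormal F du`. -/
def faceNormal : Face → R3
  | .quad => ![0, 0, -1]
  | .tri b c => ![-Pi.single b.castSucc 1, Pi.single b.castSucc 1 + Pi.single 2 1] c

/-! ### Energy spaces (weak derivatives) and traces on open faces -/

/-- Smooth functions with compact support in `U`. -/
def IsTest {E : Type*} [NormedAddCommGroup E] [NormedSpace ℝ E] (U : Set R3) (φ : R3 → E) : Prop :=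
  ContDiff ℝ ∞ φ ∧ HasCompactSupport φ ∧ tsupport φ ⊆ U

/-- Square integrability over the pyramid. -/
def SqInt {E : Type*} [NormedAddCommGroup E] (f : R3 → E) : Prop :=
  MemLp f 2 (volume.restrict Omega)

/-- `G` is a square integrable weak gradient of `f` in the pyramid. -/
def IsWeakGrad (f : R3 → ℝ) (G : R3 → R3) : Prop :=
  SqInt G ∧ ∀ Φ : R3 → R3, IsTest Omega Φ →
    ∫ x in Omega, f x * div Φ x = -∫ x in Omega, G x ⬝ᵥ Φ x

/-- `C` is a square integrable weak curl of `E` in the pyramid. -/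
def IsWeakCurl (E C : R3 → R3) : Prop :=
  SqInt C ∧ ∀ Φ : R3 → R3, IsTest Omega Φ →
    ∫ x in Omega, E x ⬝ᵥ curl Φ x = ∫ x in Omega, C x ⬝ᵥ Φ x

/-- `D` is a square integrable weak divergence of `V` in the pyramid. -/
def IsWeakDiv (V : R3 → R3) (D : R3 → ℝ) : Prop :=
  SqInt D ∧ ∀ ψ : R3 → ℝ, IsTest Omega ψ →
    ∫ x in Omega, V x ⬝ᵥ grad ψ x = -∫ x in Omega, D x * ψ x

def H1 : Set (R3 → ℝ) := {f | SqInt f ∧ ∃ G, IsWeakGrad f G}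

def Hcurl : Set (R3 → R3) := {E | SqInt E ∧ ∃ C, IsWeakCurl E C}

def Hdiv : Set (R3 → R3) := {V | SqInt V ∧ ∃ D, IsWeakDiv V D}

def L2 : Set (R3 → ℝ) := {ψ | SqInt ψ}

/-- The trace of `f` on the open face `F` is (the restriction to `F` of) `g`:
`∫_Ω (f ∇·Φ + ∇f·Φ) = ∫_F g Φ·n` for all test fields `Φ` supported near the open face. -/
def HasTrace0 (f : R3 → ℝ) (F : Face) (g : R3 → ℝ) : Prop :=
  IntegrableOn (fun u => g (facePar F u)) (faceDom F) ∧
  ∃ G, IsWeakGrad f G ∧ ∀ Φ : R3 → R3, IsTest (faceNhd F) Φ →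
    ∫ x in Omega, (f x * div Φ x + G x ⬝ᵥ Φ x)
      = ∫ u in faceDom F, g (facePar F u) * (Φ (facePar F u) ⬝ᵥ faceNormal F)

/-- The tangential trace of `E` on the open face `F` is that of `g`:
`∫_Ω ((∇×E)·Φ - E·(∇×Φ)) = ∫_F (n × g)·Φ` for all test fields `Φ` supported near the open face. -/
def HasTrace1 (E : R3 → R3) (F : Face) (g : R3 → R3) : Prop :=
  IntegrableOn (fun u => faceNormal F ⨯₃ g (facePar F u)) (faceDom F) ∧
  ∃ C, IsWeakCurl E C ∧ ∀ Φ : R3 → R3, IsTest (faceNhd F) Φ →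
    ∫ x in Omega, (C x ⬝ᵥ Φ x - E x ⬝ᵥ curl Φ x)
      = ∫ u in faceDom F, (faceNormal F ⨯₃ g (facePar F u)) ⬝ᵥ Φ (facePar F u)

/-- The normal trace of `V` on the open face `F` is that of `g`:
`∫_Ω ((∇·V) ψ + V·∇ψ) = ∫_F ψ g·n` for all test functions `ψ` supported near the open face. -/
def HasTrace2 (V : R3 → R3) (F : Face) (g : R3 → R3) : Prop :=
  IntegrableOn (fun u => g (facePar F u) ⬝ᵥ faceNormal F) (faceDom F) ∧
  ∃ D, IsWeakDiv V D ∧ ∀ ψ : R3 → ℝ, IsTest (faceNhd F) ψ →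
    ∫ x in Omega, (D x * ψ x + V x ⬝ᵥ grad ψ x)
      = ∫ u in faceDom F, ψ (facePar F u) * (g (facePar F u) ⬝ᵥ faceNormal F)

/-- All face traces at once: `q` on the quadrilateral face and `t b c` on the triangle faces. -/
def HasTraces0 (f : R3 → ℝ) (q : R3 → ℝ) (t : Fin 2 → Fin 2 → R3 → ℝ) : Prop :=
  HasTrace0 f .quad q ∧ ∀ b c, HasTrace0 f (.tri b c) (t b c)

def HasTraces1 (E : R3 → R3) (q : R3 → R3) (t : Fin 2 → Fin 2 → R3 → R3) : Prop :=
  HasTrace1 E .quad q ∧ ∀ b c, HasTrace1 E (.tri b c) (t b c)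

def HasTraces2 (V : R3 → R3) (q : R3 → R3) (t : Fin 2 → Fin 2 → R3 → R3) : Prop :=
  HasTrace2 V .quad q ∧ ∀ b c, HasTrace2 V (.tri b c) (t b c)

/-- The table that is `g` on the triangle face `tri b c` and zero on the other triangle faces. -/
def onlyOn {α : Type*} [Zero α] (b c : Fin 2) (g : R3 → α) : Fin 2 → Fin 2 → R3 → α :=
  fun b' c' => if b' = b ∧ c' = c then g else 0

/-! ### Polynomial spaces -/

/-- Polynomials in three variables. -/
abbrev Poly3 : Type := MvPolynomial (Fin 3) ℝ

/-- A vector of three polynomials as a vector field. -/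
def evalVec (q : Fin 3 → Poly3) (x : R3) : R3 := fun k => MvPolynomial.eval x (q k)

/-- `𝒬^{a,b,c}(x, y, z)`; it is `{0}` when one of the orders is negative. -/
def TensorPoly (a b c : ℤ) : Set Poly3 :=
  {ψ | ∀ m ∈ ψ.support, (m 0 : ℤ) ≤ a ∧ (m 1 : ℤ) ≤ b ∧ (m 2 : ℤ) ≤ c}

/-- `𝒫^p`. -/
def TotalPoly (p : ℕ) : Set Poly3 := {ψ | ∀ m ∈ ψ.support, m.degree ≤ p}

/-- `𝒫^{p-1}`, which is `{0}` when `p = 0`. -/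
def TotalPolyPred (p : ℕ) : Set Poly3 := {ψ | ∀ m ∈ ψ.support, m.degree + 1 ≤ p}

/-- The Nédélec space `𝒩^p = (𝒫^{p-1})³ ⊕ {B ∈ (homogeneous of degree p)³ : x·B(x) = 0}`. -/
def NedelecPoly (p : ℕ) : Set (Fin 3 → Poly3) :=
  {q | ∃ A B : Fin 3 → Poly3, q = A + B ∧ (∀ k, A k ∈ TotalPolyPred p) ∧
    (∀ k, (B k).IsHomogeneous p) ∧ ∀ x : R3, x ⬝ᵥ evalVec B x = 0}

/-- The Raviart-Thomas space
`ℛ𝒯^p = (𝒫^{p-1})³ ⊕ {φ(x) x : φ homogeneous of degree p-1}`. -/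
def RaviartThomasPoly (p : ℕ) : Set (Fin 3 → Poly3) :=
  {q | ∃ (A : Fin 3 → Poly3) (φ : Poly3), q = (A + fun k => φ * MvPolynomial.X k) ∧
    (∀ k, A k ∈ TotalPolyPred p) ∧ ∀ m ∈ φ.support, m.degree + 1 = p}

/-! ### Compatibility spaces -/

def Gamma0 (p : ℕ) : Set (R3 → ℝ) :=
  {f | f ∈ H1 ∧
    (∀ b c, ∃ q ∈ TotalPoly p, HasTrace0 f (.tri b c) fun x => MvPolynomial.eval x q) ∧
    ∃ q ∈ TensorPoly p p 0, HasTrace0 f .quad fun x => MvPolynomial.eval x q}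

def Gamma1 (p : ℕ) : Set (R3 → R3) :=
  {E | E ∈ Hcurl ∧
    (∀ b c, ∃ q ∈ NedelecPoly p, HasTrace1 E (.tri b c) (evalVec q)) ∧
    ∃ q₁ ∈ TensorPoly (p - 1) p 0, ∃ q₂ ∈ TensorPoly p (p - 1) 0,
      HasTrace1 E .quad (evalVec ![q₁, q₂, 0])}

def Gamma2 (p : ℕ) : Set (R3 → R3) :=
  {V | V ∈ Hdiv ∧
    (∀ b c, ∃ q ∈ RaviartThomasPoly p, HasTrace2 V (.tri b c) (evalVec q)) ∧
    ∃ q ∈ TensorPoly (p - 1) (p - 1) 0, HasTrace2 V .quad (evalVec ![0, 0, q])}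

def Gamma3 (_p : ℕ) : Set (R3 → ℝ) := L2

/-! ### The infinite pyramid, pullbacks and underlying spaces -/

/-- The infinite pyramid. -/
def OmegaInf : Set R3 := {x | 0 < x 0 ∧ x 0 < 1 ∧ 0 < x 1 ∧ x 1 < 1 ∧ 0 < x 2}

/-- The map `τ(x, y, z) = (x, y, z)/(1+z)` from the infinite pyramid to the pyramid. -/
def tau (x : R3) : R3 := fun k => x k / (1 + x 2)

/-- The Jacobian matrix of `τ`. -/
def jacTau (x : R3) : Matrix (Fin 3) (Fin 3) ℝ := fun i j => pd j (fun y => tau y i) x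

def pull0 (f : R3 → ℝ) (x : R3) : ℝ := f (tau x)

def pull1 (E : R3 → R3) (x : R3) : R3 := (jacTau x)ᵀ *ᵥ E (tau x)

def pull2 (V : R3 → R3) (x : R3) : R3 := (jacTau x).det • ((jacTau x)⁻¹ *ᵥ V (tau x))

def pull3 (ψ : R3 → ℝ) (x : R3) : ℝ := (jacTau x).det * ψ (tau x)

/-- The weighted tensor polynomial space `𝒬_n^{a,b,c}` of functions on the infinite pyramid. -/
def QW (n : ℕ) (a b c : ℤ) : Set (R3 → ℝ) :=
  {f | ∃ ψ ∈ TensorPoly a b c, ∀ x ∈ OmegaInf, f x = MvPolynomial.eval x ψ / (1 + x 2) ^ n}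

/-- Vector fields with prescribed spaces for the three components. -/
def Prod3 (S₀ S₁ S₂ : Set (R3 → ℝ)) : Set (R3 → R3) :=
  {E | (fun x => E x 0) ∈ S₀ ∧ (fun x => E x 1) ∈ S₁ ∧ (fun x => E x 2) ∈ S₂}

def Vinf0 (p : ℕ) : Set (R3 → ℝ) :=
  {f | f ∈ QW p p p p ∧
    grad f ∈ Prod3 (QW p (p - 1) p (p - 1)) (QW p p (p - 1) (p - 1)) (QW (p + 1) p p (p - 1))}

def Vinf1 (p : ℕ) : Set (R3 → R3) :=
  {E | E ∈ Prod3 (QW (p + 1) (p - 1) p p) (QW (p + 1) p (p - 1) p) (QW (p + 1) p p (p - 1)) ∧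
    curl E ∈ Prod3 (QW (p + 2) p (p - 1) (p - 1)) (QW (p + 2) (p - 1) p (p - 1))
      (QW (p + 1) (p - 1) (p - 1) (p - 1))}

def Vinf2 (p : ℕ) : Set (R3 → R3) :=
  {V | V ∈ Prod3 (QW (p + 2) p (p - 1) (p - 1)) (QW (p + 2) (p - 1) p (p - 1))
      (QW (p + 2) (p - 1) (p - 1) p) ∧
    div V ∈ QW (p + 3) (p - 1) (p - 1) (p - 1)}

def Vinf3 (p : ℕ) : Set (R3 → ℝ) := QW (p + 3) (p - 1) (p - 1) (p - 1)

/-- The spaces `𝒰^{(m),p} = 𝒱^{(m),p} ∩ Γ^{(m),p}`, where `𝒱^{(m),p}` consists of the functions on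
the pyramid whose pullback lies in `𝒱_∞^{(m),p}`. -/
def U0 (p : ℕ) : Set (R3 → ℝ) := {f | pull0 f ∈ Vinf0 p} ∩ Gamma0 p

def U1 (p : ℕ) : Set (R3 → R3) := {E | pull1 E ∈ Vinf1 p} ∩ Gamma1 p

def U2 (p : ℕ) : Set (R3 → R3) := {V | pull2 V ∈ Vinf2 p} ∩ Gamma2 p

def U3 (p : ℕ) : Set (R3 → ℝ) := {ψ | pull3 ψ ∈ Vinf3 p} ∩ Gamma3 p

/-! ### The shape functions: `H¹` -/

/-- Vertices: `λ_{d+1}`. -/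
def h1Vertex (d : Fin 5) : R3 → ℝ := lam d

/-- Mixed edges: `μ_c(ξ_b/(1-ζ)) φ_i^E(ν_0(ξ_a,ζ), ν_1(ξ_a,ζ))`. -/
def h1MixedEdge (a b c : Fin 2) (i : ℕ) (x : R3) : ℝ := muS c b x * phiE i (nu 0 a) (nu 1 a) x

/-- Triangle edges: `φ_i^E(λ_{d+1}, λ_5)`. -/
def h1TriEdge (d : Fin 5) (i : ℕ) : R3 → ℝ := phiE i (lam d) (lam 4)

/-- Quadrilateral face. -/
def h1QuadFace (i j : ℕ) (x : R3) : ℝ := muZ 0 x * phiQuadS i j 0 1 x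

/-- Triangle faces. -/
def h1TriFace (a b c : Fin 2) (i j : ℕ) (x : R3) : ℝ :=
  muS c b x * phiTri i j (nu 0 a) (nu 1 a) (nu 2 a) x

/-- Interior bubbles. -/
def h1Bubble (i j k : ℕ) (x : R3) : ℝ := phiQuadS i j 0 1 x * phiZ k x

/-! ### The shape functions: `H(curl)` -/

/-- Mixed edges. -/
def hcurlMixedEdge (a b c : Fin 2) (i : ℕ) (x : R3) : R3 := muS c b x • opE i (nu 0 a) (nu 1 a) x

/-- Triangle edges. -/
def hcurlTriEdge (d : Fin 5) (i : ℕ) : R3 → R3 := opE i (lam d) (lam 4)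

/-- Quadrilateral face: family I is `(a, b) = (0, 1)`, family II is `(a, b) = (1, 0)`. -/
def hcurlQuadFace (a b : Fin 2) (i j : ℕ) (x : R3) : R3 := muZ 0 x ^ 2 • opEQuadS i j a b x

/-- Triangle faces, family I. -/
def hcurlTriFaceI (a b c : Fin 2) (i j : ℕ) (x : R3) : R3 :=
  muS c b x • opETri i j (nu 0 a) (nu 1 a) (nu 2 a) x

/-- Triangle faces, family II. -/
def hcurlTriFaceII (a b c : Fin 2) (i j : ℕ) (x : R3) : R3 :=
  muS c b x • opETri i j (nu 1 a) (nu 2 a) (nu 0 a) x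

/-- Interior bubbles, family I (gradients of the `H¹` bubbles). -/
def hcurlBubbleI (i j k : ℕ) (x : R3) : R3 :=
  phiZ k x • grad (phiQuadS i j 0 1) x + phiQuadS i j 0 1 x • grad (phiZ k) x

/-- Interior bubbles, families II (`(a, b) = (0, 1)`) and III (`(a, b) = (1, 0)`). -/
def hcurlBubbleII (a b : Fin 2) (i j k : ℕ) (x : R3) : R3 :=
  (muZ 0 x * phiZ k x) • opEQuadS i j a b x

/-- Interior bubbles, family IV; the entries are permuted, and `n = max i j`. -/
def hcurlBubbleIV (i j : ℕ) (x : R3) : R3 :=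
  phiQuadS i j 1 0 x •
    ((((max i j : ℕ) : ℝ) * muZ 0 x ^ (max i j - 1)) • grad (muZ 0) x)

/-! ### The shape functions: `H(div)` -/

/-- Quadrilateral face. -/
def hdivQuadFace (i j : ℕ) (x : R3) : R3 := muZ 0 x ^ 3 • opVQuadS i j 0 1 x

/-- Triangle faces: `½ (μ V_ij^Δ(ν₀₁₂(ξ_a,ζ)) + μ⁻¹ V_ij^Δ(λ_d, λ_e, λ_5))` with
`μ = μ_c(ξ_b/(1-ζ))`, where `d`, `e` are the base vertices of the face, at which `ξ_a` is `0`
and `1`, respectively. -/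
def hdivTriFace (a b c : Fin 2) (i j : ℕ) (x : R3) : R3 :=
  (1 / 2 : ℝ) • (muS c b x • opVTri i j (nu 0 a) (nu 1 a) (nu 2 a) x
    + (muS c b x)⁻¹ •
      opVTri i j (lam (vertexAlong a 0 c)) (lam (vertexAlong a 1 c)) (lam 4) x)

/-- The expression without the factor `μ⁻¹` for the triangle face functions. -/
def hdivTriFaceReg (a b c : Fin 2) (i j : ℕ) (x : R3) : R3 :=
  (1 / 2 : ℝ) • (muS c b x • opVTri i j (nu 0 a) (nu 1 a) (nu 2 a) x
    + hPP i j (muS c b x * nu 0 a x) (muS c b x * nu 1 a x) (nu 2 a x) •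
      (muS c b x • opVTri 0 0 (nu 0 a) (nu 1 a) (nu 2 a) x
        + nu 2 a x • (grad (muS c b) x ⨯₃ opE 0 (nu 0 a) (nu 1 a) x)))

/-- Interior bubbles, families I (`(a, b) = (0, 1)`) and II (`(a, b) = (1, 0)`). -/
def hdivBubbleI (a b : Fin 2) (i j k : ℕ) (x : R3) : R3 :=
  (muZ 0 x * phiZ k x) • curl (opEQuadS i j a b) x
    + (muZ 0 x • grad (phiZ k) x + phiZ k x • grad (muZ 0) x) ⨯₃ opEQuadS i j a b x

/-- Interior bubbles, family III; the entries are permuted, and `n = max i j`. -/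
def hdivBubbleIII (i j : ℕ) (x : R3) : R3 :=
  (((max i j : ℕ) : ℝ) * muZ 0 x ^ (max i j - 1)) •
    (grad (phiQuadS i j 1 0) x ⨯₃ grad (muZ 0) x)

/-- Interior bubbles, family IV. -/
def hdivBubbleIV (i j k : ℕ) (x : R3) : R3 := (muZ 0 x ^ 2 * phiZ k x) • opVQuadS i j 0 1 x

/-- Interior bubbles, family V; `n = max i j`. -/
def hdivBubbleV (i j : ℕ) (x : R3) : R3 :=
  muZ 1 x ^ (max i j - 1) • opVLeft i j (muS 0 0) (muS 1 0) (muS 0 1) (muS 1 1) (muZ 0) x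

/-- Interior bubbles, families VI (`(a, b) = (0, 1)`) and VII (`(a, b) = (1, 0)`). -/
def hdivBubbleVI (a b : Fin 2) (i : ℕ) (x : R3) : R3 :=
  muZ 1 x ^ (i - 1) • opVRight i (muS 0 a) (muS 1 a) (muS 1 b) (muZ 0) x

/-! ### The shape functions: `L²` -/

/-- Interior functions. -/
def l2Interior (i j k : ℕ) (x : R3) : ℝ :=
  hP i (muS 0 0 x) (muS 1 0 x) * hP j (muS 0 1 x) (muS 1 1 x) * hP k (muZ 0 x) (muZ 1 x) *
    ((grad (nu 1 0) x ⨯₃ grad (nu 1 1) x) ⬝ᵥ grad (muZ 1) x)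

end

end PyramidFE

open PyramidFE

namespace PyramidFE

open Topology

/-! ### Vector calculus -/

/-! All shape functions are smooth in the half space ζ < 1 (for the face functions containing μ⁻¹,
after an algebraic cancellation). The apex is the only singular point, and it belongs to no open
face. The claims then split into two independent kinds.

Traces. A test field supported near one open face has compact support away from the apex, so its
product with a shape function is C¹ with compact support. The divergence theorem
`integral_div_eq_face` applied to this product shows that the classical derivative is the weak one
and that the trace is the restriction, once the derivative is square integrable. What remains is
algebra on the faces: [L_i] is divisible by s₀s₁ for i ≥ 2, [L_j^α] is divisible by s₁, the scaled μ
takes the values 0 and 1 on the two faces of its axis, and its gradient is normal there.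

Degrees and integrability. Put w = 1/(1+z). Under τ one has ζ ↦ 1 - w, the scaled μ becomes the
unscaled one, ν_c(ξ_a, ζ) ↦ w μ_c(x_a), and λ_k ↦ w times a bilinear function. Hence the pullbacks
are combinations of monomials x^α y^β w^m, and `WT a b lo hi` records the degrees and the range lo ≤
m ≤ hi. Such a function lies in 𝒬_n^{a,b,c} when hi ≤ n ≤ c + lo, and it is O(w^lo). The lower
exponents that the spaces 𝒱_∞ require are exactly those that make the original field bounded on Ω:
(1,1,2) for m = 1, (3,3,2) for m = 2 and 4 for m = 3. Since ∂_z w = -w², each z-derivative raises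
the exponent by one. So a field with exponents (2,2,3) has an admissible curl (`CurlClass`), and one
with (4,4,3) an admissible divergence (`DivClass`); pullbacks commute with the differential
operators (`pull1_grad`, `pull2_curl`, `pull3_div`).

Some pullbacks are one power of w short of these classes. The missing decay matters only for the
next derivative, so it suffices to split off an exact part that this derivative annihilates. The
criteria `mem_U1_of_pull` and `mem_U2_of_pull` therefore accept E' + ∇g and V' + curl E'. The
gradient is needed for the triangle edges and the first bubbles of `H(curl)`. The curl is needed for
the bubbles of `H(div)` built from curls and for its triangle faces with i = 0; there the equal
weights ½, ½ in V^f are what allows a single curl to absorb both leading terms.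

The factor μ⁻¹ is harmless because the vector part of V^Δ(μs₀, μs₁, s₂) is divisible by μ. The
formula for the divergence follows from Euler's relation for the homogeneous polynomial [P_i,
P_j^{2i+1}]. -/

theorem cross_apply_zero (a b : R3) : (a ⨯₃ b) 0 = a 1 * b 2 - a 2 * b 1 := by
  simp [cross_apply]

theorem cross_apply_one (a b : R3) : (a ⨯₃ b) 1 = a 2 * b 0 - a 0 * b 2 := by
  simp [cross_apply]

theorem cross_apply_two (a b : R3) : (a ⨯₃ b) 2 = a 0 * b 1 - a 1 * b 0 := by
  simp [cross_apply]

theorem dot_apply (a b : R3) : a ⬝ᵥ b = a 0 * b 0 + a 1 * b 1 + a 2 * b 2 := by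
  simp [dotProduct, Fin.sum_univ_three]

theorem curl_apply_zero (E : R3 → R3) (x : R3) :
    curl E x 0 = pd 1 (fun y => E y 2) x - pd 2 (fun y => E y 1) x := rfl

theorem curl_apply_one (E : R3 → R3) (x : R3) :
    curl E x 1 = pd 2 (fun y => E y 0) x - pd 0 (fun y => E y 2) x := rfl

theorem curl_apply_two (E : R3 → R3) (x : R3) :
    curl E x 2 = pd 0 (fun y => E y 1) x - pd 1 (fun y => E y 0) x := rfl

theorem div_apply (V : R3 → R3) (x : R3) :
    PyramidFE.div V x
      = pd 0 (fun y => V y 0) x + pd 1 (fun y => V y 1) x + pd 2 (fun y => V y 2) x := by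
  simp [PyramidFE.div, Fin.sum_univ_three]

/-! ### Partial derivatives and the chain rule. -/

section Pd

variable {f g : R3 → ℝ} {x : R3} {k : Fin 3}

theorem pd_congr (h : f =ᶠ[𝓝 x] g) : pd k f x = pd k g x := by
  unfold pd; rw [h.fderiv_eq]

theorem pd_const (c : ℝ) : pd k (fun _ => c) x = 0 := by
  simp [pd]

theorem pd_add (hf : DifferentiableAt ℝ f x) (hg : DifferentiableAt ℝ g x) :
    pd k (fun y => f y + g y) x = pd k f x + pd k g x := by
  unfold pd; rw [fderiv_fun_add hf hg]; rfl

theorem pd_sub (hf : DifferentiableAt ℝ f x) (hg : DifferentiableAt ℝ g x) :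
    pd k (fun y => f y - g y) x = pd k f x - pd k g x := by
  unfold pd; rw [fderiv_fun_sub hf hg]; rfl

theorem pd_mul (hf : DifferentiableAt ℝ f x) (hg : DifferentiableAt ℝ g x) :
    pd k (fun y => f y * g y) x = f x * pd k g x + g x * pd k f x := by
  unfold pd; rw [fderiv_fun_mul hf hg]; simp

theorem pd_coord (j : Fin 3) : pd k (fun y => y j) x = if j = k then 1 else 0 := by
  unfold pd
  have : HasFDerivAt (fun y : R3 => y j) (ContinuousLinearMap.proj (R := ℝ) j) x :=
    (ContinuousLinearMap.proj (R := ℝ) (φ := fun _ : Fin 3 => ℝ) j).hasFDerivAt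
  rw [this.fderiv]
  simp [Pi.single_apply]

/-- The chain rule for the outer function of one variable. -/
theorem pd_comp_hasDerivAt {P : ℝ → ℝ} {P' : ℝ} (hP : HasDerivAt P P' (f x))
    (hf : DifferentiableAt ℝ f x) : pd k (fun y => P (f y)) x = P' * pd k f x := by
  have h : HasFDerivAt (fun y => P (f y)) (P' • fderiv ℝ f x) x :=
    hP.comp_hasFDerivAt x hf.hasFDerivAt
  unfold pd
  rw [h.fderiv]
  simp

/-- The chain rule for the outer function of three variables. -/
theorem pd_comp {F : R3 → ℝ} {s : R3 → R3} (hF : DifferentiableAt ℝ F (s x))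
    (hs : DifferentiableAt ℝ s x) :
    pd k (fun y => F (s y)) x = ∑ j, pd k (fun y => s y j) x * pd j F (s x) := by
  unfold pd
  have h1 : HasFDerivAt (fun y => F (s y)) ((fderiv ℝ F (s x)).comp (fderiv ℝ s x)) x :=
    hF.hasFDerivAt.comp x hs.hasFDerivAt
  rw [h1.fderiv, ContinuousLinearMap.comp_apply]
  have h2 : ∀ j, fderiv ℝ (fun y => s y j) x (Pi.single k 1)
      = fderiv ℝ s x (Pi.single k 1) j := by
    intro j
    have := (hasFDerivAt_pi'.1 hs.hasFDerivAt j).fderiv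
    rw [this]; rfl
  simp_rw [h2]
  conv_lhs => rw [pi_eq_sum_univ' (fderiv ℝ s x (Pi.single k 1))]
  rw [map_sum]
  refine Finset.sum_congr rfl fun j _ => ?_
  rw [map_smul, smul_eq_mul]

end Pd

/-! ### Rules for gradients. -/

section Grad

variable {f g : R3 → ℝ} {x : R3}

theorem grad_congr (h : f =ᶠ[𝓝 x] g) : grad f x = grad g x := by
  ext k; exact pd_congr h

theorem grad_const (c : ℝ) : grad (fun _ => c) x = 0 := by
  ext k; exact pd_const c

theorem grad_add (hf : DifferentiableAt ℝ f x) (hg : DifferentiableAt ℝ g x) :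
    grad (fun y => f y + g y) x = grad f x + grad g x := by
  ext k; exact pd_add hf hg

theorem grad_sub (hf : DifferentiableAt ℝ f x) (hg : DifferentiableAt ℝ g x) :
    grad (fun y => f y - g y) x = grad f x - grad g x := by
  ext k; exact pd_sub hf hg

theorem grad_mul (hf : DifferentiableAt ℝ f x) (hg : DifferentiableAt ℝ g x) :
    grad (fun y => f y * g y) x = f x • grad g x + g x • grad f x := by
  ext k; exact pd_mul hf hg

theorem grad_coord (j : Fin 3) : grad (fun y => y j) x = Pi.single j 1 := by
  ext k
  change pd k _ x = _
  rw [pd_coord, Pi.single_apply]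
  simp [eq_comm]

theorem grad_comp_hasDerivAt {P : ℝ → ℝ} {P' : ℝ} (hP : HasDerivAt P P' (f x))
    (hf : DifferentiableAt ℝ f x) : grad (fun y => P (f y)) x = P' • grad f x := by
  ext k; exact pd_comp_hasDerivAt hP hf

theorem grad_pow (n : ℕ) (hf : DifferentiableAt ℝ f x) :
    grad (fun y => f y ^ n) x = ((n : ℝ) * f x ^ (n - 1)) • grad f x :=
  grad_comp_hasDerivAt (P := fun t => t ^ n) (hasDerivAt_pow n _) hf

theorem grad_eval (P : Polynomial ℝ) (hf : DifferentiableAt ℝ f x) :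
    grad (fun y => P.eval (f y)) x = P.derivative.eval (f x) • grad f x :=
  grad_comp_hasDerivAt (P := fun t => P.eval t) (P.hasDerivAt _) hf

theorem grad_inv (hf : DifferentiableAt ℝ f x) (h0 : f x ≠ 0) :
    grad (fun y => (f y)⁻¹) x = (-(f x ^ 2)⁻¹) • grad f x :=
  grad_comp_hasDerivAt (P := fun t => t⁻¹) (hasDerivAt_inv h0) hf

end Grad

/-! ### Product rules for curl and divergence, and symmetry of second derivatives. -/

section Curl

variable {x : R3}

theorem differentiableAt_apply {E : R3 → R3} (hE : DifferentiableAt ℝ E x) (k : Fin 3) :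
    DifferentiableAt ℝ (fun y => E y k) x := differentiableAt_pi.1 hE k

theorem curl_congr {E F : R3 → R3} (h : E =ᶠ[𝓝 x] F) : curl E x = curl F x := by
  have h' : ∀ k, (fun y => E y k) =ᶠ[𝓝 x] fun y => F y k := fun k => h.mono fun y hy => by
    simp only [hy]
  unfold curl
  simp only [pd_congr (h' 0), pd_congr (h' 1), pd_congr (h' 2)]

theorem div_congr {E F : R3 → R3} (h : E =ᶠ[𝓝 x] F) :
    PyramidFE.div E x = PyramidFE.div F x := by
  have h' : ∀ k, (fun y => E y k) =ᶠ[𝓝 x] fun y => F y k := fun k => h.mono fun y hy => by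
    simp only [hy]
  simp only [div_apply, pd_congr (h' 0), pd_congr (h' 1), pd_congr (h' 2)]

theorem curl_add {E F : R3 → R3} (hE : DifferentiableAt ℝ E x) (hF : DifferentiableAt ℝ F x) :
    curl (fun y => E y + F y) x = curl E x + curl F x := by
  have e := differentiableAt_apply hE
  have f := differentiableAt_apply hF
  ext k
  fin_cases k <;>
    simp [curl, pd_add (e _) (f _)] <;> ring

theorem div_add {E F : R3 → R3} (hE : DifferentiableAt ℝ E x) (hF : DifferentiableAt ℝ F x) :
    PyramidFE.div (fun y => E y + F y) x = PyramidFE.div E x + PyramidFE.div F x := by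
  have e := differentiableAt_apply hE
  have f := differentiableAt_apply hF
  simp [div_apply, pd_add (e _) (f _)]
  ring

theorem curl_smul {f : R3 → ℝ} {G : R3 → R3} (hf : DifferentiableAt ℝ f x)
    (hG : DifferentiableAt ℝ G x) :
    curl (fun y => f y • G y) x = f x • curl G x + grad f x ⨯₃ G x := by
  have g := differentiableAt_apply hG
  ext k
  fin_cases k <;>
    simp [curl, pd_mul hf (g _), cross_apply, grad] <;> ring

theorem div_smul {f : R3 → ℝ} {G : R3 → R3} (hf : DifferentiableAt ℝ f x)
    (hG : DifferentiableAt ℝ G x) :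
    PyramidFE.div (fun y => f y • G y) x = f x * PyramidFE.div G x + grad f x ⬝ᵥ G x := by
  have g := differentiableAt_apply hG
  simp [div_apply, pd_mul hf (g _), dot_apply, grad]
  ring

theorem div_cross {E F : R3 → R3} (hE : DifferentiableAt ℝ E x) (hF : DifferentiableAt ℝ F x) :
    PyramidFE.div (fun y => E y ⨯₃ F y) x = curl E x ⬝ᵥ F x - E x ⬝ᵥ curl F x := by
  have e := differentiableAt_apply hE
  have f := differentiableAt_apply hF
  simp only [div_apply, cross_apply_zero, cross_apply_one, cross_apply_two]
  simp only [pd_sub ((e _).fun_mul (f _)) ((e _).fun_mul (f _)), pd_mul (e _) (f _), dot_apply,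
    curl_apply_zero, curl_apply_one, curl_apply_two]
  ring

theorem differentiableAt_pd {f : R3 → ℝ} (hf : ContDiffAt ℝ 2 f x) (k : Fin 3) :
    DifferentiableAt ℝ (pd k f) x := by
  have h : DifferentiableAt ℝ (fderiv ℝ f) x :=
    (hf.fderiv_right (m := 1) (by norm_num)).differentiableAt (by norm_num)
  exact h.clm_apply (differentiableAt_const _)

theorem differentiableAt_grad {f : R3 → ℝ} (hf : ContDiffAt ℝ 2 f x) :
    DifferentiableAt ℝ (grad f) x := differentiableAt_pi.2 (differentiableAt_pd hf)

theorem pd_comm {f : R3 → ℝ} (hf : ContDiffAt ℝ 2 f x) (j k : Fin 3) :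
    pd j (pd k f) x = pd k (pd j f) x := by
  have h : DifferentiableAt ℝ (fderiv ℝ f) x :=
    (hf.fderiv_right (m := 1) (by norm_num)).differentiableAt (by norm_num)
  have hs := hf.isSymmSndFDerivAt (by simp)
  unfold pd
  rw [fderiv_clm_apply h (differentiableAt_const _), fderiv_clm_apply h (differentiableAt_const _)]
  simpa using hs (Pi.single j 1) (Pi.single k 1)

theorem curl_grad {f : R3 → ℝ} (hf : ContDiffAt ℝ 2 f x) : curl (grad f) x = 0 := by
  ext k
  fin_cases k
  · exact sub_eq_zero.2 (pd_comm hf 1 2)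
  · exact sub_eq_zero.2 (pd_comm hf 2 0)
  · exact sub_eq_zero.2 (pd_comm hf 0 1)

/-- As gradients are curl free, only the derivative of the coefficient survives. Curls are computed
below by writing fields as sums of terms f ∇g. -/
theorem curl_smul_grad {f g : R3 → ℝ} (hf : DifferentiableAt ℝ f x) (hg : ContDiffAt ℝ 2 g x) :
    curl (fun y => f y • grad g y) x = grad f x ⨯₃ grad g x := by
  rw [curl_smul hf (differentiableAt_grad hg), curl_grad hg]; simp

theorem differentiableAt_cross {E F : R3 → R3} (hE : DifferentiableAt ℝ E x)
    (hF : DifferentiableAt ℝ F x) : DifferentiableAt ℝ (fun y => E y ⨯₃ F y) x := by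
  have e := differentiableAt_apply hE
  have f := differentiableAt_apply hF
  refine differentiableAt_pi.2 fun k => ?_
  fin_cases k <;> simp [cross_apply] <;> exact ((e _).mul (f _)).sub ((e _).mul (f _))

/-- A cross product of two gradients is divergence free, by `div_cross` and `curl_grad`. The
counterpart of `curl_smul_grad` one degree higher. -/
theorem div_smul_cross_grad {f g h : R3 → ℝ} (hf : DifferentiableAt ℝ f x)
    (hg : ContDiffAt ℝ 2 g x) (hh : ContDiffAt ℝ 2 h x) :
    PyramidFE.div (fun y => f y • (grad g y ⨯₃ grad h y)) x
      = grad f x ⬝ᵥ (grad g x ⨯₃ grad h x) := by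
  rw [div_smul hf (differentiableAt_cross (differentiableAt_grad hg) (differentiableAt_grad hh)),
    div_cross (differentiableAt_grad hg) (differentiableAt_grad hh), curl_grad hg, curl_grad hh]
  simp

end Curl

theorem two_le_infty : (2 : WithTop ℕ∞) ≤ ∞ := by
  have : ((2 : ℕ∞) : WithTop ℕ∞) ≤ ((⊤ : ℕ∞) : WithTop ℕ∞) := WithTop.coe_le_coe.2 le_top
  exact this

/-! ### Smoothness of derivatives on open sets. -/

section Smooth

variable {E : Type*} [NormedAddCommGroup E] [NormedSpace ℝ E] {U : Set R3}

theorem contDiffOn_grad (hU : IsOpen U) {f : R3 → ℝ} (hf : ContDiffOn ℝ ∞ f U) :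
    ContDiffOn ℝ ∞ (grad f) U := by
  refine contDiffOn_pi.2 fun k => ?_
  exact (hf.fderiv_of_isOpen hU (by simp)).clm_apply contDiffOn_const

theorem contDiffOn_pd (hU : IsOpen U) {f : R3 → ℝ} (hf : ContDiffOn ℝ ∞ f U) (k : Fin 3) :
    ContDiffOn ℝ ∞ (pd k f) U := contDiffOn_pi.1 (contDiffOn_grad hU hf) k

theorem contDiffOn_apply {F : R3 → R3} (hF : ContDiffOn ℝ ∞ F U) (k : Fin 3) :
    ContDiffOn ℝ ∞ (fun y => F y k) U := contDiffOn_pi.1 hF k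

theorem contDiffOn_cross {F G : R3 → R3} (hF : ContDiffOn ℝ ∞ F U) (hG : ContDiffOn ℝ ∞ G U) :
    ContDiffOn ℝ ∞ (fun y => F y ⨯₃ G y) U := by
  have e := contDiffOn_apply hF
  have f := contDiffOn_apply hG
  refine contDiffOn_pi.2 fun k => ?_
  fin_cases k <;> simp [cross_apply] <;> exact ((e _).mul (f _)).sub ((e _).mul (f _))

theorem contDiffOn_curl (hU : IsOpen U) {F : R3 → R3} (hF : ContDiffOn ℝ ∞ F U) :
    ContDiffOn ℝ ∞ (curl F) U := by
  have e := fun j k => contDiffOn_pd hU (contDiffOn_apply hF j) k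
  refine contDiffOn_pi.2 fun k => ?_
  fin_cases k <;> exact (e _ _).sub (e _ _)

theorem contDiffOn_div (hU : IsOpen U) {F : R3 → R3} (hF : ContDiffOn ℝ ∞ F U) :
    ContDiffOn ℝ ∞ (PyramidFE.div F) U :=
  ContDiffOn.sum fun k _ => contDiffOn_pd hU (contDiffOn_apply hF k) k

theorem ContDiffOn.contDiffAt_of_isOpen {F : R3 → E} (hU : IsOpen U) (hF : ContDiffOn ℝ ∞ F U)
    {x : R3} (hx : x ∈ U) : ContDiffAt ℝ ∞ F x := hF.contDiffAt (hU.mem_nhds hx)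

theorem ContDiffOn.differentiableAt_of_isOpen {F : R3 → E} (hU : IsOpen U)
    (hF : ContDiffOn ℝ ∞ F U) {x : R3} (hx : x ∈ U) : DifferentiableAt ℝ F x :=
  (hF.contDiffAt (hU.mem_nhds hx)).differentiableAt (by simp)

theorem div_curl {F : R3 → R3} (hU : IsOpen U) (hF : ContDiffOn ℝ ∞ F U) {x : R3} (hx : x ∈ U) :
    PyramidFE.div (curl F) x = 0 := by
  have h2 : ∀ k, ContDiffAt ℝ 2 (fun y => F y k) x := fun k =>
    ((contDiffOn_apply hF k).contDiffAt (hU.mem_nhds hx)).of_le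
      two_le_infty
  have e := fun j k => differentiableAt_pd (h2 j) k
  simp only [div_apply, curl_apply_zero, curl_apply_one, curl_apply_two]
  rw [pd_sub (e _ _) (e _ _), pd_sub (e _ _) (e _ _), pd_sub (e _ _) (e _ _),
    pd_comm (h2 2) 0 1, pd_comm (h2 1) 0 2, pd_comm (h2 0) 1 2]
  ring

end Smooth

end PyramidFE

namespace PyramidFE

open Topology

/-! ### The divergence theorem for fields supported near one face -/

/-- Turns statements about faces into five explicit cases that linear arithmetic can decide. -/
theorem forall_face {P : Face → Prop} :
    (∀ F, P F) ↔ P .quad ∧ P (.tri 0 0) ∧ P (.tri 0 1) ∧ P (.tri 1 0) ∧ P (.tri 1 1) := by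
  constructor
  · intro h; exact ⟨h _, h _, h _, h _, h _⟩
  · rintro ⟨h, h1, h2, h3, h4⟩ (_ | ⟨b, c⟩)
    · exact h
    · fin_cases b <;> fin_cases c <;> assumption

theorem mem_Omega_iff {x : R3} : x ∈ Omega ↔ ∀ F, 0 < faceFun F x := by
  rw [forall_face]
  simp only [Omega, faceFun, Set.mem_ofPred_eq]
  simp
  constructor
  · rintro ⟨h0, h1, h2, h3, h4⟩; refine ⟨?_, ?_, ?_, ?_, ?_⟩ <;> linarith
  · rintro ⟨h0, h1, h2, h3, h4⟩; refine ⟨?_, ?_, ?_, ?_, ?_⟩ <;> linarith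

theorem mem_Omega_of_mem_faceNhd {F : Face} {x : R3} (hx : x ∈ faceNhd F)
    (h0 : 0 < faceFun F x) : x ∈ Omega :=
  mem_Omega_iff.2 fun F' => by
    by_cases h : F' = F
    · rw [h]; exact h0
    · exact hx F' h

theorem Omega_subset_faceNhd (F : Face) : Omega ⊆ faceNhd F :=
  fun _ hx F' _ => mem_Omega_iff.1 hx F'

/-- For any F, at least one of the two axes b has both faces `tri b 0` and `tri b 1` among the
remaining ones. Their two affine functions are positive and add up to 1 - ζ. -/
theorem faceNhd_subset (F : Face) : faceNhd F ⊆ {x | x 2 < 1} := by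
  intro x hx
  simp only [faceNhd, Set.mem_ofPred_eq] at hx ⊢
  rw [forall_face] at hx
  simp only [faceFun] at hx
  revert F
  rw [forall_face]
  simp
  refine ⟨?_, ?_, ?_, ?_, ?_⟩ <;> intros <;> linarith

/-- A field supported in `faceNhd F` thus vanishes at the parameters outside `faceDom F`, so that
integrals over the face extend to the whole plane. -/
theorem facePar_mem_faceNhd_iff {F : Face} {u : ℝ × ℝ} :
    facePar F u ∈ faceNhd F ↔ u ∈ faceDom F := by
  simp only [faceNhd, Set.mem_ofPred_eq]
  rw [forall_face]
  revert F
  rw [forall_face]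
  simp [faceFun, facePar, faceDom]
  constructorm* _ ∧ _, _ ↔ _ <;> intros <;> casesm* _ ∧ _ <;> constructorm* _ ∧ _ <;> linarith

theorem measurableSet_faceDom (F : Face) : MeasurableSet (faceDom F) := by
  cases F <;> simp only [faceDom, Set.ofPred_and]
  · exact ((isOpen_lt continuous_const continuous_fst).inter
      ((isOpen_lt continuous_fst continuous_const).inter
      ((isOpen_lt continuous_const continuous_snd).inter
      (isOpen_lt continuous_snd continuous_const)))).measurableSet
  · exact ((isOpen_lt continuous_const continuous_fst).inter
      ((isOpen_lt continuous_const continuous_snd).inter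
      (isOpen_lt (continuous_fst.add continuous_snd) continuous_const))).measurableSet

theorem isOpen_Omega : IsOpen Omega := by
  simp only [Omega, Set.ofPred_and]
  refine (isOpen_lt continuous_const (continuous_apply 0)).inter
    ((isOpen_lt continuous_const (continuous_apply 1)).inter
    ((isOpen_lt continuous_const (continuous_apply 2)).inter
    ((isOpen_lt ?_ continuous_const).inter (isOpen_lt ?_ continuous_const)))) <;> fun_prop

theorem eq_zero_of_notMem_tsupport {E : Type*} [Zero E] {Ψ : R3 → E} {s : Set R3}
    (hs : tsupport Ψ ⊆ s) {x : R3} (hx : x ∉ s) : Ψ x = 0 :=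
  image_eq_zero_of_notMem_tsupport fun h => hx (hs h)

theorem div_eq_zero_of_notMem_tsupport {Ψ : R3 → R3} {x : R3} (hx : x ∉ tsupport Ψ) :
    PyramidFE.div Ψ x = 0 := by
  have h : Ψ =ᶠ[𝓝 x] fun _ => 0 := notMem_tsupport_iff_eventuallyEq.1 hx
  rw [div_congr h]
  simp [PyramidFE.div, pd]

/-- The divergence theorem near a face contained in a coordinate plane `x_k = 0`. -/
theorem integral_div_eq_coord (F : Face) (k : Fin 3) (hF : ∀ x, faceFun F x = x k)
    {Ψ : R3 → R3} (hΨ : ContDiff ℝ 1 Ψ) (hc : HasCompactSupport Ψ)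
    (hs : tsupport Ψ ⊆ faceNhd F) :
    ∫ x in Omega, PyramidFE.div Ψ x = -∫ u : Fin 2 → ℝ, Ψ (k.insertNth 0 u) k := by
  obtain ⟨R₀, hR₀⟩ := hc.isCompact.isBounded.subset_closedBall 0
  -- The support lies strictly inside the cube of radius R, and so does the pyramid, whose
  -- coordinates are at most 1.
  set R : ℝ := max R₀ 1 + 1 with hR
  have hR1 : 1 < R := by have := le_max_right R₀ 1; linarith
  have hsm : ∀ x ∈ tsupport Ψ, ∀ i, |x i| < R := by
    intro x hx i
    have h1 := hR₀ hx
    rw [mem_closedBall_zero_iff] at h1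
    have h2 := norm_le_pi_norm x i
    rw [Real.norm_eq_abs] at h2
    have := le_max_left R₀ 1
    linarith
  have hz : ∀ x i, R ≤ |x i| → Ψ x = 0 := fun x i h =>
    image_eq_zero_of_notMem_tsupport fun hx => absurd (hsm x hx i) (not_lt.2 h)
  -- The box has one side on the plane of the face. Its other five sides lie where the field
  -- vanishes, so the divergence theorem for boxes leaves one boundary term.
  set a : R3 := fun i => if i = k then 0 else -R with ha
  set b : R3 := fun _ => R with hb
  have hab : a ≤ b := by
    intro i; simp only [ha, hb]; split_ifs <;> linarith
  have hΨd : ∀ x, HasFDerivAt Ψ (fderiv ℝ Ψ x) x := fun x =>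
    ((hΨ.differentiable (by norm_num)) x).hasFDerivAt
  have hdiv : ∀ x, ∑ i, fderiv ℝ Ψ x (Pi.single i 1) i = PyramidFE.div Ψ x := by
    intro x
    refine Finset.sum_congr rfl fun i _ => ?_
    unfold pd
    rw [(hasFDerivAt_pi'.1 (hΨd x) i).fderiv]; rfl
  have hcont : Continuous fun x => ∑ i, fderiv ℝ Ψ x (Pi.single i 1) i := by
    have := hΨ.continuous_fderiv (by norm_num)
    refine continuous_finsetSum _ fun i _ => ?_
    exact (continuous_apply i).comp (this.clm_apply continuous_const)
  have key := integral_divergence_of_hasFDerivAt_off_countable a b hab Ψ (fderiv ℝ Ψ) ∅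
    Set.countable_empty hΨ.continuous.continuousOn (fun x _ => hΨd x)
    (hcont.continuousOn.integrableOn_compact isCompact_Icc)
  simp only [hdiv] at key
  have h1 : ∫ x in Set.Icc a b, PyramidFE.div Ψ x = ∫ x in Omega, PyramidFE.div Ψ x := by
    -- In the open box x_k > 0, so a point of the support there satisfies all inequalities of the
    -- pyramid. Outside the pyramid the divergence is therefore zero.
    rw [volume_pi, ← setIntegral_congr_set Measure.univ_pi_Ioo_ae_eq_Icc]
    refine setIntegral_eq_of_subset_of_forall_sdiff_eq_zero
      (MeasurableSet.univ_pi fun _ => measurableSet_Ioo) ?_ ?_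
    · intro x hx i _
      have hk := mem_Omega_iff.1 hx F
      rw [hF] at hk
      obtain ⟨h0, h1, h2, h3, h4⟩ := hx
      have : 0 < x i ∧ x i < 1 := by
        fin_cases i <;> simp <;> constructor <;> linarith
      simp only [ha, hb]
      constructor
      · split_ifs <;> linarith
      · linarith
    · rintro x ⟨hx, hx'⟩
      refine div_eq_zero_of_notMem_tsupport fun hxt => hx' ?_
      refine mem_Omega_of_mem_faceNhd (hs hxt) ?_
      rw [hF]
      have := (hx k trivial).1
      simpa [ha] using this
  rw [← h1, key, Finset.sum_eq_single k]
  · have e1 : ∀ y : Fin 2 → ℝ, Ψ (k.insertNth (b k) y) k = 0 := fun y => by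
      rw [hz _ k (by simp [hb, le_abs_self])]; rfl
    have e2 : a k = 0 := by simp [ha]
    simp only [e1, integral_zero, zero_sub, e2]
    congr 1
    refine setIntegral_eq_integral_of_forall_compl_eq_zero fun y hy => ?_
    by_contra hne
    refine hy ⟨fun j => ?_, fun j => ?_⟩
    all_goals
      have hlt : |y j| < R := by
        by_contra hle
        refine hne ?_
        rw [hz _ (k.succAbove j) (by simpa using not_lt.1 hle)]; rfl
      have := abs_lt.1 hlt
      simp [ha, hb]
      linarith
  · intro i _ hik
    have e1 : ∀ y : Fin 2 → ℝ, Ψ (i.insertNth (b i) y) i = 0 := fun y => by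
      rw [hz _ i (by simp [hb, le_abs_self])]; rfl
    have e2 : ∀ y : Fin 2 → ℝ, Ψ (i.insertNth (a i) y) i = 0 := fun y => by
      rw [hz _ i (by simp [ha, hik, le_abs_self])]; rfl
    simp [e1, e2]
  · simp

theorem integral_div_eq_of_coord (F : Face) (k : Fin 3) (hF : ∀ x, faceFun F x = x k)
    (hn : faceNormal F = -Pi.single k 1) (hp : ∀ u, facePar F u = k.insertNth 0 ![u.1, u.2])
    {Ψ : R3 → R3} (hΨ : ContDiff ℝ 1 Ψ) (hc : HasCompactSupport Ψ)
    (hs : tsupport Ψ ⊆ faceNhd F) :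
    ∫ x in Omega, PyramidFE.div Ψ x
      = ∫ u in faceDom F, Ψ (facePar F u) ⬝ᵥ faceNormal F := by
  rw [integral_div_eq_coord F k hF hΨ hc hs, hn]
  rw [setIntegral_eq_integral_of_forall_compl_eq_zero]
  · rw [← integral_neg]
    rw [← (volume_preserving_finTwoArrow ℝ).integral_comp MeasurableEquiv.finTwoArrow.measurableEmbedding]
    refine integral_congr_ae (Filter.Eventually.of_forall fun y => ?_)
    have : ![y 0, y 1] = y := by ext i; fin_cases i <;> rfl
    simp [hp, this]
  · intro u hu
    rw [eq_zero_of_notMem_tsupport hs (mt facePar_mem_faceNhd_iff.1 hu)]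
    simp

/-- The affine involution of the pyramid that exchanges the faces `tri b 0` and `tri b 1`. -/
def flip (b : Fin 2) (x : R3) : R3 :=
  Function.update x b.castSucc (1 - x b.castSucc - x 2)

theorem flip_same (b : Fin 2) (x : R3) : flip b x b.castSucc = 1 - x b.castSucc - x 2 := by
  simp [flip]

theorem flip_of_ne (b : Fin 2) (x : R3) {k : Fin 3} (h : k ≠ b.castSucc) : flip b x k = x k := by
  simp [flip, h]

theorem flip_two (b : Fin 2) (x : R3) : flip b x 2 = x 2 :=
  flip_of_ne b x (by fin_cases b <;> decide)

theorem flip_flip (b : Fin 2) (x : R3) : flip b (flip b x) = x := by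
  ext k
  by_cases h : k = b.castSucc
  · subst h; rw [flip_same, flip_same, flip_two]; ring
  · rw [flip_of_ne _ _ h, flip_of_ne _ _ h]

theorem contDiff_flip (b : Fin 2) : ContDiff ℝ ∞ (flip b) := by
  refine contDiff_pi.2 fun k => ?_
  by_cases h : k = b.castSucc
  · subst h; simp only [flip_same]; fun_prop
  · simp only [flip_of_ne _ _ h]; fun_prop

def flipHomeo (b : Fin 2) : R3 ≃ₜ R3 where
  toFun := flip b
  invFun := flip b
  left_inv := flip_flip b
  right_inv := flip_flip b
  continuous_toFun := (contDiff_flip b).continuous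
  continuous_invFun := (contDiff_flip b).continuous

/-- The linear part of `flip`. -/
def flipLinear (b : Fin 2) : R3 →ₗ[ℝ] R3 :=
  Matrix.toLin' (![!![-1, 0, -1; 0, 1, 0; 0, 0, 1], !![1, 0, 0; 0, -1, -1; 0, 0, 1]] b)

theorem flip_eq (b : Fin 2) (x : R3) : flip b x = flipLinear b x + Pi.single b.castSucc 1 := by
  ext k
  fin_cases b <;> fin_cases k <;>
    simp [flip, flipLinear, dotProduct, Fin.sum_univ_three] <;> ring

/-- The involution is affine, and its linear part has determinant -1. -/
theorem measurePreserving_flip (b : Fin 2) : MeasurePreserving (flip b) volume volume := by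
  have hdet : |LinearMap.det (flipLinear b)| = 1 := by
    unfold flipLinear
    rw [LinearMap.det_toLin']
    fin_cases b <;> simp [Matrix.det_fin_three]
  have h0 : LinearMap.det (flipLinear b) ≠ 0 := by
    intro h; rw [h] at hdet; simp at hdet
  have h1 : MeasurePreserving (flipLinear b) volume volume := by
    refine ⟨(LinearMap.continuous_of_finiteDimensional _).measurable, ?_⟩
    rw [Real.map_linearMap_volume_pi_eq_smul_volume_pi h0, abs_inv, hdet]
    simp
  have h2 := (measurePreserving_add_right (volume : Measure R3) (Pi.single b.castSucc 1)).comp h1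
  convert h2 using 1
  ext1 x
  exact flip_eq b x

theorem faceFun_flip (b : Fin 2) (F : Face) (x : R3) :
    faceFun F (flip b x) = match F with
      | .quad => faceFun .quad x
      | .tri b' c => faceFun (.tri b' (if b' = b then 1 - c else c)) x := by
  cases F with
  | quad => exact flip_two b x
  | tri b' c =>
    fin_cases b <;> fin_cases b' <;> fin_cases c <;> simp [faceFun, flip] <;> ring

theorem flip_mem_Omega {b : Fin 2} {x : R3} : flip b x ∈ Omega ↔ x ∈ Omega := by
  rw [mem_Omega_iff, mem_Omega_iff, forall_face, forall_face]
  simp only [faceFun_flip]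
  fin_cases b <;> simp <;> tauto

theorem flip_mem_faceNhd {b : Fin 2} {x : R3} :
    flip b x ∈ faceNhd (.tri b 1) ↔ x ∈ faceNhd (.tri b 0) := by
  simp only [faceNhd, Set.mem_ofPred_eq]
  rw [forall_face, forall_face]
  simp only [faceFun_flip]
  fin_cases b <;> simp

/-- The contravariant (Piola) transform of a vector field under `flip`. -/
def flipField (b : Fin 2) (Ψ : R3 → R3) (x : R3) : R3 :=
  Function.update (Ψ (flip b x)) b.castSucc (-Ψ (flip b x) b.castSucc - Ψ (flip b x) 2)

theorem contDiff_flipField (b : Fin 2) {Ψ : R3 → R3} (hΨ : ContDiff ℝ 1 Ψ) :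
    ContDiff ℝ 1 (flipField b Ψ) := by
  have h : ∀ k, ContDiff ℝ 1 fun x => Ψ (flip b x) k :=
    contDiff_pi.1 (hΨ.comp ((contDiff_flip b).of_le (mod_cast le_top)))
  refine contDiff_pi.2 fun k => ?_
  by_cases hk : k = b.castSucc
  · subst hk; simp only [flipField, Function.update_self]; exact (h _).neg.sub (h _)
  · simp only [flipField, Function.update_of_ne hk]; exact h k

/-- If A is the linear part of `flip b`, then A = A⁻¹ and the transformed field is A applied to Ψ ∘
`flip b`. Its Jacobian is conjugate to that of Ψ, and the trace is invariant under conjugation. -/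
theorem div_flipField (b : Fin 2) {Ψ : R3 → R3} (hΨ : ContDiff ℝ 1 Ψ) (x : R3) :
    PyramidFE.div (flipField b Ψ) x = PyramidFE.div Ψ (flip b x) := by
  have hd : DifferentiableAt ℝ (flip b) x :=
    (contDiff_flip b).differentiable (by simp) x
  have hΨd : ∀ k, DifferentiableAt ℝ (fun y => Ψ y k) (flip b x) := fun k =>
    differentiableAt_apply (hΨ.differentiable (by norm_num) _) k
  have hcd : ∀ k, DifferentiableAt ℝ (fun y => Ψ (flip b y) k) x := fun k => (hΨd k).comp x hd
  have hchain : ∀ j k, pd k (fun y => Ψ (flip b y) j) x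
      = ∑ l, pd k (fun y => flip b y l) x * pd l (fun y => Ψ y j) (flip b x) :=
    fun j k => pd_comp (F := fun y => Ψ y j) (hΨd j) hd
  have hc : ∀ k : Fin 3, DifferentiableAt ℝ (fun y : R3 => y k) x := fun k => by fun_prop
  have hneg : ∀ k (f g : R3 → ℝ), DifferentiableAt ℝ f x → DifferentiableAt ℝ g x →
      pd k (fun y => -f y - g y) x = -pd k f x - pd k g x := by
    intro k f g hf hg
    rw [pd_sub (f := fun y => -f y) hf.neg hg]
    congr 1
    simp [pd]
  have hsub : ∀ k (l m : Fin 3), pd k (fun y => 1 - y l - y m) x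
      = -(if l = k then 1 else 0) - (if m = k then 1 else 0) := by
    intro k l m
    rw [pd_sub ((differentiableAt_const _).fun_sub (hc l)) (hc m), pd_sub (differentiableAt_const _) (hc l),
      pd_const, pd_coord, pd_coord]
    ring
  have hcomp : ∀ k, (fun y => flipField b Ψ y k) = if k = b.castSucc then
      fun y => -Ψ (flip b y) b.castSucc - Ψ (flip b y) 2 else fun y => Ψ (flip b y) k := by
    intro k; split_ifs with h
    · subst h; simp [flipField]
    · simp [flipField, h]
  have hfl : ∀ k, (fun y => flip b y k) = if k = b.castSucc then
      fun y => 1 - y b.castSucc - y 2 else fun y => y k := by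
    intro k; split_ifs with h
    · subst h; simp [flip]
    · simp [flip, h]
  simp only [div_apply, hcomp]
  fin_cases b <;>
  · simp at hcd hchain hfl
    simp [hneg _ _ _ (hcd _) (hcd _), hchain, Fin.sum_univ_three, hfl, hsub, pd_coord]
    try ring

/-- The quadrilateral face and the faces `tri b 0` lie in coordinate planes. The slanted faces `tri
b 1` are carried to these by `flip b`, which preserves volume and, with the Piola transform, the
divergence and the flux. -/
theorem integral_div_eq_face (F : Face) {Ψ : R3 → R3} (hΨ : ContDiff ℝ 1 Ψ)
    (hc : HasCompactSupport Ψ) (hs : tsupport Ψ ⊆ faceNhd F) :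
    ∫ x in Omega, PyramidFE.div Ψ x
      = ∫ u in faceDom F, Ψ (facePar F u) ⬝ᵥ faceNormal F := by
  have htri : ∀ b : Fin 2, ∀ {Ψ : R3 → R3}, ContDiff ℝ 1 Ψ → HasCompactSupport Ψ →
      tsupport Ψ ⊆ faceNhd (.tri b 0) → ∫ x in Omega, PyramidFE.div Ψ x
        = ∫ u in faceDom (.tri b 0), Ψ (facePar (.tri b 0) u) ⬝ᵥ faceNormal (.tri b 0) := by
    intro b Ψ hΨ hc hs
    refine integral_div_eq_of_coord _ b.castSucc (fun x => rfl) rfl ?_ hΨ hc hs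
    intro u
    ext k
    fin_cases b <;> fin_cases k <;> simp [facePar] <;> rfl
  cases F with
  | quad =>
    refine integral_div_eq_of_coord _ 2 (fun x => rfl) ?_ ?_ hΨ hc hs
    · ext k; fin_cases k <;> simp [faceNormal]
    · intro u; ext k; fin_cases k <;> rfl
  | tri b c =>
    obtain rfl | rfl : c = 0 ∨ c = 1 := by fin_cases c <;> simp
    · exact htri b hΨ hc hs
    · have hsub : tsupport (flipField b Ψ) ⊆ flip b ⁻¹' tsupport Ψ := by
        refine closure_minimal ?_ ((isClosed_tsupport _).preimage (contDiff_flip b).continuous)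
        intro x hx
        by_contra h
        refine hx ?_
        have h0 := image_eq_zero_of_notMem_tsupport h
        ext k
        by_cases hk : k = b.castSucc
        · subst hk; simp [flipField, h0]
        · simp [flipField, h0, hk]
      have h1 := htri b (contDiff_flipField b hΨ)
        (((flipHomeo b).isCompact_preimage.2 hc.isCompact).of_isClosed_subset
          (isClosed_tsupport _) hsub)
        (fun x hx => flip_mem_faceNhd.1 (hs (hsub hx)))
      have h2 : ∫ x in Omega, PyramidFE.div Ψ x = ∫ x in Omega, PyramidFE.div (flipField b Ψ) x := by
        simp only [div_flipField b hΨ]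
        rw [← (measurePreserving_flip b).setIntegral_preimage_emb
          (flipHomeo b).measurableEmbedding]
        congr 2
        ext x
        rw [Set.mem_preimage]
        exact flip_mem_Omega
      rw [h2, h1]
      refine setIntegral_congr_fun (measurableSet_faceDom _) fun u _ => ?_
      have e : flip b (facePar (.tri b 0) u) = facePar (.tri b 1) u := by
        ext k; fin_cases b <;> fin_cases k <;> simp [flip, facePar]
      fin_cases b <;>
        simp [flipField, faceNormal] <;> simp at e <;> simp [e] <;> ring

end PyramidFE

namespace PyramidFE

open Topology

/-! ### Weak derivatives and traces of fields that are smooth below the apex -/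

/-- The half space below the apex of the pyramid. -/
def belowApex : Set R3 := {x | x 2 < 1}

theorem isOpen_belowApex : IsOpen belowApex :=
  isOpen_lt (continuous_apply 2) continuous_const

theorem faceNhd_subset_belowApex (F : Face) : faceNhd F ⊆ belowApex := faceNhd_subset F

theorem Omega_subset_belowApex : Omega ⊆ belowApex :=
  (Omega_subset_faceNhd .quad).trans (faceNhd_subset _)

theorem contDiff_of_forall_mem_tsupport {E : Type*} [NormedAddCommGroup E] [NormedSpace ℝ E]
    {n : WithTop ℕ∞} {f : R3 → E} (h : ∀ x ∈ tsupport f, ContDiffAt ℝ n f x) :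
    ContDiff ℝ n f := by
  refine contDiff_iff_contDiffAt.2 fun x => ?_
  by_cases hx : x ∈ tsupport f
  · exact h x hx
  · exact contDiffAt_const.congr_of_eventuallyEq (notMem_tsupport_iff_eventuallyEq.1 hx)

theorem integrable_of_eq_zero_off {h : R3 → ℝ} {K : Set R3} (hc : ContinuousOn h belowApex)
    (hK : IsCompact K) (hKD : K ⊆ belowApex) (h0 : ∀ x, x ∉ K → h x = 0) : Integrable h := by
  have h1 : IntegrableOn h K := (hc.mono hKD).integrableOn_compact hK
  refine (integrableOn_iff_integrable_of_support_subset fun x hx => ?_).1 h1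
  by_contra hxK
  exact hx (h0 x hxK)

theorem continuousOn_dot {U : Set R3} {F G : R3 → R3} (hF : ContinuousOn F U)
    (hG : ContinuousOn G U) : ContinuousOn (fun x => F x ⬝ᵥ G x) U := by
  have e := continuousOn_pi.1 hF
  have f := continuousOn_pi.1 hG
  simp only [dot_apply]
  exact (((e 0).mul (f 0)).add ((e 1).mul (f 1))).add ((e 2).mul (f 2))

/-- A product with a test function has its support inside that of the test function, hence away from
the apex. Smoothness below the apex therefore gives C¹ regularity on all of space. -/
theorem contDiff_one_of_tsupport {E E' : Type*} [NormedAddCommGroup E] [NormedSpace ℝ E]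
    [NormedAddCommGroup E'] {Ψ : R3 → E} {Φ : R3 → E'}
    (hΨ : ContDiffOn ℝ ∞ Ψ belowApex) (hs : tsupport Φ ⊆ belowApex)
    (h0 : ∀ x, Φ x = 0 → Ψ x = 0) (hc : HasCompactSupport Φ) :
    ContDiff ℝ 1 Ψ ∧ HasCompactSupport Ψ ∧ tsupport Ψ ⊆ tsupport Φ := by
  have hsub : tsupport Ψ ⊆ tsupport Φ :=
    closure_mono fun x hx h => hx (h0 x h)
  refine ⟨contDiff_of_forall_mem_tsupport fun x hx => ?_, hc.mono' ?_, hsub⟩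
  · exact (hΨ.contDiffAt (isOpen_belowApex.mem_nhds (hs (hsub hx)))).of_le (mod_cast le_top)
  · exact (subset_tsupport Ψ).trans hsub

theorem eq_zero_near_of_notMem_tsupport {E : Type*} [Zero E] {Φ : R3 → E} {x : R3}
    (hx : x ∉ tsupport Φ) : Φ =ᶠ[𝓝 x] fun _ => 0 := notMem_tsupport_iff_eventuallyEq.1 hx

theorem curl_eq_zero_of_notMem_tsupport {Ψ : R3 → R3} {x : R3} (hx : x ∉ tsupport Ψ) :
    curl Ψ x = 0 := by
  rw [curl_congr (eq_zero_near_of_notMem_tsupport hx)]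
  ext k
  fin_cases k <;> simp [curl, pd]

theorem grad_eq_zero_of_notMem_tsupport {ψ : R3 → ℝ} {x : R3} (hx : x ∉ tsupport ψ) :
    grad ψ x = 0 := by
  rw [grad_congr (eq_zero_near_of_notMem_tsupport hx), grad_const]

theorem facePar_quad_notMem_Omega (u : ℝ × ℝ) : facePar .quad u ∉ Omega := by
  rintro ⟨-, -, h, -, -⟩
  simp [facePar] at h

theorem eq_neg_integral {A B : R3 → ℝ} (hA : Integrable A) (hB : Integrable B)
    (h : ∫ x in Omega, (A x + B x) = 0) : ∫ x in Omega, A x = -∫ x in Omega, B x := by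
  rw [integral_add hA.integrableOn hB.integrableOn] at h
  linarith

/-! ### Weak gradients and value traces. -/

section Scalar

variable {f : R3 → ℝ}

/-- The divergence theorem for the field f Φ. -/
theorem integral_face_grad (hf : ContDiffOn ℝ ∞ f belowApex) {F : Face} {Φ : R3 → R3}
    (hΦ : IsTest (faceNhd F) Φ) :
    ∫ x in Omega, (f x * PyramidFE.div Φ x + grad f x ⬝ᵥ Φ x)
      = ∫ u in faceDom F, f (facePar F u) * (Φ (facePar F u) ⬝ᵥ faceNormal F) := by
  obtain ⟨hΦ, hc, hs⟩ := hΦ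
  obtain ⟨h1, h2, h3⟩ := contDiff_one_of_tsupport (Ψ := fun x => f x • Φ x)
    (hf.smul hΦ.contDiffOn) (hs.trans (faceNhd_subset F)) (fun x h => by simp [h]) hc
  have key := integral_div_eq_face F h1 h2 (h3.trans hs)
  simp only [smul_dotProduct, smul_eq_mul] at key
  rw [← key]
  refine setIntegral_congr_fun isOpen_Omega.measurableSet fun x hx => ?_
  exact (div_smul (hf.differentiableAt_of_isOpen isOpen_belowApex (Omega_subset_belowApex hx))
    (hΦ.differentiable (by simp) x)).symm

/-- A test field supported in Ω is also one near the quadrilateral face, where its boundary integral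
vanishes. The definition of the weak gradient is thus a special case of the trace formula; any other
face would serve as well. -/
theorem isWeakGrad_grad (hf : ContDiffOn ℝ ∞ f belowApex) (hL : SqInt (grad f)) :
    IsWeakGrad f (grad f) := by
  refine ⟨hL, fun Φ hΦ => ?_⟩
  have h := integral_face_grad hf (F := .quad)
    (Φ := Φ) ⟨hΦ.1, hΦ.2.1, hΦ.2.2.trans (Omega_subset_faceNhd _)⟩
  have hD : tsupport Φ ⊆ belowApex := hΦ.2.2.trans Omega_subset_belowApex
  refine eq_neg_integral ?_ ?_ (h.trans ?_)
  · refine integrable_of_eq_zero_off ?_ hΦ.2.1.isCompact hD fun x hx => ?_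
    · exact hf.continuousOn.mul (contDiffOn_div isOpen_belowApex hΦ.1.contDiffOn).continuousOn
    · rw [div_eq_zero_of_notMem_tsupport hx, mul_zero]
  · refine integrable_of_eq_zero_off ?_ hΦ.2.1.isCompact hD fun x hx => ?_
    · exact continuousOn_dot (contDiffOn_grad isOpen_belowApex hf).continuousOn
        hΦ.1.continuous.continuousOn
    · rw [image_eq_zero_of_notMem_tsupport hx, dotProduct_zero]
  · have : ∀ u, Φ (facePar .quad u) = 0 := fun u =>
      eq_zero_of_notMem_tsupport hΦ.2.2 (facePar_quad_notMem_Omega u)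
    simp [this]

theorem hasTrace0_of_eqOn (hf : ContDiffOn ℝ ∞ f belowApex) (hL : SqInt (grad f)) {F : Face}
    {g : R3 → ℝ} (hg : ∀ u ∈ faceDom F, f (facePar F u) = g (facePar F u))
    (hi : IntegrableOn (fun u => g (facePar F u)) (faceDom F)) : HasTrace0 f F g := by
  refine ⟨hi, grad f, isWeakGrad_grad hf hL, fun Φ hΦ => ?_⟩
  rw [integral_face_grad hf hΦ]
  exact setIntegral_congr_fun (measurableSet_faceDom F) fun u hu => by simp only [hg u hu]

end Scalar

/-! ### Weak curls and tangential traces. -/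

section CurlTrace

variable {E : R3 → R3}

/-- The divergence theorem for E × Φ, with the triple product permuted cyclically on the face. -/
theorem integral_face_curl (hE : ContDiffOn ℝ ∞ E belowApex) {F : Face} {Φ : R3 → R3}
    (hΦ : IsTest (faceNhd F) Φ) :
    ∫ x in Omega, (curl E x ⬝ᵥ Φ x - E x ⬝ᵥ curl Φ x)
      = ∫ u in faceDom F, (faceNormal F ⨯₃ E (facePar F u)) ⬝ᵥ Φ (facePar F u) := by
  obtain ⟨hΦ, hc, hs⟩ := hΦ
  obtain ⟨h1, h2, h3⟩ := contDiff_one_of_tsupport (Ψ := fun x => E x ⨯₃ Φ x)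
    (contDiffOn_cross hE hΦ.contDiffOn) (hs.trans (faceNhd_subset F)) (fun x h => by simp [h]) hc
  have key := integral_div_eq_face F h1 h2 (h3.trans hs)
  have e : ∀ a b c : R3, (a ⨯₃ b) ⬝ᵥ c = (c ⨯₃ a) ⬝ᵥ b := fun a b c => by
    rw [dotProduct_comm, triple_product_permutation, triple_product_permutation, dotProduct_comm]
  simp only [e (E _)] at key
  rw [← key]
  refine setIntegral_congr_fun isOpen_Omega.measurableSet fun x hx => ?_
  exact (div_cross (hE.differentiableAt_of_isOpen isOpen_belowApex (Omega_subset_belowApex hx))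
    (hΦ.differentiable (by simp) x)).symm

theorem isWeakCurl_curl (hE : ContDiffOn ℝ ∞ E belowApex) (hL : SqInt (curl E)) :
    IsWeakCurl E (curl E) := by
  refine ⟨hL, fun Φ hΦ => ?_⟩
  have h := integral_face_curl hE (F := .quad)
    (Φ := Φ) ⟨hΦ.1, hΦ.2.1, hΦ.2.2.trans (Omega_subset_faceNhd _)⟩
  have hD : tsupport Φ ⊆ belowApex := hΦ.2.2.trans Omega_subset_belowApex
  have h0 : ∫ u in faceDom .quad, (faceNormal .quad ⨯₃ E (facePar .quad u)) ⬝ᵥ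
      Φ (facePar .quad u) = 0 := by
    have : ∀ u, Φ (facePar .quad u) = 0 := fun u =>
      eq_zero_of_notMem_tsupport hΦ.2.2 (facePar_quad_notMem_Omega u)
    simp [this]
  rw [h0, integral_sub, sub_eq_zero] at h
  · exact h.symm
  · refine (integrable_of_eq_zero_off ?_ hΦ.2.1.isCompact hD fun x hx => ?_).integrableOn
    · exact continuousOn_dot (contDiffOn_curl isOpen_belowApex hE).continuousOn
        hΦ.1.continuous.continuousOn
    · rw [image_eq_zero_of_notMem_tsupport hx, dotProduct_zero]
  · refine (integrable_of_eq_zero_off ?_ hΦ.2.1.isCompact hD fun x hx => ?_).integrableOn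
    · exact continuousOn_dot hE.continuousOn
        (contDiffOn_curl isOpen_belowApex hΦ.1.contDiffOn).continuousOn
    · rw [curl_eq_zero_of_notMem_tsupport hx, dotProduct_zero]

theorem hasTrace1_of_eqOn (hE : ContDiffOn ℝ ∞ E belowApex) (hL : SqInt (curl E)) {F : Face}
    {g : R3 → R3} (hg : ∀ u ∈ faceDom F,
      faceNormal F ⨯₃ E (facePar F u) = faceNormal F ⨯₃ g (facePar F u))
    (hi : IntegrableOn (fun u => faceNormal F ⨯₃ g (facePar F u)) (faceDom F)) :
    HasTrace1 E F g := by
  refine ⟨hi, curl E, isWeakCurl_curl hE hL, fun Φ hΦ => ?_⟩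
  rw [integral_face_curl hE hΦ]
  exact setIntegral_congr_fun (measurableSet_faceDom F) fun u hu => by simp only [hg u hu]

end CurlTrace

/-! ### Weak divergences and normal traces. -/

section DivTrace

variable {V : R3 → R3}

/-- The divergence theorem for the field ψ V. -/
theorem integral_face_div (hV : ContDiffOn ℝ ∞ V belowApex) {F : Face} {ψ : R3 → ℝ}
    (hψ : IsTest (faceNhd F) ψ) :
    ∫ x in Omega, (PyramidFE.div V x * ψ x + V x ⬝ᵥ grad ψ x)
      = ∫ u in faceDom F, ψ (facePar F u) * (V (facePar F u) ⬝ᵥ faceNormal F) := by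
  obtain ⟨hψ, hc, hs⟩ := hψ
  obtain ⟨h1, h2, h3⟩ := contDiff_one_of_tsupport (Ψ := fun x => ψ x • V x)
    (hψ.contDiffOn.smul hV) (hs.trans (faceNhd_subset F)) (fun x h => by simp [h]) hc
  have key := integral_div_eq_face F h1 h2 (h3.trans hs)
  simp only [smul_dotProduct, smul_eq_mul] at key
  rw [← key]
  refine setIntegral_congr_fun isOpen_Omega.measurableSet fun x hx => ?_
  have := div_smul (hψ.differentiable (by simp) x)
    (hV.differentiableAt_of_isOpen isOpen_belowApex (Omega_subset_belowApex hx))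
  simp only [this]
  rw [dotProduct_comm, mul_comm]

theorem isWeakDiv_div (hV : ContDiffOn ℝ ∞ V belowApex) (hL : SqInt (PyramidFE.div V)) :
    IsWeakDiv V (PyramidFE.div V) := by
  refine ⟨hL, fun ψ hψ => ?_⟩
  have h := integral_face_div hV (F := .quad)
    (ψ := ψ) ⟨hψ.1, hψ.2.1, hψ.2.2.trans (Omega_subset_faceNhd _)⟩
  have hD : tsupport ψ ⊆ belowApex := hψ.2.2.trans Omega_subset_belowApex
  refine eq_neg_integral ?_ ?_ (Eq.trans ?_ (h.trans ?_))
  · refine integrable_of_eq_zero_off ?_ hψ.2.1.isCompact hD fun x hx => ?_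
    · exact continuousOn_dot hV.continuousOn
        (contDiffOn_grad isOpen_belowApex hψ.1.contDiffOn).continuousOn
    · rw [grad_eq_zero_of_notMem_tsupport hx, dotProduct_zero]
  · refine integrable_of_eq_zero_off ?_ hψ.2.1.isCompact hD fun x hx => ?_
    · exact (contDiffOn_div isOpen_belowApex hV).continuousOn.mul hψ.1.continuous.continuousOn
    · rw [image_eq_zero_of_notMem_tsupport hx, mul_zero]
  · simp only [add_comm]
  · have : ∀ u, ψ (facePar .quad u) = 0 := fun u =>
      eq_zero_of_notMem_tsupport hψ.2.2 (facePar_quad_notMem_Omega u)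
    simp [this]

theorem hasTrace2_of_eqOn (hV : ContDiffOn ℝ ∞ V belowApex) (hL : SqInt (PyramidFE.div V))
    {F : Face} {g : R3 → R3} (hg : ∀ u ∈ faceDom F,
      V (facePar F u) ⬝ᵥ faceNormal F = g (facePar F u) ⬝ᵥ faceNormal F)
    (hi : IntegrableOn (fun u => g (facePar F u) ⬝ᵥ faceNormal F) (faceDom F)) :
    HasTrace2 V F g := by
  refine ⟨hi, PyramidFE.div V, isWeakDiv_div hV hL, fun ψ hψ => ?_⟩
  rw [integral_face_div hV hψ]
  exact setIntegral_congr_fun (measurableSet_faceDom F) fun u hu => by simp only [hg u hu]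

end DivTrace

end PyramidFE

namespace PyramidFE

open Topology

/-! ### Pullbacks to the infinite pyramid -/

/-- The half space on which `τ` is smooth; it contains the closed infinite pyramid. -/
noncomputable def extInf : Set R3 := {x | 0 < 1 + x 2}

theorem isOpen_extInf : IsOpen extInf :=
  isOpen_lt continuous_const (continuous_const.add (continuous_apply 2))

theorem OmegaInf_subset_extInf : OmegaInf ⊆ extInf := fun x hx => by
  have := hx.2.2.2.2
  simp only [extInf, Set.mem_ofPred_eq]
  linarith

theorem isOpen_OmegaInf : IsOpen OmegaInf := by
  simp only [OmegaInf, Set.ofPred_and]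
  refine (isOpen_lt continuous_const (continuous_apply 0)).inter
    ((isOpen_lt (continuous_apply 0) continuous_const).inter
    ((isOpen_lt continuous_const (continuous_apply 1)).inter
    ((isOpen_lt (continuous_apply 1) continuous_const).inter
    (isOpen_lt continuous_const (continuous_apply 2)))))

/-- The inverse of `τ`. -/
noncomputable def tauInv (x : R3) : R3 := fun k => x k / (1 - x 2)

theorem tau_tauInv {x : R3} (hx : x ∈ belowApex) : tau (tauInv x) = x := by
  have h : (1 - x 2) ≠ 0 := by
    have : x 2 < 1 := hx
    linarith
  ext k
  simp only [tau, tauInv]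
  field_simp
  simp

theorem tau_mem_belowApex {x : R3} (hx : x ∈ extInf) : tau x ∈ belowApex := by
  have h : 0 < 1 + x 2 := hx
  simp only [tau, belowApex, Set.mem_ofPred_eq]
  rw [div_lt_one h]
  linarith

theorem tauInv_mem_OmegaInf {x : R3} (hx : x ∈ Omega) : tauInv x ∈ OmegaInf := by
  obtain ⟨h0, h1, h2, h3, h4⟩ := hx
  have h : 0 < 1 - x 2 := by linarith
  simp only [tauInv, OmegaInf, Set.mem_ofPred_eq, div_lt_one h]
  refine ⟨by positivity, by linarith, by positivity, by linarith, by positivity⟩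

theorem tau_mem_Omega {x : R3} (hx : x ∈ OmegaInf) : tau x ∈ Omega := by
  obtain ⟨h0, h1, h2, h3, h4⟩ := hx
  have h : 0 < 1 + x 2 := by linarith
  simp only [tau, Omega, Set.mem_ofPred_eq, ← add_div, div_lt_one h]
  refine ⟨by positivity, by positivity, by positivity, by linarith, by linarith⟩

theorem contDiffOn_tau : ContDiffOn ℝ ∞ tau extInf := by
  refine contDiffOn_pi.2 fun k => ?_
  unfold tau
  refine ContDiffOn.div (by fun_prop) (by fun_prop) fun x hx => ?_
  exact ne_of_gt hx

theorem contDiffOn_tau_apply (k : Fin 3) : ContDiffOn ℝ ∞ (fun x => tau x k) extInf :=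
  contDiffOn_apply contDiffOn_tau k

theorem contDiffOn_pull0 {f : R3 → ℝ} (hf : ContDiffOn ℝ ∞ f belowApex) :
    ContDiffOn ℝ ∞ (pull0 f) extInf :=
  hf.comp contDiffOn_tau fun _ hx => tau_mem_belowApex hx

/-- The weight `1/(1+z)`. -/
noncomputable def wt (x : R3) : ℝ := (1 + x 2)⁻¹

theorem wt_pos {x : R3} (hx : x ∈ extInf) : 0 < wt x := inv_pos.2 hx

theorem contDiffOn_wt : ContDiffOn ℝ ∞ wt extInf := by
  unfold wt
  exact ContDiffOn.inv (by fun_prop) fun x hx => ne_of_gt hx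

theorem grad_wt {x : R3} (hx : x ∈ extInf) : grad wt x = (-wt x ^ 2) • Pi.single 2 1 := by
  unfold wt
  rw [grad_inv (by fun_prop) (ne_of_gt hx), grad_add (by fun_prop) (by fun_prop), grad_const,
    grad_coord]
  simp

/-- With w = `wt` one has τ(x) = w x and ∂_z w = -w², so only the last column of the Jacobian is not
diagonal. -/
theorem jacTau_apply {x : R3} (hx : x ∈ extInf) (i j : Fin 3) :
    jacTau x i j = (if i = j then wt x else 0) - (if 2 = j then x i * wt x ^ 2 else 0) := by
  have e : jacTau x i j = pd j (fun y => y i * wt y) x := by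
    simp [jacTau, tau, wt, div_eq_mul_inv]
  have hw := contDiffOn_wt.differentiableAt_of_isOpen isOpen_extInf hx
  have h2 : pd j wt x = (-wt x ^ 2) * (if 2 = j then 1 else 0) := by
    have := congrFun (grad_wt hx) j
    simpa [grad, Pi.single_apply, eq_comm] using this
  rw [e, pd_mul (by fun_prop) hw, pd_coord, h2]
  split_ifs <;> ring

theorem det_jacTau {x : R3} (hx : x ∈ extInf) : (jacTau x).det = wt x ^ 4 := by
  have h : wt x * (1 + x 2) = 1 := inv_mul_cancel₀ (ne_of_gt hx)
  rw [Matrix.det_fin_three]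
  simp [jacTau_apply hx]
  linear_combination (-wt x ^ 3) * h

theorem pull1_apply {x : R3} (hx : x ∈ extInf) (E : R3 → R3) :
    pull1 E x = ![wt x * E (tau x) 0, wt x * E (tau x) 1,
      wt x ^ 2 * (E (tau x) 2 - x 0 * E (tau x) 0 - x 1 * E (tau x) 1)] := by
  have h : wt x * (1 + x 2) = 1 := inv_mul_cancel₀ (ne_of_gt hx)
  ext k
  fin_cases k <;>
    simp [pull1, Matrix.mulVec, dotProduct, Fin.sum_univ_three, jacTau_apply hx]
  linear_combination (-wt x * E (tau x) 2) * h

/-- The adjugate is polynomial in the entries, which gives the explicit form of `pull2` without any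
inverse matrix. -/
theorem det_smul_inv_jacTau {x : R3} (hx : x ∈ extInf) :
    (jacTau x).det • (jacTau x)⁻¹ = (jacTau x).adjugate := by
  have h : (jacTau x).det ≠ 0 := by rw [det_jacTau hx]; exact pow_ne_zero _ (wt_pos hx).ne'
  rw [Matrix.inv_def, smul_smul, Ring.mul_inverse_cancel _ h.isUnit, one_smul]

theorem pull2_eq {x : R3} (hx : x ∈ extInf) (V : R3 → R3) :
    pull2 V x = (jacTau x).adjugate *ᵥ V (tau x) := by
  rw [← det_smul_inv_jacTau hx, Matrix.smul_mulVec]; rfl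

theorem pull2_apply {x : R3} (hx : x ∈ extInf) (V : R3 → R3) :
    pull2 V x = ![wt x ^ 3 * (V (tau x) 0 + x 0 * V (tau x) 2),
      wt x ^ 3 * (V (tau x) 1 + x 1 * V (tau x) 2), wt x ^ 2 * V (tau x) 2] := by
  have h : wt x * (1 + x 2) = 1 := inv_mul_cancel₀ (ne_of_gt hx)
  rw [pull2_eq hx, Matrix.adjugate_fin_three]
  ext k
  fin_cases k <;>
    simp [Matrix.mulVec, dotProduct, Fin.sum_univ_three, jacTau_apply hx]
  · linear_combination (-wt x ^ 2 * V (tau x) 0) * h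
  · linear_combination (-wt x ^ 2 * V (tau x) 1) * h
  · left; ring

theorem pull3_apply {x : R3} (hx : x ∈ extInf) (ψ : R3 → ℝ) :
    pull3 ψ x = wt x ^ 4 * ψ (tau x) := by rw [pull3, det_jacTau hx]

/-! ### Compatibility of the pullbacks with products and gradients. -/

section Algebra

variable {x : R3}

theorem pull1_smul (f : R3 → ℝ) (E : R3 → R3) :
    pull1 (fun y => f y • E y) x = pull0 f x • pull1 E x := by
  simp only [pull1, pull0, Matrix.mulVec_smul]

theorem pull1_add (E F : R3 → R3) : pull1 (fun y => E y + F y) x = pull1 E x + pull1 F x := by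
  simp only [pull1, Matrix.mulVec_add]

theorem pull1_sub (E F : R3 → R3) : pull1 (fun y => E y - F y) x = pull1 E x - pull1 F x := by
  simp only [pull1, Matrix.mulVec_sub]

theorem pull2_smul (f : R3 → ℝ) (E : R3 → R3) :
    pull2 (fun y => f y • E y) x = pull0 f x • pull2 E x := by
  simp only [pull2, pull0, Matrix.mulVec_smul, smul_comm (f (tau x))]

theorem pull2_add (E F : R3 → R3) : pull2 (fun y => E y + F y) x = pull2 E x + pull2 F x := by
  simp only [pull2, Matrix.mulVec_add, smul_add]

/-- The cofactor identity (Jᵀu) × (Jᵀv) = adj(J)(u × v). Cross products can thus be pulled back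
factor by factor. -/
theorem pull2_cross (hx : x ∈ extInf) (E F : R3 → R3) :
    pull2 (fun y => E y ⨯₃ F y) x = pull1 E x ⨯₃ pull1 F x := by
  rw [pull2_apply hx, pull1_apply hx, pull1_apply hx]
  ext k
  fin_cases k <;> simp [cross_apply] <;> ring

/-- The chain rule: `pull1` multiplies by the transposed Jacobian. -/
theorem pull1_grad (hx : x ∈ extInf) {f : R3 → ℝ} (hf : DifferentiableAt ℝ f (tau x)) :
    pull1 (grad f) x = grad (pull0 f) x := by
  ext k
  change _ = pd k (fun y => f (tau y)) x
  rw [pd_comp hf (contDiffOn_tau.differentiableAt_of_isOpen isOpen_extInf hx)]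
  rfl

theorem dot_pull (hx : x ∈ extInf) (E V : R3 → R3) :
    pull1 E x ⬝ᵥ pull2 V x = pull3 (fun y => E y ⬝ᵥ V y) x := by
  rw [pull2_apply hx, pull1_apply hx, pull3_apply hx]
  simp [dot_apply]
  ring

end Algebra

theorem differentiableAt_coord (k : Fin 3) (x : R3) :
    DifferentiableAt ℝ (fun y : R3 => y k) x := by fun_prop

theorem grad_coord_eq (E : R3 → R3) : E = fun y =>
    E y 0 • grad (fun z => z 0) y + E y 1 • grad (fun z => z 1) y
      + E y 2 • grad (fun z => z 2) y := by
  ext y k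
  simp only [grad_coord]
  fin_cases k <;> simp

theorem curl_coord_eq {E : R3 → R3} {x : R3} :
    curl E x = grad (fun y => E y 0) x ⨯₃ grad (fun z => z 0) x
      + grad (fun y => E y 1) x ⨯₃ grad (fun z => z 1) x
      + grad (fun y => E y 2) x ⨯₃ grad (fun z => z 2) x := by
  simp only [grad_coord]
  ext k
  fin_cases k <;> simp [curl, grad, cross_apply] <;> ring

/-- With E = Σ E_k ∇x_k, both curls become sums of cross products of gradients, Σ ∇E_k × ∇x_k before
and after the pullback. The claim follows from `pull1_grad` and `pull2_cross`; second derivatives of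
τ drop out because gradients are curl free. -/
theorem pull2_curl {E : R3 → R3} (hE : ContDiffOn ℝ ∞ E belowApex) {x : R3} (hx : x ∈ extInf) :
    pull2 (curl E) x = curl (pull1 E) x := by
  have hd : ∀ k, ContDiffOn ℝ ∞ (pull0 fun y => E y k) extInf := fun k =>
    contDiffOn_pull0 (contDiffOn_apply hE k)
  have hd' : ∀ k, DifferentiableAt ℝ (pull0 fun y => E y k) x := fun k =>
    (hd k).differentiableAt_of_isOpen isOpen_extInf hx
  have hτ : ∀ k, ContDiffOn ℝ ∞ (pull0 fun y => y k) extInf := contDiffOn_tau_apply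
  have hτ2 : ∀ k, ContDiffAt ℝ 2 (pull0 fun y => y k) x := fun k =>
    ((hτ k).contDiffAt_of_isOpen isOpen_extInf hx).of_le two_le_infty
  have hE' : ∀ k, DifferentiableAt ℝ (fun y => E y k) (tau x) := fun k =>
    (contDiffOn_apply hE k).differentiableAt_of_isOpen isOpen_belowApex (tau_mem_belowApex hx)
  have h1 : pull1 E =ᶠ[𝓝 x] fun y => pull0 (fun y => E y 0) y • grad (pull0 fun y => y 0) y
      + pull0 (fun y => E y 1) y • grad (pull0 fun y => y 1) y
      + pull0 (fun y => E y 2) y • grad (pull0 fun y => y 2) y := by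
    filter_upwards [isOpen_extInf.mem_nhds hx] with y hy
    conv_lhs => rw [grad_coord_eq E]
    rw [pull1_add, pull1_add, pull1_smul, pull1_smul, pull1_smul, pull1_grad hy (by fun_prop),
      pull1_grad hy (by fun_prop), pull1_grad hy (by fun_prop)]
  have hs := fun k => (hd' k).fun_smul (differentiableAt_grad (hτ2 k))
  rw [curl_congr h1, curl_add ((hs 0).fun_add (hs 1)) (hs 2), curl_add (hs 0) (hs 1),
    curl_smul_grad (hd' 0) (hτ2 0), curl_smul_grad (hd' 1) (hτ2 1), curl_smul_grad (hd' 2) (hτ2 2)]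
  have h2 : curl E = fun x => grad (fun y => E y 0) x ⨯₃ grad (fun z => z 0) x
      + grad (fun y => E y 1) x ⨯₃ grad (fun z => z 1) x
      + grad (fun y => E y 2) x ⨯₃ grad (fun z => z 2) x := by
    ext1 x; exact curl_coord_eq
  rw [h2, pull2_add, pull2_add, pull2_cross hx, pull2_cross hx, pull2_cross hx]
  simp only [pull1_grad hx (hE' _), pull1_grad hx (differentiableAt_coord _ _)]

/-- The same argument with V expanded in the fields ∇x_i × ∇x_j. The divergence is then a sum of
triple products of gradients, which `dot_pull` transforms with the Jacobian determinant. -/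
theorem pull3_div {V : R3 → R3} (hV : ContDiffOn ℝ ∞ V belowApex) {x : R3} (hx : x ∈ extInf) :
    pull3 (PyramidFE.div V) x = PyramidFE.div (pull2 V) x := by
  have hd' : ∀ k, DifferentiableAt ℝ (pull0 fun y => V y k) x := fun k =>
    (contDiffOn_pull0 (contDiffOn_apply hV k)).differentiableAt_of_isOpen isOpen_extInf hx
  have hτ2 : ∀ k, ContDiffAt ℝ 2 (pull0 fun y => y k) x := fun k =>
    ((contDiffOn_tau_apply k).contDiffAt_of_isOpen isOpen_extInf hx).of_le two_le_infty
  have hV' : ∀ k, DifferentiableAt ℝ (fun y => V y k) (tau x) := fun k =>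
    (contDiffOn_apply hV k).differentiableAt_of_isOpen isOpen_belowApex (tau_mem_belowApex hx)
  have e : V = fun y => V y 0 • (grad (fun z => z 1) y ⨯₃ grad (fun z => z 2) y)
      + V y 1 • (grad (fun z => z 2) y ⨯₃ grad (fun z => z 0) y)
      + V y 2 • (grad (fun z => z 0) y ⨯₃ grad (fun z => z 1) y) := by
    ext y k
    simp only [grad_coord]
    fin_cases k <;> simp [cross_apply]
  have h1 : pull2 V =ᶠ[𝓝 x] fun y =>
      pull0 (fun y => V y 0) y • (grad (pull0 fun y => y 1) y ⨯₃ grad (pull0 fun y => y 2) y)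
      + pull0 (fun y => V y 1) y • (grad (pull0 fun y => y 2) y ⨯₃ grad (pull0 fun y => y 0) y)
      + pull0 (fun y => V y 2) y • (grad (pull0 fun y => y 0) y ⨯₃ grad (pull0 fun y => y 1) y) := by
    filter_upwards [isOpen_extInf.mem_nhds hx] with y hy
    conv_lhs => rw [e]
    rw [pull2_add, pull2_add, pull2_smul, pull2_smul, pull2_smul, pull2_cross hy, pull2_cross hy,
      pull2_cross hy]
    simp only [pull1_grad hy (differentiableAt_coord _ _)]
  have hs := fun k i j => (hd' k).fun_smul
    (differentiableAt_cross (differentiableAt_grad (hτ2 i)) (differentiableAt_grad (hτ2 j)))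
  rw [div_congr h1, div_add ((hs _ _ _).fun_add (hs _ _ _)) (hs _ _ _), div_add (hs _ _ _) (hs _ _ _),
    div_smul_cross_grad (hd' 0) (hτ2 _) (hτ2 _), div_smul_cross_grad (hd' 1) (hτ2 _) (hτ2 _),
    div_smul_cross_grad (hd' 2) (hτ2 _) (hτ2 _)]
  have hg : ∀ k : Fin 3, grad (pull0 fun y => y k) x = pull1 (grad fun y => y k) x := fun k =>
    (pull1_grad hx (by fun_prop)).symm
  simp only [← pull1_grad hx (hV' _), hg, ← pull2_cross hx, dot_pull hx, pull3_apply hx]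
  simp only [grad_coord, cross_apply, dot_apply, div_apply]
  simp [grad]
  ring

end PyramidFE

namespace PyramidFE

open Topology

/-! ### Weighted tensor product polynomials -/

/-- The span of the monomials `x^α y^β (1+z)^{-m}` with `α ≤ a`, `β ≤ b`, `lo ≤ m ≤ hi`. -/
def wtMonomials (a b : ℤ) (lo hi : ℕ) : Submodule ℝ (R3 → ℝ) :=
  Submodule.span ℝ {g | ∃ α β m : ℕ, (α : ℤ) ≤ a ∧ (β : ℤ) ≤ b ∧ lo ≤ m ∧ m ≤ hi ∧
    g = fun x => x 0 ^ α * x 1 ^ β * wt x ^ m}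

/-- The functions that agree on `extInf` with a combination of the monomials
`x^α y^β (1+z)^{-m}` with `α ≤ a`, `β ≤ b`, `lo ≤ m ≤ hi`. -/
def WT (a b : ℤ) (lo hi : ℕ) : Submodule ℝ (R3 → ℝ) where
  carrier := {g | ∃ s ∈ wtMonomials a b lo hi, Set.EqOn g s extInf}
  add_mem' := by
    rintro f g ⟨s, hs, hfs⟩ ⟨t, ht, hgt⟩
    exact ⟨s + t, add_mem hs ht, fun x hx => by simp [hfs hx, hgt hx]⟩
  zero_mem' := ⟨0, zero_mem _, fun _ _ => rfl⟩
  smul_mem' := by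
    rintro c g ⟨s, hs, hgs⟩
    exact ⟨c • s, Submodule.smul_mem _ _ hs, fun x hx => by simp [hgs hx]⟩

theorem WT_congr {a b : ℤ} {lo hi : ℕ} {f g : R3 → ℝ} (hg : g ∈ WT a b lo hi)
    (h : Set.EqOn f g extInf) : f ∈ WT a b lo hi := by
  obtain ⟨s, hs, hgs⟩ := hg
  exact ⟨s, hs, h.trans hgs⟩

theorem WT_monomial {a b : ℤ} {lo hi α β m : ℕ} (h1 : (α : ℤ) ≤ a) (h2 : (β : ℤ) ≤ b)
    (h3 : lo ≤ m) (h4 : m ≤ hi) : (fun x : R3 => x 0 ^ α * x 1 ^ β * wt x ^ m) ∈ WT a b lo hi :=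
  ⟨_, Submodule.subset_span ⟨α, β, m, h1, h2, h3, h4, rfl⟩, fun _ _ => rfl⟩

/-- Span induction in pointwise form. Equality on the open set `extInf` is enough, so the arbitrary
values of the functions elsewhere never matter. -/
theorem WT_induction {a b : ℤ} {lo hi : ℕ} {p : (R3 → ℝ) → Prop}
    (mono : ∀ α β m : ℕ, (α : ℤ) ≤ a → (β : ℤ) ≤ b → lo ≤ m → m ≤ hi →
      p fun x => x 0 ^ α * x 1 ^ β * wt x ^ m)
    (zero : p fun _ => 0)
    (add : ∀ f g, f ∈ WT a b lo hi → g ∈ WT a b lo hi → p f → p g → p fun x => f x + g x)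
    (smul : ∀ (c : ℝ) f, f ∈ WT a b lo hi → p f → p fun x => c * f x)
    (congr : ∀ f g, Set.EqOn f g extInf → p g → p f) {g : R3 → ℝ} (hg : g ∈ WT a b lo hi) :
    p g := by
  obtain ⟨s, hs, hgs⟩ := hg
  refine congr g s hgs ?_
  refine Submodule.span_induction (p := fun s _ => p s) ?_ zero ?_ ?_ hs
  · rintro _ ⟨α, β, m, h1, h2, h3, h4, rfl⟩
    exact mono α β m h1 h2 h3 h4
  · intro f g hf hg hpf hpg
    exact add f g ⟨f, hf, fun _ _ => rfl⟩ ⟨g, hg, fun _ _ => rfl⟩ hpf hpg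
  · intro c f hf hpf
    exact smul c f ⟨f, hf, fun _ _ => rfl⟩ hpf

theorem WT_mono {a b a' b' : ℤ} {lo hi lo' hi' : ℕ} {g : R3 → ℝ} (hg : g ∈ WT a b lo hi)
    (ha : a ≤ a') (hb : b ≤ b') (hlo : lo' ≤ lo) (hhi : hi ≤ hi') : g ∈ WT a' b' lo' hi' := by
  refine WT_induction (p := fun g => g ∈ WT a' b' lo' hi') ?_ ?_ ?_ ?_ ?_ hg
  · intro α β m h1 h2 h3 h4
    exact WT_monomial (by omega) (by omega) (by omega) (by omega)
  · exact zero_mem _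
  · exact fun f g _ _ hf hg => add_mem hf hg
  · exact fun c f _ hf => Submodule.smul_mem _ c hf
  · exact fun f g h hg => WT_congr hg h

theorem WT_mul {a b a' b' : ℤ} {lo hi lo' hi' : ℕ} {f g : R3 → ℝ} (hf : f ∈ WT a b lo hi)
    (hg : g ∈ WT a' b' lo' hi') :
    (fun x => f x * g x) ∈ WT (a + a') (b + b') (lo + lo') (hi + hi') := by
  refine WT_induction (p := fun f => (fun x => f x * g x) ∈ WT (a + a') (b + b') (lo + lo')
    (hi + hi')) ?_ ?_ ?_ ?_ ?_ hf
  · intro α β m h1 h2 h3 h4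
    refine WT_induction (p := fun g => (fun x => x 0 ^ α * x 1 ^ β * wt x ^ m * g x) ∈
      WT (a + a') (b + b') (lo + lo') (hi + hi')) ?_ ?_ ?_ ?_ ?_ hg
    · intro α' β' m' h1' h2' h3' h4'
      have := WT_monomial (a := a + a') (b := b + b') (lo := lo + lo') (hi := hi + hi')
        (α := α + α') (β := β + β') (m := m + m') (by omega) (by omega) (by omega) (by omega)
      refine WT_congr this fun x _ => ?_
      simp only [pow_add]; ring
    · simp only [mul_zero]; exact zero_mem _
    · intro f g _ _ hf hg; simp only [mul_add]; exact add_mem hf hg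
    · intro c f _ hf; simp only [mul_left_comm _ c]; exact Submodule.smul_mem _ c hf
    · intro f g h hg; exact WT_congr hg fun x hx => by simp only [h hx]
  · simp only [zero_mul]; exact zero_mem _
  · intro f g _ _ hf hg; simp only [add_mul]; exact add_mem hf hg
  · intro c f _ hf; simp only [mul_assoc c]; exact Submodule.smul_mem _ c hf
  · intro f g h hg; exact WT_congr hg fun x hx => by simp only [h hx]

theorem WT_const (c : ℝ) : (fun _ : R3 => c) ∈ WT 0 0 0 0 := by
  refine WT_congr (Submodule.smul_mem _ c (WT_monomial (α := 0) (β := 0) (m := 0) le_rfl le_rfl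
    le_rfl le_rfl)) fun x _ => ?_
  simp

theorem WT_x : (fun x : R3 => x 0) ∈ WT 1 0 0 0 :=
  WT_congr (WT_monomial (α := 1) (β := 0) (m := 0) le_rfl le_rfl le_rfl le_rfl) fun x _ => by simp

theorem WT_y : (fun x : R3 => x 1) ∈ WT 0 1 0 0 :=
  WT_congr (WT_monomial (α := 0) (β := 1) (m := 0) le_rfl le_rfl le_rfl le_rfl) fun x _ => by simp

theorem WT_wt_pow (m : ℕ) : (fun x : R3 => wt x ^ m) ∈ WT 0 0 m m :=
  WT_congr (WT_monomial (α := 0) (β := 0) (m := m) le_rfl le_rfl le_rfl le_rfl) fun x _ => by simp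

theorem WT_const_mul (c : ℝ) {a b : ℤ} {lo hi : ℕ} {f : R3 → ℝ} (hf : f ∈ WT a b lo hi) :
    (fun x => c * f x) ∈ WT a b lo hi := Submodule.smul_mem _ c hf

theorem WT_add {a b : ℤ} {lo hi : ℕ} {f g : R3 → ℝ} (hf : f ∈ WT a b lo hi)
    (hg : g ∈ WT a b lo hi) : (fun x => f x + g x) ∈ WT a b lo hi := add_mem hf hg

theorem WT_sub {a b : ℤ} {lo hi : ℕ} {f g : R3 → ℝ} (hf : f ∈ WT a b lo hi)
    (hg : g ∈ WT a b lo hi) : (fun x => f x - g x) ∈ WT a b lo hi := sub_mem hf hg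

theorem WT_zero {a b : ℤ} {lo hi : ℕ} : (fun _ : R3 => (0 : ℝ)) ∈ WT a b lo hi := zero_mem _

theorem WT_pow {a b : ℤ} {lo hi : ℕ} {f : R3 → ℝ} (hf : f ∈ WT a b lo hi) (n : ℕ) :
    (fun x => f x ^ n) ∈ WT (n * a) (n * b) (n * lo) (n * hi) := by
  induction n with
  | zero => simpa using WT_const 1
  | succ n ih =>
    simp only [pow_succ]
    refine WT_mono (WT_mul ih hf) ?_ ?_ ?_ ?_ <;> push_cast <;> ring_nf <;> rfl

theorem contDiffOn_of_WT {a b : ℤ} {lo hi : ℕ} {g : R3 → ℝ} (hg : g ∈ WT a b lo hi) :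
    ContDiffOn ℝ ∞ g extInf := by
  refine WT_induction (p := fun g => ContDiffOn ℝ ∞ g extInf) ?_ contDiffOn_const ?_ ?_ ?_ hg
  · intro α β m _ _ _ _
    exact ContDiffOn.mul (by fun_prop) (contDiffOn_wt.pow m)
  · exact fun f g _ _ hf hg => hf.add hg
  · exact fun c f _ hf => contDiffOn_const.mul hf
  · exact fun f g h hg => hg.congr h

theorem differentiableAt_of_WT {a b : ℤ} {lo hi : ℕ} {g : R3 → ℝ} (hg : g ∈ WT a b lo hi) {x : R3}
    (hx : x ∈ extInf) : DifferentiableAt ℝ g x :=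
  (contDiffOn_of_WT hg).differentiableAt_of_isOpen isOpen_extInf hx

theorem grad_wtMonomial (α β m : ℕ) {x : R3} (hx : x ∈ extInf) :
    grad (fun x : R3 => x 0 ^ α * x 1 ^ β * wt x ^ m) x =
      ![α * (x 0 ^ (α - 1) * x 1 ^ β * wt x ^ m), β * (x 0 ^ α * x 1 ^ (β - 1) * wt x ^ m),
        -m * (x 0 ^ α * x 1 ^ β * wt x ^ (m + 1))] := by
  have hw : DifferentiableAt ℝ wt x := contDiffOn_wt.differentiableAt_of_isOpen isOpen_extInf hx
  rw [grad_mul (by fun_prop) (by fun_prop), grad_mul (by fun_prop) (by fun_prop),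
    grad_pow _ hw, grad_pow _ (differentiableAt_coord 0 x), grad_pow _ (differentiableAt_coord 1 x),
    grad_coord, grad_coord, grad_wt hx]
  ext k
  fin_cases k
  · simp; ring
  · simp; ring
  · simp
    rcases m with _ | m
    · simp
    · simp; ring

/-- Differentiation is linear on these smooth functions and local on the open set `extInf`, so only
monomials have to be examined. -/
theorem WT_pd_aux {a b : ℤ} {lo hi : ℕ} {k : Fin 3} {S : Submodule ℝ (R3 → ℝ)}
    (hS : ∀ f g, Set.EqOn f g extInf → g ∈ S → f ∈ S)
    (mono : ∀ α β m : ℕ, (α : ℤ) ≤ a → (β : ℤ) ≤ b → lo ≤ m → m ≤ hi →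
      pd k (fun x => x 0 ^ α * x 1 ^ β * wt x ^ m) ∈ S) {g : R3 → ℝ} (hg : g ∈ WT a b lo hi) :
    pd k g ∈ S := by
  refine WT_induction (p := fun g => pd k g ∈ S) mono ?_ ?_ ?_ ?_ hg
  · refine hS _ _ (fun x _ => ?_) (zero_mem S)
    exact pd_const 0
  · intro f g hf hg hf' hg'
    refine hS _ _ (fun x hx => ?_) (add_mem hf' hg')
    exact pd_add (differentiableAt_of_WT hf hx) (differentiableAt_of_WT hg hx)
  · intro c f hf hf'
    refine hS _ _ (fun x hx => ?_) (S.smul_mem c hf')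
    rw [pd_mul (differentiableAt_const c) (differentiableAt_of_WT hf hx), pd_const]
    simp
  · intro f g h hg
    refine hS _ _ (fun x hx => ?_) hg
    exact pd_congr (h.eventuallyEq_of_mem (isOpen_extInf.mem_nhds hx))

theorem WT_pd_zero {a b : ℤ} {lo hi : ℕ} {g : R3 → ℝ} (hg : g ∈ WT a b lo hi) :
    pd 0 g ∈ WT (a - 1) b lo hi := by
  refine WT_pd_aux (fun f g h hg => WT_congr hg h) (fun α β m h1 h2 h3 h4 => ?_) hg
  have e : Set.EqOn (pd 0 fun x => x 0 ^ α * x 1 ^ β * wt x ^ m)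
      (fun x => α * (x 0 ^ (α - 1) * x 1 ^ β * wt x ^ m)) extInf :=
    fun x hx => congrFun (grad_wtMonomial α β m hx) 0
  refine WT_congr ?_ e
  -- For α = 0 the truncated exponent would violate the degree bound a - 1, but the coefficient α is
  -- zero then.
  rcases α with _ | α
  · simpa using WT_zero
  · exact WT_const_mul _ (WT_monomial (by push_cast at h1 ⊢; omega) h2 h3 h4)

theorem WT_pd_one {a b : ℤ} {lo hi : ℕ} {g : R3 → ℝ} (hg : g ∈ WT a b lo hi) :
    pd 1 g ∈ WT a (b - 1) lo hi := by
  refine WT_pd_aux (fun f g h hg => WT_congr hg h) (fun α β m h1 h2 h3 h4 => ?_) hg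
  have e : Set.EqOn (pd 1 fun x => x 0 ^ α * x 1 ^ β * wt x ^ m)
      (fun x => β * (x 0 ^ α * x 1 ^ (β - 1) * wt x ^ m)) extInf :=
    fun x hx => congrFun (grad_wtMonomial α β m hx) 1
  refine WT_congr ?_ e
  rcases β with _ | β
  · simpa using WT_zero
  · exact WT_const_mul _ (WT_monomial h1 (by push_cast at h2 ⊢; omega) h3 h4)

/-- From ∂_z w^m = -m w^{m+1}: both ends of the exponent range move up by one. This gain of decay is
why the lower exponent is tracked. -/
theorem WT_pd_two {a b : ℤ} {lo hi : ℕ} {g : R3 → ℝ} (hg : g ∈ WT a b lo hi) :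
    pd 2 g ∈ WT a b (lo + 1) (hi + 1) := by
  refine WT_pd_aux (fun f g h hg => WT_congr hg h) (fun α β m h1 h2 h3 h4 => ?_) hg
  have e : Set.EqOn (pd 2 fun x => x 0 ^ α * x 1 ^ β * wt x ^ m)
      (fun x => -m * (x 0 ^ α * x 1 ^ β * wt x ^ (m + 1))) extInf :=
    fun x hx => congrFun (grad_wtMonomial α β m hx) 2
  exact WT_congr (WT_const_mul _ (WT_monomial h1 h2 (by omega) (by omega))) e

theorem wt_mem_Icc {x : R3} (hx : x ∈ OmegaInf) : 0 ≤ wt x ∧ wt x ≤ 1 := by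
  refine ⟨(wt_pos (OmegaInf_subset_extInf hx)).le, inv_le_one_of_one_le₀ ?_⟩
  have := hx.2.2.2.2
  linarith

/-- On the infinite pyramid x, y and w lie in [0, 1], so the lowest power of w dominates. -/
theorem WT_bound {a b : ℤ} {lo hi : ℕ} {g : R3 → ℝ} (hg : g ∈ WT a b lo hi) :
    ∃ C, 0 ≤ C ∧ ∀ x ∈ OmegaInf, |g x| ≤ C * wt x ^ lo := by
  refine WT_induction (p := fun g => ∃ C, 0 ≤ C ∧ ∀ x ∈ OmegaInf, |g x| ≤ C * wt x ^ lo)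
    ?_ ⟨0, le_rfl, by simp⟩ ?_ ?_ ?_ hg
  · intro α β m _ _ h3 _
    refine ⟨1, zero_le_one, fun x hx => ?_⟩
    obtain ⟨hw0, hw1⟩ := wt_mem_Icc hx
    obtain ⟨h0, h0', h1, h1', -⟩ := hx
    rw [abs_of_nonneg (by positivity), one_mul]
    calc x 0 ^ α * x 1 ^ β * wt x ^ m ≤ 1 * 1 * wt x ^ lo := by
          refine mul_le_mul (mul_le_mul ?_ ?_ (by positivity) zero_le_one) ?_ (by positivity)
            (by norm_num)
          · exact pow_le_one₀ h0.le h0'.le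
          · exact pow_le_one₀ h1.le h1'.le
          · exact pow_le_pow_of_le_one hw0 hw1 h3
      _ = _ := by ring
  · rintro f g - - ⟨C, hC, h⟩ ⟨C', hC', h'⟩
    refine ⟨C + C', by positivity, fun x hx => ?_⟩
    calc |f x + g x| ≤ |f x| + |g x| := abs_add_le _ _
      _ ≤ C * wt x ^ lo + C' * wt x ^ lo := add_le_add (h x hx) (h' x hx)
      _ = _ := by ring
  · rintro c f - ⟨C, hC, h⟩
    refine ⟨|c| * C, by positivity, fun x hx => ?_⟩
    rw [abs_mul, mul_assoc]
    exact mul_le_mul_of_nonneg_left (h x hx) (abs_nonneg c)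
  · rintro f g h ⟨C, hC, h'⟩
    exact ⟨C, hC, fun x hx => by rw [h (OmegaInf_subset_extInf hx)]; exact h' x hx⟩

/-! ### Tensor degrees of polynomials in three variables. -/

section TensorPoly

variable {a b c : ℤ}

theorem tensorPoly_of_degreeOf_le {ψ : Poly3} (h0 : (ψ.degreeOf 0 : ℤ) ≤ a)
    (h1 : (ψ.degreeOf 1 : ℤ) ≤ b) (h2 : (ψ.degreeOf 2 : ℤ) ≤ c) : ψ ∈ TensorPoly a b c := by
  intro m hm
  have h := fun i => MvPolynomial.monomial_le_degreeOf i hm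
  have e0 := h 0
  have e1 := h 1
  have e2 := h 2
  refine ⟨?_, ?_, ?_⟩ <;> omega

theorem tensorPoly_zero : (0 : Poly3) ∈ TensorPoly a b c := fun m hm => by simp at hm

theorem tensorPoly_add {ψ χ : Poly3} (hψ : ψ ∈ TensorPoly a b c) (hχ : χ ∈ TensorPoly a b c) :
    ψ + χ ∈ TensorPoly a b c := fun m hm => by
  rcases Finset.mem_union.1 (MvPolynomial.support_add hm) with h | h
  · exact hψ m h
  · exact hχ m h

theorem tensorPoly_smul (r : ℝ) {ψ : Poly3} (hψ : ψ ∈ TensorPoly a b c) :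
    r • ψ ∈ TensorPoly a b c := fun m hm => hψ m (MvPolynomial.support_smul hm)

end TensorPoly

/-- Write w^m = (1+z)^{n-m}/(1+z)^n. This needs m ≤ n, and the numerator has degree n - m ≤ n - lo ≤
c in z. -/
theorem QW_of_WT {a b c : ℤ} {lo hi n : ℕ} {g : R3 → ℝ} (hg : g ∈ WT a b lo hi)
    (hn : hi ≤ n) (hc : (n : ℤ) ≤ c + lo) : g ∈ QW n a b c := by
  refine WT_induction (p := fun g => g ∈ QW n a b c) ?_ ?_ ?_ ?_ ?_ hg
  · intro α β m h1 h2 h3 h4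
    have hd : ∀ k : Fin 3, (MvPolynomial.X 0 ^ α * MvPolynomial.X 1 ^ β
        * (1 + MvPolynomial.X 2) ^ (n - m) : Poly3).degreeOf k
          ≤ α * (if k = 0 then 1 else 0) + β * (if k = 1 then 1 else 0)
            + (n - m) * (if k = 2 then 1 else 0) := by
      intro k
      have h1X : (1 + MvPolynomial.X 2 : Poly3).degreeOf k ≤ if k = 2 then 1 else 0 := by
        refine (MvPolynomial.degreeOf_add_le _ _ _).trans ?_
        rw [← MvPolynomial.C_1, MvPolynomial.degreeOf_C, MvPolynomial.degreeOf_X]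
        simp
      refine (MvPolynomial.degreeOf_mul_le _ _ _).trans (add_le_add
        ((MvPolynomial.degreeOf_mul_le _ _ _).trans (add_le_add ?_ ?_)) ?_)
      · exact (MvPolynomial.degreeOf_pow_le _ _ _).trans (by rw [MvPolynomial.degreeOf_X])
      · exact (MvPolynomial.degreeOf_pow_le _ _ _).trans (by rw [MvPolynomial.degreeOf_X])
      · exact (MvPolynomial.degreeOf_pow_le _ _ _).trans (Nat.mul_le_mul_left _ h1X)
    refine ⟨MvPolynomial.X 0 ^ α * MvPolynomial.X 1 ^ β * (1 + MvPolynomial.X 2) ^ (n - m),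
      tensorPoly_of_degreeOf_le ?_ ?_ ?_, fun x hx => ?_⟩
    · have := hd 0
      simp only [if_true, if_neg (show (0 : Fin 3) ≠ 1 by decide),
        if_neg (show (0 : Fin 3) ≠ 2 by decide)] at this
      omega
    · have := hd 1
      simp only [if_true, if_neg (show (1 : Fin 3) ≠ 0 by decide),
        if_neg (show (1 : Fin 3) ≠ 2 by decide)] at this
      omega
    · have := hd 2
      simp only [if_true, if_neg (show (2 : Fin 3) ≠ 0 by decide),
        if_neg (show (2 : Fin 3) ≠ 1 by decide)] at this
      omega
    · have h : (1 + x 2) ≠ 0 := ne_of_gt (OmegaInf_subset_extInf hx)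
      have e : (1 + x 2) ^ n = (1 + x 2) ^ m * (1 + x 2) ^ (n - m) := by
        rw [← pow_add, Nat.add_sub_cancel' (h4.trans hn)]
      simp only [map_mul, map_pow, map_add, map_one, MvPolynomial.eval_X, wt, e, inv_pow]
      field_simp
  · exact ⟨0, tensorPoly_zero, by simp⟩
  · rintro f g - - ⟨ψ, hψ, hf⟩ ⟨χ, hχ, hg⟩
    exact ⟨ψ + χ, tensorPoly_add hψ hχ, fun x hx => by
      simp only [hf x hx, hg x hx, map_add, add_div]⟩
  · rintro r f - ⟨ψ, hψ, hf⟩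
    exact ⟨r • ψ, tensorPoly_smul r hψ, fun x hx => by
      simp only [hf x hx, MvPolynomial.smul_eval, mul_div_assoc]⟩
  · rintro f g h ⟨ψ, hψ, hg⟩
    exact ⟨ψ, hψ, fun x hx => by rw [h (OmegaInf_subset_extInf hx), hg x hx]⟩

/-! ### Boundedness of fields with prescribed pullbacks -/

theorem sqInt_of_bounded {E : Type*} [NormedAddCommGroup E] [NormedSpace ℝ E] {f : R3 → E}
    (hf : ContinuousOn f Omega) (hb : ∃ C, ∀ x ∈ Omega, ‖f x‖ ≤ C) : SqInt f := by
  have hfin : IsFiniteMeasure (volume.restrict Omega) := by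
    refine ⟨?_⟩
    rw [Measure.restrict_apply_univ]
    refine lt_of_le_of_lt (measure_mono (t := Set.Icc 0 1) fun x hx => ?_)
      isCompact_Icc.measure_lt_top
    obtain ⟨h0, h1, h2, h3, h4⟩ := hx
    constructor <;> intro i <;> fin_cases i <;> simp <;> linarith
  obtain ⟨C, hC⟩ := hb
  have hmeas : AEStronglyMeasurable f (volume.restrict Omega) :=
    hf.aestronglyMeasurable isOpen_Omega.measurableSet
  exact MemLp.of_bound hmeas C ((ae_restrict_iff' isOpen_Omega.measurableSet).2
    (Filter.Eventually.of_forall hC))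

theorem bounded_of_pull {E : Type*} [NormedAddCommGroup E] {f : R3 → E}
    (h : ∃ C, ∀ x ∈ OmegaInf, ‖f (tau x)‖ ≤ C) : ∃ C, ∀ x ∈ Omega, ‖f x‖ ≤ C := by
  obtain ⟨C, hC⟩ := h
  refine ⟨C, fun x hx => ?_⟩
  have := hC _ (tauInv_mem_OmegaInf hx)
  rwa [tau_tauInv (Omega_subset_belowApex hx)] at this

theorem norm_le_of_apply {v : R3} {C : ℝ} (hC : 0 ≤ C) (h0 : |v 0| ≤ C) (h1 : |v 1| ≤ C)
    (h2 : |v 2| ≤ C) : ‖v‖ ≤ C := by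
  refine (pi_norm_le_iff_of_nonneg hC).2 fun i => ?_
  fin_cases i <;> assumption

theorem abs_le_of_pow_mul {w v C : ℝ} {n : ℕ} (hw : 0 < w) (h : |w ^ n * v| ≤ C * w ^ n) :
    |v| ≤ C := by
  rw [abs_mul, abs_of_pos (pow_pos hw n), mul_comm] at h
  exact le_of_mul_le_mul_right h (pow_pos hw n)

/-- The exponents 1, 1, 2 match the weights w, w, w² in `pull1_apply`. The third component is
recovered from the others because 0 < x, y < 1. -/
theorem bounded_of_pull1 {E : R3 → R3} {a b : Fin 3 → ℤ} {hi : Fin 3 → ℕ}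
    (h0 : (fun x => pull1 E x 0) ∈ WT (a 0) (b 0) 1 (hi 0))
    (h1 : (fun x => pull1 E x 1) ∈ WT (a 1) (b 1) 1 (hi 1))
    (h2 : (fun x => pull1 E x 2) ∈ WT (a 2) (b 2) 2 (hi 2)) : ∃ C, ∀ x ∈ Omega, ‖E x‖ ≤ C := by
  obtain ⟨C0, hC0, h0⟩ := WT_bound h0
  obtain ⟨C1, hC1, h1⟩ := WT_bound h1
  obtain ⟨C2, hC2, h2⟩ := WT_bound h2
  refine bounded_of_pull ⟨C0 + C1 + C2, fun x hx => ?_⟩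
  have hx' := OmegaInf_subset_extInf hx
  have hw := wt_pos hx'
  have e0 := h0 x hx
  have e1 := h1 x hx
  have e2 := h2 x hx
  rw [pull1_apply hx'] at e0 e1 e2
  simp only [Matrix.cons_val_zero, Matrix.cons_val_one, Matrix.cons_val] at e0 e1 e2
  have e0 : |E (tau x) 0| ≤ C0 :=
    abs_le_of_pow_mul (n := 1) hw (by rw [pow_one] at e0 ⊢; exact e0)
  have e1 : |E (tau x) 1| ≤ C1 :=
    abs_le_of_pow_mul (n := 1) hw (by rw [pow_one] at e1 ⊢; exact e1)
  have e2 := abs_le_of_pow_mul hw e2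
  obtain ⟨p0, p0', p1, p1', -⟩ := hx
  have f0 : |x 0 * E (tau x) 0| ≤ C0 := by
    rw [abs_mul, abs_of_pos p0]
    exact (mul_le_of_le_one_left (abs_nonneg _) p0'.le).trans e0
  have f1 : |x 1 * E (tau x) 1| ≤ C1 := by
    rw [abs_mul, abs_of_pos p1]
    exact (mul_le_of_le_one_left (abs_nonneg _) p1'.le).trans e1
  refine norm_le_of_apply (by positivity) (by linarith) (by linarith) ?_
  rw [abs_le] at *
  constructor <;> linarith

/-- As for `bounded_of_pull1`, with the weights w³, w³, w² of `pull2_apply`. -/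
theorem bounded_of_pull2 {V : R3 → R3} {a b : Fin 3 → ℤ} {hi : Fin 3 → ℕ}
    (h0 : (fun x => pull2 V x 0) ∈ WT (a 0) (b 0) 3 (hi 0))
    (h1 : (fun x => pull2 V x 1) ∈ WT (a 1) (b 1) 3 (hi 1))
    (h2 : (fun x => pull2 V x 2) ∈ WT (a 2) (b 2) 2 (hi 2)) : ∃ C, ∀ x ∈ Omega, ‖V x‖ ≤ C := by
  obtain ⟨C0, hC0, h0⟩ := WT_bound h0
  obtain ⟨C1, hC1, h1⟩ := WT_bound h1
  obtain ⟨C2, hC2, h2⟩ := WT_bound h2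
  refine bounded_of_pull ⟨C0 + C1 + C2, fun x hx => ?_⟩
  have hx' := OmegaInf_subset_extInf hx
  have hw := wt_pos hx'
  have e0 := h0 x hx
  have e1 := h1 x hx
  have e2 := h2 x hx
  rw [pull2_apply hx'] at e0 e1 e2
  simp only [Matrix.cons_val_zero, Matrix.cons_val_one, Matrix.cons_val] at e0 e1 e2
  have e0 := abs_le_of_pow_mul hw e0
  have e1 := abs_le_of_pow_mul hw e1
  have e2 := abs_le_of_pow_mul hw e2
  obtain ⟨p0, p0', p1, p1', -⟩ := hx
  have f0 : |x 0 * V (tau x) 2| ≤ C2 := by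
    rw [abs_mul, abs_of_pos p0]
    exact (mul_le_of_le_one_left (abs_nonneg _) p0'.le).trans e2
  have f1 : |x 1 * V (tau x) 2| ≤ C2 := by
    rw [abs_mul, abs_of_pos p1]
    exact (mul_le_of_le_one_left (abs_nonneg _) p1'.le).trans e2
  refine norm_le_of_apply (by positivity) ?_ ?_ (by linarith)
  all_goals
    rw [abs_le] at *
    constructor <;> linarith

theorem bounded_of_pull3 {ψ : R3 → ℝ} {a b : ℤ} {hi : ℕ}
    (h : pull3 ψ ∈ WT a b 4 hi) : ∃ C, ∀ x ∈ Omega, ‖ψ x‖ ≤ C := by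
  obtain ⟨C, hC, h⟩ := WT_bound h
  refine bounded_of_pull ⟨C, fun x hx => ?_⟩
  have hx' := OmegaInf_subset_extInf hx
  have e := h x hx
  rw [pull3_apply hx'] at e
  exact abs_le_of_pow_mul (wt_pos hx') e

end PyramidFE

namespace PyramidFE

open Topology

/-! ### Criteria for membership in the discrete spaces -/

theorem continuous_facePar (F : Face) : Continuous (facePar F) := by
  refine continuous_pi fun k => ?_
  cases F with
  | quad => fin_cases k <;> simp [facePar] <;> fun_prop
  | tri b c =>
    simp only [facePar]
    split_ifs <;> fin_cases k <;> simp <;> fun_prop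

theorem integrableOn_face {E : Type*} [NormedAddCommGroup E] [NormedSpace ℝ E] {F : Face}
    {h : ℝ × ℝ → E} {Q : R3 → E} (hQ : Continuous Q) (hh : ∀ u, h u = Q (facePar F u)) :
    IntegrableOn h (faceDom F) := by
  have h1 : Continuous h := by
    rw [show h = fun u => Q (facePar F u) from funext hh]
    exact hQ.comp (continuous_facePar F)
  refine (h1.continuousOn.integrableOn_compact (K := Set.Icc 0 1) isCompact_Icc).mono_set
    fun u hu => ?_
  rw [Set.mem_Icc, Prod.le_def, Prod.le_def]
  cases F with
  | quad =>
    obtain ⟨h1, h2, h3, h4⟩ := hu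
    exact ⟨⟨h1.le, h3.le⟩, h2.le, h4.le⟩
  | tri b c =>
    obtain ⟨h1, h2, h3⟩ := hu
    refine ⟨⟨h1.le, h2.le⟩, ?_, ?_⟩ <;> simp <;> linarith

theorem facePar_mem_belowApex {F : Face} {u : ℝ × ℝ} (hu : u ∈ faceDom F) :
    facePar F u ∈ belowApex := faceNhd_subset_belowApex F (facePar_mem_faceNhd_iff.2 hu)

theorem faceFun_facePar (F : Face) (u : ℝ × ℝ) : faceFun F (facePar F u) = 0 := by
  revert F
  rw [forall_face]
  simp [faceFun, facePar]

theorem continuous_evalVec (Q : Fin 3 → Poly3) : Continuous (evalVec Q) :=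
  continuous_pi fun k => MvPolynomial.continuous_eval (Q k)

theorem continuous_cross_left (a : R3) {Q : R3 → R3} (hQ : Continuous Q) :
    Continuous fun x => a ⨯₃ Q x := by
  have e := continuous_pi_iff.1 hQ
  refine continuous_pi fun k => ?_
  fin_cases k <;> simp [cross_apply] <;>
    exact (continuous_const.mul (e _)).sub (continuous_const.mul (e _))

theorem continuous_dot_right (a : R3) {Q : R3 → R3} (hQ : Continuous Q) :
    Continuous fun x => Q x ⬝ᵥ a := by
  have e := continuous_pi_iff.1 hQ
  simp only [dot_apply]
  exact (((e 0).mul continuous_const).add ((e 1).mul continuous_const)).add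
    ((e 2).mul continuous_const)

/-- Lower exponent 1 for g gives the exponents 1, 1, 2 for its gradient, as required both by the
weighted spaces and by boundedness. The constant c does not affect the gradient; it is there for λ₅,
whose pullback 1 - w does not decay. -/
theorem mem_U0_of_pull {p : ℕ} {f q : R3 → ℝ} {t : Fin 2 → Fin 2 → R3 → ℝ} {c : ℝ} {g : R3 → ℝ}
    (hf : ContDiffOn ℝ ∞ f belowApex) (hg : g ∈ WT p p 1 p)
    (hfg : Set.EqOn (pull0 f) (fun x => c + g x) extInf)
    (hq : ∀ x ∈ belowApex, faceFun .quad x = 0 → f x = q x)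
    (ht : ∀ b c, ∀ x ∈ belowApex, faceFun (.tri b c) x = 0 → f x = t b c x)
    (hqP : ∃ Q ∈ TensorPoly p p 0, ∀ x, q x = MvPolynomial.eval x Q)
    (htP : ∀ b c, ∃ Q ∈ TotalPoly p, ∀ x, t b c x = MvPolynomial.eval x Q) :
    f ∈ U0 p ∧ HasTraces0 f q t := by
  have hp0 : pull0 f ∈ WT p p 0 p :=
    WT_congr (WT_add (WT_mono (WT_const c) (by omega) (by omega) (by omega) (by omega))
      (WT_mono hg le_rfl le_rfl (by omega) le_rfl)) hfg
  have hgrad : Set.EqOn (grad (pull0 f)) (grad g) extInf := fun x hx => by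
    rw [grad_congr (hfg.eventuallyEq_of_mem (isOpen_extInf.mem_nhds hx)),
      grad_add (differentiableAt_const c) (differentiableAt_of_WT hg hx), grad_const, zero_add]
  have hd : ∀ k, Set.EqOn (fun x => grad (pull0 f) x k) (pd k g) extInf := fun k x hx =>
    congrFun (hgrad hx) k
  have h0 := WT_congr (WT_pd_zero hg) (hd 0)
  have h1 := WT_congr (WT_pd_one hg) (hd 1)
  have h2 := WT_congr (WT_pd_two hg) (hd 2)
  have hp : ∀ k, Set.EqOn (fun x => pull1 (grad f) x k) (fun x => grad (pull0 f) x k) extInf :=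
    fun k x hx => congrFun (pull1_grad hx (hf.differentiableAt_of_isOpen isOpen_belowApex
      (tau_mem_belowApex hx))) k
  have hsq : SqInt f := by
    obtain ⟨C, -, hC⟩ := WT_bound hp0
    exact sqInt_of_bounded (hf.continuousOn.mono Omega_subset_belowApex)
      (bounded_of_pull ⟨C, fun x hx => by simpa [pull0] using hC x hx⟩)
  have hsg : SqInt (grad f) :=
    sqInt_of_bounded ((contDiffOn_grad isOpen_belowApex hf).continuousOn.mono
      Omega_subset_belowApex) (bounded_of_pull1 (a := ![_, _, _]) (b := ![_, _, _])
        (hi := ![_, _, _]) (WT_congr h0 (hp 0)) (WT_congr h1 (hp 1)) (WT_congr h2 (hp 2)))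
  have htq : HasTrace0 f .quad q := by
    obtain ⟨Q, -, hQ⟩ := hqP
    exact hasTrace0_of_eqOn hf hsg
      (fun u hu => hq _ (facePar_mem_belowApex hu) (faceFun_facePar _ u))
      (integrableOn_face (MvPolynomial.continuous_eval Q) fun u => hQ _)
  have htt : ∀ b c, HasTrace0 f (.tri b c) (t b c) := fun b c => by
    obtain ⟨Q, -, hQ⟩ := htP b c
    exact hasTrace0_of_eqOn hf hsg
      (fun u hu => ht b c _ (facePar_mem_belowApex hu) (faceFun_facePar _ u))
      (integrableOn_face (MvPolynomial.continuous_eval Q) fun u => hQ _)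
  refine ⟨⟨⟨?_, ?_, ?_, ?_⟩, ⟨hsq, _, isWeakGrad_grad hf hsg⟩, fun b c => ?_, ?_⟩, htq, htt⟩
  · exact QW_of_WT hp0 le_rfl (by omega)
  · exact QW_of_WT h0 le_rfl (by omega)
  · exact QW_of_WT h1 le_rfl (by omega)
  · exact QW_of_WT h2 le_rfl (by push_cast; omega)
  · obtain ⟨Q, hQ', hQ⟩ := htP b c
    refine ⟨Q, hQ', ?_⟩
    rw [← show t b c = fun x => MvPolynomial.eval x Q from funext hQ]
    exact htt b c
  · obtain ⟨Q, hQ', hQ⟩ := hqP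
    refine ⟨Q, hQ', ?_⟩
    rw [← show q = fun x => MvPolynomial.eval x Q from funext hQ]
    exact htq

/-- A class of fields on the infinite pyramid that are admissible in `H(curl)`. -/
def CurlClass (p : ℕ) : Set (R3 → R3) :=
  {E | (fun x => E x 0) ∈ WT (p - 1) p 2 (p + 1) ∧ (fun x => E x 1) ∈ WT p (p - 1) 2 (p + 1) ∧
    (fun x => E x 2) ∈ WT p p 3 (p + 1)}

/-- A class of fields on the infinite pyramid that are admissible in `H(div)`. -/
def DivClass (p : ℕ) : Set (R3 → R3) :=
  {V | (fun x => V x 0) ∈ WT p (p - 1) 4 (p + 2) ∧ (fun x => V x 1) ∈ WT (p - 1) p 4 (p + 2) ∧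
    (fun x => V x 2) ∈ WT (p - 1) (p - 1) 3 (p + 2)}

theorem contDiffOn_of_curlClass {p : ℕ} {E : R3 → R3} (hE : E ∈ CurlClass p) :
    ContDiffOn ℝ ∞ E extInf := by
  refine contDiffOn_pi.2 fun k => ?_
  fin_cases k
  · exact contDiffOn_of_WT hE.1
  · exact contDiffOn_of_WT hE.2.1
  · exact contDiffOn_of_WT hE.2.2

theorem contDiffOn_of_divClass {p : ℕ} {E : R3 → R3} (hE : E ∈ DivClass p) :
    ContDiffOn ℝ ∞ E extInf := by
  refine contDiffOn_pi.2 fun k => ?_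
  fin_cases k
  · exact contDiffOn_of_WT hE.1
  · exact contDiffOn_of_WT hE.2.1
  · exact contDiffOn_of_WT hE.2.2

/-- The exponents 2, 2, 3 become 3, 3, 2. The first two components of the curl gain a power from ∂_z
of a horizontal component or keep the 3 of the vertical one; the last involves no ∂_z. -/
theorem curl_mem_of_curlClass {p : ℕ} {E : R3 → R3} (hE : E ∈ CurlClass p) :
    (fun x => curl E x 0) ∈ WT p (p - 1) 3 (p + 2) ∧
    (fun x => curl E x 1) ∈ WT (p - 1) p 3 (p + 2) ∧
    (fun x => curl E x 2) ∈ WT (p - 1) (p - 1) 2 (p + 1) := by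
  obtain ⟨h0, h1, h2⟩ := hE
  refine ⟨?_, ?_, ?_⟩
  · exact WT_sub (WT_mono (WT_pd_one h2) le_rfl le_rfl le_rfl (by omega)) (WT_pd_two h1)
  · exact WT_sub (WT_pd_two h0) (WT_mono (WT_pd_zero h2) le_rfl le_rfl le_rfl (by omega))
  · exact WT_sub (WT_pd_zero h1) (WT_pd_one h0)

/-- The vertical exponent 3 is raised to 4 by ∂_z, and the horizontal ones are 4 already. -/
theorem div_mem_of_divClass {p : ℕ} {V : R3 → R3} (hV : V ∈ DivClass p) :
    PyramidFE.div V ∈ WT (p - 1) (p - 1) 4 (p + 3) := by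
  obtain ⟨h0, h1, h2⟩ := hV
  refine WT_congr (WT_add (WT_add (WT_mono (WT_pd_zero h0) le_rfl le_rfl le_rfl (by omega))
    (WT_mono (WT_pd_one h1) le_rfl le_rfl le_rfl (by omega))) (WT_pd_two h2)) fun x _ => ?_
  exact div_apply V x

/-- A gradient ∇g only has the exponents 1, 1, 2. That is enough for the field itself, though not
for membership in `CurlClass`; but it contributes nothing to the curl. -/
theorem mem_U1_of_pull {p : ℕ} {E q : R3 → R3} {t : Fin 2 → Fin 2 → R3 → R3} {E' : R3 → R3}
    {g : R3 → ℝ} (hE : ContDiffOn ℝ ∞ E belowApex) (hE' : E' ∈ CurlClass p)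
    (hg : g ∈ WT p p 1 p)
    (heq : Set.EqOn (pull1 E) (fun x => E' x + grad g x) extInf)
    (hq : ∀ x ∈ belowApex, faceFun .quad x = 0 →
      faceNormal .quad ⨯₃ E x = faceNormal .quad ⨯₃ q x)
    (ht : ∀ b c, ∀ x ∈ belowApex, faceFun (.tri b c) x = 0 →
      faceNormal (.tri b c) ⨯₃ E x = faceNormal (.tri b c) ⨯₃ t b c x)
    (hqP : ∃ q₁ ∈ TensorPoly (p - 1) p 0, ∃ q₂ ∈ TensorPoly p (p - 1) 0,
      ∀ x, q x = evalVec ![q₁, q₂, 0] x)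
    (htP : ∀ b c, ∃ Q ∈ NedelecPoly p, ∀ x, t b c x = evalVec Q x) :
    E ∈ U1 p ∧ HasTraces1 E q t := by
  have hc : ∀ k, Set.EqOn (fun x => pull1 E x k) (fun x => E' x k + pd k g x) extInf :=
    fun k x hx => congrFun (heq hx) k
  have h0 : (fun x => pull1 E x 0) ∈ WT (p - 1) p 1 (p + 1) := WT_congr
    (WT_add (WT_mono hE'.1 le_rfl le_rfl (by omega) le_rfl)
      (WT_mono (WT_pd_zero hg) le_rfl le_rfl le_rfl (by omega))) (hc 0)
  have h1 : (fun x => pull1 E x 1) ∈ WT p (p - 1) 1 (p + 1) := WT_congr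
    (WT_add (WT_mono hE'.2.1 le_rfl le_rfl (by omega) le_rfl)
      (WT_mono (WT_pd_one hg) le_rfl le_rfl le_rfl (by omega))) (hc 1)
  have h2 : (fun x => pull1 E x 2) ∈ WT p p 2 (p + 1) := WT_congr
    (WT_add (WT_mono hE'.2.2 le_rfl le_rfl (by omega) le_rfl) (WT_pd_two hg)) (hc 2)
  have hcurl : Set.EqOn (curl (pull1 E)) (curl E') extInf := fun x hx => by
    have hg2 : ContDiffAt ℝ 2 g x :=
      ((contDiffOn_of_WT hg).contDiffAt_of_isOpen isOpen_extInf hx).of_le two_le_infty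
    rw [curl_congr (heq.eventuallyEq_of_mem (isOpen_extInf.mem_nhds hx)),
      curl_add ((contDiffOn_of_curlClass hE').differentiableAt_of_isOpen isOpen_extInf hx)
        (differentiableAt_grad hg2), curl_grad hg2, add_zero]
  have hd : ∀ k, Set.EqOn (fun x => curl (pull1 E) x k) (fun x => curl E' x k) extInf :=
    fun k x hx => congrFun (hcurl hx) k
  obtain ⟨c0, c1, c2⟩ := curl_mem_of_curlClass hE'
  have c0 := WT_congr c0 (hd 0)
  have c1 := WT_congr c1 (hd 1)
  have c2 := WT_congr c2 (hd 2)
  have hp : ∀ k, Set.EqOn (fun x => pull2 (curl E) x k) (fun x => curl (pull1 E) x k) extInf :=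
    fun k x hx => congrFun (pull2_curl hE hx) k
  have hsq : SqInt E := sqInt_of_bounded (hE.continuousOn.mono Omega_subset_belowApex)
    (bounded_of_pull1 (a := ![_, _, _]) (b := ![_, _, _]) (hi := ![_, _, _]) h0 h1 h2)
  have hsc : SqInt (curl E) :=
    sqInt_of_bounded ((contDiffOn_curl isOpen_belowApex hE).continuousOn.mono
      Omega_subset_belowApex) (bounded_of_pull2 (a := ![_, _, _]) (b := ![_, _, _])
        (hi := ![_, _, _]) (WT_congr c0 (hp 0)) (WT_congr c1 (hp 1)) (WT_congr c2 (hp 2)))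
  have htq : HasTrace1 E .quad q := by
    obtain ⟨q₁, -, q₂, -, hQ⟩ := hqP
    exact hasTrace1_of_eqOn hE hsc
      (fun u hu => hq _ (facePar_mem_belowApex hu) (faceFun_facePar _ u))
      (integrableOn_face (continuous_cross_left _ (continuous_evalVec _)) fun u => by rw [hQ])
  have htt : ∀ b c, HasTrace1 E (.tri b c) (t b c) := fun b c => by
    obtain ⟨Q, -, hQ⟩ := htP b c
    exact hasTrace1_of_eqOn hE hsc
      (fun u hu => ht b c _ (facePar_mem_belowApex hu) (faceFun_facePar _ u))
      (integrableOn_face (continuous_cross_left _ (continuous_evalVec _)) fun u => by rw [hQ])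
  refine ⟨⟨⟨⟨?_, ?_, ?_⟩, ?_, ?_, ?_⟩, ⟨hsq, _, isWeakCurl_curl hE hsc⟩, fun b c => ?_, ?_⟩,
    htq, htt⟩
  · exact QW_of_WT h0 le_rfl (by push_cast; omega)
  · exact QW_of_WT h1 le_rfl (by push_cast; omega)
  · exact QW_of_WT h2 le_rfl (by push_cast; omega)
  · exact QW_of_WT c0 le_rfl (by push_cast; omega)
  · exact QW_of_WT c1 le_rfl (by push_cast; omega)
  · exact QW_of_WT c2 le_rfl (by push_cast; omega)
  · obtain ⟨Q, hQ', hQ⟩ := htP b c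
    refine ⟨Q, hQ', ?_⟩
    rw [← show t b c = evalVec Q from funext hQ]
    exact htt b c
  · obtain ⟨q₁, hq₁, q₂, hq₂, hQ⟩ := hqP
    refine ⟨q₁, hq₁, q₂, hq₂, ?_⟩
    rw [← show q = evalVec _ from funext hQ]
    exact htq

/-- A curl of a `CurlClass` field only has the exponents 3, 3, 2. That is enough for the field
itself, and its divergence vanishes. -/
theorem mem_U2_of_pull {p : ℕ} {V q : R3 → R3} {t : Fin 2 → Fin 2 → R3 → R3} {V' E' : R3 → R3}
    (hV : ContDiffOn ℝ ∞ V belowApex) (hV' : V' ∈ DivClass p) (hE' : E' ∈ CurlClass p)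
    (heq : Set.EqOn (pull2 V) (fun x => V' x + curl E' x) extInf)
    (hq : ∀ x ∈ belowApex, faceFun .quad x = 0 →
      V x ⬝ᵥ faceNormal .quad = q x ⬝ᵥ faceNormal .quad)
    (ht : ∀ b c, ∀ x ∈ belowApex, faceFun (.tri b c) x = 0 →
      V x ⬝ᵥ faceNormal (.tri b c) = t b c x ⬝ᵥ faceNormal (.tri b c))
    (hqP : ∃ Q ∈ TensorPoly (p - 1) (p - 1) 0, ∀ x, q x = evalVec ![0, 0, Q] x)
    (htP : ∀ b c, ∃ Q ∈ RaviartThomasPoly p, ∀ x, t b c x = evalVec Q x) :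
    V ∈ U2 p ∧ HasTraces2 V q t := by
  have hc : ∀ k, Set.EqOn (fun x => pull2 V x k) (fun x => V' x k + curl E' x k) extInf :=
    fun k x hx => congrFun (heq hx) k
  obtain ⟨c0, c1, c2⟩ := curl_mem_of_curlClass hE'
  have h0 : (fun x => pull2 V x 0) ∈ WT p (p - 1) 3 (p + 2) := WT_congr
    (WT_add (WT_mono hV'.1 le_rfl le_rfl (by omega) le_rfl) c0) (hc 0)
  have h1 : (fun x => pull2 V x 1) ∈ WT (p - 1) p 3 (p + 2) := WT_congr
    (WT_add (WT_mono hV'.2.1 le_rfl le_rfl (by omega) le_rfl) c1) (hc 1)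
  have h2 : (fun x => pull2 V x 2) ∈ WT (p - 1) (p - 1) 2 (p + 2) := WT_congr
    (WT_add (WT_mono hV'.2.2 le_rfl le_rfl (by omega) le_rfl)
      (WT_mono c2 le_rfl le_rfl le_rfl (by omega))) (hc 2)
  have hsE := contDiffOn_of_curlClass hE'
  have hdiv : Set.EqOn (PyramidFE.div (pull2 V)) (PyramidFE.div V') extInf := fun x hx => by
    rw [div_congr (heq.eventuallyEq_of_mem (isOpen_extInf.mem_nhds hx)),
      div_add ((contDiffOn_of_divClass hV').differentiableAt_of_isOpen isOpen_extInf hx)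
        ((contDiffOn_curl isOpen_extInf hsE).differentiableAt_of_isOpen isOpen_extInf hx),
      div_curl isOpen_extInf hsE hx, add_zero]
  have d : PyramidFE.div (pull2 V) ∈ WT (p - 1) (p - 1) 4 (p + 3) :=
    WT_congr (div_mem_of_divClass hV') hdiv
  have hp : Set.EqOn (pull3 (PyramidFE.div V)) (PyramidFE.div (pull2 V)) extInf :=
    fun x hx => pull3_div hV hx
  have hsq : SqInt V := sqInt_of_bounded (hV.continuousOn.mono Omega_subset_belowApex)
    (bounded_of_pull2 (a := ![_, _, _]) (b := ![_, _, _]) (hi := ![_, _, _]) h0 h1 h2)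
  have hsd : SqInt (PyramidFE.div V) :=
    sqInt_of_bounded ((contDiffOn_div isOpen_belowApex hV).continuousOn.mono
      Omega_subset_belowApex) (bounded_of_pull3 (WT_congr d hp))
  have htq : HasTrace2 V .quad q := by
    obtain ⟨Q, -, hQ⟩ := hqP
    exact hasTrace2_of_eqOn hV hsd
      (fun u hu => hq _ (facePar_mem_belowApex hu) (faceFun_facePar _ u))
      (integrableOn_face (continuous_dot_right _ (continuous_evalVec _)) fun u => by rw [hQ])
  have htt : ∀ b c, HasTrace2 V (.tri b c) (t b c) := fun b c => by
    obtain ⟨Q, -, hQ⟩ := htP b c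
    exact hasTrace2_of_eqOn hV hsd
      (fun u hu => ht b c _ (facePar_mem_belowApex hu) (faceFun_facePar _ u))
      (integrableOn_face (continuous_dot_right _ (continuous_evalVec _)) fun u => by rw [hQ])
  refine ⟨⟨⟨⟨?_, ?_, ?_⟩, ?_⟩, ⟨hsq, _, isWeakDiv_div hV hsd⟩, fun b c => ?_, ?_⟩, htq, htt⟩
  · exact QW_of_WT h0 le_rfl (by push_cast; omega)
  · exact QW_of_WT h1 le_rfl (by push_cast; omega)
  · exact QW_of_WT h2 le_rfl (by push_cast; omega)
  · exact QW_of_WT d le_rfl (by push_cast; omega)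
  · obtain ⟨Q, hQ', hQ⟩ := htP b c
    refine ⟨Q, hQ', ?_⟩
    rw [← show t b c = evalVec Q from funext hQ]
    exact htt b c
  · obtain ⟨Q, hQ', hQ⟩ := hqP
    refine ⟨Q, hQ', ?_⟩
    rw [← show q = evalVec _ from funext hQ]
    exact htq

theorem mem_U3_of_pull {p : ℕ} {ψ : R3 → ℝ} (hψ : ContDiffOn ℝ ∞ ψ belowApex)
    (h : pull3 ψ ∈ WT (p - 1) (p - 1) 4 (p + 3)) : ψ ∈ U3 p :=
  ⟨QW_of_WT h le_rfl (by push_cast; omega),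
    sqInt_of_bounded (hψ.continuousOn.mono Omega_subset_belowApex) (bounded_of_pull3 h)⟩

/-! ### Fields that agree in the pyramid -/

theorem sqInt_congr {E : Type*} [NormedAddCommGroup E] {f g : R3 → E} (h : Set.EqOn f g Omega)
    (hg : SqInt g) : SqInt f :=
  (memLp_congr_ae ((ae_restrict_iff' isOpen_Omega.measurableSet).2
    (Filter.Eventually.of_forall h))).2 hg

theorem isWeakDiv_congr {V W : R3 → R3} (h : Set.EqOn V W Omega) {D : R3 → ℝ}
    (hW : IsWeakDiv W D) : IsWeakDiv V D := by
  refine ⟨hW.1, fun ψ hψ => ?_⟩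
  rw [← hW.2 ψ hψ]
  exact setIntegral_congr_fun isOpen_Omega.measurableSet fun x hx => by simp only [h hx]

theorem hasTrace2_congr {V W : R3 → R3} (h : Set.EqOn V W Omega) {F : Face} {g : R3 → R3}
    (hW : HasTrace2 W F g) : HasTrace2 V F g := by
  obtain ⟨hi, D, hD, hT⟩ := hW
  refine ⟨hi, D, isWeakDiv_congr h hD, fun ψ hψ => ?_⟩
  rw [← hT ψ hψ]
  exact setIntegral_congr_fun isOpen_Omega.measurableSet fun x hx => by simp only [h hx]

/-- The pullback to `OmegaInf`, the weak divergence and the traces depend only on the values inside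
Ω. This serves the functions with a factor μ⁻¹, whose values where μ = 0 are a convention. -/
theorem mem_U2_congr {p : ℕ} {V W q : R3 → R3} {t : Fin 2 → Fin 2 → R3 → R3}
    (h : Set.EqOn V W Omega) (hW : W ∈ U2 p ∧ HasTraces2 W q t) :
    V ∈ U2 p ∧ HasTraces2 V q t := by
  obtain ⟨⟨⟨⟨h0, h1, h2⟩, hd⟩, ⟨hsq, D, hD⟩, htP, Q, hQ, hqP⟩, hq, ht⟩ := hW
  have hp : Set.EqOn (pull2 V) (pull2 W) OmegaInf := fun x hx => by
    simp only [pull2, h (tau_mem_Omega hx)]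
  have hQW : ∀ {n : ℕ} {a b c : ℤ} {f g : R3 → ℝ}, Set.EqOn f g OmegaInf → g ∈ QW n a b c →
      f ∈ QW n a b c := by
    rintro n a b c f g hfg ⟨ψ, hψ, hg⟩
    exact ⟨ψ, hψ, fun x hx => (hfg hx).trans (hg x hx)⟩
  refine ⟨⟨⟨⟨hQW (fun x hx => ?_) h0, hQW (fun x hx => ?_) h1, hQW (fun x hx => ?_) h2⟩,
    hQW (fun x hx => ?_) hd⟩, ⟨sqInt_congr h hsq, D, isWeakDiv_congr h hD⟩, fun b c => ?_,
    Q, hQ, hasTrace2_congr h hqP⟩, hasTrace2_congr h hq, fun b c => hasTrace2_congr h (ht b c)⟩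
  · exact congrFun (hp hx) 0
  · exact congrFun (hp hx) 1
  · exact congrFun (hp hx) 2
  · exact div_congr (hp.eventuallyEq_of_mem (isOpen_OmegaInf.mem_nhds hx))
  · obtain ⟨Q, hQ, hT⟩ := htP b c
    exact ⟨Q, hQ, hasTrace2_congr h hT⟩

end PyramidFE

namespace PyramidFE

open Topology

/-! ### Legendre and Jacobi polynomials -/

section Legendre

open Polynomial

theorem C_two : (C 2 : ℝ[X]) = 2 := map_ofNat C 2

theorem C_three : (C 3 : ℝ[X]) = 3 := map_ofNat C 3

theorem legendreClassical_rec (n : ℕ) :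
    ((n : ℝ[X]) + 2) * legendreClassical (n + 2)
      = (2 * (n : ℝ[X]) + 3) * X * legendreClassical (n + 1)
        - ((n : ℝ[X]) + 1) * legendreClassical n := by
  have h : ((n : ℝ[X]) + 2) = C ((n : ℝ) + 2) := by simp [C_two]
  have h' : ((n : ℝ) + 2) ≠ 0 := by positivity
  rw [legendreClassical, h, ← mul_assoc, ← C_mul, mul_one_div_cancel h']
  simp [C_two, C_three]

theorem natCast_add_two_ne_zero (n : ℕ) : ((n : ℝ[X]) + 2) ≠ 0 := by
  have h : ((n : ℝ[X]) + 2) = C ((n : ℝ) + 2) := by simp [C_two]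
  rw [h, C_ne_zero]
  positivity

theorem derivative_legendreClassical_rec (n : ℕ) :
    ((n : ℝ[X]) + 2) * derivative (legendreClassical (n + 2))
      = (2 * (n : ℝ[X]) + 3) * (legendreClassical (n + 1)
          + X * derivative (legendreClassical (n + 1)))
        - ((n : ℝ[X]) + 1) * derivative (legendreClassical n) := by
  have h := congrArg derivative (legendreClassical_rec n)
  simp only [derivative_mul, derivative_add, derivative_sub, derivative_natCast, derivative_X,
    derivative_ofNat, derivative_one] at h
  linear_combination h

/-- A simultaneous induction. The first two identities are the ones wanted for P'_{n+2} - P'_n; the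
third is carried along because the second needs it in the inductive step. -/
theorem derivative_legendreClassical_aux (n : ℕ) :
    derivative (legendreClassical (n + 1))
        = X * derivative (legendreClassical n) + ((n : ℝ[X]) + 1) * legendreClassical n ∧
    X * derivative (legendreClassical (n + 1)) - derivative (legendreClassical n)
        = ((n : ℝ[X]) + 1) * legendreClassical (n + 1) ∧
    (X ^ 2 - 1) * derivative (legendreClassical (n + 1))
        = ((n : ℝ[X]) + 1) * (X * legendreClassical (n + 1) - legendreClassical n) := by
  induction n with
  | zero => simp [legendreClassical]; ring
  | succ n ih =>
    obtain ⟨h1, h2, h3⟩ := ih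
    have hr := legendreClassical_rec n
    have hd := derivative_legendreClassical_rec n
    have e1 : derivative (legendreClassical (n + 2)) = X * derivative (legendreClassical (n + 1))
        + ((n : ℝ[X]) + 2) * legendreClassical (n + 1) := by
      refine mul_left_cancel₀ (natCast_add_two_ne_zero n) ?_
      linear_combination hd + ((n : ℝ[X]) + 1) * h2
    push_cast
    refine ⟨?_, ?_, ?_⟩
    · linear_combination e1
    · linear_combination X * e1 + h3 - hr
    · linear_combination (X ^ 2 - 1) * e1 + X * h3 - X * hr

/-- Adds the first identity at n + 1 to the second at n; the point is an explicit antiderivative of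
each Legendre polynomial of positive degree. -/
theorem legendreClassical_eq_derivative (n : ℕ) :
    (2 * (n : ℝ[X]) + 3) * legendreClassical (n + 1)
      = derivative (legendreClassical (n + 2) - legendreClassical n) := by
  have h1 := (derivative_legendreClassical_aux (n + 1)).1
  have h2 := (derivative_legendreClassical_aux n).2.1
  push_cast at h1
  rw [derivative_sub]
  linear_combination -h1 - h2

theorem legendreClassical_eval_one : ∀ n, (legendreClassical n).eval 1 = 1
  | 0 => by simp [legendreClassical]
  | 1 => by simp [legendreClassical]
  | n + 2 => by
    have h := congrArg (eval 1) (legendreClassical_rec n)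
    simp [legendreClassical_eval_one n, legendreClassical_eval_one (n + 1)] at h
    have h' : ((n : ℝ) + 2) ≠ 0 := by positivity
    exact mul_left_cancel₀ h' (by linarith)

theorem legendreClassical_eval_neg_one : ∀ n, (legendreClassical n).eval (-1) = (-1) ^ n
  | 0 => by simp [legendreClassical]
  | 1 => by simp [legendreClassical]
  | n + 2 => by
    have h := congrArg (eval (-1)) (legendreClassical_rec n)
    simp [legendreClassical_eval_neg_one n, legendreClassical_eval_neg_one (n + 1)] at h
    have h' : ((n : ℝ) + 2) ≠ 0 := by positivity
    refine mul_left_cancel₀ h' (h.trans ?_)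
    ring

theorem natDegree_legendreClassical_le : ∀ n, (legendreClassical n).natDegree ≤ n
  | 0 => by simp [legendreClassical]
  | 1 => by simp [legendreClassical]
  | n + 2 => by
    have h0 := natDegree_legendreClassical_le n
    have h1 := natDegree_legendreClassical_le (n + 1)
    rw [legendreClassical]
    refine (natDegree_C_mul_le _ _).trans ((natDegree_sub_le _ _).trans (max_le ?_ ?_))
    · rw [mul_assoc]
      refine (natDegree_C_mul_le _ _).trans (natDegree_mul_le.trans ?_)
      rw [natDegree_X]; omega
    · exact (natDegree_C_mul_le _ _).trans (by omega)

theorem natDegree_two_X_sub_one_le : (2 * X - 1 : ℝ[X]).natDegree ≤ 1 := by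
  refine (natDegree_sub_le _ _).trans (max_le ?_ (by simp))
  rw [← C_two]
  exact (natDegree_C_mul_le _ _).trans (by simp)

theorem natDegree_legendre_le (n : ℕ) : (legendre n).natDegree ≤ n := by
  refine natDegree_comp_le.trans ?_
  exact (Nat.mul_le_mul (natDegree_legendreClassical_le n) natDegree_two_X_sub_one_le).trans
    (by simp)

theorem natDegree_jacobi_le (α : ℕ) : ∀ n, (jacobi α n).natDegree ≤ n
  | 0 => by simp [jacobi]
  | 1 => by
    rw [jacobi]
    refine (natDegree_add_le _ _).trans (max_le natDegree_two_X_sub_one_le ?_)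
    exact (natDegree_C_mul_le _ _).trans (by simp)
  | n + 2 => by
    have h0 := natDegree_jacobi_le α n
    have h1 := natDegree_jacobi_le α (n + 1)
    rw [jacobi]
    refine (natDegree_C_mul_le _ _).trans ((natDegree_sub_le _ _).trans (max_le ?_ ?_))
    · rw [mul_assoc]
      refine (natDegree_C_mul_le _ _).trans (natDegree_mul_le.trans ?_)
      have : (C ((2 * ((n : ℝ) + 2) + α) * (2 * ((n : ℝ) + 2) + α - 2)) * (2 * X - 1)
          + C ((α : ℝ) ^ 2)).natDegree ≤ 1 := by
        refine (natDegree_add_le _ _).trans (max_le ?_ (by rw [natDegree_C]; omega))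
        exact (natDegree_C_mul_le _ _).trans natDegree_two_X_sub_one_le
      omega
    · exact (natDegree_C_mul_le _ _).trans (by omega)

theorem natDegree_antider_le (ψ : ℝ[X]) : (antider ψ).natDegree ≤ ψ.natDegree + 1 := by
  unfold antider
  refine natDegree_sum_le_of_forall_le _ _ fun k hk => ?_
  exact (natDegree_monomial_le _).trans (Nat.add_le_add_right (le_natDegree_of_mem_supp k hk) 1)

theorem antider_eval_zero (ψ : ℝ[X]) : (antider ψ).eval 0 = 0 := by
  rw [eval_antider, intervalIntegral.integral_same]

theorem natDegree_intLegendre_le {i : ℕ} (hi : 1 ≤ i) : (intLegendre i).natDegree ≤ i :=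
  (natDegree_antider_le _).trans (by have := natDegree_legendre_le (i - 1); omega)

/-- The polynomial P_{i-1} with i - 1 ≥ 1 has mean zero: its antiderivative is proportional to
P_{n+2} - P_n, which vanishes at both ends because the two degrees have the same parity. -/
theorem intLegendre_eval_one {i : ℕ} (hi : 2 ≤ i) : (intLegendre i).eval 1 = 0 := by
  obtain ⟨n, rfl⟩ := Nat.exists_eq_add_of_le' hi
  set G : ℝ[X] := (legendreClassical (n + 2) - legendreClassical n).comp (2 * X - 1) with hG
  have hd : derivative G = C (2 * (2 * (n : ℝ) + 3)) * legendre (n + 1) := by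
    rw [hG, derivative_comp, ← legendreClassical_eq_derivative, legendre]
    simp [mul_comp, C_two, C_three]
    ring
  have hne : (2 * (2 * (n : ℝ) + 3)) ≠ 0 := by positivity
  have h1 : ∫ t in (0 : ℝ)..1, (2 * (2 * (n : ℝ) + 3)) * (legendre (n + 1)).eval t
      = G.eval 1 - G.eval 0 := by
    refine intervalIntegral.integral_eq_sub_of_hasDerivAt (f := fun t => G.eval t)
      (fun t _ => ?_) ?_
    · have := G.hasDerivAt t
      rwa [hd, eval_mul, eval_C] at this
    · apply Continuous.intervalIntegrable
      fun_prop
  have h2 : G.eval 1 - G.eval 0 = 0 := by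
    simp only [hG, eval_comp, eval_sub, eval_mul, eval_X, eval_one, eval_ofNat]
    norm_num [legendreClassical_eval_one, legendreClassical_eval_neg_one]
    ring
  rw [h2, intervalIntegral.integral_const_mul] at h1
  rw [intLegendre, eval_antider]
  exact (mul_eq_zero.1 h1).resolve_left hne

theorem intLegendre_eval_zero (i : ℕ) : (intLegendre i).eval 0 = 0 := antider_eval_zero _

theorem intJacobi_eval_zero (α j : ℕ) : (intJacobi α j).eval 0 = 0 := antider_eval_zero _

/-! ### Homogenization -/

theorem homog_X_mul (i : ℕ) (K : ℝ[X]) (s₀ s₁ : ℝ) :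
    homog (i + 1) (X * K) s₀ s₁ = s₁ * homog i K s₀ s₁ := by
  unfold homog
  rw [Finset.sum_range_succ', Finset.mul_sum]
  simp only [coeff_X_mul, mul_coeff_zero, coeff_X_zero, zero_mul, add_zero]
  refine Finset.sum_congr rfl fun k _ => ?_
  rw [Nat.add_sub_add_right, pow_succ]
  ring

theorem homog_succ {i : ℕ} {K : ℝ[X]} (hK : K.natDegree ≤ i) (s₀ s₁ : ℝ) :
    homog (i + 1) K s₀ s₁ = (s₀ + s₁) * homog i K s₀ s₁ := by
  unfold homog
  rw [Finset.sum_range_succ, coeff_eq_zero_of_natDegree_lt (by omega), Finset.mul_sum]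
  simp only [zero_mul, add_zero]
  refine Finset.sum_congr rfl fun k hk => ?_
  rw [Nat.succ_sub (by simpa [Nat.lt_succ_iff] using hk), pow_succ]
  ring

theorem homog_add (i : ℕ) (φ ψ : ℝ[X]) (s₀ s₁ : ℝ) :
    homog i (φ + ψ) s₀ s₁ = homog i φ s₀ s₁ + homog i ψ s₀ s₁ := by
  simp only [homog, coeff_add, add_mul, Finset.sum_add_distrib]

theorem homog_sub (i : ℕ) (φ ψ : ℝ[X]) (s₀ s₁ : ℝ) :
    homog i (φ - ψ) s₀ s₁ = homog i φ s₀ s₁ - homog i ψ s₀ s₁ := by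
  simp only [homog, coeff_sub, sub_mul, Finset.sum_sub_distrib]

/-- Raising the order by one multiplies by s₀ + s₁, and a factor X becomes s₁; the difference is s₀.
-/
theorem homog_one_sub_X_mul {i : ℕ} {K : ℝ[X]} (hK : K.natDegree ≤ i) (s₀ s₁ : ℝ) :
    homog (i + 1) ((1 - X) * K) s₀ s₁ = s₀ * homog i K s₀ s₁ := by
  rw [sub_mul, one_mul, homog_sub, homog_X_mul, homog_succ hK]
  ring

theorem homog_C_mul_X_pow (i : ℕ) (c s₀ s₁ : ℝ) :
    homog i (C c * X ^ i) s₀ s₁ = c * s₁ ^ i := by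
  unfold homog
  rw [Finset.sum_eq_single i]
  · simp
  · intro k _ hk
    simp [coeff_X_pow, hk]
  · intro h; simp at h

theorem homog_smul (i : ℕ) (ψ : ℝ[X]) (c s₀ s₁ : ℝ) :
    homog i ψ (c * s₀) (c * s₁) = c ^ i * homog i ψ s₀ s₁ := by
  unfold homog
  rw [Finset.mul_sum]
  refine Finset.sum_congr rfl fun k hk => ?_
  have hk' : k ≤ i := Nat.lt_succ_iff.1 (Finset.mem_range.1 hk)
  rw [← mul_add, mul_pow, mul_pow, ← Nat.add_sub_cancel' hk', pow_add, Nat.add_sub_cancel_left]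
  ring

theorem homog_of_add_eq_one {i : ℕ} {ψ : ℝ[X]} (hψ : ψ.natDegree ≤ i) {s₀ s₁ : ℝ}
    (h : s₀ + s₁ = 1) : homog i ψ s₀ s₁ = ψ.eval s₁ := by
  rw [homog_eq i ψ hψ _ _ (by rw [h]; exact one_ne_zero), h]
  simp

/-- Division by `X` under homogenization. -/
theorem exists_homog_eq_mul {i : ℕ} {ψ : ℝ[X]} (h0 : ψ.eval 0 = 0) :
    ∃ K : ℝ[X], ∀ s₀ s₁, homog (i + 1) ψ s₀ s₁ = s₁ * homog i K s₀ s₁ := by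
  obtain ⟨K, rfl⟩ := X_dvd_iff.2 ((coeff_zero_eq_eval_zero ψ).trans h0)
  exact ⟨K, homog_X_mul i K⟩

/-- Splitting off the value at `1` under homogenization. -/
theorem exists_homog_eq_add (i : ℕ) {ψ : ℝ[X]} (hψ : ψ.natDegree ≤ i) :
    ∃ K : ℝ[X], ∀ s₀ s₁, homog i ψ s₀ s₁
      = ψ.eval 1 * s₁ ^ i + s₀ * (if i = 0 then 0 else homog (i - 1) K s₀ s₁) := by
  rcases i with _ | i
  · refine ⟨0, fun s₀ s₁ => ?_⟩
    rw [eq_C_of_natDegree_eq_zero (Nat.le_zero.1 hψ)]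
    simp [homog]
  -- Subtracting ψ(1) X^{i+1}, which homogenizes to ψ(1) s₁^{i+1}, creates a root at 1 and hence a
  -- factor 1 - X.
  · have hr : (ψ - C (ψ.eval 1) * X ^ (i + 1)).IsRoot 1 := by simp
    obtain ⟨K, hK⟩ := dvd_iff_isRoot.2 hr
    have hd : K.natDegree ≤ i := by
      by_cases hK0 : K = 0
      · simp [hK0]
      have h1 : (ψ - C (ψ.eval 1) * X ^ (i + 1)).natDegree ≤ i + 1 :=
        (natDegree_sub_le _ _).trans (max_le hψ (natDegree_C_mul_X_pow_le _ _))
      rw [hK, natDegree_mul (X_sub_C_ne_zero 1) hK0, natDegree_X_sub_C] at h1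
      omega
    refine ⟨-K, fun s₀ s₁ => ?_⟩
    have e : ψ = C (ψ.eval 1) * X ^ (i + 1) + (1 - X) * -K := by
      rw [C_1] at hK
      linear_combination hK
    conv_lhs => rw [e]
    rw [homog_add, homog_C_mul_X_pow, homog_one_sub_X_mul (by simpa using hd)]
    simp

/-- The homogenization of a polynomial that vanishes at both ends of the unit interval. -/
theorem exists_homog_eq_mul_mul {i : ℕ} {ψ : ℝ[X]} (hψ : ψ.natDegree ≤ i + 2)
    (h0 : ψ.eval 0 = 0) (h1 : ψ.eval 1 = 0) :
    ∃ K : ℝ[X], ∀ s₀ s₁, homog (i + 2) ψ s₀ s₁ = s₀ * s₁ * homog i K s₀ s₁ := by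
  -- The root at 0 gives the factor s₁. The quotient still vanishes at 1, so that
  -- `exists_homog_eq_add` leaves only its multiple of s₀.
  obtain ⟨φ, rfl⟩ := X_dvd_iff.2 ((coeff_zero_eq_eval_zero ψ).trans h0)
  have hφ : φ.natDegree ≤ i + 1 := by
    by_cases hφ0 : φ = 0
    · simp [hφ0]
    rw [natDegree_mul X_ne_zero hφ0, natDegree_X] at hψ
    omega
  obtain ⟨K, hK⟩ := exists_homog_eq_add (i + 1) hφ
  refine ⟨K, fun s₀ s₁ => ?_⟩
  have h1' : φ.eval 1 = 0 := by simpa using h1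
  rw [homog_X_mul, hK, h1']
  simp
  ring

end Legendre

/-- Since L_i vanishes at 0 and at 1. This yields the vanishing traces, and in the pullbacks the
factor w(1 - w) that supplies decay. -/
theorem hL_eq_mul {i : ℕ} (hi : 2 ≤ i) :
    ∃ K, ∀ s₀ s₁, hL i s₀ s₁ = s₀ * s₁ * homog (i - 2) K s₀ s₁ := by
  obtain ⟨n, rfl⟩ := Nat.exists_eq_add_of_le' hi
  exact exists_homog_eq_mul_mul (natDegree_intLegendre_le (by omega)) (intLegendre_eval_zero _)
    (intLegendre_eval_one hi)

/-- The integrated Jacobi polynomials are only used to vanish at 0, whence a single factor. -/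
theorem hLJ_eq_mul (α : ℕ) {j : ℕ} (hj : 1 ≤ j) :
    ∃ K, ∀ s₀ s₁, hLJ α j s₀ s₁ = s₁ * homog (j - 1) K s₀ s₁ := by
  obtain ⟨n, rfl⟩ := Nat.exists_eq_add_of_le' hj
  exact exists_homog_eq_mul (intJacobi_eval_zero _ _)

theorem hL_zero_left {i : ℕ} (hi : 2 ≤ i) (s : ℝ) : hL i 0 s = 0 := by
  obtain ⟨K, hK⟩ := hL_eq_mul hi
  simp [hK]

theorem hL_zero_right {i : ℕ} (hi : 2 ≤ i) (s : ℝ) : hL i s 0 = 0 := by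
  obtain ⟨K, hK⟩ := hL_eq_mul hi
  simp [hK]

theorem hLJ_zero_right (α : ℕ) {j : ℕ} (hj : 1 ≤ j) (s : ℝ) : hLJ α j s 0 = 0 := by
  obtain ⟨K, hK⟩ := hLJ_eq_mul α hj
  simp [hK]

/-- Homogenizations respect multiplicative filtrations of function spaces. -/
theorem homog_mem_filtration {A : ℕ → Submodule ℝ (R3 → ℝ)} (h1 : (fun _ => 1) ∈ A 0)
    (hmul : ∀ m n f g, f ∈ A m → g ∈ A n → (fun x => f x * g x) ∈ A (m + n)) {s₀ s₁ : R3 → ℝ}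
    (h₀ : s₀ ∈ A 1) (h₁ : s₁ ∈ A 1) (i : ℕ) (ψ : Polynomial ℝ) :
    (fun x => homog i ψ (s₀ x) (s₁ x)) ∈ A i := by
  have hpow : ∀ {f}, f ∈ A 1 → ∀ n, (fun x => f x ^ n) ∈ A n := by
    intro f hf n
    induction n with
    | zero => simpa using h1
    | succ n ih => simpa only [pow_succ] using hmul _ _ _ _ ih hf
  have e : (fun x => homog i ψ (s₀ x) (s₁ x)) = ∑ k ∈ Finset.range (i + 1),
      ψ.coeff k • fun x => s₁ x ^ k * (s₀ x + s₁ x) ^ (i - k) := by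
    ext x
    simp only [homog, Finset.sum_apply, Pi.smul_apply, smul_eq_mul]
    exact Finset.sum_congr rfl fun k _ => by ring
  rw [e]
  refine Submodule.sum_mem _ fun k hk => Submodule.smul_mem _ _ ?_
  have hk' : k ≤ i := Nat.lt_succ_iff.1 (Finset.mem_range.1 hk)
  have := hmul _ _ _ _ (hpow h₁ k) (hpow (add_mem h₀ h₁) (i - k))
  rwa [Nat.add_sub_cancel' hk'] at this

theorem WT_homog {a b : ℤ} {lo hi : ℕ} {s₀ s₁ : R3 → ℝ} (h₀ : s₀ ∈ WT a b lo hi)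
    (h₁ : s₁ ∈ WT a b lo hi) (i : ℕ) (ψ : Polynomial ℝ) :
    (fun x => homog i ψ (s₀ x) (s₁ x)) ∈ WT (i * a) (i * b) (i * lo) (i * hi) := by
  refine homog_mem_filtration (A := fun n => WT (n * a) (n * b) (n * lo) (n * hi)) ?_ ?_ ?_ ?_ i ψ
  · simpa using WT_const 1
  · intro m n f g hf hg
    refine WT_mono (WT_mul hf hg) ?_ ?_ ?_ ?_ <;> push_cast <;> ring_nf <;> rfl
  · simpa using h₀
  · simpa using h₁

theorem contDiff_homog (i : ℕ) (ψ : Polynomial ℝ) :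
    ContDiff ℝ ∞ fun p : ℝ × ℝ => homog i ψ p.1 p.2 := by
  unfold homog
  fun_prop

theorem ContDiffOn.homog {U : Set R3} {s₀ s₁ : R3 → ℝ} (h₀ : ContDiffOn ℝ ∞ s₀ U)
    (h₁ : ContDiffOn ℝ ∞ s₁ U) (i : ℕ) (ψ : Polynomial ℝ) :
    ContDiffOn ℝ ∞ (fun x => PyramidFE.homog i ψ (s₀ x) (s₁ x)) U :=
  (contDiff_homog i ψ).comp_contDiffOn (h₀.prodMk h₁)

end PyramidFE

namespace PyramidFE

open Topology

/-! ### Polynomial functions for the face traces -/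

/-- The functions given by polynomials of total degree at most `n`. -/
def polyFun (n : ℕ) : Submodule ℝ (R3 → ℝ) where
  carrier := {f | ∃ Q : Poly3, Q.totalDegree ≤ n ∧ ∀ x, f x = MvPolynomial.eval x Q}
  add_mem' := by
    rintro f g ⟨Q, hQ, hf⟩ ⟨R, hR, hg⟩
    exact ⟨Q + R, (MvPolynomial.totalDegree_add _ _).trans (max_le hQ hR),
      fun x => by simp [hf, hg]⟩
  zero_mem' := ⟨0, by simp, fun x => by simp⟩
  smul_mem' := by
    rintro c f ⟨Q, hQ, hf⟩
    exact ⟨c • Q, (MvPolynomial.totalDegree_smul_le _ _).trans hQ,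
      fun x => by simp [hf, MvPolynomial.smul_eval]⟩

theorem polyFun_const (c : ℝ) (n : ℕ) : (fun _ => c) ∈ polyFun n :=
  ⟨MvPolynomial.C c, by simp, fun x => by simp⟩

theorem polyFun_coord (k : Fin 3) : (fun x => x k) ∈ polyFun 1 :=
  ⟨MvPolynomial.X k, by simp, fun x => by simp⟩

theorem polyFun_mul {m n : ℕ} {f g : R3 → ℝ} (hf : f ∈ polyFun m) (hg : g ∈ polyFun n) :
    (fun x => f x * g x) ∈ polyFun (m + n) := by
  obtain ⟨Q, hQ, hf⟩ := hf
  obtain ⟨R, hR, hg⟩ := hg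
  exact ⟨Q * R, (MvPolynomial.totalDegree_mul _ _).trans (add_le_add hQ hR),
    fun x => by simp [hf, hg]⟩

theorem polyFun_homog {s₀ s₁ : R3 → ℝ} (h₀ : s₀ ∈ polyFun 1) (h₁ : s₁ ∈ polyFun 1) (i : ℕ)
    (ψ : Polynomial ℝ) : (fun x => homog i ψ (s₀ x) (s₁ x)) ∈ polyFun i :=
  homog_mem_filtration (polyFun_const 1 0) (fun _ _ _ _ => polyFun_mul) h₀ h₁ i ψ

theorem exists_totalPoly {n : ℕ} {f : R3 → ℝ} (hf : f ∈ polyFun n) :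
    ∃ Q ∈ TotalPoly n, ∀ x, f x = MvPolynomial.eval x Q := by
  obtain ⟨Q, hQ, hf⟩ := hf
  exact ⟨Q, fun m hm => (MvPolynomial.le_totalDegree hm).trans hQ, hf⟩

theorem totalPolyPred_mul {k : ℕ} {φ ψ : Poly3} (hφ : φ ∈ TotalPolyPred k)
    (hψ : ψ.totalDegree ≤ 1) : φ * ψ ∈ TotalPolyPred (k + 1) := by
  classical
  intro m hm
  obtain ⟨m₁, h₁, m₂, h₂, rfl⟩ := Finset.mem_add.1 (MvPolynomial.support_mul φ ψ hm)
  have e₁ := hφ m₁ h₁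
  have e₂ : m₂.degree ≤ 1 := (MvPolynomial.le_totalDegree h₂).trans hψ
  rw [map_add]
  omega

theorem totalPolyPred_add {k : ℕ} {φ ψ : Poly3} (hφ : φ ∈ TotalPolyPred k)
    (hψ : ψ ∈ TotalPolyPred k) : φ + ψ ∈ TotalPolyPred k := fun m hm => by
  classical
  rcases Finset.mem_union.1 (MvPolynomial.support_add hm) with h | h
  · exact hφ m h
  · exact hψ m h

theorem totalPolyPred_of_totalDegree_le {k : ℕ} {φ : Poly3} (hφ : φ.totalDegree ≤ k) :
    φ ∈ TotalPolyPred (k + 1) := fun _ hm =>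
  Nat.succ_le_succ ((MvPolynomial.le_totalDegree hm).trans hφ)

/-- A polynomial times an infinitesimal rigid motion lies in the Nédélec space. -/
theorem exists_nedelecPoly {k : ℕ} {f : R3 → ℝ} (hf : f ∈ polyFun k) (c d : R3) :
    ∃ Q ∈ NedelecPoly (k + 1), ∀ x, f x • (c + d ⨯₃ x) = evalVec Q x := by
  obtain ⟨Q, hQ, hf⟩ := hf
  -- Degree k + 1 arises only as T (d × x), which is orthogonal to x; this is the homogeneous
  -- Nédélec part. All other products have degree at most k.
  set T := MvPolynomial.homogeneousComponent k Q with hT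
  set L : Fin 3 → Poly3 := ![MvPolynomial.C (d 1) * MvPolynomial.X 2
      - MvPolynomial.C (d 2) * MvPolynomial.X 1,
    MvPolynomial.C (d 2) * MvPolynomial.X 0 - MvPolynomial.C (d 0) * MvPolynomial.X 2,
    MvPolynomial.C (d 0) * MvPolynomial.X 1 - MvPolynomial.C (d 1) * MvPolynomial.X 0] with hL
  have hLe : ∀ x : R3, ∀ j, MvPolynomial.eval x (L j) = (d ⨯₃ x) j := by
    intro x j
    fin_cases j <;> simp [hL, cross_apply]
  have hLh : ∀ j, (L j).IsHomogeneous 1 := by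
    intro j
    fin_cases j <;> exact (MvPolynomial.isHomogeneous_C_mul_X _ _).sub
      (MvPolynomial.isHomogeneous_C_mul_X _ _)
  have hR : Q - T ∈ TotalPolyPred k := by
    intro m hm
    rw [MvPolynomial.mem_support_iff, MvPolynomial.coeff_sub, hT,
      MvPolynomial.coeff_homogeneousComponent] at hm
    have h1 : m.degree ≠ k := fun h => hm (by rw [if_pos h, sub_self])
    rw [if_neg h1, sub_zero, ← MvPolynomial.mem_support_iff] at hm
    have h2 : m.degree ≤ k := (MvPolynomial.le_totalDegree hm).trans hQ
    omega
  refine ⟨(fun j => T * MvPolynomial.C (c j) + (Q - T) * (MvPolynomial.C (c j) + L j))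
    + fun j => T * L j, ⟨_, _, rfl, fun j => ?_, fun j => ?_, fun x => ?_⟩, fun x => ?_⟩
  · refine totalPolyPred_add (totalPolyPred_of_totalDegree_le ?_) (totalPolyPred_mul hR ?_)
    · refine (MvPolynomial.totalDegree_mul _ _).trans ?_
      rw [MvPolynomial.totalDegree_C, add_zero]
      exact (MvPolynomial.homogeneousComponent_isHomogeneous k Q).totalDegree_le
    · refine (MvPolynomial.totalDegree_add _ _).trans (max_le (by simp) (hLh j).totalDegree_le)
  · exact (MvPolynomial.homogeneousComponent_isHomogeneous k Q).mul (hLh j)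
  · have : evalVec (fun j => T * L j) x = MvPolynomial.eval x T • (d ⨯₃ x) := by
      ext j; simp [evalVec, hLe]
    rw [this, dotProduct_smul, dot_cross_self, smul_zero]
  · ext j
    simp [evalVec, hLe, hf]
    ring

/-- The direction is constant, so the full polynomial part of the space suffices and the radial part
is zero. -/
theorem exists_raviartThomasPoly {k : ℕ} {f : R3 → ℝ} (hf : f ∈ polyFun k) (v : R3) :
    ∃ Q ∈ RaviartThomasPoly (k + 1), ∀ x, f x • v = evalVec Q x := by
  obtain ⟨Q, hQ, hf⟩ := hf
  refine ⟨_, ⟨fun j => Q * MvPolynomial.C (v j), 0, rfl, fun j => ?_, by simp⟩, fun x => ?_⟩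
  · refine totalPolyPred_of_totalDegree_le ((MvPolynomial.totalDegree_mul _ _).trans ?_)
    rw [MvPolynomial.totalDegree_C, add_zero]
    exact hQ
  · ext j
    simp [evalVec, hf]

theorem totalPoly_zero (p : ℕ) : ∃ Q ∈ TotalPoly p, ∀ x, (0 : R3 → ℝ) x = MvPolynomial.eval x Q :=
  ⟨0, fun m hm => by simp at hm, fun x => by simp⟩

theorem nedelecPoly_zero (p : ℕ) : ∃ Q ∈ NedelecPoly p, ∀ x, (0 : R3 → R3) x = evalVec Q x := by
  refine ⟨0, ⟨0, 0, by simp, fun k m hm => by simp at hm,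
    fun k => MvPolynomial.isHomogeneous_zero _ _ _, fun x => ?_⟩, fun x => ?_⟩
  · have : evalVec 0 x = 0 := by ext k; simp [evalVec]
    rw [this, dotProduct_zero]
  · ext k; simp [evalVec]

theorem raviartThomasPoly_zero (p : ℕ) :
    ∃ Q ∈ RaviartThomasPoly p, ∀ x, (0 : R3 → R3) x = evalVec Q x := by
  refine ⟨0, ⟨0, 0, by ext k; simp, fun k m hm => by simp at hm, by simp⟩, fun x => ?_⟩
  ext k; simp [evalVec]

/-- The functions given by polynomials in `ξ₁, ξ₂` of degrees at most `a` and `b`. -/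
def tensorFun (a b : ℤ) : Submodule ℝ (R3 → ℝ) where
  carrier := {f | ∃ Q ∈ TensorPoly a b 0, ∀ x, f x = MvPolynomial.eval x Q}
  add_mem' := by
    rintro f g ⟨Q, hQ, hf⟩ ⟨R, hR, hg⟩
    exact ⟨Q + R, tensorPoly_add hQ hR, fun x => by simp [hf, hg]⟩
  zero_mem' := ⟨0, tensorPoly_zero, fun x => by simp⟩
  smul_mem' := by
    rintro c f ⟨Q, hQ, hf⟩
    exact ⟨c • Q, tensorPoly_smul c hQ, fun x => by simp [hf, MvPolynomial.smul_eval]⟩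

theorem tensorFun_const (c : ℝ) : (fun _ => c) ∈ tensorFun 0 0 :=
  ⟨MvPolynomial.C c, tensorPoly_of_degreeOf_le (by simp) (by simp) (by simp), fun x => by simp⟩

theorem tensorFun_x : (fun x => x 0) ∈ tensorFun 1 0 :=
  ⟨MvPolynomial.X 0, tensorPoly_of_degreeOf_le (by simp)
    (by simp [MvPolynomial.degreeOf_X]) (by simp [MvPolynomial.degreeOf_X]), fun x => by simp⟩

theorem tensorFun_y : (fun x => x 1) ∈ tensorFun 0 1 :=
  ⟨MvPolynomial.X 1, tensorPoly_of_degreeOf_le (by simp [MvPolynomial.degreeOf_X])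
    (by simp) (by simp [MvPolynomial.degreeOf_X]), fun x => by simp⟩

theorem tensorFun_mul {a b a' b' : ℤ} {f g : R3 → ℝ} (hf : f ∈ tensorFun a b)
    (hg : g ∈ tensorFun a' b') : (fun x => f x * g x) ∈ tensorFun (a + a') (b + b') := by
  classical
  obtain ⟨Q, hQ, hf⟩ := hf
  obtain ⟨R, hR, hg⟩ := hg
  refine ⟨Q * R, fun m hm => ?_, fun x => by simp [hf, hg]⟩
  obtain ⟨m₁, h₁, m₂, h₂, rfl⟩ := Finset.mem_add.1 (MvPolynomial.support_mul Q R hm)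
  have e₁ := hQ m₁ h₁
  have e₂ := hR m₂ h₂
  simp only [Finsupp.add_apply]
  push_cast
  omega

theorem tensorFun_mono {a b a' b' : ℤ} {f : R3 → ℝ} (hf : f ∈ tensorFun a b) (ha : a ≤ a')
    (hb : b ≤ b') : f ∈ tensorFun a' b' := by
  obtain ⟨Q, hQ, hf⟩ := hf
  exact ⟨Q, fun m hm => ⟨(hQ m hm).1.trans ha, (hQ m hm).2.1.trans hb, (hQ m hm).2.2⟩, hf⟩

theorem tensorFun_homog {a b : ℤ} {s₀ s₁ : R3 → ℝ} (h₀ : s₀ ∈ tensorFun a b)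
    (h₁ : s₁ ∈ tensorFun a b) (i : ℕ) (ψ : Polynomial ℝ) :
    (fun x => homog i ψ (s₀ x) (s₁ x)) ∈ tensorFun (i * a) (i * b) := by
  refine homog_mem_filtration (A := fun n => tensorFun (n * a) (n * b)) ?_ ?_ ?_ ?_ i ψ
  · simpa using tensorFun_const 1
  · intro m n f g hf hg
    refine tensorFun_mono (tensorFun_mul hf hg) ?_ ?_ <;> push_cast <;> ring_nf <;> rfl
  · simpa using h₀
  · simpa using h₁

theorem tensorFun_zero (a b : ℤ) :
    ∃ Q ∈ TensorPoly a b 0, ∀ x, (0 : R3 → ℝ) x = MvPolynomial.eval x Q :=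
  ⟨0, tensorPoly_zero, fun x => by simp⟩

/-- As `tensorFun`, with degree at most `d` in `ξ_a` and `e` in the other variable. -/
def tensorFunAlong (a : Fin 2) (d e : ℤ) : Submodule ℝ (R3 → ℝ) :=
  if a = 0 then tensorFun d e else tensorFun e d

/-- As `WT`, with degree at most `d` in `x_a` and `e` in the other horizontal variable. -/
def WA (a : Fin 2) (d e : ℤ) (lo hi : ℕ) : Submodule ℝ (R3 → ℝ) :=
  if a = 0 then WT d e lo hi else WT e d lo hi

/-! ### Degrees counted along a chosen horizontal axis. -/

section Along

variable {a : Fin 2} {d e d' e' : ℤ} {lo hi lo' hi' : ℕ} {f g : R3 → ℝ}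

theorem tensorFunAlong_mul (hf : f ∈ tensorFunAlong a d e) (hg : g ∈ tensorFunAlong a d' e') :
    (fun x => f x * g x) ∈ tensorFunAlong a (d + d') (e + e') := by
  unfold tensorFunAlong at *
  split_ifs at * <;> exact tensorFun_mul hf hg

theorem tensorFunAlong_mono (hf : f ∈ tensorFunAlong a d e) (h1 : d ≤ d') (h2 : e ≤ e') :
    f ∈ tensorFunAlong a d' e' := by
  unfold tensorFunAlong at *
  split_ifs at *
  · exact tensorFun_mono hf h1 h2
  · exact tensorFun_mono hf h2 h1

theorem tensorFunAlong_homog {s₀ s₁ : R3 → ℝ} (h₀ : s₀ ∈ tensorFunAlong a d e)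
    (h₁ : s₁ ∈ tensorFunAlong a d e) (i : ℕ) (ψ : Polynomial ℝ) :
    (fun x => homog i ψ (s₀ x) (s₁ x)) ∈ tensorFunAlong a (i * d) (i * e) := by
  unfold tensorFunAlong at *
  split_ifs at * <;> exact tensorFun_homog h₀ h₁ i ψ

theorem WA_mul (hf : f ∈ WA a d e lo hi) (hg : g ∈ WA a d' e' lo' hi') :
    (fun x => f x * g x) ∈ WA a (d + d') (e + e') (lo + lo') (hi + hi') := by
  unfold WA at *
  split_ifs at * <;> exact WT_mul hf hg

theorem WA_mono (hf : f ∈ WA a d e lo hi) (h1 : d ≤ d') (h2 : e ≤ e') (h3 : lo' ≤ lo)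
    (h4 : hi ≤ hi') : f ∈ WA a d' e' lo' hi' := by
  unfold WA at *
  split_ifs at *
  · exact WT_mono hf h1 h2 h3 h4
  · exact WT_mono hf h2 h1 h3 h4

theorem WA_homog {s₀ s₁ : R3 → ℝ} (h₀ : s₀ ∈ WA a d e lo hi) (h₁ : s₁ ∈ WA a d e lo hi) (i : ℕ)
    (ψ : Polynomial ℝ) :
    (fun x => homog i ψ (s₀ x) (s₁ x)) ∈ WA a (i * d) (i * e) (i * lo) (i * hi) := by
  unfold WA at *
  split_ifs at * <;> exact WT_homog h₀ h₁ i ψ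

theorem WA_const (a : Fin 2) (c : ℝ) : (fun _ : R3 => c) ∈ WA a 0 0 0 0 := by
  unfold WA
  split_ifs <;> exact WT_const c

theorem WA_wt_pow (a : Fin 2) (m : ℕ) : (fun x : R3 => wt x ^ m) ∈ WA a 0 0 m m := by
  unfold WA
  split_ifs <;> exact WT_wt_pow m

theorem WA_wt (a : Fin 2) : wt ∈ WA a 0 0 1 1 := by simpa using WA_wt_pow a 1

theorem WA_add (hf : f ∈ WA a d e lo hi) (hg : g ∈ WA a d e lo hi) :
    (fun x => f x + g x) ∈ WA a d e lo hi := add_mem hf hg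

theorem WA_sub (hf : f ∈ WA a d e lo hi) (hg : g ∈ WA a d e lo hi) :
    (fun x => f x - g x) ∈ WA a d e lo hi := sub_mem hf hg

theorem WA_const_mul (c : ℝ) (hf : f ∈ WA a d e lo hi) :
    (fun x => c * f x) ∈ WA a d e lo hi := Submodule.smul_mem _ c hf

theorem WA_neg (hf : f ∈ WA a d e lo hi) : (fun x => -f x) ∈ WA a d e lo hi := neg_mem hf

theorem WA_pow (hf : f ∈ WA a d e lo hi) (n : ℕ) :
    (fun x => f x ^ n) ∈ WA a (n * d) (n * e) (n * lo) (n * hi) := by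
  unfold WA at *
  split_ifs at * <;> exact WT_pow hf n

theorem WA_one_sub_wt (a : Fin 2) : (fun x => 1 - wt x) ∈ WA a 0 0 0 1 :=
  WA_sub (WA_mono (WA_const a 1) le_rfl le_rfl le_rfl (by omega))
    (WA_mono (WA_wt a) le_rfl le_rfl (by omega) le_rfl)

theorem WA_muQ (c a : Fin 2) : muQ c a ∈ WA a 1 0 0 0 := by
  have h0 : (fun x : R3 => x a.castSucc) ∈ WA a 1 0 0 0 := by
    unfold WA
    fin_cases a
    · exact WT_x
    · exact WT_y
  fin_cases c
  · exact WA_sub (WA_mono (WA_const a 1) (by omega) le_rfl le_rfl le_rfl) h0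
  · exact h0

theorem WA_muQ_of_ne (c : Fin 2) {a b : Fin 2} (hab : a ≠ b) : muQ c b ∈ WA a 0 1 0 0 := by
  have h := WA_muQ c b
  unfold WA at *
  fin_cases a <;> fin_cases b <;> simp at * <;> exact h

theorem tensorFunAlong_muQ (c a : Fin 2) : muQ c a ∈ tensorFunAlong a 1 0 := by
  have h0 : (fun x : R3 => x a.castSucc) ∈ tensorFunAlong a 1 0 := by
    unfold tensorFunAlong
    fin_cases a
    · exact tensorFun_x
    · exact tensorFun_y
  have h1 : (fun _ : R3 => (1 : ℝ)) ∈ tensorFunAlong a 1 0 := by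
    unfold tensorFunAlong
    split_ifs <;> exact tensorFun_mono (tensorFun_const 1) (by omega) (by omega)
  fin_cases c
  · exact sub_mem h1 h0
  · exact h0

theorem tensorFunAlong_muQ_of_ne (c : Fin 2) {a b : Fin 2} (hab : a ≠ b) :
    muQ c b ∈ tensorFunAlong a 0 1 := by
  have h := tensorFunAlong_muQ c b
  unfold tensorFunAlong at *
  fin_cases a <;> fin_cases b <;> simp at * <;> exact h

end Along

/-- A field along a horizontal axis in the `H(curl)` class. -/
theorem single_mem_curlClass {a : Fin 2} {p : ℕ} {g : R3 → ℝ} (hg : g ∈ WA a (p - 1) p 2 (p + 1)) :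
    (fun x => g x • (Pi.single a.castSucc 1 : R3)) ∈ CurlClass p := by
  unfold WA at hg
  fin_cases a
  · refine ⟨?_, ?_, ?_⟩ <;> simp <;> first | exact hg | exact WT_zero
  · refine ⟨?_, ?_, ?_⟩ <;> simp <;> first | exact hg | exact WT_zero

theorem single_two_mem_curlClass {p : ℕ} {g : R3 → ℝ} (hg : g ∈ WT p p 3 (p + 1)) :
    (fun x => g x • (Pi.single 2 1 : R3)) ∈ CurlClass p := by
  refine ⟨?_, ?_, ?_⟩ <;> simp <;> first | exact hg | exact WT_zero

theorem single_mem_divClass {a : Fin 2} {p : ℕ} {g : R3 → ℝ} (hg : g ∈ WA a p (p - 1) 4 (p + 2)) :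
    (fun x => g x • (Pi.single a.castSucc 1 : R3)) ∈ DivClass p := by
  unfold WA at hg
  fin_cases a
  · refine ⟨?_, ?_, ?_⟩ <;> simp <;> first | exact hg | exact WT_zero
  · refine ⟨?_, ?_, ?_⟩ <;> simp <;> first | exact hg | exact WT_zero

theorem single_two_mem_divClass {p : ℕ} {g : R3 → ℝ} (hg : g ∈ WT (p - 1) (p - 1) 3 (p + 2)) :
    (fun x => g x • (Pi.single 2 1 : R3)) ∈ DivClass p := by
  refine ⟨?_, ?_, ?_⟩ <;> simp <;> first | exact hg | exact WT_zero

theorem curlClass_zero (p : ℕ) : (fun _ => 0) ∈ CurlClass p := ⟨WT_zero, WT_zero, WT_zero⟩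

theorem divClass_zero (p : ℕ) : (fun _ => 0) ∈ DivClass p := ⟨WT_zero, WT_zero, WT_zero⟩

theorem curlClass_add {p : ℕ} {E F : R3 → R3} (hE : E ∈ CurlClass p) (hF : F ∈ CurlClass p) :
    (fun x => E x + F x) ∈ CurlClass p :=
  ⟨WT_add hE.1 hF.1, WT_add hE.2.1 hF.2.1, WT_add hE.2.2 hF.2.2⟩

theorem divClass_add {p : ℕ} {E F : R3 → R3} (hE : E ∈ DivClass p) (hF : F ∈ DivClass p) :
    (fun x => E x + F x) ∈ DivClass p :=
  ⟨WT_add hE.1 hF.1, WT_add hE.2.1 hF.2.1, WT_add hE.2.2 hF.2.2⟩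

end PyramidFE

namespace PyramidFE

open Topology

/-! ### Smoothness and gradients of the coordinates -/

theorem contDiff_nu (k : Fin 3) (a : Fin 2) : ContDiff ℝ ∞ (nu k a) := by
  fin_cases k <;> simp [nu] <;> fun_prop

theorem contDiff_muZ (c : Fin 2) : ContDiff ℝ ∞ (muZ c) := by
  fin_cases c <;> simp [muZ] <;> fun_prop

theorem contDiff_muQ (c a : Fin 2) : ContDiff ℝ ∞ (muQ c a) := by
  fin_cases c <;> simp [muQ] <;> fun_prop

theorem one_sub_ne_zero_of_belowApex {x : R3} (hx : x ∈ belowApex) : 1 - x 2 ≠ 0 := by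
  have : x 2 < 1 := hx
  linarith

theorem contDiffOn_muS (c a : Fin 2) : ContDiffOn ℝ ∞ (muS c a) belowApex := by
  have h : ContDiffOn ℝ ∞ (fun x : R3 => x a.castSucc / (1 - x 2)) belowApex :=
    ContDiffOn.div (by fun_prop) (by fun_prop) fun _ => one_sub_ne_zero_of_belowApex
  fin_cases c
  · exact contDiffOn_const.sub h
  · exact h

theorem contDiffOn_lam (d : Fin 5) : ContDiffOn ℝ ∞ (lam d) belowApex := by
  have h4 : ContDiffOn ℝ ∞ (fun x : R3 => x 2) belowApex := by fun_prop
  fin_cases d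
  iterate 4
    exact ContDiffOn.div (by fun_prop) (by fun_prop) fun _ => one_sub_ne_zero_of_belowApex
  exact h4

theorem contDiffOn_phiE {U : Set R3} {s₀ s₁ : R3 → ℝ} (h₀ : ContDiffOn ℝ ∞ s₀ U)
    (h₁ : ContDiffOn ℝ ∞ s₁ U) (i : ℕ) : ContDiffOn ℝ ∞ (phiE i s₀ s₁) U := h₀.homog h₁ _ _

theorem contDiffOn_opE {U : Set R3} (hU : IsOpen U) {s₀ s₁ : R3 → ℝ} (h₀ : ContDiffOn ℝ ∞ s₀ U)
    (h₁ : ContDiffOn ℝ ∞ s₁ U) (i : ℕ) : ContDiffOn ℝ ∞ (opE i s₀ s₁) U :=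
  (h₀.homog h₁ _ _).smul
    ((h₀.smul (contDiffOn_grad hU h₁)).sub (h₁.smul (contDiffOn_grad hU h₀)))

theorem grad_nu_zero (a : Fin 2) (x : R3) :
    grad (nu 0 a) x = -Pi.single a.castSucc 1 - Pi.single 2 1 := by
  have : nu 0 a = fun x => (1 - x a.castSucc) - x 2 := rfl
  rw [this, grad_sub (by fun_prop) (by fun_prop), grad_sub (by fun_prop) (by fun_prop), grad_const,
    grad_coord, grad_coord, zero_sub]

theorem grad_nu_one (a : Fin 2) (x : R3) : grad (nu 1 a) x = Pi.single a.castSucc 1 :=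
  grad_coord _

theorem grad_nu_two (a : Fin 2) (x : R3) : grad (nu 2 a) x = Pi.single 2 1 := grad_coord _

theorem grad_muQ_zero (a : Fin 2) (x : R3) : grad (muQ 0 a) x = -Pi.single a.castSucc 1 := by
  have : muQ 0 a = fun x => 1 - x a.castSucc := rfl
  rw [this, grad_sub (by fun_prop) (by fun_prop), grad_const, grad_coord, zero_sub]

theorem grad_muQ_one (a : Fin 2) (x : R3) : grad (muQ 1 a) x = Pi.single a.castSucc 1 :=
  grad_coord _

theorem grad_muZ_zero (x : R3) : grad (muZ 0) x = -Pi.single 2 1 := by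
  have : muZ 0 = fun x => 1 - x 2 := rfl
  rw [this, grad_sub (by fun_prop) (by fun_prop), grad_const, grad_coord, zero_sub]

theorem grad_muZ_one (x : R3) : grad (muZ 1) x = Pi.single 2 1 := grad_coord _

theorem grad_muS_one (a : Fin 2) {x : R3} (hx : x ∈ belowApex) :
    grad (muS 1 a) x = (1 - x 2)⁻¹ • (Pi.single a.castSucc 1 + muS 1 a x • Pi.single 2 1) := by
  have h0 := one_sub_ne_zero_of_belowApex hx
  have : muS 1 a = fun x => x a.castSucc * (1 - x 2)⁻¹ := rfl
  rw [this, grad_mul (by fun_prop) (by fun_prop (disch := exact h0)),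
    grad_inv (f := fun y => 1 - y 2) (by fun_prop) h0, grad_sub (by fun_prop) (by fun_prop),
    grad_const, grad_coord, grad_coord]
  ext k
  simp
  field_simp
  ring

theorem muS_add (a : Fin 2) (x : R3) : muS 0 a x + muS 1 a x = 1 := by simp [muS]

theorem muQ_add (a : Fin 2) (x : R3) : muQ 0 a x + muQ 1 a x = 1 := by simp [muQ]

theorem muZ_add (x : R3) : muZ 0 x + muZ 1 x = 1 := by simp [muZ]

theorem nu_add (a : Fin 2) (x : R3) : nu 0 a x + nu 1 a x + nu 2 a x = 1 := by simp [nu]; ring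

theorem grad_eq_neg_of_add_eq_one {s₀ s₁ : R3 → ℝ} {x : R3} (h : ∀ y, s₀ y + s₁ y = 1)
    (hs : DifferentiableAt ℝ s₁ x) : grad s₀ x = -grad s₁ x := by
  have : s₀ = fun y => 1 - s₁ y := funext fun y => eq_sub_of_add_eq (h y)
  rw [this, grad_sub (by fun_prop) hs, grad_const, zero_sub]

/-- Here ∇s₀ = -∇s₁, so the bracket collapses to (s₀ + s₁)∇s₁. -/
theorem opE_of_add_eq_one {s₀ s₁ : R3 → ℝ} {x : R3} (h : ∀ y, s₀ y + s₁ y = 1)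
    (hs : DifferentiableAt ℝ s₁ x) (i : ℕ) :
    opE i s₀ s₁ x = hP i (s₀ x) (s₁ x) • grad s₁ x := by
  rw [opE, grad_eq_neg_of_add_eq_one h hs, smul_neg, sub_neg_eq_add, ← add_smul, h, one_smul]

theorem grad_muS_zero (a : Fin 2) {x : R3} (hx : x ∈ belowApex) :
    grad (muS 0 a) x = -grad (muS 1 a) x :=
  grad_eq_neg_of_add_eq_one (muS_add a)
    ((contDiffOn_muS 1 a).differentiableAt_of_isOpen isOpen_belowApex hx)

theorem opE_muS (i : ℕ) (a : Fin 2) {x : R3} (hx : x ∈ belowApex) :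
    opE i (muS 0 a) (muS 1 a) x = hP i (muS 0 a x) (muS 1 a x) • grad (muS 1 a) x :=
  opE_of_add_eq_one (muS_add a)
    ((contDiffOn_muS 1 a).differentiableAt_of_isOpen isOpen_belowApex hx) i

theorem opE_muQ (i : ℕ) (a : Fin 2) (x : R3) :
    opE i (muQ 0 a) (muQ 1 a) x = hP i (muQ 0 a x) (muQ 1 a x) • Pi.single a.castSucc 1 := by
  rw [opE_of_add_eq_one (muQ_add a) ((contDiff_muQ 1 a).differentiable (by simp) x), grad_muQ_one]

theorem opE_nu (i : ℕ) (a : Fin 2) (x : R3) :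
    opE i (nu 0 a) (nu 1 a) x = hP i (nu 0 a x) (nu 1 a x) •
      ((1 - x 2) • Pi.single a.castSucc 1 + x a.castSucc • Pi.single 2 1) := by
  rw [opE, grad_nu_zero, grad_nu_one]
  congr 1
  ext k
  simp [nu]
  ring

/-- For affine coordinates of a triangle the three cross products coincide, and their coefficients
add up to 1. -/
theorem opVTri_nu (i j : ℕ) (a : Fin 2) (x : R3) :
    opVTri i j (nu 0 a) (nu 1 a) (nu 2 a) x = hPP i j (nu 0 a x) (nu 1 a x) (nu 2 a x) •
      ((Pi.single a.castSucc 1 : R3) ⨯₃ Pi.single 2 1) := by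
  rw [opVTri, grad_nu_zero, grad_nu_one, grad_nu_two]
  congr 1
  simp only [map_sub, map_neg, LinearMap.sub_apply, LinearMap.neg_apply, cross_self, sub_zero,
    ← cross_anticomm (Pi.single a.castSucc 1 : R3) (Pi.single 2 1), neg_zero, zero_sub, neg_neg]
  rw [← add_smul, ← add_smul, nu_add, one_smul]

/-! ### Restrictions of the coordinates to the faces -/

section Faces

variable {a b c : Fin 2} {x : R3}

theorem eq_of_faceFun_zero (h : faceFun (.tri b 0) x = 0) : x b.castSucc = 0 := h

theorem eq_of_faceFun_one (h : faceFun (.tri b 1) x = 0) : x b.castSucc = 1 - x 2 := by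
  have : 1 - x b.castSucc - x 2 = 0 := h
  linarith

theorem muS_eq_one (hx : x ∈ belowApex) (h : faceFun (.tri b c) x = 0) : muS c b x = 1 := by
  have h0 := one_sub_ne_zero_of_belowApex hx
  fin_cases c
  · simp [muS, eq_of_faceFun_zero h]
  · simp [muS, eq_of_faceFun_one h, h0]

theorem muS_eq_zero (hx : x ∈ belowApex) (h : faceFun (.tri b c) x = 0) {c' : Fin 2}
    (hc : c' ≠ c) : muS c' b x = 0 := by
  have h1 := muS_eq_one hx h
  have h2 := muS_add b x
  fin_cases c <;> fin_cases c' <;> simp at hc h1 h2 ⊢ <;> linarith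

theorem nu_eq_zero (h : faceFun (.tri a c) x = 0) {c' : Fin 2} (hc : c' ≠ c) :
    nu c'.castSucc a x = 0 := by
  fin_cases c <;> fin_cases c' <;> simp at hc ⊢
  · exact eq_of_faceFun_zero h
  · exact h

/-- The function is constant on the face, so its gradient is normal there. -/
theorem grad_muS_face (d : Fin 2) (hx : x ∈ belowApex) (h : faceFun (.tri b c) x = 0) :
    ∃ r : ℝ, grad (muS d b) x = r • faceNormal (.tri b c) := by
  obtain ⟨r, hr⟩ : ∃ r : ℝ, grad (muS 1 b) x = r • faceNormal (.tri b c) := by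
    rw [grad_muS_one b hx]
    fin_cases c
    · refine ⟨-(1 - x 2)⁻¹, ?_⟩
      simp [muS, eq_of_faceFun_zero h, faceNormal]
    · have h1 : muS 1 b x = 1 := muS_eq_one hx h
      refine ⟨(1 - x 2)⁻¹, ?_⟩
      simp [h1, faceNormal]
  fin_cases d
  · exact ⟨-r, by rw [neg_smul, ← hr]; exact grad_muS_zero b hx⟩
  · exact ⟨r, hr⟩

theorem opE_muS_face (i : ℕ) (hx : x ∈ belowApex) (h : faceFun (.tri b c) x = 0) :
    ∃ r : ℝ, opE i (muS 0 b) (muS 1 b) x = r • faceNormal (.tri b c) := by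
  obtain ⟨r, hr⟩ := grad_muS_face 1 hx h
  exact ⟨_, by rw [opE_muS i b hx, hr, smul_smul]⟩

/-- On a face of the axis a, one of ν₀, ν₁ vanishes identically; what remains of s₀∇s₁ - s₁∇s₀ is a
multiple of its gradient. -/
theorem opE_nu_face (i : ℕ) (h : faceFun (.tri a c) x = 0) :
    ∃ r : ℝ, opE i (nu 0 a) (nu 1 a) x = r • faceNormal (.tri a c) := by
  rw [opE_nu]
  fin_cases c
  · refine ⟨-(hP i (nu 0 a x) (nu 1 a x) * (1 - x 2)), ?_⟩
    simp [eq_of_faceFun_zero h, faceNormal, smul_smul]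
  · refine ⟨hP i (nu 0 a x) (nu 1 a x) * (1 - x 2), ?_⟩
    simp [eq_of_faceFun_one h, faceNormal, smul_smul]

theorem phiE_muS_face {i : ℕ} (hi : 2 ≤ i) (hx : x ∈ belowApex)
    (h : faceFun (.tri b c) x = 0) : phiE i (muS 0 b) (muS 1 b) x = 0 := by
  fin_cases c
  · rw [phiE, muS_eq_zero hx h (c' := 1) (by decide), hL_zero_right hi]
  · rw [phiE, muS_eq_zero hx h (c' := 0) (by decide), hL_zero_left hi]

theorem phiE_nu_face {i : ℕ} (hi : 2 ≤ i) (h : faceFun (.tri a c) x = 0) :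
    phiE i (nu 0 a) (nu 1 a) x = 0 := by
  fin_cases c
  · have := nu_eq_zero h (c' := 1) (by decide)
    rw [phiE, show nu 1 a x = 0 from this, hL_zero_right hi]
  · have := nu_eq_zero h (c' := 0) (by decide)
    rw [phiE, show nu 0 a x = 0 from this, hL_zero_left hi]

theorem muS_quad (c a : Fin 2) (h : faceFun .quad x = 0) : muS c a x = muQ c a x := by
  have : x 2 = 0 := h
  fin_cases c <;> simp [muS, muQ, this]

theorem nu_quad (c a : Fin 2) (h : faceFun .quad x = 0) : nu c.castSucc a x = muQ c a x := by
  have : x 2 = 0 := h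
  fin_cases c <;> simp [nu, muQ, this]

theorem muZ_zero_quad (h : faceFun .quad x = 0) : muZ 0 x = 1 := by
  have : x 2 = 0 := h
  simp [muZ, this]

theorem muZ_one_quad (h : faceFun .quad x = 0) : muZ 1 x = 0 := h

theorem phiZ_quad {k : ℕ} (hk : 2 ≤ k) (h : faceFun .quad x = 0) : phiZ k x = 0 := by
  rw [phiZ, phiE, muZ_one_quad h, hL_zero_right hk]

theorem faceNormal_quad : faceNormal .quad = -(Pi.single 2 1 : R3) := by
  ext k
  fin_cases k <;> simp [faceNormal]

/-- The vertex function factors in the same way with respect to either axis. On the faces of the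
axis b, the version whose first factor is the scaled μ of ξ_b gives the trace. -/
theorem lam_baseVertex (k : Fin 2 → Fin 2) (b : Fin 2) (hx : x ∈ belowApex) :
    lam (baseVertex (k 0) (k 1)) x = muS (k b) b x * nu (k (1 - b)).castSucc (1 - b) x := by
  have h0 := one_sub_ne_zero_of_belowApex hx
  generalize hk0 : k 0 = k0
  generalize hk1 : k 1 = k1
  fin_cases b <;> simp [hk0, hk1] <;> fin_cases k0 <;> fin_cases k1 <;>
    simp [lam, baseVertex, muS, nu] <;> field_simp
  all_goals ring

end Faces

/-! ### Pullbacks of the coordinates -/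

section Pull

variable {x : R3}

/-- The start of the dictionary that expresses all coordinates through x, y and w. -/
theorem tau_two (hx : x ∈ extInf) : tau x 2 = 1 - wt x := by
  have : (1 + x 2) ≠ 0 := ne_of_gt hx
  simp [tau, wt]
  field_simp
  ring

theorem tau_apply (x : R3) (k : Fin 3) : tau x k = x k * wt x := div_eq_mul_inv _ _

theorem pull0_muZ_zero (hx : x ∈ extInf) : pull0 (muZ 0) x = wt x := by
  simp [pull0, muZ, tau_two hx]

theorem pull0_muZ_one (hx : x ∈ extInf) : pull0 (muZ 1) x = 1 - wt x := tau_two hx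

theorem pull0_nu_two (a : Fin 2) (hx : x ∈ extInf) : pull0 (nu 2 a) x = 1 - wt x := tau_two hx

theorem pull0_nu (c a : Fin 2) (hx : x ∈ extInf) :
    pull0 (nu c.castSucc a) x = wt x * muQ c a x := by
  fin_cases c
  · simp [pull0, nu, muQ, tau_two hx]
    rw [tau_apply]
    ring
  · simp [pull0, nu, muQ]
    rw [tau_apply, mul_comm]

theorem pull0_muS (c a : Fin 2) (hx : x ∈ extInf) : pull0 (muS c a) x = muQ c a x := by
  have h := (wt_pos hx).ne'
  fin_cases c <;> simp [pull0, muS, muQ, tau_two hx] <;> rw [tau_apply] <;> field_simp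

theorem pull0_lam (k : Fin 2 → Fin 2) (hx : x ∈ extInf) :
    pull0 (lam (baseVertex (k 0) (k 1))) x = wt x * (muQ (k 0) 0 x * muQ (k 1) 1 x) := by
  have h : pull0 (lam (baseVertex (k 0) (k 1))) x
      = pull0 (muS (k 0) 0) x * pull0 (nu (k 1).castSucc 1) x :=
    lam_baseVertex k 0 (tau_mem_belowApex hx)
  rw [h, pull0_muS _ _ hx, pull0_nu _ _ hx]
  ring

theorem pull1_opE (hx : x ∈ extInf) {s₀ s₁ : R3 → ℝ} (h₀ : DifferentiableAt ℝ s₀ (tau x))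
    (h₁ : DifferentiableAt ℝ s₁ (tau x)) (i : ℕ) :
    pull1 (opE i s₀ s₁) x = opE i (pull0 s₀) (pull0 s₁) x := by
  have : opE i s₀ s₁ = fun y => hP i (s₀ y) (s₁ y) •
    ((fun y => s₀ y • grad s₁ y) y - (fun y => s₁ y • grad s₀ y) y) := rfl
  rw [this, pull1_smul, pull1_sub, pull1_smul, pull1_smul, pull1_grad hx h₀, pull1_grad hx h₁]
  rfl

theorem opE_congr {s₀ s₁ t₀ t₁ : R3 → ℝ} (h₀ : s₀ =ᶠ[𝓝 x] t₀) (h₁ : s₁ =ᶠ[𝓝 x] t₁) (i : ℕ) :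
    opE i s₀ s₁ x = opE i t₀ t₁ x := by
  simp only [opE, h₀.eq_of_nhds, h₁.eq_of_nhds, grad_congr h₀, grad_congr h₁]

theorem eventuallyEq_of_extInf {E : Type*} {s t : R3 → E} (h : ∀ y ∈ extInf, s y = t y)
    (hx : x ∈ extInf) : s =ᶠ[𝓝 x] t :=
  Filter.eventually_of_mem (isOpen_extInf.mem_nhds hx) h

theorem eventuallyEq_of_belowApex {E : Type*} {s t : R3 → E} (h : ∀ y ∈ belowApex, s y = t y)
    (hx : x ∈ belowApex) : s =ᶠ[𝓝 x] t :=
  Filter.eventually_of_mem (isOpen_belowApex.mem_nhds hx) h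

/-- In s₀∇s₁ - s₁∇s₀ the terms with ∇f cancel, which leaves f²; homogeneity of [P_i] adds f^i. With
f = w this is the source of the exponents i + 2. -/
theorem opE_mul_left {f s₀ s₁ : R3 → ℝ} (hf : DifferentiableAt ℝ f x)
    (h₀ : DifferentiableAt ℝ s₀ x) (h₁ : DifferentiableAt ℝ s₁ x) (i : ℕ) :
    opE i (fun y => f y * s₀ y) (fun y => f y * s₁ y) x = f x ^ (i + 2) • opE i s₀ s₁ x := by
  have h : hP i (f x * s₀ x) (f x * s₁ x) = f x ^ i * hP i (s₀ x) (s₁ x) := homog_smul _ _ _ _ _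
  simp only [opE]
  rw [h, grad_mul hf h₀, grad_mul hf h₁]
  ext k
  simp
  ring

theorem differentiableAt_wt (hx : x ∈ extInf) : DifferentiableAt ℝ wt x :=
  contDiffOn_wt.differentiableAt_of_isOpen isOpen_extInf hx

theorem differentiableAt_muQ (c a : Fin 2) (x : R3) : DifferentiableAt ℝ (muQ c a) x :=
  (contDiff_muQ c a).differentiable (by simp) x

theorem differentiableAt_nu (k : Fin 3) (a : Fin 2) (x : R3) : DifferentiableAt ℝ (nu k a) x :=
  (contDiff_nu k a).differentiable (by simp) x

theorem differentiableAt_muS (c a : Fin 2) (hx : x ∈ belowApex) :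
    DifferentiableAt ℝ (muS c a) x :=
  (contDiffOn_muS c a).differentiableAt_of_isOpen isOpen_belowApex hx

theorem pull1_opE_muS (i : ℕ) (a : Fin 2) (hx : x ∈ extInf) :
    pull1 (opE i (muS 0 a) (muS 1 a)) x
      = hP i (muQ 0 a x) (muQ 1 a x) • Pi.single a.castSucc 1 := by
  have hτ := tau_mem_belowApex hx
  rw [pull1_opE hx (differentiableAt_muS _ _ hτ) (differentiableAt_muS _ _ hτ),
    opE_congr (eventuallyEq_of_extInf (fun y => pull0_muS 0 a) hx)
      (eventuallyEq_of_extInf (fun y => pull0_muS 1 a) hx), opE_muQ]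

theorem pull1_opE_nu (i : ℕ) (a : Fin 2) (hx : x ∈ extInf) :
    pull1 (opE i (nu 0 a) (nu 1 a)) x
      = (wt x ^ (i + 2) * hP i (muQ 0 a x) (muQ 1 a x)) • Pi.single a.castSucc 1 := by
  rw [pull1_opE hx (differentiableAt_nu _ _ _) (differentiableAt_nu _ _ _),
    opE_congr (s₀ := pull0 (nu 0 a)) (s₁ := pull0 (nu 1 a))
      (eventuallyEq_of_extInf (fun y => pull0_nu 0 a) hx)
      (eventuallyEq_of_extInf (fun y => pull0_nu 1 a) hx),
    opE_mul_left (differentiableAt_wt hx) (differentiableAt_muQ _ _ _) (differentiableAt_muQ _ _ _),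
    opE_muQ, smul_smul]

theorem pull1_grad_muS_one (a : Fin 2) (hx : x ∈ extInf) :
    pull1 (grad (muS 1 a)) x = Pi.single a.castSucc 1 := by
  rw [pull1_grad hx (differentiableAt_muS 1 a (tau_mem_belowApex hx)),
    grad_congr (eventuallyEq_of_extInf (fun y => pull0_muS 1 a) hx), grad_muQ_one]

theorem pull1_grad_muZ_zero (hx : x ∈ extInf) :
    pull1 (grad (muZ 0)) x = (-wt x ^ 2) • Pi.single 2 1 := by
  rw [pull1_grad hx ((contDiff_muZ 0).differentiable (by simp) _),
    grad_congr (eventuallyEq_of_extInf (fun y => pull0_muZ_zero) hx), grad_wt hx]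

end Pull

theorem polyFun_nu (k : Fin 3) (a : Fin 2) : nu k a ∈ polyFun 1 := by
  have h1 : (fun _ : R3 => (1 : ℝ)) ∈ polyFun 1 := polyFun_const 1 1
  have h2 := polyFun_coord a.castSucc
  have h3 := polyFun_coord 2
  fin_cases k
  · exact sub_mem (sub_mem h1 h2) h3
  · exact h2
  · exact h3

end PyramidFE

namespace PyramidFE

open Topology

/-! ### Auxiliary facts shared by the families -/

/-- The cases are the distinguished face, the opposite face, and the two faces of the other axis. -/
theorem forall_onlyOn {α : Type*} [Zero α] {P : Fin 2 → Fin 2 → (R3 → α) → Prop} {a b c : Fin 2}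
    {g : R3 → α} (hab : a ≠ b) (h1 : P b c g) (h2 : ∀ c', c' ≠ c → P b c' 0)
    (h3 : ∀ c', P a c' 0) (b' c' : Fin 2) : P b' c' (onlyOn b c g b' c') := by
  unfold onlyOn
  have hb : b' = b ∨ b' = a := by omega
  rcases hb with rfl | rfl
  · by_cases hc : c' = c
    · subst hc; simpa using h1
    · simpa [hc] using h2 c' hc
  · simpa [hab] using h3 c'

section Families

variable {a b : Fin 2} {d e : ℤ} {lo hi : ℕ} {f : R3 → ℝ} {p : ℕ}

theorem WT_of_WA (hf : f ∈ WA a d d lo hi) : f ∈ WT d d lo hi := by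
  unfold WA at hf
  split_ifs at hf <;> exact hf

theorem WA_homog_muQ (a : Fin 2) (i : ℕ) (ψ : Polynomial ℝ) :
    (fun x => homog i ψ (muQ 0 a x) (muQ 1 a x)) ∈ WA a i 0 0 0 := by
  simpa using WA_homog (WA_muQ 0 a) (WA_muQ 1 a) i ψ

theorem WA_homog_muQ_of_ne (hab : a ≠ b) (i : ℕ) (ψ : Polynomial ℝ) :
    (fun x => homog i ψ (muQ 0 b x) (muQ 1 b x)) ∈ WA a 0 i 0 0 := by
  simpa using WA_homog (WA_muQ_of_ne 0 hab) (WA_muQ_of_ne 1 hab) i ψ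

theorem WA_homog_wt (a : Fin 2) (i : ℕ) (ψ : Polynomial ℝ) :
    (fun x => homog i ψ (wt x) (1 - wt x)) ∈ WA a 0 0 0 i := by
  simpa using WA_homog (WA_mono (WA_wt a) le_rfl le_rfl (Nat.zero_le 1) le_rfl)
    (WA_one_sub_wt a) i ψ

/-- The lower exponent 1 is the factor s₀ = w of `hL_eq_mul`; a general homogenization in w, 1 - w
only has exponent 0. -/
theorem WA_hL_wt (a : Fin 2) {k : ℕ} (hk : 2 ≤ k) :
    (fun x => hL k (wt x) (1 - wt x)) ∈ WA a 0 0 1 k := by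
  obtain ⟨K, hK⟩ := hL_eq_mul hk
  simp only [hK]
  exact WA_mono (WA_mul (WA_mul (WA_wt a) (WA_one_sub_wt a)) (WA_homog_wt a (k - 2) K))
    (by omega) (by omega) (by omega) (by omega)

theorem tensorFun_of_along {d : ℤ} (hf : f ∈ tensorFunAlong a d d) : f ∈ tensorFun d d := by
  unfold tensorFunAlong at hf
  split_ifs at hf <;> exact hf

theorem tensorFunAlong_homog_muQ (a : Fin 2) (i : ℕ) (ψ : Polynomial ℝ) :
    (fun x => homog i ψ (muQ 0 a x) (muQ 1 a x)) ∈ tensorFunAlong a i 0 := by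
  simpa using tensorFunAlong_homog (tensorFunAlong_muQ 0 a) (tensorFunAlong_muQ 1 a) i ψ

theorem tensorFunAlong_homog_muQ_of_ne (hab : a ≠ b) (i : ℕ) (ψ : Polynomial ℝ) :
    (fun x => homog i ψ (muQ 0 b x) (muQ 1 b x)) ∈ tensorFunAlong a 0 i := by
  simpa using tensorFunAlong_homog (tensorFunAlong_muQ_of_ne 0 hab)
    (tensorFunAlong_muQ_of_ne 1 hab) i ψ

theorem pull0_phiE_nu (i : ℕ) (a : Fin 2) {x : R3} (hx : x ∈ extInf) :
    pull0 (phiE i (nu 0 a) (nu 1 a)) x = wt x ^ i * hL i (muQ 0 a x) (muQ 1 a x) := by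
  have h0 : nu 0 a (tau x) = wt x * muQ 0 a x := pull0_nu 0 a hx
  have h1 : nu 1 a (tau x) = wt x * muQ 1 a x := pull0_nu 1 a hx
  rw [pull0, phiE, h0, h1]
  exact homog_smul _ _ _ _ _

theorem pull0_phiQuadS (i j : ℕ) (a b : Fin 2) {x : R3} (hx : x ∈ extInf) :
    pull0 (phiQuadS i j a b) x
      = hL i (muQ 0 a x) (muQ 1 a x) * hL j (muQ 0 b x) (muQ 1 b x) := by
  have h (c a) : muS c a (tau x) = muQ c a x := pull0_muS c a hx
  simp only [pull0, phiQuadS, phiQuad, phiE, h]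

theorem pull0_phiZ (k : ℕ) {x : R3} (hx : x ∈ extInf) :
    pull0 (phiZ k) x = hL k (wt x) (1 - wt x) := by
  have h0 : muZ 0 (tau x) = wt x := pull0_muZ_zero hx
  have h1 : muZ 1 (tau x) = 1 - wt x := pull0_muZ_one hx
  simp only [pull0, phiZ, phiE, h0, h1]

theorem nu_pull_add (a : Fin 2) {x : R3} (hx : x ∈ extInf) :
    nu 0 a (tau x) + nu 1 a (tau x) = wt x := by
  have h := nu_add a (tau x)
  have h2 : nu 2 a (tau x) = 1 - wt x := pull0_nu_two a hx
  linarith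

theorem contDiffOn_phiQuadS (i j : ℕ) (a b : Fin 2) :
    ContDiffOn ℝ ∞ (phiQuadS i j a b) belowApex :=
  (contDiffOn_phiE (contDiffOn_muS _ _) (contDiffOn_muS _ _) i).mul
    (contDiffOn_phiE (contDiffOn_muS _ _) (contDiffOn_muS _ _) j)

theorem contDiffOn_phiZ (k : ℕ) : ContDiffOn ℝ ∞ (phiZ k) belowApex :=
  contDiffOn_phiE (contDiff_muZ _).contDiffOn (contDiff_muZ _).contDiffOn k

theorem phiQuadS_face {i j : ℕ} (hi : 2 ≤ i) (hj : 2 ≤ j) (hab : a ≠ b) (b' c : Fin 2) {x : R3}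
    (hx : x ∈ belowApex) (h : faceFun (.tri b' c) x = 0) : phiQuadS i j a b x = 0 := by
  have hb : b' = b ∨ b' = a := by omega
  rcases hb with rfl | rfl
  · simp [phiQuadS, phiQuad, phiE_muS_face hj hx h]
  · simp [phiQuadS, phiQuad, phiE_muS_face hi hx h]

/-! ### `H¹` shape functions -/

theorem h1Vertex_base_mem (k : Fin 2 → Fin 2) :
    h1Vertex (baseVertex (k 0) (k 1)) ∈ U0 1 ∧
      HasTraces0 (h1Vertex (baseVertex (k 0) (k 1)))
        (fun x => muQ (k 0) 0 x * muQ (k 1) 1 x)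
        (fun b c => if c = k b then nu (k (1 - b)).castSucc (1 - b) else 0) := by
  have h01 : (0 : Fin 2) ≠ 1 := by decide
  refine mem_U0_of_pull (c := 0) (g := fun x => wt x * (muQ (k 0) 0 x * muQ (k 1) 1 x))
    (contDiffOn_lam _) ?_ (fun x hx => ?_) (fun x hx h => ?_) (fun b c x hx h => ?_) ?_
    (fun b c => ?_)
  · exact WT_of_WA (WA_mono (WA_mul (WA_wt 0) (WA_mul (WA_muQ (k 0) 0) (WA_muQ_of_ne (k 1) h01)))
      (by omega) (by omega) (by omega) (by omega))
  · simp only [zero_add]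
    exact pull0_lam k hx
  · have := lam_baseVertex k 0 hx
    simp only [sub_zero] at this
    rw [h1Vertex, this, muS_quad _ _ h, nu_quad _ _ h]
  · rw [h1Vertex, lam_baseVertex k b hx]
    split_ifs with hc
    · subst hc
      rw [muS_eq_one hx h, one_mul]
    · rw [muS_eq_zero hx h (Ne.symm hc), zero_mul]; rfl
  · exact tensorFun_of_along (tensorFunAlong_mono (tensorFunAlong_mul (tensorFunAlong_muQ (k 0) 0)
      (tensorFunAlong_muQ_of_ne (k 1) h01)) (by omega) (by omega))
  · split_ifs
    · exact exists_totalPoly (polyFun_nu _ _)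
    · exact totalPoly_zero _

/-- The pullback is 1 - w; this is the only use of a nonzero constant in `mem_U0_of_pull`. -/
theorem h1Vertex_top_mem :
    h1Vertex 4 ∈ U0 1 ∧ HasTraces0 (h1Vertex 4) 0 (fun b _ => nu 2 (1 - b)) := by
  refine mem_U0_of_pull (c := 1) (g := fun x => -wt x)
    (contDiffOn_lam _) ?_ (fun x hx => ?_) (fun x hx h => h) (fun b c x hx h => rfl) ?_
    (fun b c => ?_)
  · exact WT_of_WA (WA_mono (WA_neg (WA_wt 0)) (by omega) (by omega) (by omega) (by omega))
  · exact (pull0_muZ_one hx).trans (sub_eq_add_neg _ _)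
  · exact tensorFun_zero _ _
  · exact exists_totalPoly (polyFun_nu _ _)

theorem h1MixedEdge_mem {a b : Fin 2} (c : Fin 2) {i : ℕ} (hab : a ≠ b) (hi : 2 ≤ i) :
    h1MixedEdge a b c i ∈ U0 i ∧
      HasTraces0 (h1MixedEdge a b c i)
        (fun x => muQ c b x * phiE i (muQ 0 a) (muQ 1 a) x)
        (onlyOn b c (phiE i (nu 0 a) (nu 1 a))) := by
  refine mem_U0_of_pull (c := 0)
    (g := fun x => muQ c b x * (wt x ^ i * hL i (muQ 0 a x) (muQ 1 a x)))
    ((contDiffOn_muS c b).mul (contDiffOn_phiE (contDiff_nu 0 a).contDiffOn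
      (contDiff_nu 1 a).contDiffOn i)) ?_ (fun x hx => ?_) (fun x hx h => ?_)
    (forall_onlyOn (P := fun b' c' t => ∀ x ∈ belowApex, faceFun (.tri b' c') x = 0 →
      h1MixedEdge a b c i x = t x) hab (fun x hx h => ?_) (fun c' hc x hx h => ?_)
      (fun c' x hx h => ?_)) ?_
    (forall_onlyOn (P := fun b' c' t => ∃ Q ∈ TotalPoly i, ∀ x, t x = MvPolynomial.eval x Q)
      hab ?_ (fun _ _ => totalPoly_zero _) (fun _ => totalPoly_zero _))
  · exact WT_of_WA (WA_mono (WA_mul (WA_muQ_of_ne c hab) (WA_mul (WA_wt_pow a i)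
      (WA_homog_muQ a i _))) (by omega) (by omega) (by omega) (by omega))
  · simp only [zero_add]
    rw [← pull0_muS c b hx, ← pull0_phiE_nu i a hx]
    rfl
  · have h0 : nu 0 a x = muQ 0 a x := nu_quad 0 a h
    have h1 : nu 1 a x = muQ 1 a x := nu_quad 1 a h
    simp only [h1MixedEdge, muS_quad _ _ h, phiE, h0, h1]
  · rw [h1MixedEdge, muS_eq_one hx h, one_mul]
  · rw [h1MixedEdge, muS_eq_zero hx h (Ne.symm hc), zero_mul]; rfl
  · rw [h1MixedEdge, phiE_nu_face hi h, mul_zero]; rfl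
  · exact tensorFun_of_along (tensorFunAlong_mono (tensorFunAlong_mul
      (tensorFunAlong_muQ_of_ne c hab) (tensorFunAlong_homog_muQ a i _)) (by omega) (by omega))
  · exact exists_totalPoly (polyFun_homog (polyFun_nu 0 a) (polyFun_nu 1 a) i _)

theorem WA_wt_mul_vertex (k : Fin 2 → Fin 2) :
    (fun x => wt x * (muQ (k 0) 0 x * muQ (k 1) 1 x)) ∈ WA 0 1 1 1 1 :=
  WA_mono (WA_mul (WA_wt 0) (WA_mul (WA_muQ (k 0) 0) (WA_muQ_of_ne (k 1) (by decide))))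
    (by omega) (by omega) (by omega) (by omega)

theorem WA_homog_vertex (k : Fin 2 → Fin 2) (i : ℕ) (ψ : Polynomial ℝ) :
    (fun x => homog i ψ (wt x * (muQ (k 0) 0 x * muQ (k 1) 1 x)) (1 - wt x)) ∈ WA 0 i i 0 i := by
  simpa using WA_homog (WA_mono (WA_wt_mul_vertex k) le_rfl le_rfl (Nat.zero_le 1) le_rfl)
    (WA_mono (WA_one_sub_wt 0) (by omega) (by omega) le_rfl le_rfl) i ψ

theorem h1TriEdge_mem (k : Fin 2 → Fin 2) {i : ℕ} (hi : 2 ≤ i) :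
    h1TriEdge (baseVertex (k 0) (k 1)) i ∈ U0 i ∧
      HasTraces0 (h1TriEdge (baseVertex (k 0) (k 1)) i) 0
        (fun b c => if c = k b then
          phiE i (nu (k (1 - b)).castSucc (1 - b)) (nu 2 (1 - b)) else 0) := by
  -- The factor s₀ = w m, with m bilinear, provides the lower exponent 1 that the homogenization
  -- alone lacks.
  obtain ⟨K, hK⟩ := hL_eq_mul hi
  refine mem_U0_of_pull (c := 0)
    (g := fun x => wt x * (muQ (k 0) 0 x * muQ (k 1) 1 x) * (1 - wt x) *
      homog (i - 2) K (wt x * (muQ (k 0) 0 x * muQ (k 1) 1 x)) (1 - wt x))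
    (contDiffOn_phiE (contDiffOn_lam _) (contDiffOn_lam _) i) ?_ (fun x hx => ?_)
    (fun x hx h => ?_) (fun b c x hx h => ?_) (tensorFun_zero _ _) (fun b c => ?_)
  · exact WT_of_WA (WA_mono (WA_mul (WA_mul (WA_wt_mul_vertex k) (WA_one_sub_wt 0))
      (WA_homog_vertex k (i - 2) K)) (by omega) (by omega) (by omega) (by omega))
  · simp only [zero_add]
    have h1 : lam (baseVertex (k 0) (k 1)) (tau x) = _ := pull0_lam k hx
    have h2 : lam 4 (tau x) = 1 - wt x := pull0_muZ_one hx
    rw [pull0, h1TriEdge, phiE, h1, h2, hK]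
  · have h2 : lam 4 x = 0 := h
    rw [h1TriEdge, phiE, h2, hL_zero_right hi]; rfl
  · rw [h1TriEdge, phiE, lam_baseVertex k b hx]
    split_ifs with hc
    · subst hc
      rw [muS_eq_one hx h, one_mul]; rfl
    · rw [muS_eq_zero hx h (Ne.symm hc), zero_mul, hL_zero_left hi]; rfl
  · split_ifs
    · exact exists_totalPoly (polyFun_homog (polyFun_nu _ _) (polyFun_nu _ _) i _)
    · exact totalPoly_zero _

theorem h1QuadFace_mem {i j : ℕ} (hi : 2 ≤ i) (hj : 2 ≤ j) :
    h1QuadFace i j ∈ U0 (max i j) ∧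
      HasTraces0 (h1QuadFace i j)
        (phiQuad i j (muQ 0 0) (muQ 1 0) (muQ 0 1) (muQ 1 1)) (fun _ _ => 0) := by
  have h01 : (0 : Fin 2) ≠ 1 := by decide
  refine mem_U0_of_pull (c := 0)
    (g := fun x => wt x * (hL i (muQ 0 0 x) (muQ 1 0 x) * hL j (muQ 0 1 x) (muQ 1 1 x)))
    ((contDiff_muZ 0).contDiffOn.mul (contDiffOn_phiQuadS _ _ _ _)) ?_ (fun x hx => ?_)
    (fun x hx h => ?_) (fun b c x hx h => ?_) ?_ (fun b c => totalPoly_zero _)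
  · exact WT_of_WA (WA_mono (WA_mul (WA_wt 0) (WA_mul (WA_homog_muQ 0 i _)
      (WA_homog_muQ_of_ne h01 j _))) (by omega) (by omega) (by omega) (by omega))
  · simp only [zero_add]
    rw [← pull0_phiQuadS i j 0 1 hx, ← pull0_muZ_zero hx]
    rfl
  · simp only [h1QuadFace, muZ_zero_quad h, one_mul, phiQuadS, phiQuad, phiE, muS_quad _ _ h]
  · rw [h1QuadFace, phiQuadS_face hi hj h01 b c hx h, mul_zero]; rfl
  · exact tensorFun_of_along (tensorFunAlong_mono (tensorFunAlong_mul (tensorFunAlong_homog_muQ 0 i _)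
      (tensorFunAlong_homog_muQ_of_ne h01 j _)) (by omega) (by omega))

theorem h1TriFace_mem {a b : Fin 2} (c : Fin 2) {i j : ℕ} (hab : a ≠ b) (hi : 2 ≤ i) (hj : 1 ≤ j) :
    h1TriFace a b c i j ∈ U0 (i + j) ∧
      HasTraces0 (h1TriFace a b c i j) 0
        (onlyOn b c (phiTri i j (nu 0 a) (nu 1 a) (nu 2 a))) := by
  refine mem_U0_of_pull (c := 0)
    (g := fun x => muQ c b x * (wt x ^ i * hL i (muQ 0 a x) (muQ 1 a x) *
      hLJ (2 * i) j (wt x) (1 - wt x)))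
    ((contDiffOn_muS c b).mul ((contDiffOn_phiE (contDiff_nu 0 a).contDiffOn
      (contDiff_nu 1 a).contDiffOn i).mul (((contDiff_nu 0 a).contDiffOn.add
      (contDiff_nu 1 a).contDiffOn).homog (contDiff_nu 2 a).contDiffOn _ _)))
    ?_ (fun x hx => ?_) (fun x hx h => ?_)
    (forall_onlyOn (P := fun b' c' t => ∀ x ∈ belowApex, faceFun (.tri b' c') x = 0 →
      h1TriFace a b c i j x = t x) hab (fun x hx h => ?_) (fun c' hc x hx h => ?_)
      (fun c' x hx h => ?_)) (tensorFun_zero _ _)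
    (forall_onlyOn (P := fun b' c' t => ∃ Q ∈ TotalPoly (i + j), ∀ x, t x = MvPolynomial.eval x Q)
      hab ?_ (fun _ _ => totalPoly_zero _) (fun _ => totalPoly_zero _))
  · exact WT_of_WA (WA_mono (WA_mul (WA_muQ_of_ne c hab) (WA_mul (WA_mul (WA_wt_pow a i)
      (WA_homog_muQ a i _)) (WA_homog_wt a j _))) (by omega) (by omega) (by omega) (by omega))
  · simp only [zero_add]
    have h2 : nu 2 a (tau x) = 1 - wt x := pull0_nu_two a hx
    rw [← pull0_muS c b hx, ← pull0_phiE_nu i a hx, ← h2, ← nu_pull_add a hx]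
    rfl
  · have h2 : nu 2 a x = 0 := h
    rw [h1TriFace, phiTri, h2, hLJ_zero_right _ hj, mul_zero, mul_zero]; rfl
  · rw [h1TriFace, muS_eq_one hx h, one_mul]
  · rw [h1TriFace, muS_eq_zero hx h (Ne.symm hc), zero_mul]; rfl
  · rw [h1TriFace, phiTri, phiE_nu_face hi h, zero_mul, mul_zero]; rfl
  · exact exists_totalPoly (polyFun_mul (polyFun_homog (polyFun_nu 0 a) (polyFun_nu 1 a) i _)
      (polyFun_homog (add_mem (polyFun_nu 0 a) (polyFun_nu 1 a)) (polyFun_nu 2 a) j _))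

theorem WT_pull_bubble {i j k : ℕ} (hk : 2 ≤ k) :
    (fun x => hL i (muQ 0 0 x) (muQ 1 0 x) * hL j (muQ 0 1 x) (muQ 1 1 x) *
      hL k (wt x) (1 - wt x)) ∈ WT (max (max i j) k : ℕ) (max (max i j) k : ℕ) 1
        (max (max i j) k) :=
  WT_of_WA (WA_mono (WA_mul (WA_mul (WA_homog_muQ 0 i _)
    (WA_homog_muQ_of_ne (by decide) j _)) (WA_hL_wt 0 hk))
    (by omega) (by omega) (by omega) (by omega))

theorem pull0_h1Bubble (i j k : ℕ) {x : R3} (hx : x ∈ extInf) :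
    pull0 (h1Bubble i j k) x = hL i (muQ 0 0 x) (muQ 1 0 x) * hL j (muQ 0 1 x) (muQ 1 1 x) *
      hL k (wt x) (1 - wt x) := by
  rw [← pull0_phiQuadS i j 0 1 hx, ← pull0_phiZ k hx]
  rfl

theorem h1Bubble_mem {i j k : ℕ} (hi : 2 ≤ i) (hj : 2 ≤ j) (hk : 2 ≤ k) :
    h1Bubble i j k ∈ U0 (max (max i j) k) ∧ HasTraces0 (h1Bubble i j k) 0 (fun _ _ => 0) := by
  refine mem_U0_of_pull (c := 0) ((contDiffOn_phiQuadS _ _ _ _).mul (contDiffOn_phiZ _))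
    (WT_pull_bubble hk) (fun x hx => ?_)
    (fun x hx h => ?_) (fun b c x hx h => ?_) (tensorFun_zero _ _) (fun b c => totalPoly_zero _)
  · simp only [zero_add]
    exact pull0_h1Bubble i j k hx
  · rw [h1Bubble, phiZ_quad hk h, mul_zero]; rfl
  · rw [h1Bubble, phiQuadS_face hi hj (by decide) b c hx h, zero_mul]; rfl

end Families

end PyramidFE

namespace PyramidFE

open Topology

/-! ### `H(curl)` shape functions -/

theorem mem_U1_of_pull_curlClass {p : ℕ} {E q : R3 → R3} {t : Fin 2 → Fin 2 → R3 → R3}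
    {E' : R3 → R3} (hE : ContDiffOn ℝ ∞ E belowApex) (hE' : E' ∈ CurlClass p)
    (heq : Set.EqOn (pull1 E) E' extInf)
    (hq : ∀ x ∈ belowApex, faceFun .quad x = 0 →
      faceNormal .quad ⨯₃ E x = faceNormal .quad ⨯₃ q x)
    (ht : ∀ b c, ∀ x ∈ belowApex, faceFun (.tri b c) x = 0 →
      faceNormal (.tri b c) ⨯₃ E x = faceNormal (.tri b c) ⨯₃ t b c x)
    (hqP : ∃ q₁ ∈ TensorPoly (p - 1) p 0, ∃ q₂ ∈ TensorPoly p (p - 1) 0,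
      ∀ x, q x = evalVec ![q₁, q₂, 0] x)
    (htP : ∀ b c, ∃ Q ∈ NedelecPoly p, ∀ x, t b c x = evalVec Q x) :
    E ∈ U1 p ∧ HasTraces1 E q t :=
  mem_U1_of_pull hE hE' (WT_zero (a := p) (b := p) (lo := 1) (hi := p))
    (fun x hx => by simp only [grad_const, add_zero]; exact heq hx) hq ht hqP htP

theorem pull1_congr {E F : R3 → R3} {x : R3} (h : E (tau x) = F (tau x)) :
    pull1 E x = pull1 F x := by rw [pull1, pull1, h]

theorem exists_quadPoly_along {a : Fin 2} {p : ℕ} {f : R3 → ℝ}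
    (hf : f ∈ tensorFunAlong a (p - 1) p) :
    ∃ q₁ ∈ TensorPoly (p - 1) p 0, ∃ q₂ ∈ TensorPoly p (p - 1) 0,
      ∀ x, f x • (Pi.single a.castSucc 1 : R3) = evalVec ![q₁, q₂, 0] x := by
  unfold tensorFunAlong at hf
  have ha : a = 0 ∨ a = 1 := by omega
  rcases ha with rfl | rfl
  · obtain ⟨Q, hQ, hf⟩ := hf
    refine ⟨Q, hQ, 0, tensorPoly_zero, fun x => ?_⟩
    ext k; fin_cases k <;> simp [evalVec, hf]
  · obtain ⟨Q, hQ, hf⟩ := hf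
    refine ⟨0, tensorPoly_zero, Q, hQ, fun x => ?_⟩
    ext k; fin_cases k <;> simp [evalVec, hf]

theorem exists_quadPoly_zero (p : ℕ) :
    ∃ q₁ ∈ TensorPoly (p - 1) p 0, ∃ q₂ ∈ TensorPoly p (p - 1) 0,
      ∀ x, (0 : R3 → R3) x = evalVec ![q₁, q₂, 0] x := by
  refine ⟨0, tensorPoly_zero, 0, tensorPoly_zero, fun x => ?_⟩
  ext k; fin_cases k <;> simp [evalVec]

section Families

variable {a b c : Fin 2} {x : R3}

theorem grad_nu (k : Fin 3) (a : Fin 2) (x : R3) : grad (nu k a) x = grad (nu k a) 0 := by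
  fin_cases k
  · exact (grad_nu_zero a x).trans (grad_nu_zero a 0).symm
  · exact (grad_nu_one a x).trans (grad_nu_one a 0).symm
  · exact (grad_nu_two a x).trans (grad_nu_two a 0).symm

theorem nu_eq_affine (k : Fin 3) (a : Fin 2) (x : R3) :
    nu k a x = nu k a 0 + grad (nu k a) 0 ⬝ᵥ x := by
  fin_cases k
  · simp [grad_nu_zero]; simp [nu]; ring
  · simp [grad_nu_one]; simp [nu]
  · simp [grad_nu_two]; simp [nu]

/-- For affine s₀, s₁ the field s₀∇s₁ - s₁∇s₀ equals c + d × x with d = ∇s₀ × ∇s₁ and c its value at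
the origin, so `exists_nedelecPoly` applies. -/
theorem exists_nedelecPoly_opE_nu {n : ℕ} {f : R3 → ℝ} (hf : f ∈ polyFun n) (i : ℕ)
    (k l : Fin 3) (a : Fin 2) :
    ∃ Q ∈ NedelecPoly (i + n + 1), ∀ x, f x • opE i (nu k a) (nu l a) x = evalVec Q x := by
  obtain ⟨Q, hQ, h⟩ := exists_nedelecPoly
    (polyFun_mul (polyFun_homog (polyFun_nu k a) (polyFun_nu l a) i (legendre i)) hf)
    (nu k a 0 • grad (nu l a) 0 - nu l a 0 • grad (nu k a) 0)
    (grad (nu k a) 0 ⨯₃ grad (nu l a) 0)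
  refine ⟨Q, hQ, fun x => ?_⟩
  rw [← h, opE, hP, smul_smul, grad_nu k, grad_nu l, mul_comm (f x)]
  congr 1
  conv_lhs => rw [nu_eq_affine k, nu_eq_affine l]
  generalize grad (nu k a) 0 = u
  generalize grad (nu l a) 0 = v
  generalize nu k a 0 = α
  generalize nu l a 0 = β
  ext m
  fin_cases m <;> simp [cross_apply, dot_apply] <;> ring

theorem exists_nedelecPoly_opE_nu' (i : ℕ) (k l : Fin 3) (a : Fin 2) :
    ∃ Q ∈ NedelecPoly (i + 1), ∀ x, opE i (nu k a) (nu l a) x = evalVec Q x := by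
  simpa using exists_nedelecPoly_opE_nu (polyFun_const 1 0) i k l a

theorem exists_grad_muQ (c a : Fin 2) :
    ∃ r : ℝ, ∀ x, grad (muQ c a) x = r • Pi.single a.castSucc 1 := by
  fin_cases c
  · exact ⟨-1, fun x => by rw [neg_smul, one_smul]; exact grad_muQ_zero a x⟩
  · exact ⟨1, fun x => by rw [one_smul]; exact grad_muQ_one a x⟩

theorem phiE_eq_eval {s₀ s₁ : R3 → ℝ} (h : ∀ y, s₀ y + s₁ y = 1) {i : ℕ} (hi : 1 ≤ i) :
    phiE i s₀ s₁ = fun y => (intLegendre i).eval (s₁ y) :=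
  funext fun y => homog_of_add_eq_one (natDegree_intLegendre_le hi) (h y)

theorem exists_grad_phiE {s₀ s₁ : R3 → ℝ} (h : ∀ y, s₀ y + s₁ y = 1) {i : ℕ} (hi : 1 ≤ i)
    (hs : DifferentiableAt ℝ s₁ x) : ∃ r : ℝ, grad (phiE i s₀ s₁) x = r • grad s₁ x := by
  rw [phiE_eq_eval h hi]
  exact ⟨_, grad_eval _ hs⟩

theorem exists_grad_phiZ {k : ℕ} (hk : 1 ≤ k) (x : R3) :
    ∃ r : ℝ, grad (phiZ k) x = r • Pi.single 2 1 := by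
  obtain ⟨r, hr⟩ := exists_grad_phiE muZ_add hk
    ((contDiff_muZ 1).differentiable (by simp) x)
  exact ⟨r, by rw [phiZ, hr, grad_muZ_one]⟩

theorem grad_phiE_muS_face {i : ℕ} (hi : 1 ≤ i) (hx : x ∈ belowApex)
    (h : faceFun (.tri b c) x = 0) :
    ∃ r : ℝ, grad (phiE i (muS 0 b) (muS 1 b)) x = r • faceNormal (.tri b c) := by
  obtain ⟨r, hr⟩ := exists_grad_phiE (muS_add b) hi (differentiableAt_muS 1 b hx)
  obtain ⟨s, hs⟩ := grad_muS_face 1 hx h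
  exact ⟨r * s, by rw [hr, hs, smul_smul]⟩

theorem differentiableAt_phiE_muS (i : ℕ) (a : Fin 2) (hx : x ∈ belowApex) :
    DifferentiableAt ℝ (phiE i (muS 0 a) (muS 1 a)) x :=
  (contDiffOn_phiE (contDiffOn_muS 0 a) (contDiffOn_muS 1 a) i).differentiableAt_of_isOpen
    isOpen_belowApex hx

theorem grad_phiQuadS_face {i j : ℕ} (hi : 2 ≤ i) (hj : 2 ≤ j) (hab : a ≠ b) (b' : Fin 2)
    (hx : x ∈ belowApex) (h : faceFun (.tri b' c) x = 0) :
    ∃ r : ℝ, grad (phiQuadS i j a b) x = r • faceNormal (.tri b' c) := by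
  have hg : grad (phiQuadS i j a b) x = _ :=
    grad_mul (differentiableAt_phiE_muS i a hx) (differentiableAt_phiE_muS j b hx)
  rw [hg]
  have hb : b' = b ∨ b' = a := by omega
  rcases hb with rfl | rfl
  · obtain ⟨r, hr⟩ := grad_phiE_muS_face (i := j) (by omega) hx h
    rw [phiE_muS_face hj hx h, hr, zero_smul, add_zero, smul_smul]
    exact ⟨_, rfl⟩
  · obtain ⟨r, hr⟩ := grad_phiE_muS_face (i := i) (by omega) hx h
    rw [phiE_muS_face hi hx h, hr, zero_smul, zero_add, smul_smul]
    exact ⟨_, rfl⟩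

theorem pull1_opEQuadS (i j : ℕ) (a b : Fin 2) (hx : x ∈ extInf) :
    pull1 (opEQuadS i j a b) x = (hL j (muQ 0 b x) (muQ 1 b x) * hP i (muQ 0 a x) (muQ 1 a x)) •
      Pi.single a.castSucc 1 := by
  have h (c a) : muS c a (tau x) = muQ c a x := pull0_muS c a hx
  have : opEQuadS i j a b = fun y => phiE j (muS 0 b) (muS 1 b) y • opE i (muS 0 a) (muS 1 a) y :=
    rfl
  rw [this, pull1_smul, pull1_opE_muS i a hx, smul_smul, pull0, phiE, h, h]

theorem contDiffOn_opEQuadS (i j : ℕ) (a b : Fin 2) :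
    ContDiffOn ℝ ∞ (opEQuadS i j a b) belowApex :=
  (contDiffOn_phiE (contDiffOn_muS _ _) (contDiffOn_muS _ _) j).smul
    (contDiffOn_opE isOpen_belowApex (contDiffOn_muS _ _) (contDiffOn_muS _ _) i)

theorem opEQuadS_face (i : ℕ) {j : ℕ} (hj : 2 ≤ j) (hab : a ≠ b) (b' : Fin 2)
    (hx : x ∈ belowApex) (h : faceFun (.tri b' c) x = 0) :
    ∃ r : ℝ, opEQuadS i j a b x = r • faceNormal (.tri b' c) := by
  have hb : b' = b ∨ b' = a := by omega
  rcases hb with rfl | rfl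
  · exact ⟨0, by rw [opEQuadS, opEQuad, phiE_muS_face hj hx h, zero_smul, zero_smul]⟩
  · obtain ⟨r, hr⟩ := opE_muS_face i hx h
    exact ⟨_, by rw [opEQuadS, opEQuad, hr, smul_smul]⟩

theorem cross_smul_self (n : R3) (r : ℝ) : n ⨯₃ (r • n) = 0 := by
  rw [map_smul, cross_self, smul_zero]

theorem hcurlMixedEdge_mem (c : Fin 2) (i : ℕ) (hab : a ≠ b) :
    hcurlMixedEdge a b c i ∈ U1 (i + 1) ∧
      HasTraces1 (hcurlMixedEdge a b c i)
        (fun x => muQ c b x • opE i (muQ 0 a) (muQ 1 a) x)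
        (onlyOn b c (opE i (nu 0 a) (nu 1 a))) := by
  refine mem_U1_of_pull_curlClass
    ((contDiffOn_muS c b).smul (contDiffOn_opE isOpen_belowApex (contDiff_nu 0 a).contDiffOn
      (contDiff_nu 1 a).contDiffOn i))
    (single_mem_curlClass (a := a)
      (g := fun x => muQ c b x * (wt x ^ (i + 2) * hP i (muQ 0 a x) (muQ 1 a x))) ?_)
    (fun x hx => ?_) (fun x hx h => ?_)
    (forall_onlyOn (P := fun b' c' t => ∀ x ∈ belowApex, faceFun (.tri b' c') x = 0 →
      faceNormal (.tri b' c') ⨯₃ hcurlMixedEdge a b c i x = faceNormal (.tri b' c') ⨯₃ t x) hab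
      (fun x hx h => ?_) (fun c' hc x hx h => ?_) (fun c' x hx h => ?_)) ?_
    (forall_onlyOn (P := fun b' c' t => ∃ Q ∈ NedelecPoly (i + 1), ∀ x, t x = evalVec Q x)
      hab ?_ (fun _ _ => nedelecPoly_zero _) (fun _ => nedelecPoly_zero _))
  · exact WA_mono (WA_mul (WA_muQ_of_ne c hab) (WA_mul (WA_wt_pow a (i + 2))
      (WA_homog_muQ a i _))) (by omega) (by omega) (by omega) (by omega)
  · have : hcurlMixedEdge a b c i = fun y => muS c b y • opE i (nu 0 a) (nu 1 a) y := rfl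
    rw [this, pull1_smul, pull0_muS c b hx, pull1_opE_nu i a hx, smul_smul]
  -- On ζ = 0 the two fields differ by a multiple of the vertical unit vector, which has no
  -- tangential component.
  · have h0 : nu 0 a x = muQ 0 a x := nu_quad 0 a h
    have h1 : nu 1 a x = muQ 1 a x := nu_quad 1 a h
    have h2 : x 2 = 0 := h
    rw [hcurlMixedEdge, opE_nu, opE_muQ, muS_quad _ _ h, h0, h1, h2, faceNormal_quad]
    simp [-cross_anticomm]
  · rw [hcurlMixedEdge, muS_eq_one hx h, one_smul]
  · rw [hcurlMixedEdge, muS_eq_zero hx h (Ne.symm hc), zero_smul]; rfl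
  · obtain ⟨r, hr⟩ := opE_nu_face i h
    rw [hcurlMixedEdge, hr, smul_smul, cross_smul_self, Pi.zero_apply, map_zero]
  · simp only [opE_muQ, smul_smul]
    exact exists_quadPoly_along (tensorFunAlong_mono (tensorFunAlong_mul
      (tensorFunAlong_muQ_of_ne c hab) (tensorFunAlong_homog_muQ a i _)) (by omega) (by omega))
  · exact exists_nedelecPoly_opE_nu' i 0 1 a

/-- The factor (1 - ζ)² becomes w², precisely the decay asked of horizontal components in
`CurlClass`. -/
theorem hcurlQuadFace_mem (i : ℕ) {j : ℕ} (hab : a ≠ b) (hj : 2 ≤ j) :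
    hcurlQuadFace a b i j ∈ U1 (max (i + 1) j) ∧
      HasTraces1 (hcurlQuadFace a b i j)
        (opEQuad i j (muQ 0 a) (muQ 1 a) (muQ 0 b) (muQ 1 b)) (fun _ _ => 0) := by
  refine mem_U1_of_pull_curlClass
    (((contDiff_muZ 0).contDiffOn.pow 2).smul (contDiffOn_opEQuadS i j a b))
    (single_mem_curlClass (a := a)
      (g := fun x => wt x ^ 2 * (hL j (muQ 0 b x) (muQ 1 b x) * hP i (muQ 0 a x) (muQ 1 a x))) ?_)
    (fun x hx => ?_) (fun x hx h => ?_) (fun b' c' x hx h => ?_) ?_ (fun _ _ => nedelecPoly_zero _)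
  · exact WA_mono (WA_mul (WA_wt_pow a 2) (WA_mul (WA_homog_muQ_of_ne hab j _)
      (WA_homog_muQ a i _))) (by omega) (by omega) (by omega) (by omega)
  · have : hcurlQuadFace a b i j = fun y => muZ 0 y ^ 2 • opEQuadS i j a b y := rfl
    have hw : muZ 0 (tau x) = wt x := pull0_muZ_zero hx
    rw [this, pull1_smul (fun y => muZ 0 y ^ 2), pull1_opEQuadS i j a b hx, smul_smul, pull0, hw]
  · have h2 : x 2 = 0 := h
    rw [hcurlQuadFace, opEQuadS, opEQuad, opEQuad, opE_muS i a hx, opE_muQ, grad_muS_one a hx,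
      muZ_zero_quad h, phiE, phiE, h2, faceNormal_quad]
    simp [muS_quad _ _ h, -cross_anticomm]
  · obtain ⟨r, hr⟩ := opEQuadS_face i hj hab b' hx h
    rw [hcurlQuadFace, hr, smul_smul, cross_smul_self, Pi.zero_apply, map_zero]
  · simp only [opEQuad, opE_muQ, smul_smul]
    exact exists_quadPoly_along (tensorFunAlong_mono (tensorFunAlong_mul
      (tensorFunAlong_homog_muQ_of_ne hab j _) (tensorFunAlong_homog_muQ a i _))
      (by omega) (by omega))

theorem contDiffOn_opETri_nu (i j : ℕ) (k l m : Fin 3) (a : Fin 2) (U : Set R3) (hU : IsOpen U) :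
    ContDiffOn ℝ ∞ (opETri i j (nu k a) (nu l a) (nu m a)) U :=
  (((contDiff_nu k a).contDiffOn.add (contDiff_nu l a).contDiffOn).homog
    (contDiff_nu m a).contDiffOn _ _).smul
    (contDiffOn_opE hU (contDiff_nu k a).contDiffOn (contDiff_nu l a).contDiffOn i)

theorem hcurlTriFaceI_mem (c : Fin 2) (i : ℕ) {j : ℕ} (hab : a ≠ b) (hj : 1 ≤ j) :
    hcurlTriFaceI a b c i j ∈ U1 (i + j + 1) ∧
      HasTraces1 (hcurlTriFaceI a b c i j) 0
        (onlyOn b c (opETri i j (nu 0 a) (nu 1 a) (nu 2 a))) := by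
  refine mem_U1_of_pull_curlClass
    ((contDiffOn_muS c b).smul (contDiffOn_opETri_nu i j 0 1 2 a _ isOpen_belowApex))
    (single_mem_curlClass (a := a)
      (g := fun x => muQ c b x * (hLJ (2 * i + 1) j (wt x) (1 - wt x) *
        (wt x ^ (i + 2) * hP i (muQ 0 a x) (muQ 1 a x)))) ?_)
    (fun x hx => ?_) (fun x hx h => ?_)
    (forall_onlyOn (P := fun b' c' t => ∀ x ∈ belowApex, faceFun (.tri b' c') x = 0 →
      faceNormal (.tri b' c') ⨯₃ hcurlTriFaceI a b c i j x = faceNormal (.tri b' c') ⨯₃ t x) hab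
      (fun x hx h => ?_) (fun c' hc x hx h => ?_) (fun c' x hx h => ?_)) (exists_quadPoly_zero _)
    (forall_onlyOn (P := fun b' c' t => ∃ Q ∈ NedelecPoly (i + j + 1), ∀ x, t x = evalVec Q x)
      hab ?_ (fun _ _ => nedelecPoly_zero _) (fun _ => nedelecPoly_zero _))
  · exact WA_mono (WA_mul (WA_muQ_of_ne c hab) (WA_mul (WA_homog_wt a j _)
      (WA_mul (WA_wt_pow a (i + 2)) (WA_homog_muQ a i _))))
      (by omega) (by omega) (by omega) (by omega)
  · have : hcurlTriFaceI a b c i j = fun y => muS c b y •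
      (fun z => hLJ (2 * i + 1) j (nu 0 a z + nu 1 a z) (nu 2 a z) •
        opE i (nu 0 a) (nu 1 a) z) y := rfl
    have h2 : nu 2 a (tau x) = 1 - wt x := pull0_nu_two a hx
    rw [this, pull1_smul, pull0_muS c b hx,
      pull1_smul (fun z => hLJ (2 * i + 1) j (nu 0 a z + nu 1 a z) (nu 2 a z)),
      pull1_opE_nu i a hx, smul_smul, smul_smul, pull0, h2, nu_pull_add a hx, mul_assoc]
  · have h2 : nu 2 a x = 0 := h
    rw [hcurlTriFaceI, opETri, h2, hLJ_zero_right _ hj, zero_smul, smul_zero]; rfl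
  · rw [hcurlTriFaceI, muS_eq_one hx h, one_smul]
  · rw [hcurlTriFaceI, muS_eq_zero hx h (Ne.symm hc), zero_smul]; rfl
  · obtain ⟨r, hr⟩ := opE_nu_face i h
    rw [hcurlTriFaceI, opETri, hr, smul_smul, smul_smul, cross_smul_self, Pi.zero_apply, map_zero]
  · exact exists_nedelecPoly_opE_nu (polyFun_homog (add_mem (polyFun_nu 0 a) (polyFun_nu 1 a))
      (polyFun_nu 2 a) j _) i 0 1 a

theorem pull1_opE_nu_one_two (i : ℕ) (a : Fin 2) (hx : x ∈ extInf) :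
    pull1 (opE i (nu 1 a) (nu 2 a)) x = hP i (wt x * muQ 1 a x) (1 - wt x) •
      ((muQ 1 a x * wt x ^ 2) • Pi.single 2 1
        - (wt x * (1 - wt x)) • Pi.single a.castSucc 1) := by
  have e1 := eventuallyEq_of_extInf (fun y => pull0_nu 1 a) hx
  have e2 := eventuallyEq_of_extInf (fun y => pull0_nu_two a) hx
  rw [pull1_opE hx (differentiableAt_nu _ _ _) (differentiableAt_nu _ _ _),
    opE_congr (s₀ := pull0 (nu 1 a)) (s₁ := pull0 (nu 2 a)) e1 e2, opE,
    grad_mul (differentiableAt_wt hx) (differentiableAt_muQ _ _ _),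
    grad_sub (by fun_prop) (differentiableAt_wt hx), grad_const, grad_wt hx]
  have h1 : grad (muQ (1 : Fin 2) a) x = Pi.single a.castSucc 1 := grad_muQ_one a x
  rw [h1]
  congr 1
  ext k
  simp
  ring

theorem opE_of_right_eq_zero (i : ℕ) {s₀ s₁ : R3 → ℝ} (h : s₁ x = 0) :
    ∃ r : ℝ, opE i s₀ s₁ x = r • grad s₁ x :=
  ⟨hP i (s₀ x) (s₁ x) * s₀ x, by rw [opE, h, zero_smul, sub_zero, smul_smul]⟩

theorem opE_of_left_eq_zero (i : ℕ) {s₀ s₁ : R3 → ℝ} (h : s₀ x = 0) :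
    ∃ r : ℝ, opE i s₀ s₁ x = r • grad s₀ x :=
  ⟨-(hP i (s₀ x) (s₁ x) * s₁ x), by rw [opE, h, zero_smul, zero_sub, smul_neg, smul_smul, neg_smul]⟩

theorem hcurlTriFaceII_mem (c : Fin 2) (i : ℕ) {j : ℕ} (hab : a ≠ b) (hj : 1 ≤ j) :
    hcurlTriFaceII a b c i j ∈ U1 (i + j + 1) ∧
      HasTraces1 (hcurlTriFaceII a b c i j) 0
        (onlyOn b c (opETri i j (nu 1 a) (nu 2 a) (nu 0 a))) := by
  -- The vector part has only w horizontally and w² vertically, by `pull1_opE_nu_one_two`. The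
  -- missing power is the factor ν₀ of the integrated Jacobi polynomial, which pulls back to w μ₀;
  -- it is why C has lower exponent 1.
  obtain ⟨K, hK⟩ := hLJ_eq_mul (2 * i + 1) hj
  have hw : wt ∈ WA a 0 0 0 1 := WA_mono (WA_wt a) le_rfl le_rfl (Nat.zero_le 1) le_rfl
  have hw' (c : Fin 2) : (fun x => wt x * muQ c a x) ∈ WA a 1 0 0 1 :=
    WA_mono (WA_mul hw (WA_muQ c a)) (by omega) (by omega) (by omega) (by omega)
  have hw1 : (fun x => 1 - wt x) ∈ WA a 1 0 0 1 :=
    WA_mono (WA_one_sub_wt a) (by omega) (by omega) (by omega) (by omega)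
  set C : R3 → ℝ := fun x => muQ c b x * ((wt x * muQ 0 a x) *
    (homog (j - 1) K (wt x * muQ 1 a x + (1 - wt x)) (wt x * muQ 0 a x) *
      hP i (wt x * muQ 1 a x) (1 - wt x))) with hC
  have hCm : C ∈ WA a (i + j) 1 1 (i + j) :=
    WA_mono (WA_mul (WA_muQ_of_ne c hab) (WA_mul (WA_mul (WA_wt a) (WA_muQ 0 a))
      (WA_mul (WA_homog (WA_add (hw' 1) hw1) (hw' 0) (j - 1) K)
      (WA_homog (hw' 1) hw1 i (legendre i)))))
      (by omega) (by omega) (by omega) (by omega)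
  refine mem_U1_of_pull_curlClass
    ((contDiffOn_muS c b).smul (contDiffOn_opETri_nu i j 1 2 0 a _ isOpen_belowApex))
    (curlClass_add (single_two_mem_curlClass (g := fun x => C x * (muQ 1 a x * wt x ^ 2)) ?_)
      (single_mem_curlClass (a := a) (g := fun x => -(C x * (wt x * (1 - wt x)))) ?_))
    (fun x hx => ?_) (fun x hx h => ?_)
    (forall_onlyOn (P := fun b' c' t => ∀ x ∈ belowApex, faceFun (.tri b' c') x = 0 →
      faceNormal (.tri b' c') ⨯₃ hcurlTriFaceII a b c i j x = faceNormal (.tri b' c') ⨯₃ t x) hab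
      (fun x hx h => ?_) (fun c' hc x hx h => ?_) (fun c' x hx h => ?_)) (exists_quadPoly_zero _)
    (forall_onlyOn (P := fun b' c' t => ∃ Q ∈ NedelecPoly (i + j + 1), ∀ x, t x = evalVec Q x)
      hab ?_ (fun _ _ => nedelecPoly_zero _) (fun _ => nedelecPoly_zero _))
  · exact WT_of_WA (WA_mono (WA_mul hCm (WA_mul (WA_muQ 1 a) (WA_wt_pow a 2)))
      (by omega) (by omega) (by omega) (by omega))
  · exact WA_neg (WA_mono (WA_mul hCm (WA_mul (WA_wt a) (WA_one_sub_wt a)))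
      (by omega) (by omega) (by omega) (by omega))
  · have : hcurlTriFaceII a b c i j = fun y => muS c b y •
      (fun z => hLJ (2 * i + 1) j (nu 1 a z + nu 2 a z) (nu 0 a z) •
        opE i (nu 1 a) (nu 2 a) z) y := rfl
    have h2 : nu 2 a (tau x) = 1 - wt x := pull0_nu_two a hx
    have h1 : nu 1 a (tau x) = wt x * muQ 1 a x := pull0_nu 1 a hx
    have h0 : nu 0 a (tau x) = wt x * muQ 0 a x := pull0_nu 0 a hx
    rw [this, pull1_smul, pull0_muS c b hx,
      pull1_smul (fun z => hLJ (2 * i + 1) j (nu 1 a z + nu 2 a z) (nu 0 a z)),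
      pull1_opE_nu_one_two i a hx, pull0, h0, h1, h2, hK, hC]
    ext k
    simp
    ring
  · have h2 : nu 2 a x = 0 := h
    obtain ⟨r, hr⟩ := opE_of_right_eq_zero i (s₀ := nu 1 a) h2
    rw [hcurlTriFaceII, opETri, hr, grad_nu_two, faceNormal_quad]
    simp
  · rw [hcurlTriFaceII, muS_eq_one hx h, one_smul]
  · rw [hcurlTriFaceII, muS_eq_zero hx h (Ne.symm hc), zero_smul]; rfl
  -- Where ν₁ = 0 the field is parallel to ∇ν₁, a normal; where ν₀ = 0 the Jacobi factor vanishes.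
  · have hc : c' = 0 ∨ c' = 1 := by omega
    rcases hc with rfl | rfl
    · have h1 : nu 1 a x = 0 := h
      obtain ⟨r, hr⟩ := opE_of_left_eq_zero i (s₁ := nu 2 a) h1
      rw [hcurlTriFaceII, opETri, hr, grad_nu_one]
      simp [faceNormal]
    · have h0 : nu 0 a x = 0 := h
      rw [hcurlTriFaceII, opETri, h0, hLJ_zero_right _ hj, zero_smul, smul_zero]; rfl
  · exact exists_nedelecPoly_opE_nu (polyFun_homog (add_mem (polyFun_nu 1 a) (polyFun_nu 2 a))
      (polyFun_nu 0 a) j _) i 1 2 a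

theorem hcurlBubbleI_eq_grad (i j k : ℕ) (hx : x ∈ belowApex) :
    hcurlBubbleI i j k x = grad (h1Bubble i j k) x := by
  have h : grad (h1Bubble i j k) x = _ := grad_mul
    ((contDiffOn_phiQuadS i j 0 1).differentiableAt_of_isOpen isOpen_belowApex hx)
    ((contDiffOn_phiZ k).differentiableAt_of_isOpen isOpen_belowApex hx)
  rw [h, hcurlBubbleI, add_comm]

theorem contDiffOn_h1Bubble (i j k : ℕ) : ContDiffOn ℝ ∞ (h1Bubble i j k) belowApex :=
  (contDiffOn_phiQuadS i j 0 1).mul (contDiffOn_phiZ k)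

/-- The function is the gradient of an `H¹` bubble, so its `CurlClass` part is zero. -/
theorem hcurlBubbleI_mem {i j k : ℕ} (hi : 2 ≤ i) (hj : 2 ≤ j) (hk : 2 ≤ k) :
    hcurlBubbleI i j k ∈ U1 (max (max i j) k) ∧
      HasTraces1 (hcurlBubbleI i j k) 0 (fun _ _ => 0) := by
  refine mem_U1_of_pull
    ((contDiffOn_grad isOpen_belowApex (contDiffOn_h1Bubble i j k)).congr
      fun x => hcurlBubbleI_eq_grad i j k)
    (curlClass_zero _) (WT_pull_bubble hk) (fun x hx => ?_) (fun x hx h => ?_)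
    (fun b' c' x hx h => ?_) (exists_quadPoly_zero _) (fun _ _ => nedelecPoly_zero _)
  · have hτ := tau_mem_belowApex hx
    simp only [zero_add]
    rw [pull1_congr (hcurlBubbleI_eq_grad i j k hτ), pull1_grad hx
      ((contDiffOn_h1Bubble i j k).differentiableAt_of_isOpen isOpen_belowApex hτ),
      grad_congr (eventuallyEq_of_extInf (fun y => pull0_h1Bubble i j k) hx)]
  · obtain ⟨r, hr⟩ := exists_grad_phiZ (k := k) (by omega) x
    rw [hcurlBubbleI, phiZ_quad hk h, hr, faceNormal_quad]
    simp
  · obtain ⟨r, hr⟩ := grad_phiQuadS_face hi hj (a := 0) (b := 1) (by decide) b' hx h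
    rw [hcurlBubbleI, phiQuadS_face hi hj (by decide) b' c' hx h, hr, zero_smul, add_zero,
      smul_smul, cross_smul_self, Pi.zero_apply, map_zero]

theorem contDiffOn_hcurlBubbleII (a b : Fin 2) (i j k : ℕ) :
    ContDiffOn ℝ ∞ (hcurlBubbleII a b i j k) belowApex :=
  ((contDiff_muZ 0).contDiffOn.mul (contDiffOn_phiZ k)).smul (contDiffOn_opEQuadS i j a b)

theorem pull1_hcurlBubbleII (a b : Fin 2) (i j k : ℕ) (hx : x ∈ extInf) :
    pull1 (hcurlBubbleII a b i j k) x = (wt x * hL k (wt x) (1 - wt x) *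
      (hL j (muQ 0 b x) (muQ 1 b x) * hP i (muQ 0 a x) (muQ 1 a x))) •
        Pi.single a.castSucc 1 := by
  have : hcurlBubbleII a b i j k = fun y => (muZ 0 y * phiZ k y) • opEQuadS i j a b y := rfl
  rw [this, pull1_smul (fun y => muZ 0 y * phiZ k y), pull1_opEQuadS i j a b hx, smul_smul,
    ← pull0_phiZ k hx, ← pull0_muZ_zero hx]
  rfl

theorem pull_hcurlBubbleII_mem (i j : ℕ) {k : ℕ} (hab : a ≠ b) (hk : 2 ≤ k) :
    (fun x => (wt x * hL k (wt x) (1 - wt x) *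
      (hL j (muQ 0 b x) (muQ 1 b x) * hP i (muQ 0 a x) (muQ 1 a x))) •
        (Pi.single a.castSucc 1 : R3)) ∈ CurlClass (max (max (i + 1) j) k) :=
  single_mem_curlClass (WA_mono (WA_mul (WA_mul (WA_wt a) (WA_hL_wt a hk))
    (WA_mul (WA_homog_muQ_of_ne hab j _) (WA_homog_muQ a i _)))
    (by omega) (by omega) (by omega) (by omega))

theorem hcurlBubbleII_mem (i : ℕ) {j k : ℕ} (hab : a ≠ b) (hj : 2 ≤ j) (hk : 2 ≤ k) :
    hcurlBubbleII a b i j k ∈ U1 (max (max (i + 1) j) k) ∧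
      HasTraces1 (hcurlBubbleII a b i j k) 0 (fun _ _ => 0) := by
  refine mem_U1_of_pull_curlClass (contDiffOn_hcurlBubbleII a b i j k)
    (pull_hcurlBubbleII_mem i j hab hk) (fun x hx => pull1_hcurlBubbleII a b i j k hx)
    (fun x hx h => ?_)
    (fun b' c' x hx h => ?_) (exists_quadPoly_zero _) (fun _ _ => nedelecPoly_zero _)
  · rw [hcurlBubbleII, phiZ_quad hk h, mul_zero, zero_smul]; rfl
  · obtain ⟨r, hr⟩ := opEQuadS_face i hj hab b' hx h
    rw [hcurlBubbleII, hr, smul_smul, cross_smul_self, Pi.zero_apply, map_zero]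

theorem contDiffOn_hcurlBubbleIV (i j : ℕ) : ContDiffOn ℝ ∞ (hcurlBubbleIV i j) belowApex :=
  (contDiffOn_phiQuadS i j 1 0).smul ((contDiffOn_const.mul
    ((contDiff_muZ 0).contDiffOn.pow _)).smul
    (contDiffOn_grad isOpen_belowApex (contDiff_muZ 0).contDiffOn))

theorem pull1_hcurlBubbleIV (i j : ℕ) (hx : x ∈ extInf) :
    pull1 (hcurlBubbleIV i j) x = (-(hL i (muQ 0 1 x) (muQ 1 1 x) * hL j (muQ 0 0 x) (muQ 1 0 x) *
      ((max i j : ℕ) * (wt x ^ (max i j - 1) * wt x ^ 2)))) • Pi.single 2 1 := by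
  have : hcurlBubbleIV i j = fun y => (phiQuadS i j 1 0 y *
    (((max i j : ℕ) : ℝ) * muZ 0 y ^ (max i j - 1))) • grad (muZ 0) y := by
    funext y; rw [hcurlBubbleIV, smul_smul]
  have hw : muZ 0 (tau x) = wt x := pull0_muZ_zero hx
  rw [this, pull1_smul (fun y => phiQuadS i j 1 0 y *
    (((max i j : ℕ) : ℝ) * muZ 0 y ^ (max i j - 1))), pull1_grad_muZ_zero hx, smul_smul,
    ← pull0_phiQuadS i j 1 0 hx]
  simp only [pull0, hw]
  congr 1
  ring

/-- With n = max(i, j) ≥ 2 the power is w^{n+1}, and n + 1 ≥ 3 as `CurlClass` asks of vertical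
components. -/
theorem pull_hcurlBubbleIV_mem {i j : ℕ} (hi : 2 ≤ i) :
    (fun x => (-(hL i (muQ 0 1 x) (muQ 1 1 x) * hL j (muQ 0 0 x) (muQ 1 0 x) *
      ((max i j : ℕ) * (wt x ^ (max i j - 1) * wt x ^ 2)))) •
        (Pi.single 2 1 : R3)) ∈ CurlClass (max i j) :=
  single_two_mem_curlClass (WT_of_WA (WA_neg (WA_mono (WA_mul
    (WA_mul (WA_homog_muQ 1 i _) (WA_homog_muQ_of_ne (a := 1) (by decide) j _))
    (WA_const_mul _ (WA_mul (WA_wt_pow 1 _) (WA_wt_pow 1 2))))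
    (by omega) (by omega) (by omega) (by omega))))

theorem hcurlBubbleIV_mem {i j : ℕ} (hi : 2 ≤ i) (hj : 2 ≤ j) :
    hcurlBubbleIV i j ∈ U1 (max i j) ∧ HasTraces1 (hcurlBubbleIV i j) 0 (fun _ _ => 0) := by
  refine mem_U1_of_pull_curlClass (contDiffOn_hcurlBubbleIV i j)
    (pull_hcurlBubbleIV_mem hi) (fun x hx => pull1_hcurlBubbleIV i j hx)
    (fun x hx h => ?_)
    (fun b' c' x hx h => ?_) (exists_quadPoly_zero _) (fun _ _ => nedelecPoly_zero _)
  · rw [hcurlBubbleIV, grad_muZ_zero, faceNormal_quad]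
    simp
  · rw [hcurlBubbleIV, phiQuadS_face hi hj (by decide) b' c' hx h, zero_smul]; rfl

end Families

end PyramidFE

namespace PyramidFE

open Topology

/-! ### Triangle edge functions of `H(curl)` -/

section TriEdge

variable {x : R3}

theorem grad_lam (k : Fin 2 → Fin 2) (b : Fin 2) (hx : x ∈ belowApex) :
    grad (lam (baseVertex (k 0) (k 1))) x =
      muS (k b) b x • grad (nu (k (1 - b)).castSucc (1 - b)) x
        + nu (k (1 - b)).castSucc (1 - b) x • grad (muS (k b) b) x := by
  rw [grad_congr (eventuallyEq_of_belowApex (fun y => lam_baseVertex k b) hx),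
    grad_mul (differentiableAt_muS _ _ hx) (differentiableAt_nu _ _ _)]

/-- The direct pullback is [P_i](wm, 1-w)(m w² e_z - w(1-w)∇m), whose horizontal part has only one
power of w. Split [P_i] = c s₁^i + s₀ K. The second term gains w from s₀ = wm, and adding c∇(w m
(1-w)^i) to the first cancels its part of order w. That gradient is returned as the last summand. -/
theorem pull1_hcurlTriEdge {i : ℕ} {k : Fin 2 → Fin 2} {m : R3 → ℝ}
    (hm : ∀ y, m y = muQ (k 0) 0 y * muQ (k 1) 1 y) {K : ℝ → ℝ → ℝ} {c : ℝ}
    (hK : ∀ s₀ s₁, hP i s₀ s₁ = c * s₁ ^ i + s₀ * K s₀ s₁) (hx : x ∈ extInf) :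
    pull1 (hcurlTriEdge (baseVertex (k 0) (k 1)) i) x =
      (c * (wt x ^ 2 * (1 - wt x) ^ i)
        - wt x ^ 2 * (m x * K (wt x * m x) (1 - wt x)) * (1 - wt x)) • grad m x
      + (c * (wt x * m x * (wt x ^ 2 * (i * (1 - wt x) ^ (i - 1))))
        + wt x * m x * (wt x ^ 2 * (m x * K (wt x * m x) (1 - wt x)))) • Pi.single 2 1
      + grad (fun y => -c * (wt y * m y * (1 - wt y) ^ i)) x := by
  have hτ := tau_mem_belowApex hx
  have hwd := differentiableAt_wt hx
  have hmd : DifferentiableAt ℝ m x := by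
    rw [funext hm]
    exact (differentiableAt_muQ _ _ _).mul (differentiableAt_muQ _ _ _)
  have h1d : DifferentiableAt ℝ (fun y => 1 - wt y) x := (differentiableAt_const _).sub hwd
  have e1 : pull0 (lam (baseVertex (k 0) (k 1))) =ᶠ[𝓝 x] fun y => wt y * m y :=
    eventuallyEq_of_extInf (fun y hy => by rw [hm]; exact pull0_lam k hy) hx
  have e2 : pull0 (lam 4) =ᶠ[𝓝 x] fun y => 1 - wt y :=
    eventuallyEq_of_extInf (fun y => pull0_muZ_one) hx
  have hg1 : grad (fun y => 1 - wt y) x = wt x ^ 2 • Pi.single 2 1 := by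
    rw [grad_sub (by fun_prop) hwd, grad_const, grad_wt hx, zero_sub, neg_smul, neg_neg]
  rw [hcurlTriEdge, pull1_opE hx
    ((contDiffOn_lam _).differentiableAt_of_isOpen isOpen_belowApex hτ)
    ((contDiffOn_lam _).differentiableAt_of_isOpen isOpen_belowApex hτ), opE_congr e1 e2, opE,
    hg1, grad_mul (differentiableAt_const _) ((hwd.fun_mul hmd).fun_mul (h1d.fun_pow i)),
    grad_const, grad_mul (hwd.fun_mul hmd) (h1d.fun_pow i), grad_pow i h1d, hg1,
    grad_mul hwd hmd, grad_wt hx, hK]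
  ext l
  simp
  ring

theorem hcurlTriEdge_mem (k : Fin 2 → Fin 2) (i : ℕ) :
    hcurlTriEdge (baseVertex (k 0) (k 1)) i ∈ U1 (i + 1) ∧
      HasTraces1 (hcurlTriEdge (baseVertex (k 0) (k 1)) i) 0
        (fun b c => if c = k b then
          opE i (nu (k (1 - b)).castSucc (1 - b)) (nu 2 (1 - b)) else 0) := by
  have h01 : (0 : Fin 2) ≠ 1 := by decide
  obtain ⟨K, hK⟩ := exists_homog_eq_add i (natDegree_legendre_le i)
  obtain ⟨r, hr⟩ := exists_grad_muQ (k 0) 0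
  obtain ⟨s, hs⟩ := exists_grad_muQ (k 1) 1
  set c := (legendre i).eval 1
  set m : R3 → ℝ := fun y => muQ (k 0) 0 y * muQ (k 1) 1 y with hm
  have hmW : m ∈ WA 0 1 1 0 0 := WA_mono (WA_mul (WA_muQ (k 0) 0) (WA_muQ_of_ne (k 1) h01))
    (by omega) (by omega) (by omega) (by omega)
  -- The case i = 0 is separate here and in the next bound: there the remainder is absent, and the
  -- factor i removes the truncated power.
  have hA : (fun x => wt x ^ 2 * (m x * if i = 0 then 0 else
      homog (i - 1) K (wt x * m x) (1 - wt x))) ∈ WA 0 i i 2 (i + 1) := by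
    by_cases h0 : i = 0
    · simp only [h0, if_true, mul_zero]
      exact zero_mem _
    · simp only [h0, if_false]
      exact WA_mono (WA_mul (WA_wt_pow 0 2) (WA_mul hmW (WA_homog_vertex k (i - 1) K)))
        (by omega) (by omega) (by omega) (by omega)
  have hB : (fun x => wt x ^ 2 * ((i : ℝ) * (1 - wt x) ^ (i - 1))) ∈ WA 0 0 0 2 (i + 1) := by
    by_cases h0 : i = 0
    · simp only [h0, Nat.cast_zero, zero_mul, mul_zero]
      exact zero_mem _
    · exact WA_mono (WA_mul (WA_wt_pow 0 2) (WA_const_mul _ (WA_pow (WA_one_sub_wt 0) (i - 1))))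
        (by omega) (by omega) (by omega) (by omega)
  have hwm : (fun x => wt x * m x) ∈ WA 0 1 1 1 1 := WA_wt_mul_vertex k
  set C : R3 → ℝ := fun x => c * (wt x ^ 2 * (1 - wt x) ^ i)
    - wt x ^ 2 * (m x * if i = 0 then 0 else homog (i - 1) K (wt x * m x) (1 - wt x))
      * (1 - wt x) with hC
  have hCW : C ∈ WA 0 i i 2 (i + 2) :=
    WA_sub (WA_const_mul c (WA_mono (WA_mul (WA_wt_pow 0 2) (WA_pow (WA_one_sub_wt 0) i))
      (by omega) (by omega) (by omega) (by omega)))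
      (WA_mono (WA_mul hA (WA_one_sub_wt 0)) (by omega) (by omega) (by omega) (by omega))
  have hgm (x : R3) : grad m x = (s * muQ (k 0) 0 x) • Pi.single (Fin.castSucc 1) 1
      + (r * muQ (k 1) 1 x) • Pi.single (Fin.castSucc 0) 1 := by
    rw [hm, grad_mul (differentiableAt_muQ _ _ _) (differentiableAt_muQ _ _ _), hr, hs, smul_smul,
      smul_smul, mul_comm s, mul_comm r]
  have hCW' : C ∈ WA 1 i i 2 (i + 2) := by simpa [WA] using hCW
  refine mem_U1_of_pull
    (contDiffOn_opE isOpen_belowApex (contDiffOn_lam _) (contDiffOn_lam _) i)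
    (curlClass_add (curlClass_add
      (single_mem_curlClass (a := 1) (g := fun x => C x * (s * muQ (k 0) 0 x)) ?_)
      (single_mem_curlClass (a := 0) (g := fun x => C x * (r * muQ (k 1) 1 x)) ?_))
      (single_two_mem_curlClass (g := fun x =>
        c * (wt x * m x * (wt x ^ 2 * (i * (1 - wt x) ^ (i - 1))))
        + wt x * m x * (wt x ^ 2 * (m x * if i = 0 then 0 else
          homog (i - 1) K (wt x * m x) (1 - wt x)))) ?_))
    (g := fun y => -c * (wt y * m y * (1 - wt y) ^ i)) ?_
    (fun x hx => ?_) (fun x hx h => ?_) (fun b c x hx h => ?_) (exists_quadPoly_zero _)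
    (fun b c => ?_)
  · exact WA_mono (WA_mul hCW' (WA_const_mul s (WA_muQ_of_ne (k 0) h01.symm)))
      (by omega) (by omega) (by omega) (by omega)
  · exact WA_mono (WA_mul hCW (WA_const_mul r (WA_muQ_of_ne (k 1) h01)))
      (by omega) (by omega) (by omega) (by omega)
  · exact WT_of_WA (WA_add (WA_const_mul c (WA_mono (WA_mul hwm hB)
      (by omega) (by omega) (by omega) (by omega)))
      (WA_mono (WA_mul hwm hA) (by omega) (by omega) (by omega) (by omega)))
  · exact WT_of_WA (WA_const_mul (-c) (WA_mono (WA_mul hwm (WA_pow (WA_one_sub_wt 0) i))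
      (by omega) (by omega) (by omega) (by omega)))
  · have h := pull1_hcurlTriEdge (k := k) (m := m) (fun _ => rfl)
      (K := fun s₀ s₁ => if i = 0 then 0 else homog (i - 1) K s₀ s₁) hK hx
    rw [h, hgm, smul_add, smul_smul, smul_smul]
  · have h2 : lam 4 x = 0 := h
    obtain ⟨t, ht⟩ := opE_of_right_eq_zero i (s₀ := lam (baseVertex (k 0) (k 1))) h2
    have h3 : grad (lam 4) x = Pi.single 2 1 := grad_coord 2
    rw [hcurlTriEdge, ht, h3, faceNormal_quad]
    simp
  · have h3 : grad (lam 4) x = grad (nu 2 (1 - b)) x := rfl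
    have h4 : lam 4 x = nu 2 (1 - b) x := rfl
    rw [hcurlTriEdge, opE, lam_baseVertex k b hx, grad_lam k b hx, h3, h4]
    -- In ∇λ = μ∇ν + ν∇μ the second term is normal to the face, hence invisible to the tangential
    -- trace.
    obtain ⟨t, ht⟩ := grad_muS_face (k b) hx h
    rw [ht]
    split_ifs with hc
    · subst hc
      rw [muS_eq_one hx h, one_mul, one_smul, opE]
      simp only [map_smul, map_sub, map_add, cross_self, smul_zero, add_zero]
    · rw [muS_eq_zero hx h (Ne.symm hc), zero_mul]
      simp only [zero_smul, zero_add, zero_sub, ← smul_neg, map_smul, map_neg, cross_self,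
        smul_zero, neg_zero, Pi.zero_apply, map_zero]
  · split_ifs
    · exact exists_nedelecPoly_opE_nu' i _ 2 _
    · exact nedelecPoly_zero _

end TriEdge

end PyramidFE

namespace PyramidFE

open Topology

/-! ### `H(div)` shape functions -/

theorem curl_zero (x : R3) : curl (fun _ => 0) x = 0 := by
  ext k
  fin_cases k <;> simp [curl, pd_const]

theorem mem_U2_of_pull_divClass {p : ℕ} {V q : R3 → R3} {t : Fin 2 → Fin 2 → R3 → R3}
    {V' : R3 → R3} (hV : ContDiffOn ℝ ∞ V belowApex) (hV' : V' ∈ DivClass p)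
    (heq : Set.EqOn (pull2 V) V' extInf)
    (hq : ∀ x ∈ belowApex, faceFun .quad x = 0 →
      V x ⬝ᵥ faceNormal .quad = q x ⬝ᵥ faceNormal .quad)
    (ht : ∀ b c, ∀ x ∈ belowApex, faceFun (.tri b c) x = 0 →
      V x ⬝ᵥ faceNormal (.tri b c) = t b c x ⬝ᵥ faceNormal (.tri b c))
    (hqP : ∃ Q ∈ TensorPoly (p - 1) (p - 1) 0, ∀ x, q x = evalVec ![0, 0, Q] x)
    (htP : ∀ b c, ∃ Q ∈ RaviartThomasPoly p, ∀ x, t b c x = evalVec Q x) :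
    V ∈ U2 p ∧ HasTraces2 V q t :=
  mem_U2_of_pull hV hV' (curlClass_zero p)
    (fun x hx => by simp only [curl_zero, add_zero]; exact heq hx) hq ht hqP htP

/-- For curls of fields already known to pull back into `CurlClass`; the `DivClass` part is zero. -/
theorem mem_U2_of_pull_curl {p : ℕ} {V q : R3 → R3} {t : Fin 2 → Fin 2 → R3 → R3}
    {E E' : R3 → R3} (hE : ContDiffOn ℝ ∞ E belowApex) (hE' : E' ∈ CurlClass p)
    (hV : ∀ x ∈ belowApex, V x = curl E x)
    (heq : Set.EqOn (pull1 E) E' extInf)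
    (hq : ∀ x ∈ belowApex, faceFun .quad x = 0 →
      V x ⬝ᵥ faceNormal .quad = q x ⬝ᵥ faceNormal .quad)
    (ht : ∀ b c, ∀ x ∈ belowApex, faceFun (.tri b c) x = 0 →
      V x ⬝ᵥ faceNormal (.tri b c) = t b c x ⬝ᵥ faceNormal (.tri b c))
    (hqP : ∃ Q ∈ TensorPoly (p - 1) (p - 1) 0, ∀ x, q x = evalVec ![0, 0, Q] x)
    (htP : ∀ b c, ∃ Q ∈ RaviartThomasPoly p, ∀ x, t b c x = evalVec Q x) :
    V ∈ U2 p ∧ HasTraces2 V q t := by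
  refine mem_U2_of_pull ((contDiffOn_curl isOpen_belowApex hE).congr hV) (divClass_zero p) hE'
    (fun x hx => ?_) hq ht hqP htP
  have h : pull2 V x = pull2 (curl E) x := by
    rw [pull2, pull2, hV _ (tau_mem_belowApex hx)]
  simp only [zero_add]
  rw [h, pull2_curl hE hx, curl_congr (eventuallyEq_of_extInf heq hx)]

theorem exists_quadPoly_div {p : ℕ} {f : R3 → ℝ} (hf : f ∈ tensorFun (p - 1) (p - 1)) :
    ∃ Q ∈ TensorPoly (p - 1) (p - 1) 0, ∀ x, f x • (Pi.single 2 1 : R3) = evalVec ![0, 0, Q] x := by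
  obtain ⟨Q, hQ, hf⟩ := hf
  refine ⟨Q, hQ, fun x => ?_⟩
  ext k; fin_cases k <;> simp [evalVec, hf]

theorem exists_quadPoly_div_zero (p : ℕ) :
    ∃ Q ∈ TensorPoly (p - 1) (p - 1) 0, ∀ x, (0 : R3 → R3) x = evalVec ![0, 0, Q] x := by
  refine ⟨0, tensorPoly_zero, fun x => ?_⟩
  ext k; fin_cases k <;> simp [evalVec]

theorem single_zero_cross_single_one :
    (Pi.single (Fin.castSucc (0 : Fin 2)) 1 : R3) ⨯₃ Pi.single (Fin.castSucc 1) 1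
      = Pi.single 2 1 := by
  ext k; fin_cases k <;> simp [cross_apply]

theorem exists_single_two_cross {a b : Fin 2} (hab : a ≠ b) :
    ∃ r : ℝ, (Pi.single 2 1 : R3) ⨯₃ Pi.single b.castSucc 1 = r • Pi.single a.castSucc 1 := by
  have hb : (a = 0 ∧ b = 1) ∨ (a = 1 ∧ b = 0) := by omega
  rcases hb with ⟨rfl, rfl⟩ | ⟨rfl, rfl⟩
  · refine ⟨-1, ?_⟩
    ext k; fin_cases k <;> simp [cross_apply]
  · refine ⟨1, ?_⟩
    ext k; fin_cases k <;> simp [cross_apply]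

theorem cross_smul_dot_self (u n : R3) (r : ℝ) : (u ⨯₃ (r • n)) ⬝ᵥ n = 0 := by
  rw [map_smul, smul_dotProduct, dotProduct_comm, dot_cross_self, smul_zero]

theorem smul_cross_dot_self (u n : R3) (r : ℝ) : ((r • n) ⨯₃ u) ⬝ᵥ n = 0 := by
  rw [map_smul, LinearMap.smul_apply, smul_dotProduct, dotProduct_comm, dot_self_cross, smul_zero]

section Families

variable {a b c : Fin 2} {x : R3}

theorem opVQuadS_face (i j : ℕ) (hab : a ≠ b) (b' : Fin 2)
    (hx : x ∈ belowApex) (h : faceFun (.tri b' c) x = 0) :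
    opVQuadS i j a b x ⬝ᵥ faceNormal (.tri b' c) = 0 := by
  have hb : b' = b ∨ b' = a := by omega
  rcases hb with rfl | rfl
  · obtain ⟨r, hr⟩ := opE_muS_face j hx h
    rw [opVQuadS, opVQuad, hr, cross_smul_dot_self]
  · obtain ⟨r, hr⟩ := opE_muS_face i hx h
    rw [opVQuadS, opVQuad, hr, smul_cross_dot_self]

theorem pull2_opVQuadS (i j : ℕ) (hx : x ∈ extInf) :
    pull2 (opVQuadS i j 0 1) x =
      (hP i (muQ 0 0 x) (muQ 1 0 x) * hP j (muQ 0 1 x) (muQ 1 1 x)) • Pi.single 2 1 := by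
  have : opVQuadS i j 0 1 = fun y =>
    opE i (muS 0 0) (muS 1 0) y ⨯₃ opE j (muS 0 1) (muS 1 1) y := rfl
  rw [this, pull2_cross hx, pull1_opE_muS i 0 hx, pull1_opE_muS j 1 hx, map_smul, map_smul,
    LinearMap.smul_apply, single_zero_cross_single_one, smul_smul, mul_comm]

theorem contDiffOn_opVQuadS (i j : ℕ) (a b : Fin 2) :
    ContDiffOn ℝ ∞ (opVQuadS i j a b) belowApex :=
  contDiffOn_cross (contDiffOn_opE isOpen_belowApex (contDiffOn_muS _ _) (contDiffOn_muS _ _) i)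
    (contDiffOn_opE isOpen_belowApex (contDiffOn_muS _ _) (contDiffOn_muS _ _) j)

/-- The pullback of V^□ is vertical and free of w. The factor (1 - ζ)³ supplies the exponent 3 of
`DivClass`. -/
theorem hdivQuadFace_mem (i j : ℕ) :
    hdivQuadFace i j ∈ U2 (max (i + 1) (j + 1)) ∧
      HasTraces2 (hdivQuadFace i j)
        (opVQuad i j (muQ 0 0) (muQ 1 0) (muQ 0 1) (muQ 1 1)) (fun _ _ => 0) := by
  have h01 : (0 : Fin 2) ≠ 1 := by decide
  refine mem_U2_of_pull_divClass
    (((contDiff_muZ 0).contDiffOn.pow 3).smul (contDiffOn_opVQuadS i j 0 1))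
    (single_two_mem_divClass
      (g := fun x => wt x ^ 3 * (hP i (muQ 0 0 x) (muQ 1 0 x) * hP j (muQ 0 1 x) (muQ 1 1 x))) ?_)
    (fun x hx => ?_) (fun x hx h => ?_) (fun b' c' x hx h => ?_) ?_
    (fun _ _ => raviartThomasPoly_zero _)
  · exact WT_of_WA (WA_mono (WA_mul (WA_wt_pow 0 3) (WA_mul (WA_homog_muQ 0 i _)
      (WA_homog_muQ_of_ne h01 j _))) (by omega) (by omega) (by omega) (by omega))
  · have : hdivQuadFace i j = fun y => muZ 0 y ^ 3 • opVQuadS i j 0 1 y := rfl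
    have hw : muZ 0 (tau x) = wt x := pull0_muZ_zero hx
    rw [this, pull2_smul (fun y => muZ 0 y ^ 3), pull2_opVQuadS i j hx, smul_smul, pull0, hw]
  · have h2 : x 2 = 0 := h
    rw [hdivQuadFace, opVQuadS, opVQuad, opVQuad, opE_muS i 0 hx, opE_muQ, opE_muS j 1 hx, opE_muQ,
      grad_muS_one 0 hx, grad_muS_one 1 hx, muZ_zero_quad h, h2, faceNormal_quad]
    simp [muS_quad _ _ h, cross_apply, mul_comm]
  · rw [hdivQuadFace, smul_dotProduct, opVQuadS_face i j h01 b' hx h, smul_zero, Pi.zero_apply,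
      zero_dotProduct]
  · have h (x : R3) : opVQuad i j (muQ 0 0) (muQ 1 0) (muQ 0 1) (muQ 1 1) x =
        (hP i (muQ 0 0 x) (muQ 1 0 x) * hP j (muQ 0 1 x) (muQ 1 1 x)) • Pi.single 2 1 := by
      rw [opVQuad, opE_muQ, opE_muQ, map_smul, map_smul, LinearMap.smul_apply,
        single_zero_cross_single_one, smul_smul, mul_comm]
    simp only [h]
    exact exists_quadPoly_div (tensorFun_of_along (tensorFunAlong_mono (tensorFunAlong_mul
      (tensorFunAlong_homog_muQ 0 i _) (tensorFunAlong_homog_muQ_of_ne h01 j _))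
      (by omega) (by omega)))

theorem hdivBubbleIV_mem (i j : ℕ) {k : ℕ} (hk : 2 ≤ k) :
    hdivBubbleIV i j k ∈ U2 (max (max (i + 1) (j + 1)) k) ∧
      HasTraces2 (hdivBubbleIV i j k) 0 (fun _ _ => 0) := by
  have h01 : (0 : Fin 2) ≠ 1 := by decide
  refine mem_U2_of_pull_divClass
    ((((contDiff_muZ 0).contDiffOn.pow 2).mul (contDiffOn_phiZ k)).smul
      (contDiffOn_opVQuadS i j 0 1))
    (single_two_mem_divClass
      (g := fun x => wt x ^ 2 * hL k (wt x) (1 - wt x) *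
        (hP i (muQ 0 0 x) (muQ 1 0 x) * hP j (muQ 0 1 x) (muQ 1 1 x))) ?_)
    (fun x hx => ?_) (fun x hx h => ?_) (fun b' c' x hx h => ?_) (exists_quadPoly_div_zero _)
    (fun _ _ => raviartThomasPoly_zero _)
  · exact WT_of_WA (WA_mono (WA_mul (WA_mul (WA_wt_pow 0 2) (WA_hL_wt 0 hk))
      (WA_mul (WA_homog_muQ 0 i _) (WA_homog_muQ_of_ne h01 j _)))
      (by omega) (by omega) (by omega) (by omega))
  · have : hdivBubbleIV i j k = fun y => (muZ 0 y ^ 2 * phiZ k y) • opVQuadS i j 0 1 y := rfl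
    have hw : muZ 0 (tau x) = wt x := pull0_muZ_zero hx
    rw [this, pull2_smul (fun y => muZ 0 y ^ 2 * phiZ k y), pull2_opVQuadS i j hx, smul_smul,
      ← pull0_phiZ k hx, ← hw]
    rfl
  · rw [hdivBubbleIV, phiZ_quad hk h, mul_zero, zero_smul]; rfl
  · rw [hdivBubbleIV, smul_dotProduct, opVQuadS_face i j h01 b' hx h, smul_zero, Pi.zero_apply,
      zero_dotProduct]

/-- The edge factor is a function of the scaled μ₁ of ξ_a times its gradient, hence curl free. Only
the gradient of φ_j contributes, and it is parallel to that of the scaled μ₁ of ξ_b. -/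
theorem curl_opEQuadS (i : ℕ) {j : ℕ} (hj : 1 ≤ j) (a b : Fin 2) (hx : x ∈ belowApex) :
    ∃ r : ℝ, curl (opEQuadS i j a b) x = r • (grad (muS 1 b) x ⨯₃ grad (muS 1 a) x) := by
  have hP' : (fun y => hP i (muS 0 a y) (muS 1 a y)) = fun y => (legendre i).eval (muS 1 a y) :=
    funext fun y => homog_of_add_eq_one (natDegree_legendre_le i) (muS_add a y)
  have hda := differentiableAt_muS 1 a hx
  have hdb := differentiableAt_muS 1 b hx
  have hdP : DifferentiableAt ℝ (fun y => (legendre i).eval (muS 1 a y)) x :=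
    ((legendre i).differentiable (muS 1 a x)).comp x hda
  have hdphi := differentiableAt_phiE_muS j b hx
  have h : opEQuadS i j a b =ᶠ[𝓝 x] fun y =>
      (phiE j (muS 0 b) (muS 1 b) y * (legendre i).eval (muS 1 a y)) • grad (muS 1 a) y :=
    eventuallyEq_of_belowApex (fun y hy => by
      rw [opEQuadS, opEQuad, opE_muS i a hy, smul_smul, ← congrFun hP' y]) hx
  obtain ⟨r, hr⟩ := exists_grad_phiE (muS_add b) hj hdb
  rw [curl_congr h, curl_smul_grad (hdphi.fun_mul hdP)
    (((contDiffOn_muS 1 a).contDiffAt_of_isOpen isOpen_belowApex hx).of_le two_le_infty),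
    grad_mul hdphi hdP, grad_eval _ hda, hr]
  refine ⟨(legendre i).eval (muS 1 a x) * r, ?_⟩
  simp only [map_add, map_smul, LinearMap.add_apply, LinearMap.smul_apply, cross_self, smul_zero,
    zero_add, smul_smul]

theorem grad_cross_grad_muS_face (hab : a ≠ b) (b' : Fin 2) (hx : x ∈ belowApex)
    (h : faceFun (.tri b' c) x = 0) :
    (grad (muS 1 b) x ⨯₃ grad (muS 1 a) x) ⬝ᵥ faceNormal (.tri b' c) = 0 := by
  have hb : b' = b ∨ b' = a := by omega
  obtain ⟨r, hr⟩ := grad_muS_face 1 hx h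
  rcases hb with rfl | rfl
  · rw [hr, smul_cross_dot_self]
  · rw [hr, cross_smul_dot_self]

/-- By the product rules this is the curl of `hcurlBubbleII`. -/
theorem hdivBubbleI_mem (i : ℕ) {j k : ℕ} (hab : a ≠ b) (hj : 2 ≤ j) (hk : 2 ≤ k) :
    hdivBubbleI a b i j k ∈ U2 (max (max (i + 1) j) k) ∧
      HasTraces2 (hdivBubbleI a b i j k) 0 (fun _ _ => 0) := by
  refine mem_U2_of_pull_curl (contDiffOn_hcurlBubbleII a b i j k)
    (pull_hcurlBubbleII_mem i j hab hk) (fun x hx => ?_)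
    (fun x hx => pull1_hcurlBubbleII a b i j k hx)
    (fun x hx h => ?_) (fun b' c' x hx h => ?_) (exists_quadPoly_div_zero _)
    (fun _ _ => raviartThomasPoly_zero _)
  · have : hcurlBubbleII a b i j k = fun y => (muZ 0 y * phiZ k y) • opEQuadS i j a b y := rfl
    have h1 : DifferentiableAt ℝ (muZ 0) x := (contDiff_muZ 0).differentiable (by simp) x
    have h2 := (contDiffOn_phiZ k).differentiableAt_of_isOpen isOpen_belowApex hx
    rw [this, curl_smul (h1.fun_mul h2)
      ((contDiffOn_opEQuadS i j a b).differentiableAt_of_isOpen isOpen_belowApex hx),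
      grad_mul h1 h2, hdivBubbleI]
  · obtain ⟨r, hr⟩ := exists_grad_phiZ (k := k) (by omega) x
    rw [hdivBubbleI, phiZ_quad hk h, hr, mul_zero, zero_smul, zero_smul, zero_add, add_zero,
      smul_smul, ← neg_neg (Pi.single 2 1 : R3), ← faceNormal_quad, smul_neg, ← neg_smul,
      smul_cross_dot_self, Pi.zero_apply, zero_dotProduct]
  · obtain ⟨r, hr⟩ := curl_opEQuadS i (j := j) (by omega) a b hx
    obtain ⟨s, hs⟩ := opEQuadS_face i hj hab b' hx h
    rw [hdivBubbleI, hr, hs, add_dotProduct, cross_smul_dot_self, smul_dotProduct, smul_dotProduct,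
      grad_cross_grad_muS_face hab b' hx h, smul_zero, smul_zero, add_zero, Pi.zero_apply,
      zero_dotProduct]

/-- As n μ₀^{n-1}∇μ₀ = ∇(μ₀^n), this is the curl of `hcurlBubbleIV`. -/
theorem hdivBubbleIII_mem {i j : ℕ} (hi : 2 ≤ i) (hj : 2 ≤ j) :
    hdivBubbleIII i j ∈ U2 (max i j) ∧ HasTraces2 (hdivBubbleIII i j) 0 (fun _ _ => 0) := by
  refine mem_U2_of_pull_curl (contDiffOn_hcurlBubbleIV i j)
    (pull_hcurlBubbleIV_mem hi) (fun x hx => ?_) (fun x hx => pull1_hcurlBubbleIV i j hx)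
    (fun x hx h => ?_) (fun b' c' x hx h => ?_) (exists_quadPoly_div_zero _)
    (fun _ _ => raviartThomasPoly_zero _)
  · have h1 (y : R3) : DifferentiableAt ℝ (muZ 0) y :=
      (contDiff_muZ 0).differentiable (by simp) y
    have : hcurlBubbleIV i j = fun y => phiQuadS i j 1 0 y •
        grad (fun z => muZ 0 z ^ max i j) y := by
      funext y
      rw [grad_pow _ (h1 y), hcurlBubbleIV]
    rw [this, curl_smul_grad
      ((contDiffOn_phiQuadS i j 1 0).differentiableAt_of_isOpen isOpen_belowApex hx)
      ((contDiff_muZ 0).pow _ |>.contDiffAt.of_le two_le_infty), grad_pow _ (h1 x), map_smul,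
      hdivBubbleIII]
  · rw [hdivBubbleIII, grad_muZ_zero, ← faceNormal_quad, smul_dotProduct,
      dotProduct_comm, dot_cross_self, smul_zero, Pi.zero_apply, zero_dotProduct]
  · obtain ⟨r, hr⟩ := grad_phiQuadS_face hi hj (a := 1) (b := 0) (by decide) b' hx h
    rw [hdivBubbleIII, hr, smul_dotProduct, smul_cross_dot_self, smul_zero, Pi.zero_apply,
      zero_dotProduct]

end Families

end PyramidFE

namespace PyramidFE

open Topology

/-! ### Bubbles of `H(div)` that are curls multiplied by powers of ζ. -/

section Families

variable {a b c : Fin 2} {x : R3}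

theorem differentiableAt_of_curlClass {p : ℕ} {E : R3 → R3} (hE : E ∈ CurlClass p)
    (hx : x ∈ extInf) : DifferentiableAt ℝ E x :=
  (contDiffOn_of_curlClass hE).differentiableAt_of_isOpen isOpen_extInf hx

/-- Moving the power of ζ ↦ 1 - w inside the curl costs the commutator ∇((1-w)^n) × G', which
carries an extra w². With G' of order w² it is of order w⁴, as `DivClass` demands. -/
theorem pull2_pow_smul_curl {G G' : R3 → R3} (hG : ContDiffOn ℝ ∞ G belowApex)
    (hG' : Set.EqOn (pull1 G) G' extInf) (hd : DifferentiableAt ℝ G' x) (hx : x ∈ extInf) (n : ℕ) :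
    pull2 (fun y => muZ 1 y ^ n • curl G y) x
      = -((n * (1 - wt x) ^ (n - 1) * wt x ^ 2) • ((Pi.single 2 1 : R3) ⨯₃ G' x))
        + curl (fun y => (1 - wt y) ^ n • G' y) x := by
  have hwd := differentiableAt_wt hx
  have h1d : DifferentiableAt ℝ (fun y => 1 - wt y) x := (differentiableAt_const _).sub hwd
  have hg1 : grad (fun y => 1 - wt y) x = wt x ^ 2 • Pi.single 2 1 := by
    rw [grad_sub (by fun_prop) hwd, grad_const, grad_wt hx, zero_sub, neg_smul, neg_neg]
  have hw : muZ 1 (tau x) = 1 - wt x := pull0_muZ_one hx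
  rw [pull2_smul (fun y => muZ 1 y ^ n), pull2_curl hG hx,
    curl_congr (eventuallyEq_of_extInf hG' hx), pull0, hw, curl_smul (h1d.fun_pow n) hd,
    grad_pow n h1d, hg1, smul_smul, map_smul, LinearMap.smul_apply]
  abel

theorem pull1_grad_phiE_muS {i : ℕ} (hi : 1 ≤ i) (a : Fin 2) (hx : x ∈ extInf) :
    pull1 (grad (phiE i (muS 0 a) (muS 1 a))) x
      = (Polynomial.derivative (intLegendre i)).eval (muQ 1 a x) • Pi.single a.castSucc 1 := by
  have h : pull0 (phiE i (muS 0 a) (muS 1 a)) =ᶠ[𝓝 x]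
      fun y => (intLegendre i).eval (muQ 1 a y) :=
    eventuallyEq_of_extInf (fun y hy => by
      rw [phiE_eq_eval (muS_add a) hi, ← pull0_muS 1 a hy]; rfl) hx
  rw [pull1_grad hx (differentiableAt_phiE_muS i a (tau_mem_belowApex hx)), grad_congr h,
    grad_eval _ (differentiableAt_muQ _ _ _), grad_muQ_one]

theorem WA_eval_muQ (a c : Fin 2) {P : Polynomial ℝ} {i : ℕ} (hP : P.natDegree ≤ i) :
    (fun x => P.eval (muQ c a x)) ∈ WA a i 0 0 0 := by
  have h (x : R3) : P.eval (muQ c a x) = homog i P (1 - muQ c a x) (muQ c a x) :=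
    (homog_of_add_eq_one hP (sub_add_cancel _ _)).symm
  simp only [h]
  simpa using WA_homog (WA_sub (WA_mono (WA_const a 1) (by omega) le_rfl le_rfl le_rfl)
    (WA_muQ c a)) (WA_muQ c a) i P

theorem WA_eval_muQ_of_ne (hab : a ≠ b) (c : Fin 2) {P : Polynomial ℝ} {i : ℕ}
    (hP : P.natDegree ≤ i) : (fun x => P.eval (muQ c b x)) ∈ WA a 0 i 0 0 := by
  have h := WA_eval_muQ b c hP
  unfold WA at *
  fin_cases a <;> fin_cases b <;> simp at * <;> exact h

theorem natDegree_derivative_intLegendre_le {i : ℕ} (hi : 1 ≤ i) :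
    (Polynomial.derivative (intLegendre i)).natDegree ≤ i - 1 :=
  (Polynomial.natDegree_derivative_le _).trans (Nat.sub_le_sub_right (natDegree_intLegendre_le hi) 1)

/-- The operator V^⊵ is the curl of t₀² φ ∇μ₁, whose pullback is horizontal of order w², so
`pull2_pow_smul_curl` provides the splitting. The positive power of ζ removes the trace on the base.
-/
theorem hdivBubbleVI_mem {i : ℕ} (hab : a ≠ b) (hi : 2 ≤ i) :
    hdivBubbleVI a b i ∈ U2 i ∧ HasTraces2 (hdivBubbleVI a b i) 0 (fun _ _ => 0) := by
  have hfs : ContDiffOn ℝ ∞ (fun y => muZ 0 y ^ 2 * phiE i (muS 0 a) (muS 1 a) y) belowApex :=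
    ((contDiff_muZ 0).contDiffOn.pow 2).mul
      (contDiffOn_phiE (contDiffOn_muS _ _) (contDiffOn_muS _ _) i)
  have hgs := contDiffOn_grad isOpen_belowApex (contDiffOn_muS 1 b)
  set G : R3 → R3 := fun y => (muZ 0 y ^ 2 * phiE i (muS 0 a) (muS 1 a) y) • grad (muS 1 b) y
    with hG
  have hGs : ContDiffOn ℝ ∞ G belowApex := hfs.smul hgs
  have hcurl {x : R3} (hx : x ∈ belowApex) :
      opVRight i (muS 0 a) (muS 1 a) (muS 1 b) (muZ 0) x = curl G x := by
    rw [hG, curl_smul_grad (hfs.differentiableAt_of_isOpen isOpen_belowApex hx)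
      (((contDiffOn_muS 1 b).contDiffAt_of_isOpen isOpen_belowApex hx).of_le two_le_infty)]
    rfl
  set f : R3 → ℝ := fun x => wt x ^ 2 * hL i (muQ 0 a x) (muQ 1 a x) with hf
  have hG' : Set.EqOn (pull1 G) (fun x => f x • Pi.single b.castSucc 1) extInf := fun x hx => by
    have hw : muZ 0 (tau x) = wt x := pull0_muZ_zero hx
    have h (c a) : muS c a (tau x) = muQ c a x := pull0_muS c a hx
    rw [hG, pull1_smul (fun y => muZ 0 y ^ 2 * phiE i (muS 0 a) (muS 1 a) y),
      pull1_grad_muS_one b hx]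
    simp only [pull0, phiE, hw, h, hf]
  obtain ⟨r, hr⟩ := exists_single_two_cross hab
  have hfW : f ∈ WA b 0 i 2 2 := WA_mono (WA_mul (WA_wt_pow b 2) (WA_homog_muQ_of_ne hab.symm i _))
    (by omega) (by omega) (by omega) (by omega)
  have hfW' : f ∈ WA a i 0 2 2 := WA_mono (WA_mul (WA_wt_pow a 2) (WA_homog_muQ a i _))
    (by omega) (by omega) (by omega) (by omega)
  have hsm {x : R3} (hx : x ∈ belowApex) :
      hdivBubbleVI a b i x = muZ 1 x ^ (i - 1) • curl G x := by rw [hdivBubbleVI, hcurl hx]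
  refine mem_U2_of_pull
    ((((contDiff_muZ 1).contDiffOn.pow (i - 1)).smul
      (contDiffOn_curl isOpen_belowApex hGs)).congr fun x => hsm)
    (single_mem_divClass (a := a) (g := fun x =>
      -((((i - 1 : ℕ) : ℝ) * (1 - wt x) ^ (i - 1 - 1) * wt x ^ 2) * f x * r)) ?_)
    (single_mem_curlClass (a := b) (g := fun x => (1 - wt x) ^ (i - 1) * f x) ?_)
    (fun x hx => ?_) (fun x hx h => ?_) (fun b' c' x hx h => ?_) (exists_quadPoly_div_zero _)
    (fun _ _ => raviartThomasPoly_zero _)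
  · exact WA_neg (WA_mono (WA_mul (WA_mul (WA_mul (WA_const_mul _ (WA_pow (WA_one_sub_wt a) _))
      (WA_wt_pow a 2)) hfW') (WA_const a r)) (by omega) (by omega) (by omega) (by omega))
  · exact WA_mono (WA_mul (WA_pow (WA_one_sub_wt b) (i - 1)) hfW)
      (by omega) (by omega) (by omega) (by omega)
  · have h1 : pull2 (hdivBubbleVI a b i) x = pull2 (fun y => muZ 1 y ^ (i - 1) • curl G y) x := by
      rw [pull2, pull2, hsm (tau_mem_belowApex hx)]
    have hd : DifferentiableAt ℝ (fun x => f x • (Pi.single b.castSucc 1 : R3)) x :=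
      differentiableAt_of_curlClass (p := i) (single_mem_curlClass (WA_mono hfW
        (by omega) (by omega) (by omega) (by omega))) hx
    rw [h1, pull2_pow_smul_curl hGs hG' hd hx, map_smul, hr]
    simp only [smul_smul, neg_smul, mul_assoc]
  · have h1 : muZ 1 x = 0 := h
    rw [hdivBubbleVI, h1, zero_pow (by omega), zero_smul]; rfl
  · have hb : b' = b ∨ b' = a := by omega
    rw [hdivBubbleVI, smul_dotProduct, opVRight, Pi.zero_apply, zero_dotProduct]
    rcases hb with rfl | rfl
    · obtain ⟨s, hs⟩ := grad_muS_face 1 hx h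
      rw [hs, cross_smul_dot_self, smul_zero]
    · have h1 : DifferentiableAt ℝ (fun y => muZ 0 y ^ 2) x :=
        ((contDiff_muZ 0).differentiable (by simp) x).fun_pow 2
      obtain ⟨s, hs⟩ := grad_phiE_muS_face (i := i) (by omega) hx h
      rw [grad_mul h1 (differentiableAt_phiE_muS i b' hx), hs, phiE_muS_face hi hx h, zero_smul,
        add_zero, smul_smul, smul_cross_dot_self, smul_zero]

/-- The same splitting as for `hdivBubbleVI_mem`, for a potential with two horizontal components,
both of order w². -/
theorem hdivBubbleV_mem {i j : ℕ} (hi : 2 ≤ i) (hj : 2 ≤ j) :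
    hdivBubbleV i j ∈ U2 (max i j) ∧ HasTraces2 (hdivBubbleV i j) 0 (fun _ _ => 0) := by
  have h01 : (0 : Fin 2) ≠ 1 := by decide
  set φ : R3 → ℝ := phiE i (muS 0 0) (muS 1 0) with hφ
  set ψ : R3 → ℝ := phiE j (muS 0 1) (muS 1 1) with hψ
  have hφs : ContDiffOn ℝ ∞ φ belowApex := contDiffOn_phiE (contDiffOn_muS _ _) (contDiffOn_muS _ _) i
  have hψs : ContDiffOn ℝ ∞ ψ belowApex := contDiffOn_phiE (contDiffOn_muS _ _) (contDiffOn_muS _ _) j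
  set t : R3 → ℝ := fun y => 1 / 2 * muZ 0 y ^ 2 with ht
  have hts : ContDiffOn ℝ ∞ t belowApex :=
    contDiffOn_const.mul ((contDiff_muZ 0).contDiffOn.pow 2)
  set G : R3 → R3 := fun y => (t y * φ y) • grad ψ y + (-(t y * ψ y)) • grad φ y with hG
  have hGs : ContDiffOn ℝ ∞ G belowApex :=
    ((hts.mul hφs).smul (contDiffOn_grad isOpen_belowApex hψs)).add
      ((hts.mul hψs).neg.smul (contDiffOn_grad isOpen_belowApex hφs))
  have hV : hdivBubbleV i j = fun y => muZ 1 y ^ (max i j - 1) • curl G y := by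
    have : G = fun y => (1 / 2 * muZ 0 y ^ 2) • (φ y • grad ψ y - ψ y • grad φ y) := by
      funext y
      ext k
      simp [hG, ht]
      ring
    funext y
    rw [hdivBubbleV, opVLeft, this]
  have hcurl {x : R3} (hx : x ∈ belowApex) : curl G x =
      grad (fun y => t y * φ y) x ⨯₃ grad ψ x + grad (fun y => -(t y * ψ y)) x ⨯₃ grad φ x := by
    have htd := hts.differentiableAt_of_isOpen isOpen_belowApex hx
    have hφd := hφs.differentiableAt_of_isOpen isOpen_belowApex hx
    have hψd := hψs.differentiableAt_of_isOpen isOpen_belowApex hx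
    have hφ2 := (hφs.contDiffAt_of_isOpen isOpen_belowApex hx).of_le two_le_infty
    have hψ2 := (hψs.contDiffAt_of_isOpen isOpen_belowApex hx).of_le two_le_infty
    rw [hG, curl_add ((htd.fun_mul hφd).fun_smul (differentiableAt_grad hψ2))
      ((htd.fun_mul hψd).fun_neg.fun_smul (differentiableAt_grad hφ2)),
      curl_smul_grad (htd.fun_mul hφd) hψ2, curl_smul_grad (htd.fun_mul hψd).fun_neg hφ2]
  set P := intLegendre i
  set Q := intLegendre j
  set f₁ : R3 → ℝ := fun x => 1 / 2 * (wt x ^ 2 * (P.eval (muQ 1 0 x) *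
    (Polynomial.derivative Q).eval (muQ 1 1 x))) with hf₁
  set f₀ : R3 → ℝ := fun x => -(1 / 2 * (wt x ^ 2 * (Q.eval (muQ 1 1 x) *
    (Polynomial.derivative P).eval (muQ 1 0 x)))) with hf₀
  have dP : P.natDegree ≤ i := natDegree_intLegendre_le (by omega)
  have dQ : Q.natDegree ≤ j := natDegree_intLegendre_le (by omega)
  have dP' : (Polynomial.derivative P).natDegree ≤ i - 1 :=
    natDegree_derivative_intLegendre_le (by omega)
  have dQ' : (Polynomial.derivative Q).natDegree ≤ j - 1 :=
    natDegree_derivative_intLegendre_le (by omega)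
  have hf₁W : f₁ ∈ WA 1 (j - 1 : ℕ) i 2 2 := WA_const_mul _ (WA_mono (WA_mul (WA_wt_pow 1 2)
    (WA_mul (WA_eval_muQ_of_ne h01.symm 1 dP) (WA_eval_muQ 1 1 dQ')))
    (by omega) (by omega) (by omega) (by omega))
  have hf₀W : f₀ ∈ WA 0 (i - 1 : ℕ) j 2 2 := WA_neg (WA_const_mul _ (WA_mono (WA_mul (WA_wt_pow 0 2)
    (WA_mul (WA_eval_muQ_of_ne h01 1 dQ) (WA_eval_muQ 0 1 dP')))
    (by omega) (by omega) (by omega) (by omega)))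
  have hG' : Set.EqOn (pull1 G) (fun x => f₁ x • Pi.single (Fin.castSucc 1) 1 +
      f₀ x • Pi.single (Fin.castSucc 0) 1) extInf := fun x hx => by
    have hw : muZ 0 (tau x) = wt x := pull0_muZ_zero hx
    have h (c a) : muS c a (tau x) = muQ c a x := pull0_muS c a hx
    rw [hG, pull1_add (fun y => (t y * φ y) • grad ψ y), pull1_smul (fun y => t y * φ y),
      pull1_smul (fun y => -(t y * ψ y)), hψ, hφ, pull1_grad_phiE_muS (by omega) 1 hx,
      pull1_grad_phiE_muS (by omega) 0 hx, phiE_eq_eval (muS_add 0) (by omega),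
      phiE_eq_eval (muS_add 1) (by omega)]
    simp only [pull0, hw, h, hf₁, hf₀, ht, smul_smul, P, Q]
    congr 2 <;> ring
  obtain ⟨r, hr⟩ := exists_single_two_cross h01
  obtain ⟨s, hs⟩ := exists_single_two_cross h01.symm
  set d : R3 → ℝ := fun x =>
    ((max i j - 1 : ℕ) : ℝ) * (1 - wt x) ^ (max i j - 1 - 1) * wt x ^ 2 with hd
  have hdW (a : Fin 2) : d ∈ WA a 0 0 2 (max i j) :=
    WA_mono (WA_mul (WA_const_mul _ (WA_pow (WA_one_sub_wt a) _)) (WA_wt_pow a 2))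
      (by omega) (by omega) (by omega) (by omega)
  have flip {d e : ℤ} {lo hi : ℕ} {g : R3 → ℝ} (h : g ∈ WA 1 d e lo hi) : g ∈ WA 0 e d lo hi := by
    simpa [WA] using h
  have flip' {d e : ℤ} {lo hi : ℕ} {g : R3 → ℝ} (h : g ∈ WA 0 d e lo hi) :
      g ∈ WA 1 e d lo hi := by simpa [WA] using h
  rw [hV]
  refine mem_U2_of_pull
    (((contDiff_muZ 1).contDiffOn.pow (max i j - 1)).smul (contDiffOn_curl isOpen_belowApex hGs))
    (divClass_add
      (single_mem_divClass (a := 0) (g := fun x => -(d x * f₁ x * r)) ?_)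
      (single_mem_divClass (a := 1) (g := fun x => -(d x * f₀ x * s)) ?_))
    (curlClass_add
      (single_mem_curlClass (a := 1) (g := fun x => (1 - wt x) ^ (max i j - 1) * f₁ x) ?_)
      (single_mem_curlClass (a := 0) (g := fun x => (1 - wt x) ^ (max i j - 1) * f₀ x) ?_))
    (fun x hx => ?_) (fun x hx h => ?_) (fun b' c' x hx h => ?_) (exists_quadPoly_div_zero _)
    (fun _ _ => raviartThomasPoly_zero _)
  · exact WA_neg (WA_mono (WA_mul (WA_mul (hdW 0) (flip hf₁W)) (WA_const 0 r))
      (by omega) (by omega) (by omega) (by omega))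
  · exact WA_neg (WA_mono (WA_mul (WA_mul (hdW 1) (flip' hf₀W)) (WA_const 1 s))
      (by omega) (by omega) (by omega) (by omega))
  · exact WA_mono (WA_mul (WA_pow (WA_one_sub_wt 1) _) hf₁W)
      (by omega) (by omega) (by omega) (by omega)
  · exact WA_mono (WA_mul (WA_pow (WA_one_sub_wt 0) _) hf₀W)
      (by omega) (by omega) (by omega) (by omega)
  · have hdiff := differentiableAt_of_curlClass (p := max i j) (x := x) (curlClass_add
      (single_mem_curlClass (a := 1) (WA_mono hf₁W (by omega) (by omega) (by omega) (by omega)))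
      (single_mem_curlClass (a := 0) (WA_mono hf₀W (by omega) (by omega) (by omega) (by omega)))) hx
    rw [pull2_pow_smul_curl hGs hG' hdiff hx, map_add, map_smul, map_smul, hr, hs]
    simp only [smul_add, smul_smul, neg_smul, neg_add, hd, mul_assoc]
  · have h1 : muZ 1 x = 0 := h
    simp only [h1, zero_pow (show max i j - 1 ≠ 0 by omega), zero_smul, Pi.zero_apply]
  · have htd := hts.differentiableAt_of_isOpen isOpen_belowApex hx
    have hφd := hφs.differentiableAt_of_isOpen isOpen_belowApex hx
    have hψd := hψs.differentiableAt_of_isOpen isOpen_belowApex hx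
    have hneg : (fun y => -(t y * ψ y)) = fun y => (-t y) * ψ y := by funext y; ring
    have hb : b' = 1 ∨ b' = 0 := by omega
    -- On each triangle face one of φ, ψ vanishes and has a normal gradient, so both cross products
    -- contain a factor parallel to the normal.
    simp only [smul_dotProduct, hcurl hx, add_dotProduct, Pi.zero_apply, zero_dotProduct]
    rcases hb with rfl | rfl
    · obtain ⟨m, hm⟩ := grad_phiE_muS_face (i := j) (by omega) hx h
      have h0 : ψ x = 0 := phiE_muS_face hj hx h
      rw [hneg, grad_mul htd.fun_neg hψd, h0, show grad ψ x = _ from hm, zero_smul, add_zero,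
        smul_smul, smul_cross_dot_self, cross_smul_dot_self, add_zero, smul_zero]
    · obtain ⟨m, hm⟩ := grad_phiE_muS_face (i := i) (by omega) hx h
      have h0 : φ x = 0 := phiE_muS_face hi hx h
      rw [grad_mul htd hφd, h0, show grad φ x = _ from hm, zero_smul, add_zero,
        smul_smul, smul_cross_dot_self, cross_smul_dot_self, add_zero, smul_zero]

end Families

/-! ### `L²` shape functions -/

/-- The triple product of gradients is 1, and the determinant of the Jacobian alone supplies w⁴. -/
theorem l2Interior_mem (i j k : ℕ) :
    l2Interior i j k ∈ U3 (max (max (i + 1) (j + 1)) (k + 1)) := by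
  have hdet (x : R3) : (grad (nu 1 0) x ⨯₃ grad (nu 1 1) x) ⬝ᵥ grad (muZ 1) x = 1 := by
    rw [grad_nu_one, grad_nu_one, grad_muZ_one, single_zero_cross_single_one]
    simp
  have hl : l2Interior i j k = fun x => hP i (muS 0 0 x) (muS 1 0 x) *
      hP j (muS 0 1 x) (muS 1 1 x) * hP k (muZ 0 x) (muZ 1 x) := by
    funext x; rw [l2Interior, hdet, mul_one]
  rw [hl]
  refine mem_U3_of_pull ((((contDiffOn_muS 0 0).homog (contDiffOn_muS 1 0) _ _).mul
    ((contDiffOn_muS 0 1).homog (contDiffOn_muS 1 1) _ _)).mul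
    ((contDiff_muZ 0).contDiffOn.homog (contDiff_muZ 1).contDiffOn _ _))
    (WT_congr (g := fun x => wt x ^ 4 * (hP i (muQ 0 0 x) (muQ 1 0 x) *
      hP j (muQ 0 1 x) (muQ 1 1 x) * hP k (wt x) (1 - wt x))) ?_ fun x hx => ?_)
  · exact WT_of_WA (WA_mono (WA_mul (WA_wt_pow 0 4) (WA_mul (WA_mul (WA_homog_muQ 0 i _)
      (WA_homog_muQ_of_ne (by decide) j _)) (WA_homog_wt 0 k _)))
      (by omega) (by omega) (by omega) (by omega))
  · have h (c a) : muS c a (tau x) = muQ c a x := pull0_muS c a hx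
    have h0 : muZ 0 (tau x) = wt x := pull0_muZ_zero hx
    have h1 : muZ 1 (tau x) = 1 - wt x := pull0_muZ_one hx
    rw [pull3_apply hx]
    simp only [h, h0, h1]

end PyramidFE

namespace PyramidFE

open Topology

/-! ### The identities for the triangle face functions of `H(div)` -/

section Identities

variable {x : R3} {s₀ s₁ s₂ μ : R3 → ℝ}

theorem hP_zero (a b : ℝ) : hP 0 a b = 1 := by simp [hP, homog, legendre, legendreClassical]

theorem hPP_zero_zero (a b c : ℝ) : hPP 0 0 a b c = 1 := by
  simp [hPP, hP_zero, hPJ, homog, jacobi]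

theorem hPP_smul (i j : ℕ) (t a b c : ℝ) :
    hPP i j (t * a) (t * b) (t * c) = t ^ (i + j) * hPP i j a b c := by
  rw [hPP, hPP, hP, hP, hPJ, hPJ, ← mul_add, homog_smul, homog_smul, pow_add]
  ring

/-- Insert ∇(μ s_k) = μ∇s_k + s_k∇μ in the vector part. The terms in ∇μ × ∇s₂ cancel, ∇μ × ∇μ
vanishes, and everything else has a factor μ to spare. -/
theorem inv_smul_opVTri (i j : ℕ) (h₀ : DifferentiableAt ℝ s₀ x) (h₁ : DifferentiableAt ℝ s₁ x)
    (hμ : DifferentiableAt ℝ μ x) (h : μ x ≠ 0) :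
    (μ x)⁻¹ • opVTri i j (fun y => μ y * s₀ y) (fun y => μ y * s₁ y) s₂ x
      = hPP i j (μ x * s₀ x) (μ x * s₁ x) (s₂ x) •
        (μ x • opVTri 0 0 s₀ s₁ s₂ x + s₂ x • (grad μ x ⨯₃ opE 0 s₀ s₁ x)) := by
  rw [opVTri, opVTri, opE, hPP_zero_zero, hP_zero, one_smul, one_smul, smul_comm, grad_mul hμ h₀,
    grad_mul hμ h₁]
  congr 1
  rw [inv_smul_eq_iff₀ h]
  ext k
  fin_cases k <;> simp [cross_apply] <;> ring

theorem contDiff_hPP (i j : ℕ) : ContDiff ℝ ∞ fun v : R3 => hPP i j (v 0) (v 1) (v 2) := by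
  have c (k : Fin 3) : ContDiff ℝ ∞ fun v : R3 => v k := by fun_prop
  exact ((contDiff_homog i _).comp ((c 0).prodMk (c 1))).mul
    ((contDiff_homog j _).comp (((c 0).add (c 1)).prodMk (c 2)))

/-- Euler's relation for homogeneous functions. -/
theorem sum_mul_pd_of_homogeneous {F : R3 → ℝ} {n : ℕ} {v : R3} (hF : DifferentiableAt ℝ F v)
    (h : ∀ t : ℝ, F (t • v) = t ^ n * F v) : ∑ k, v k * pd k F v = n * F v := by
  have h1 : HasDerivAt (fun t : ℝ => t • v) v 1 := by
    simpa using (hasDerivAt_id (1 : ℝ)).smul_const v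
  have h2 : HasDerivAt (fun t : ℝ => F (t • v)) (fderiv ℝ F v v) 1 := by
    have := HasFDerivAt.comp_hasDerivAt (1 : ℝ) (l := F) (f := fun t : ℝ => t • v)
      (l' := fderiv ℝ F v) (by simpa using hF.hasFDerivAt) h1
    exact this
  have h3 : HasDerivAt (fun t : ℝ => F (t • v)) (n * F v) 1 := by
    simp only [h]
    simpa using (hasDerivAt_pow n (1 : ℝ)).mul_const (F v)
  have h4 : fderiv ℝ F v v = fderiv ℝ F v (∑ k, Pi.single k (v k)) := by
    rw [Finset.univ_sum_single]
  rw [← h2.unique h3, h4, map_sum]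
  refine Finset.sum_congr rfl fun k _ => ?_
  have : (Pi.single k (v k) : R3) = v k • Pi.single k 1 := by
    rw [← Pi.single_smul, smul_eq_mul, mul_one]
  rw [this, map_smul, smul_eq_mul, pd]

/-- Eliminating s₂ makes the three cross products equal, with coefficients adding up to 1. -/
theorem opVTri_zero_zero_of_add_eq_one (h₀ : DifferentiableAt ℝ s₀ x)
    (h₁ : DifferentiableAt ℝ s₁ x) (h : ∀ᶠ y in 𝓝 x, s₀ y + s₁ y + s₂ y = 1) :
    grad s₂ x = -grad s₀ x - grad s₁ x ∧ opVTri 0 0 s₀ s₁ s₂ x = grad s₀ x ⨯₃ grad s₁ x := by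
  have e : s₂ =ᶠ[𝓝 x] fun y => (1 - s₀ y) - s₁ y := h.mono fun y hy => by linarith
  have hg : grad s₂ x = -grad s₀ x - grad s₁ x := by
    rw [grad_congr e, grad_sub (by fun_prop) h₁, grad_sub (by fun_prop) h₀, grad_const, zero_sub]
  have h2 : s₂ x = 1 - s₀ x - s₁ x := e.eq_of_nhds
  refine ⟨hg, ?_⟩
  rw [opVTri, hPP_zero_zero, one_smul, hg, h2]
  ext k
  fin_cases k <;> simp [cross_apply] <;> ring

theorem div_inv_smul_opVTri (i j : ℕ) (h₀ : ContDiffAt ℝ 2 s₀ x) (h₁ : ContDiffAt ℝ 2 s₁ x)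
    (h₂ : ContDiffAt ℝ 2 s₂ x) (hμ : ContDiffAt ℝ 2 μ x) (hne : μ x ≠ 0)
    (h : ∀ᶠ y in 𝓝 x, s₀ y + s₁ y + s₂ y = 1) :
    PyramidFE.div
        (fun z => (μ z)⁻¹ • opVTri i j (fun y => μ y * s₀ y) (fun y => μ y * s₁ y) s₂ z) x
      = hPP i j (μ x * s₀ x) (μ x * s₁ x) (s₂ x) *
        (grad μ x ⬝ᵥ (((i : ℝ) + (j : ℝ) + 3) • (opE 0 s₀ s₁ x ⨯₃ grad s₂ x)
          - opVTri 0 0 s₀ s₁ s₂ x)) := by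
  have diff {f : R3 → ℝ} {y : R3} (hf : ContDiffAt ℝ 2 f y) : DifferentiableAt ℝ f y :=
    hf.differentiableAt (by simp)
  have ev {f : R3 → ℝ} (hf : ContDiffAt ℝ 2 f x) : ∀ᶠ y in 𝓝 x, ContDiffAt ℝ 2 f y :=
    hf.eventually (by simp)
  have d0 := diff h₀
  have d1 := diff h₁
  have d2 := diff h₂
  have dμ := diff hμ
  set s : R3 → R3 := fun y => ![μ y * s₀ y, μ y * s₁ y, s₂ y] with hs
  set F : R3 → ℝ := fun v => hPP i j (v 0) (v 1) (v 2) with hF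
  have hFd : DifferentiableAt ℝ F (s x) := (contDiff_hPP i j).differentiable (by simp) _
  have hsd : DifferentiableAt ℝ s x := by
    rw [differentiableAt_pi]
    intro k
    fin_cases k
    exacts [dμ.mul d0, dμ.mul d1, d2]
  set H : R3 → ℝ := fun y => hPP i j (μ y * s₀ y) (μ y * s₁ y) (s₂ y) with hH
  have hHd : DifferentiableAt ℝ H x := hFd.comp x hsd
  -- Near x the field is a sum of terms f ∇g × ∇h, so that its divergence consists of triple
  -- products of first derivatives.
  have e : (fun z => (μ z)⁻¹ • opVTri i j (fun y => μ y * s₀ y) (fun y => μ y * s₁ y) s₂ z)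
      =ᶠ[𝓝 x] fun z => (H z * μ z) • (grad s₀ z ⨯₃ grad s₁ z)
        + ((H z * (s₂ z * s₀ z)) • (grad μ z ⨯₃ grad s₁ z)
        + (-(H z * (s₂ z * s₁ z))) • (grad μ z ⨯₃ grad s₀ z)) := by
    filter_upwards [ev h₀, ev h₁, ev hμ, hμ.continuousAt.eventually_ne hne,
      eventually_eventually_nhds.2 h] with z z0 z1 zμ zne zs
    rw [inv_smul_opVTri i j (diff z0) (diff z1) (diff zμ) zne,
      (opVTri_zero_zero_of_add_eq_one (diff z0) (diff z1) zs).2, opE, hP_zero, one_smul]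
    simp only [map_sub, map_smul, hH]
    ext k
    simp
    ring
  have dH2 : DifferentiableAt ℝ (fun z => H z * (s₂ z * s₀ z)) x := hHd.mul (d2.mul d0)
  have dH3 : DifferentiableAt ℝ (fun z => -(H z * (s₂ z * s₁ z))) x := (hHd.mul (d2.mul d1)).neg
  have dc {f g : R3 → ℝ} (hf : ContDiffAt ℝ 2 f x) (hg : ContDiffAt ℝ 2 g x) :
      DifferentiableAt ℝ (fun z => grad f z ⨯₃ grad g z) x :=
    differentiableAt_cross (differentiableAt_grad hf) (differentiableAt_grad hg)
  have hneg : grad (fun z => -(H z * (s₂ z * s₁ z))) x = -grad (fun z => H z * (s₂ z * s₁ z)) x := by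
    have : (fun z => -(H z * (s₂ z * s₁ z))) = fun z => 0 - H z * (s₂ z * s₁ z) := by
      funext z; ring
    rw [this, grad_sub (differentiableAt_const _) (hHd.fun_mul (d2.fun_mul d1)), grad_const,
      zero_sub]
  obtain ⟨hg2, hV⟩ := opVTri_zero_zero_of_add_eq_one d0 d1 h
  have hgH : grad H x = pd 0 F (s x) • grad (fun y => μ y * s₀ y) x
      + pd 1 F (s x) • grad (fun y => μ y * s₁ y) x + pd 2 F (s x) • grad s₂ x := by
    ext k
    have := pd_comp (k := k) hFd hsd
    rw [Fin.sum_univ_three] at this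
    simp only [Pi.add_apply, Pi.smul_apply, smul_eq_mul]
    exact this.trans (by simp only [hs, grad]; simp; ring)
  -- The polynomial [P_i, P_j^{2i+1}] is homogeneous of degree i + j in its three arguments; this
  -- turns its partial derivatives into the constant i + j + 3.
  have euler := sum_mul_pd_of_homogeneous (n := i + j) hFd fun t => hPP_smul i j t _ _ _
  rw [Fin.sum_univ_three] at euler
  have hFs : F (s x) = H x := rfl
  have s0x : s x 0 = μ x * s₀ x := rfl
  have s1x : s x 1 = μ x * s₁ x := rfl
  have s2x : s x 2 = s₂ x := rfl
  have hsum : s₂ x = 1 - s₀ x - s₁ x := by linarith [h.self_of_nhds]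
  rw [hFs, s0x, s1x, s2x] at euler
  rw [div_congr e, div_add ((hHd.fun_mul dμ).fun_smul (dc h₀ h₁))
      ((dH2.fun_smul (dc hμ h₁)).fun_add (dH3.fun_smul (dc hμ h₀))),
    div_add (dH2.fun_smul (dc hμ h₁)) (dH3.fun_smul (dc hμ h₀)),
    div_smul_cross_grad (hHd.fun_mul dμ) h₀ h₁, div_smul_cross_grad dH2 hμ h₁,
    div_smul_cross_grad dH3 hμ h₀, hneg, grad_mul hHd dμ, grad_mul hHd (d2.fun_mul d0),
    grad_mul hHd (d2.fun_mul d1), grad_mul d2 d0, grad_mul d2 d1, hgH, grad_mul dμ d0,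
    grad_mul dμ d1, hg2, hV, opE, hP_zero, one_smul]
  change _ = H x * _
  generalize grad s₀ x = u at *
  generalize grad s₁ x = v at *
  generalize grad μ x = m at *
  generalize pd 0 F (s x) = A at *
  generalize pd 1 F (s x) = B at *
  generalize pd 2 F (s x) = C at *
  generalize H x = η at *
  rw [hsum] at euler ⊢
  push_cast at euler
  simp only [dot_apply, cross_apply_zero, cross_apply_one, cross_apply_two, Pi.add_apply,
    Pi.sub_apply, Pi.smul_apply, Pi.neg_apply, smul_eq_mul]
  -- The coefficient is the determinant of ∇μ, ∇s₀, ∇s₁ times s₀ + s₁ = 1 - s₂.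
  linear_combination ((m 0 * (u 1 * v 2 - u 2 * v 1) + m 1 * (u 2 * v 0 - u 0 * v 2)
    + m 2 * (u 0 * v 1 - u 1 * v 0)) * (s₀ x + s₁ x)) * euler

end Identities

/-! ### The triangle face functions of `H(div)` -/

section TriFace

variable {a b c : Fin 2} {x : R3}

theorem lam_vertexAlong (hab : a ≠ b) (k c : Fin 2) (hx : x ∈ belowApex) :
    lam (vertexAlong a k c) x = muS c b x * nu k.castSucc a x := by
  have hb : (a = 0 ∧ b = 1) ∨ (a = 1 ∧ b = 0) := by omega
  rcases hb with ⟨rfl, rfl⟩ | ⟨rfl, rfl⟩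
  · exact lam_baseVertex ![k, c] 1 hx
  · exact lam_baseVertex ![c, k] 0 hx

theorem muS_pos (c b : Fin 2) (hx : x ∈ Omega) : 0 < muS c b x := by
  have h : 0 < x b.castSucc ∧ x b.castSucc + x 2 < 1 := by
    obtain ⟨h0, h1, -, h3, h4⟩ := hx
    have hb : b = 0 ∨ b = 1 := by omega
    rcases hb with rfl | rfl
    exacts [⟨h0, h3⟩, ⟨h1, h4⟩]
  have h2 : 0 < 1 - x 2 := by linarith
  fin_cases c
  · simp only [muS]
    simp only [Fin.zero_eta, Matrix.cons_val_zero, sub_pos]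
    rw [div_lt_one h2]
    linarith
  · exact div_pos h.1 h2

theorem opVTri_congr {s₀ s₁ s₂ t₀ t₁ : R3 → ℝ} (h₀ : s₀ =ᶠ[𝓝 x] t₀) (h₁ : s₁ =ᶠ[𝓝 x] t₁)
    (i j : ℕ) : opVTri i j s₀ s₁ s₂ x = opVTri i j t₀ t₁ s₂ x := by
  simp only [opVTri, h₀.eq_of_nhds, h₁.eq_of_nhds, grad_congr h₀, grad_congr h₁]

/-- In Ω both λ_d and λ_e factor as μ ν_k and μ is positive, so `inv_smul_opVTri` applies pointwise.
-/
theorem hdivTriFace_eqOn (c : Fin 2) (i j : ℕ) (hab : a ≠ b) :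
    Set.EqOn (hdivTriFace a b c i j) (hdivTriFaceReg a b c i j) Omega := fun x hx => by
  have hx' := Omega_subset_belowApex hx
  have e (k : Fin 2) : lam (vertexAlong a k c) =ᶠ[𝓝 x] fun y => muS c b y * nu k.castSucc a y :=
    eventuallyEq_of_belowApex (fun y => lam_vertexAlong hab k c) hx'
  have h4 : lam 4 = nu 2 a := rfl
  rw [hdivTriFace, hdivTriFaceReg, opVTri_congr (e 0) (e 1), h4,
    inv_smul_opVTri i j (differentiableAt_nu _ _ _) (differentiableAt_nu _ _ _)
      (differentiableAt_muS c b hx') (muS_pos c b hx).ne']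
  rfl

/-- The form suited to pulling back: scalar coefficients times cross products of fields with known
`pull1`. -/
theorem hdivTriFaceReg_eq (a b c : Fin 2) (i j : ℕ) : hdivTriFaceReg a b c i j = fun x =>
    (1 / 2 * (muS c b x * hPP i j (nu 0 a x) (nu 1 a x) (nu 2 a x)
      + muS c b x * hPP i j (muS c b x * nu 0 a x) (muS c b x * nu 1 a x) (nu 2 a x))) •
        (grad (nu 1 a) x ⨯₃ grad (nu 2 a) x)
    + (1 / 2 * (hPP i j (muS c b x * nu 0 a x) (muS c b x * nu 1 a x) (nu 2 a x) * nu 2 a x)) •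
        (grad (muS c b) x ⨯₃ opE 0 (nu 0 a) (nu 1 a) x) := by
  funext x
  rw [hdivTriFaceReg, opVTri_nu, opVTri_nu, hPP_zero_zero, grad_nu_one, grad_nu_two]
  ext k
  simp
  ring

theorem contDiffOn_hPP {U : Set R3} {s₀ s₁ s₂ : R3 → ℝ} (h₀ : ContDiffOn ℝ ∞ s₀ U)
    (h₁ : ContDiffOn ℝ ∞ s₁ U) (h₂ : ContDiffOn ℝ ∞ s₂ U) (i j : ℕ) :
    ContDiffOn ℝ ∞ (fun x => hPP i j (s₀ x) (s₁ x) (s₂ x)) U :=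
  (h₀.homog h₁ _ _).mul ((h₀.add h₁).homog h₂ _ _)

theorem contDiffOn_hdivTriFaceReg (a b c : Fin 2) (i j : ℕ) :
    ContDiffOn ℝ ∞ (hdivTriFaceReg a b c i j) belowApex := by
  have hn (k : Fin 3) : ContDiffOn ℝ ∞ (nu k a) belowApex := (contDiff_nu k a).contDiffOn
  have hm := contDiffOn_muS c b
  have hH := contDiffOn_hPP (hm.mul (hn 0)) (hm.mul (hn 1)) (hn 2) i j
  rw [hdivTriFaceReg_eq]
  exact ((contDiffOn_const.mul ((hm.mul (contDiffOn_hPP (hn 0) (hn 1) (hn 2) i j)).add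
    (hm.mul hH))).smul (contDiffOn_cross (contDiffOn_grad isOpen_belowApex (hn 1))
      (contDiffOn_grad isOpen_belowApex (hn 2)))).add
    ((contDiffOn_const.mul (hH.mul (hn 2))).smul (contDiffOn_cross
      (contDiffOn_grad isOpen_belowApex hm) (contDiffOn_opE isOpen_belowApex (hn 0) (hn 1) 0)))

end TriFace

end PyramidFE

namespace PyramidFE

open Topology

/-! ### Membership and traces of the triangle face functions of `H(div)`. -/

section TriFaceMem

variable {a b c : Fin 2} {x : R3}

/-- The number ε, which is the slope of μ_c, lets both values of c be treated together. Besides the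
polynomials the powers are w³ horizontally and w² vertically, one short of `DivClass`. -/
theorem pull2_hdivTriFaceReg (c : Fin 2) (i j : ℕ) {ε : ℝ}
    (hε : ∀ y, grad (muQ c b) y = ε • Pi.single b.castSucc 1) (hx : x ∈ extInf) :
    pull2 (hdivTriFaceReg a b c i j) x =
      (1 / 2 * (muQ c b x * (hP i (wt x * muQ 0 a x) (wt x * muQ 1 a x) *
          hPJ (2 * i + 1) j (wt x) (1 - wt x))
        + muQ c b x * (hP i (muQ c b x * (wt x * muQ 0 a x)) (muQ c b x * (wt x * muQ 1 a x)) *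
          hPJ (2 * i + 1) j (muQ c b x * wt x) (1 - wt x))) * wt x ^ 3) •
        ((Pi.single a.castSucc 1 : R3) ⨯₃ Pi.single 2 1)
      + (1 / 2 * (hP i (muQ c b x * (wt x * muQ 0 a x)) (muQ c b x * (wt x * muQ 1 a x)) *
          hPJ (2 * i + 1) j (muQ c b x * wt x) (1 - wt x) * (1 - wt x)) * (ε * wt x ^ 2)) •
        ((Pi.single b.castSucc 1 : R3) ⨯₃ Pi.single a.castSucc 1) := by
  have hτ := tau_mem_belowApex hx
  have hm : muS c b (tau x) = muQ c b x := pull0_muS c b hx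
  have h0 : nu 0 a (tau x) = wt x * muQ 0 a x := pull0_nu 0 a hx
  have h1 : nu 1 a (tau x) = wt x * muQ 1 a x := pull0_nu 1 a hx
  have h2 : nu 2 a (tau x) = 1 - wt x := pull0_nu_two a hx
  have e1 := eventuallyEq_of_extInf (fun y => pull0_nu 1 a) hx
  have e2 := eventuallyEq_of_extInf (fun y => pull0_nu_two a) hx
  have em := eventuallyEq_of_extInf (fun y => pull0_muS c b) hx
  have g1 : pull1 (grad (nu 1 a)) x =
      wt x • Pi.single a.castSucc 1 + (-(muQ 1 a x * wt x ^ 2)) • Pi.single 2 1 := by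
    rw [pull1_grad hx (differentiableAt_nu _ _ _), grad_congr (f := pull0 (nu 1 a)) e1,
      grad_mul (differentiableAt_wt hx) (differentiableAt_muQ _ _ _), grad_wt hx]
    have : grad (muQ (1 : Fin 2) a) x = Pi.single a.castSucc 1 := grad_muQ_one a x
    rw [this, smul_smul]
    ring_nf
  have g2 : pull1 (grad (nu 2 a)) x = wt x ^ 2 • Pi.single 2 1 := by
    rw [pull1_grad hx (differentiableAt_nu _ _ _), grad_congr e2,
      grad_sub (by fun_prop) (differentiableAt_wt hx), grad_const, grad_wt hx, zero_sub, neg_smul,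
      neg_neg]
  have gm : pull1 (grad (muS c b)) x = ε • Pi.single b.castSucc 1 := by
    rw [pull1_grad hx (differentiableAt_muS c b hτ), grad_congr em, hε]
  have gE : pull1 (opE 0 (nu 0 a) (nu 1 a)) x = wt x ^ 2 • Pi.single a.castSucc 1 := by
    rw [pull1_opE_nu 0 a hx, hP_zero, mul_one, zero_add]
  have hs1 : muQ c b x * (wt x * muQ 0 a x) + muQ c b x * (wt x * muQ 1 a x)
      = muQ c b x * wt x := by linear_combination muQ c b x * wt x * muQ_add a x
  have hs2 : wt x * muQ 0 a x + wt x * muQ 1 a x = wt x := by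
    linear_combination wt x * muQ_add a x
  rw [hdivTriFaceReg_eq, pull2_add
      (fun x => (1 / 2 * (muS c b x * hPP i j (nu 0 a x) (nu 1 a x) (nu 2 a x)
        + muS c b x * hPP i j (muS c b x * nu 0 a x) (muS c b x * nu 1 a x) (nu 2 a x))) •
          (grad (nu 1 a) x ⨯₃ grad (nu 2 a) x)),
    pull2_smul (fun x => 1 / 2 * (muS c b x * hPP i j (nu 0 a x) (nu 1 a x) (nu 2 a x)
        + muS c b x * hPP i j (muS c b x * nu 0 a x) (muS c b x * nu 1 a x) (nu 2 a x))),
    pull2_smul (fun x => 1 / 2 * (hPP i j (muS c b x * nu 0 a x) (muS c b x * nu 1 a x) (nu 2 a x)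
      * nu 2 a x)),
    pull2_cross hx, pull2_cross hx, g1, g2, gm, gE]
  simp only [pull0, hm, h0, h1, h2, hPP, hs1, hs2, map_smul, map_add, LinearMap.smul_apply,
    LinearMap.add_apply, cross_self, smul_zero, add_zero, smul_smul]
  congr 2
  ring

theorem WA_muQ_mul_wt (c : Fin 2) (b : Fin 2) (lo : ℕ) (hlo : lo ≤ 1) :
    (fun x => muQ c b x * wt x) ∈ WA b 1 0 lo 1 :=
  WA_mono (WA_mul (WA_muQ c b) (WA_wt b)) (by omega) (by omega) (by omega) (by omega)

theorem WA_homog_muQ_mul_wt (c b : Fin 2) (j : ℕ) (ψ : Polynomial ℝ) :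
    (fun x => homog j ψ (muQ c b x * wt x) (1 - wt x)) ∈ WA b j 0 0 j := by
  simpa using WA_homog (WA_muQ_mul_wt c b 0 (by omega))
    (WA_mono (WA_one_sub_wt b) (by omega) le_rfl le_rfl le_rfl) j ψ

/-- On the face itself μ = 1, so the two halves of the average agree, and ∇μ × E is tangential
because ∇μ is normal. On the opposite face μ = 0. On the faces of the axis a, E is normal, and on
the base ν₂ = 0. -/
theorem hdivTriFaceReg_traces (c : Fin 2) (i j : ℕ) (hab : a ≠ b) :
    (∀ x ∈ belowApex, faceFun .quad x = 0 →
      hdivTriFaceReg a b c i j x ⬝ᵥ faceNormal .quad = (0 : R3 → R3) x ⬝ᵥ faceNormal .quad) ∧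
    ∀ b' c', ∀ x ∈ belowApex, faceFun (.tri b' c') x = 0 →
      hdivTriFaceReg a b c i j x ⬝ᵥ faceNormal (.tri b' c')
        = onlyOn b c (opVTri i j (nu 0 a) (nu 1 a) (nu 2 a)) b' c' x
          ⬝ᵥ faceNormal (.tri b' c') := by
  refine ⟨fun x hx h => ?_, forall_onlyOn (P := fun b' c' t => ∀ x ∈ belowApex,
      faceFun (.tri b' c') x = 0 → hdivTriFaceReg a b c i j x ⬝ᵥ faceNormal (.tri b' c')
        = t x ⬝ᵥ faceNormal (.tri b' c')) hab
      (fun x hx h => ?_) (fun c' hc x hx h => ?_) (fun c' x hx h => ?_)⟩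
  · have h2 : nu 2 a x = 0 := h
    simp only [hdivTriFaceReg_eq]
    rw [h2, mul_zero, mul_zero, zero_smul, add_zero, smul_dotProduct,
      grad_nu_two, faceNormal_quad, dotProduct_neg, dotProduct_comm, dot_cross_self, Pi.zero_apply,
      zero_dotProduct, neg_zero, smul_zero]
  · obtain ⟨r, hr⟩ := grad_muS_face c hx h
    simp only [hdivTriFaceReg_eq]
    rw [muS_eq_one hx h, hr, add_dotProduct, smul_dotProduct, smul_dotProduct,
      smul_cross_dot_self, smul_zero, add_zero, opVTri_nu, smul_dotProduct, grad_nu_one,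
      grad_nu_two]
    congr 1
    simp only [one_mul]
    ring
  · obtain ⟨r, hr⟩ := grad_muS_face c hx h
    simp only [hdivTriFaceReg_eq]
    rw [muS_eq_zero hx h (Ne.symm hc), hr, add_dotProduct, smul_dotProduct,
      smul_dotProduct, smul_cross_dot_self, smul_zero, add_zero, zero_mul, zero_mul, add_zero,
      mul_zero, zero_smul, Pi.zero_apply, zero_dotProduct]
  · obtain ⟨r, hr⟩ := opE_nu_face 0 h
    have h0 : ((Pi.single a.castSucc 1 : R3) ⨯₃ Pi.single 2 1) ⬝ᵥ faceNormal (.tri a c') = 0 := by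
      have hc : c' = 0 ∨ c' = 1 := by omega
      rcases hc with rfl | rfl
      · have : faceNormal (.tri a 0) = -Pi.single a.castSucc 1 := rfl
        rw [this, dotProduct_neg, dotProduct_comm, dot_self_cross, neg_zero]
      · have : faceNormal (.tri a 1) = Pi.single a.castSucc 1 + Pi.single 2 1 := rfl
        rw [this, dotProduct_add, dotProduct_comm, dot_self_cross, dotProduct_comm, dot_cross_self,
          zero_add]
    simp only [hdivTriFaceReg_eq]
    rw [hr, grad_nu_one, grad_nu_two, add_dotProduct, smul_dotProduct,
      smul_dotProduct, cross_smul_dot_self, h0, smul_zero, smul_zero, add_zero, Pi.zero_apply,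
      zero_dotProduct]

theorem exists_cross_two {a b : Fin 2} (hab : a ≠ b) :
    (∃ r : ℝ, (Pi.single a.castSucc 1 : R3) ⨯₃ Pi.single 2 1 = r • Pi.single b.castSucc 1) ∧
      ∃ r : ℝ, (Pi.single b.castSucc 1 : R3) ⨯₃ Pi.single a.castSucc 1 = r • Pi.single 2 1 := by
  refine ⟨?_, ?_⟩
  · obtain ⟨r, hr⟩ := exists_single_two_cross hab.symm
    exact ⟨-r, by rw [← cross_anticomm, hr, neg_smul]⟩
  · have hb : (a = 0 ∧ b = 1) ∨ (a = 1 ∧ b = 0) := by omega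
    rcases hb with ⟨rfl, rfl⟩ | ⟨rfl, rfl⟩
    · exact ⟨-1, by rw [← cross_anticomm, single_zero_cross_single_one, neg_smul, one_smul]⟩
    · exact ⟨1, by rw [single_zero_cross_single_one, one_smul]⟩

theorem exists_raviartThomasPoly_opVTri (i j : ℕ) (hab : a ≠ b) (b' c' : Fin 2) :
    ∃ Q ∈ RaviartThomasPoly (i + j + 1), ∀ x,
      onlyOn b c (opVTri i j (nu 0 a) (nu 1 a) (nu 2 a)) b' c' x = evalVec Q x := by
  refine forall_onlyOn (P := fun b' c' t => ∃ Q ∈ RaviartThomasPoly (i + j + 1),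
    ∀ x, t x = evalVec Q x) hab ?_ (fun _ _ => raviartThomasPoly_zero _)
    (fun _ => raviartThomasPoly_zero _) b' c'
  simp only [opVTri_nu]
  exact exists_raviartThomasPoly (polyFun_mul (polyFun_homog (polyFun_nu 0 a) (polyFun_nu 1 a) i _)
    (polyFun_homog (add_mem (polyFun_nu 0 a) (polyFun_nu 1 a)) (polyFun_nu 2 a) j _)) _

/-- The case `i ≥ 1`, in which the pullback has the required decay at infinity. -/
theorem hdivTriFaceReg_mem_of_pos (c : Fin 2) {i : ℕ} (j : ℕ) (hi : 1 ≤ i) (hab : a ≠ b) :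
    hdivTriFaceReg a b c i j ∈ U2 (i + j + 1) ∧
      HasTraces2 (hdivTriFaceReg a b c i j) 0
        (onlyOn b c (opVTri i j (nu 0 a) (nu 1 a) (nu 2 a))) := by
  obtain ⟨ε, hε⟩ := exists_grad_muQ c b
  obtain ⟨⟨r, hr⟩, s, hs⟩ := exists_cross_two hab
  have hba := hab.symm
  have hw3 := WA_wt_pow b 3
  -- The polynomial [P_i] is evaluated at multiples of w and contributes w^i, which for i ≥ 1
  -- supplies the missing power.
  have hA : (fun x => hP i (wt x * muQ 0 a x) (wt x * muQ 1 a x)) ∈ WA b 0 i i i := by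
    simpa [hP] using WA_homog (WA_mul (WA_wt b) (WA_muQ_of_ne 0 hba))
      (WA_mul (WA_wt b) (WA_muQ_of_ne 1 hba)) i (legendre i)
  have hB : (fun x => hP i (muQ c b x * (wt x * muQ 0 a x)) (muQ c b x * (wt x * muQ 1 a x)))
      ∈ WA b i i i i := by
    simpa [hP] using WA_homog (WA_mul (WA_muQ c b) (WA_mul (WA_wt b) (WA_muQ_of_ne 0 hba)))
      (WA_mul (WA_muQ c b) (WA_mul (WA_wt b) (WA_muQ_of_ne 1 hba))) i (legendre i)
  have hBJ := WA_mul hB (WA_homog_muQ_mul_wt c b j (jacobi (2 * i + 1) j))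
  obtain ⟨hq, ht⟩ := hdivTriFaceReg_traces c i j hab
  refine mem_U2_of_pull_divClass (contDiffOn_hdivTriFaceReg a b c i j)
    (divClass_add
      (single_mem_divClass (a := b) (g := fun x => _ * r) ?_)
      (single_two_mem_divClass (g := fun x => _ * s) ?_))
    (fun x hx => by
      rw [pull2_hdivTriFaceReg c i j hε hx, hr, hs, smul_smul, smul_smul]) hq ht
    (exists_quadPoly_div_zero _) (exists_raviartThomasPoly_opVTri i j hab)
  · exact WA_mono (WA_mul (WA_mul (WA_const_mul _ (WA_add
      (WA_mono (WA_mul (WA_muQ c b) (WA_mul hA (WA_homog_wt b j _)))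
        (d' := i + j + 1) (e' := i) (lo' := 1) (hi' := i + j)
        (by omega) (by omega) (by omega) (by omega))
      (WA_mono (WA_mul (WA_muQ c b) hBJ) (by omega) (by omega) (by omega) (by omega)))) hw3)
      (WA_const b r)) (by omega) (by omega) (by omega) (by omega)
  · exact WT_of_WA (WA_mono (WA_mul (WA_mul (WA_const_mul _ (WA_mul hBJ (WA_one_sub_wt b)))
      (WA_const_mul ε (WA_wt_pow b 2))) (WA_const b s))
      (by omega) (by omega) (by omega) (by omega))

/-- The case `i = 0`, in which a curl has to be split off. -/
theorem hdivTriFaceReg_mem_zero (c : Fin 2) (j : ℕ) (hab : a ≠ b) :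
    hdivTriFaceReg a b c 0 j ∈ U2 (0 + j + 1) ∧
      HasTraces2 (hdivTriFaceReg a b c 0 j) 0
        (onlyOn b c (opVTri 0 j (nu 0 a) (nu 1 a) (nu 2 a))) := by
  obtain ⟨ε, hε⟩ := exists_grad_muQ c b
  obtain ⟨⟨r, hr⟩, s, hs⟩ := exists_cross_two hab
  obtain ⟨K, hK⟩ := exists_homog_eq_add j (natDegree_jacobi_le (2 * 0 + 1) j)
  obtain ⟨hq, ht⟩ := hdivTriFaceReg_traces c 0 j hab
  -- By `hK`, [P_j^1](s₀, s₁) = γ s₁^j + s₀[K]. In the remainders R and S the factor s₀ is w or μw,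
  -- which restores the missing power. The leading term γ(1-w)^j has to be absorbed by the curl; T
  -- arises from differentiating (1-w)^j there.
  set γ := (jacobi (2 * 0 + 1) j).eval 1
  set R : R3 → ℝ := fun x => wt x * if j = 0 then 0 else homog (j - 1) K (wt x) (1 - wt x) with hR
  set S : R3 → ℝ := fun x => muQ c b x * wt x *
    if j = 0 then 0 else homog (j - 1) K (muQ c b x * wt x) (1 - wt x) with hS
  set T : R3 → ℝ := fun x => (j : ℝ) * (1 - wt x) ^ (j - 1) * wt x with hT
  have hw3 := WA_wt_pow b 3
  have hRW : R ∈ WA b 0 0 1 j := by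
    by_cases h0 : j = 0
    · simp only [hR, h0, if_true, mul_zero]; exact zero_mem _
    · simp only [hR, h0, if_false]
      exact WA_mono (WA_mul (WA_wt b) (WA_homog_wt b (j - 1) K))
        (by omega) (by omega) (by omega) (by omega)
  have hSW : S ∈ WA b j 0 1 j := by
    by_cases h0 : j = 0
    · simp only [hS, h0, if_true, mul_zero]; exact zero_mem _
    · simp only [hS, h0, if_false]
      exact WA_mono (WA_mul (WA_muQ_mul_wt c b 1 le_rfl) (WA_homog_muQ_mul_wt c b (j - 1) K))
        (by omega) (by omega) (by omega) (by omega)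
  have hTW : T ∈ WA b 0 0 1 j := by
    by_cases h0 : j = 0
    · simp only [hT, h0, Nat.cast_zero, zero_mul]; exact zero_mem _
    · exact WA_mono (WA_mul (WA_const_mul _ (WA_pow (WA_one_sub_wt b) (j - 1))) (WA_wt b))
        (by omega) (by omega) (by omega) (by omega)
  refine mem_U2_of_pull (contDiffOn_hdivTriFaceReg a b c 0 j)
    (divClass_add
      (single_mem_divClass (a := b) (g := fun x =>
        1 / 2 * (muQ c b x * (R x + S x + γ * T x)) * wt x ^ 3 * r) ?_)
      (single_two_mem_divClass (g := fun x =>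
        (1 / 2 * (S x * (1 - wt x)) * (ε * wt x ^ 2)
          - 1 / 2 * γ * ε * ((1 - wt x) ^ j * wt x ^ 3)) * s) ?_))
    -- The z-derivative of w² produces a factor 2, so this curl cancels ½γ + ½γ in the horizontal
    -- direction, where both halves of the average contribute, and ½γ in the vertical direction,
    -- where only the half with μ⁻¹ does. The remaining vertical term comes from (1-w)^{j+1} =
    -- (1-w)^j - w(1-w)^j.
    (single_mem_curlClass (a := a) (g := fun x =>
      1 / 2 * γ * ((1 - wt x) ^ j * (muQ c b x * wt x ^ 2))) ?_)
    (fun x hx => ?_) hq ht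
    (exists_quadPoly_div_zero _) (exists_raviartThomasPoly_opVTri 0 j hab)
  · exact WA_mono (WA_mul (WA_mul (WA_const_mul _ (WA_mul (WA_muQ c b) (WA_add (WA_add
      (WA_mono hRW (d' := j) (by omega) le_rfl le_rfl le_rfl) hSW)
      (WA_mono (WA_const_mul γ hTW) (by omega) le_rfl le_rfl le_rfl)))) hw3) (WA_const b r))
      (by omega) (by omega) (by omega) (by omega)
  · exact WT_of_WA (WA_mono (WA_mul (WA_sub
      (WA_mono (WA_mul (WA_const_mul _ (WA_mul hSW (WA_one_sub_wt b)))
        (WA_const_mul ε (WA_wt_pow b 2))) (d' := j) (e' := j) (lo' := 3) (hi' := j + 3)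
        (by omega) (by omega) (by omega) (by omega))
      (WA_mono (WA_const_mul _ (WA_mul (WA_pow (WA_one_sub_wt b) j) hw3))
        (by omega) (by omega) (by omega) (by omega))) (WA_const b s))
      (by omega) (by omega) (by omega) (by omega))
  · exact WA_mono (WA_const_mul _ (WA_mul (WA_pow (WA_one_sub_wt a) j)
      (WA_mul (WA_muQ_of_ne c hab) (WA_wt_pow a 2))))
      (by omega) (by omega) (by omega) (by omega)
  · have hwd := differentiableAt_wt hx
    have hmd := differentiableAt_muQ c b x
    have h1d : DifferentiableAt ℝ (fun y => 1 - wt y) x := (differentiableAt_const _).sub hwd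
    have hg1 : grad (fun y => 1 - wt y) x = wt x ^ 2 • Pi.single 2 1 := by
      rw [grad_sub (by fun_prop) hwd, grad_const, grad_wt hx, zero_sub, neg_smul, neg_neg]
    have hea : (fun x => (1 / 2 * γ * ((1 - wt x) ^ j * (muQ c b x * wt x ^ 2))) •
        (Pi.single a.castSucc 1 : R3)) = fun x =>
        (1 / 2 * γ * ((1 - wt x) ^ j * (muQ c b x * wt x ^ 2))) • grad (nu 1 a) x := by
      simp only [grad_nu_one]
    have hJ (u v : ℝ) : hPJ (2 * 0 + 1) j u v = _ := hK u v
    have h2a : (Pi.single 2 1 : R3) ⨯₃ Pi.single a.castSucc 1 = -(r • Pi.single b.castSucc 1) := by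
      rw [← hr, cross_anticomm]
    rw [pull2_hdivTriFaceReg c 0 j hε hx, hr, hs, hea]
    beta_reduce
    rw [curl_smul_grad
      ((differentiableAt_const _).fun_mul ((h1d.fun_pow j).fun_mul (hmd.fun_mul (hwd.fun_pow 2))))
      ((contDiff_nu 1 a).contDiffAt.of_le two_le_infty), grad_nu_one,
      grad_mul (differentiableAt_const _) ((h1d.fun_pow j).fun_mul (hmd.fun_mul (hwd.fun_pow 2))),
      grad_const, grad_mul (h1d.fun_pow j) (hmd.fun_mul (hwd.fun_pow 2)), grad_pow j h1d, hg1,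
      grad_mul hmd (hwd.fun_pow 2), grad_pow 2 hwd, grad_wt hx, hε, hP_zero, hP_zero, hJ, hJ]
    simp only [map_add, map_smul, LinearMap.add_apply, LinearMap.smul_apply, hs, h2a, hR, hS, hT]
    generalize (if j = 0 then (0 : ℝ) else homog (j - 1) K (wt x) (1 - wt x)) = A
    generalize (if j = 0 then (0 : ℝ) else homog (j - 1) K (muQ c b x * wt x) (1 - wt x)) = B
    ext k
    simp
    ring

theorem hdivTriFace_mem (c : Fin 2) (i j : ℕ) (hab : a ≠ b) :
    hdivTriFace a b c i j ∈ U2 (i + j + 1) ∧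
      HasTraces2 (hdivTriFace a b c i j) 0
        (onlyOn b c (opVTri i j (nu 0 a) (nu 1 a) (nu 2 a))) := by
  refine mem_U2_congr (hdivTriFace_eqOn c i j hab) ?_
  rcases Nat.eq_zero_or_pos i with rfl | hi
  · exact hdivTriFaceReg_mem_zero c j hab
  · exact hdivTriFaceReg_mem_of_pos c j hi hab

end TriFaceMem

end PyramidFE

theorem mainTheorem1 :
    -- `H¹` shape functions
    (∀ k : Fin 2 → Fin 2,
      h1Vertex (baseVertex (k 0) (k 1)) ∈ U0 1 ∧
      HasTraces0 (h1Vertex (baseVertex (k 0) (k 1)))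
        (fun x => muQ (k 0) 0 x * muQ (k 1) 1 x)
        (fun b c => if c = k b then nu (k (1 - b)).castSucc (1 - b) else 0)) ∧
    (h1Vertex 4 ∈ U0 1 ∧
      HasTraces0 (h1Vertex 4) 0 (fun b _ => nu 2 (1 - b))) ∧
    (∀ (a b c : Fin 2) (i : ℕ), a ≠ b → 2 ≤ i →
      h1MixedEdge a b c i ∈ U0 i ∧
      HasTraces0 (h1MixedEdge a b c i)
        (fun x => muQ c b x * phiE i (muQ 0 a) (muQ 1 a) x)
        (onlyOn b c (phiE i (nu 0 a) (nu 1 a)))) ∧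
    (∀ (k : Fin 2 → Fin 2) (i : ℕ), 2 ≤ i →
      h1TriEdge (baseVertex (k 0) (k 1)) i ∈ U0 i ∧
      HasTraces0 (h1TriEdge (baseVertex (k 0) (k 1)) i) 0
        (fun b c => if c = k b then
          phiE i (nu (k (1 - b)).castSucc (1 - b)) (nu 2 (1 - b)) else 0)) ∧
    (∀ i j : ℕ, 2 ≤ i → 2 ≤ j →
      h1QuadFace i j ∈ U0 (max i j) ∧
      HasTraces0 (h1QuadFace i j)
        (phiQuad i j (muQ 0 0) (muQ 1 0) (muQ 0 1) (muQ 1 1)) (fun _ _ => 0)) ∧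
    (∀ (a b c : Fin 2) (i j : ℕ), a ≠ b → 2 ≤ i → 1 ≤ j →
      h1TriFace a b c i j ∈ U0 (i + j) ∧
      HasTraces0 (h1TriFace a b c i j) 0
        (onlyOn b c (phiTri i j (nu 0 a) (nu 1 a) (nu 2 a)))) ∧
    (∀ i j k : ℕ, 2 ≤ i → 2 ≤ j → 2 ≤ k →
      h1Bubble i j k ∈ U0 (max (max i j) k) ∧
      HasTraces0 (h1Bubble i j k) 0 (fun _ _ => 0)) ∧
    -- `H(curl)` shape functions
    (∀ (a b c : Fin 2) (i : ℕ), a ≠ b →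
      hcurlMixedEdge a b c i ∈ U1 (i + 1) ∧
      HasTraces1 (hcurlMixedEdge a b c i)
        (fun x => muQ c b x • opE i (muQ 0 a) (muQ 1 a) x)
        (onlyOn b c (opE i (nu 0 a) (nu 1 a)))) ∧
    (∀ (k : Fin 2 → Fin 2) (i : ℕ),
      hcurlTriEdge (baseVertex (k 0) (k 1)) i ∈ U1 (i + 1) ∧
      HasTraces1 (hcurlTriEdge (baseVertex (k 0) (k 1)) i) 0
        (fun b c => if c = k b then
          opE i (nu (k (1 - b)).castSucc (1 - b)) (nu 2 (1 - b)) else 0)) ∧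
    (∀ (a b : Fin 2) (i j : ℕ), a ≠ b → 2 ≤ j →
      hcurlQuadFace a b i j ∈ U1 (max (i + 1) j) ∧
      HasTraces1 (hcurlQuadFace a b i j)
        (opEQuad i j (muQ 0 a) (muQ 1 a) (muQ 0 b) (muQ 1 b)) (fun _ _ => 0)) ∧
    (∀ (a b c : Fin 2) (i j : ℕ), a ≠ b → 1 ≤ j →
      hcurlTriFaceI a b c i j ∈ U1 (i + j + 1) ∧
      HasTraces1 (hcurlTriFaceI a b c i j) 0
        (onlyOn b c (opETri i j (nu 0 a) (nu 1 a) (nu 2 a)))) ∧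
    (∀ (a b c : Fin 2) (i j : ℕ), a ≠ b → 1 ≤ j →
      hcurlTriFaceII a b c i j ∈ U1 (i + j + 1) ∧
      HasTraces1 (hcurlTriFaceII a b c i j) 0
        (onlyOn b c (opETri i j (nu 1 a) (nu 2 a) (nu 0 a)))) ∧
    (∀ i j k : ℕ, 2 ≤ i → 2 ≤ j → 2 ≤ k →
      hcurlBubbleI i j k ∈ U1 (max (max i j) k) ∧
      HasTraces1 (hcurlBubbleI i j k) 0 (fun _ _ => 0)) ∧
    (∀ (a b : Fin 2) (i j k : ℕ), a ≠ b → 2 ≤ j → 2 ≤ k →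
      hcurlBubbleII a b i j k ∈ U1 (max (max (i + 1) j) k) ∧
      HasTraces1 (hcurlBubbleII a b i j k) 0 (fun _ _ => 0)) ∧
    (∀ i j : ℕ, 2 ≤ i → 2 ≤ j →
      hcurlBubbleIV i j ∈ U1 (max i j) ∧
      HasTraces1 (hcurlBubbleIV i j) 0 (fun _ _ => 0)) ∧
    -- `H(div)` shape functions
    (∀ i j : ℕ,
      hdivQuadFace i j ∈ U2 (max (i + 1) (j + 1)) ∧
      HasTraces2 (hdivQuadFace i j)
        (opVQuad i j (muQ 0 0) (muQ 1 0) (muQ 0 1) (muQ 1 1)) (fun _ _ => 0)) ∧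
    (∀ (a b c : Fin 2) (i j : ℕ), a ≠ b →
      hdivTriFace a b c i j ∈ U2 (i + j + 1) ∧
      HasTraces2 (hdivTriFace a b c i j) 0
        (onlyOn b c (opVTri i j (nu 0 a) (nu 1 a) (nu 2 a)))) ∧
    (∀ (a b : Fin 2) (i j k : ℕ), a ≠ b → 2 ≤ j → 2 ≤ k →
      hdivBubbleI a b i j k ∈ U2 (max (max (i + 1) j) k) ∧
      HasTraces2 (hdivBubbleI a b i j k) 0 (fun _ _ => 0)) ∧
    (∀ i j : ℕ, 2 ≤ i → 2 ≤ j →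
      hdivBubbleIII i j ∈ U2 (max i j) ∧
      HasTraces2 (hdivBubbleIII i j) 0 (fun _ _ => 0)) ∧
    (∀ i j k : ℕ, 2 ≤ k →
      hdivBubbleIV i j k ∈ U2 (max (max (i + 1) (j + 1)) k) ∧
      HasTraces2 (hdivBubbleIV i j k) 0 (fun _ _ => 0)) ∧
    (∀ i j : ℕ, 2 ≤ i → 2 ≤ j →
      hdivBubbleV i j ∈ U2 (max i j) ∧
      HasTraces2 (hdivBubbleV i j) 0 (fun _ _ => 0)) ∧
    (∀ (a b : Fin 2) (i : ℕ), a ≠ b → 2 ≤ i →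
      hdivBubbleVI a b i ∈ U2 i ∧
      HasTraces2 (hdivBubbleVI a b i) 0 (fun _ _ => 0)) ∧
    -- `L²` shape functions
    (∀ i j k : ℕ, l2Interior i j k ∈ U3 (max (max (i + 1) (j + 1)) (k + 1))) ∧
    -- the factor `μ⁻¹` is only an apparent singularity: general identities
    (∀ (i j : ℕ) (s₀ s₁ s₂ μ : R3 → ℝ) (x : R3),
      ContDiffAt ℝ 2 s₀ x → ContDiffAt ℝ 2 s₁ x → ContDiffAt ℝ 2 s₂ x → ContDiffAt ℝ 2 μ x →
      μ x ≠ 0 →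
      (μ x)⁻¹ • opVTri i j (fun y => μ y * s₀ y) (fun y => μ y * s₁ y) s₂ x
        = hPP i j (μ x * s₀ x) (μ x * s₁ x) (s₂ x) •
          (μ x • opVTri 0 0 s₀ s₁ s₂ x + s₂ x • (grad μ x ⨯₃ opE 0 s₀ s₁ x)) ∧
      ((∀ᶠ y in nhds x, s₀ y + s₁ y + s₂ y = 1) →
        PyramidFE.div
            (fun z => (μ z)⁻¹ • opVTri i j (fun y => μ y * s₀ y) (fun y => μ y * s₁ y) s₂ z) x
          = hPP i j (μ x * s₀ x) (μ x * s₁ x) (s₂ x) *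
            (grad μ x ⬝ᵥ (((i : ℝ) + (j : ℝ) + 3) • (opE 0 s₀ s₁ x ⨯₃ grad s₂ x)
              - opVTri 0 0 s₀ s₁ s₂ x)))) ∧
    -- the triangle face functions extend smoothly up to the whole boundary except the top vertex
    (∀ (a b c : Fin 2) (i j : ℕ), a ≠ b →
      Set.EqOn (hdivTriFace a b c i j) (hdivTriFaceReg a b c i j) Omega ∧
      ContDiffOn ℝ ∞ (hdivTriFaceReg a b c i j) {x | x 2 < 1}) := by
  refine ⟨h1Vertex_base_mem, h1Vertex_top_mem, fun a b c i hab hi => h1MixedEdge_mem c hab hi,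
    fun k i hi => h1TriEdge_mem k hi, fun i j hi hj => h1QuadFace_mem hi hj,
    fun a b c i j hab hi hj => h1TriFace_mem c hab hi hj,
    fun i j k hi hj hk => h1Bubble_mem hi hj hk,
    fun a b c i hab => hcurlMixedEdge_mem c i hab,
    hcurlTriEdge_mem,
    fun a b i j hab hj => hcurlQuadFace_mem i hab hj,
    fun a b c i j hab hj => hcurlTriFaceI_mem c i hab hj,
    fun a b c i j hab hj => hcurlTriFaceII_mem c i hab hj,
    fun i j k hi hj hk => hcurlBubbleI_mem hi hj hk,
    fun a b i j k hab hj hk => hcurlBubbleII_mem i hab hj hk,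
    fun i j hi hj => hcurlBubbleIV_mem hi hj,
    hdivQuadFace_mem,
    fun a b c i j hab => hdivTriFace_mem c i j hab,
    fun a b i j k hab hj hk => hdivBubbleI_mem i hab hj hk,
    fun i j hi hj => hdivBubbleIII_mem hi hj,
    fun i j k hk => hdivBubbleIV_mem i j hk,
    fun i j hi hj => hdivBubbleV_mem hi hj,
    fun a b i hab hi => hdivBubbleVI_mem hab hi,
    l2Interior_mem,
    fun i j s₀ s₁ s₂ μ x h₀ h₁ h₂ hμ hne => ⟨?_, div_inv_smul_opVTri i j h₀ h₁ h₂ hμ hne⟩,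
    fun a b c i j hab => ⟨hdivTriFace_eqOn c i j hab, contDiffOn_hdivTriFaceReg a b c i j⟩⟩
  exact inv_smul_opVTri i j (h₀.differentiableAt (by simp)) (h₁.differentiableAt (by simp))
    (hμ.differentiableAt (by simp)) hne
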